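/- **Setup.** Let $R\subset V$ be a reduced irreducible (crystallographic) root system in a finite-dimensional $\mathbb Q$-vector space, with coroots $\alpha^\vee\in V^*$, positive roots $R^+$, highest root $\gamma$ and Coxeter number $h=\operatorname{ht}(\gamma)+1$. Let $\widehat{\mathcal W}$ be the affine Weyl group, generated by the affine reflections $s_{\alpha,n}(v)=v-(\langle\alpha,v\rangle-n)\alpha^\vee$ of $V^*$ ($\alpha\in R$, $n\in\mathbb Z$), with simple reflections $\widehat{\mathcal S}=\{s_{\alpha,0}\mid\alpha\text{ simple}\}\cup\{s_{\gamma,1}\}$ and its length function and Bruhat order $\le$. Let $A_e=\{v\mid 0<\langle\alpha,v\rangle<1\ \forall\alpha\in R^+\}$, let $\hat w_0$ be the Bruhat-largest $w\in\widehat{\mathcal W}$ with $-1<\langle\alpha,\cdot\rangle<0$ on $w(A_e)$ for every simple $\alpha$, and put $\widehat{\mathcal W}^\circ=\{w\mid w\le\hat w_0\}$. Let $X$ be the weight lattice, $\widehat X=X\oplus\mathbb Z\delta$ and $\alpha_n=\alpha-n\delta$. The affine Bruhat graph $\widehat{\mathcal G}$ has vertex set $\widehat{\mathcal W}$ and an edge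 between $x$ and $s_{\alpha,n}x$ for all $x,\alpha,n$, labelled by the positive one of $\pm\alpha_n$; $\widehat{\mathcal G}^\circ$ is its full subgraph on $\widehat{\mathcal W}^\circ$. For a commutative ring $A$ let $\widehat S_A=S(\widehat X\otimes_{\mathbb Z}A)$, graded with $\widehat X$ in degree $2$. Modules over graded rings and their homomorphisms are $\mathbb Z$-graded, products are taken degree-wise, and $M\langle n\rangle_i=M_{i+n}$. Let $\mathbb Z'=\mathbb Z[1/2]$ and $$\widehat{\mathcal Z}=\Big\{(z_w)\in\prod_{w\in\widehat{\mathcal W}}\widehat S_{\mathbb Z'}\ \Big|\ z_w\equiv z_{s_{\alpha,n}w}\bmod\alpha_n\ \ \forall w,\alpha,n\Big\},\qquad \widehat{\mathcal Z}^s=\{z\in\widehat{\mathcal Z}\mid z_{ws}=z_w\ \forall w\}.$$ Let $k$ be a field of characteristic $\neq2$, $\widehat{\mathcal Z}_k=\widehat{\mathcal Z}\otimes_{\mathbb Z'}k$, $\widehat{\mathcal Z}^s_k=\widehat{\mathcal Z}^s\otimes_{\mathbb Z'}k$ and $\theta^sM=\widehat{\mathcal Z}_k\otimes_{\widehat{\mathcal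 Z}_k^s}M$ for a $\widehat{\mathcal Z}_k$-module $M$ and $s\in\widehat{\mathcal S}$. Let $B_e$ be $\widehat S_k$ with $z$ acting as multiplication by $z_e$. Let $\mathcal H_k^\circ$ be the category of graded $\widehat{\mathcal Z}_k$-modules that are isomorphic to a finite direct sum of direct summands of modules $\theta^t\circ\cdots\circ\theta^s(B_e)\langle n\rangle$, where $n\in\mathbb Z$ and $s\cdots t$ is a reduced expression of an element of $\widehat{\mathcal W}^\circ$. A $k$-sheaf $\mathscr F$ on $\widehat{\mathcal G}$ consists of $\widehat S_k$-modules $\mathscr F^x$ for the vertices $x$, $\widehat S_k$-modules $\mathscr F^E$ annihilated by the label $\alpha(E)$ for the edges $E$, and homomorphisms $\rho_{x,E}\colon\mathscr F^x\to\mathscr F^E$ for $x$ on $E$. Its sections over a set $\Omega$ of vertices are the $(m_x)\in\prod_{x\in\Omega}\mathscr F^x$ with $\rho_{x,E}(m_x)=\rho_{y,E}(m_y)$ for every edge $E$ joining two vertices $x,y\in\Omega$. For a vertex $x$ let $\mathscr F^{\delta x}$ be the image of the sections over $\{y\mid y>x\}$ in $\prod_E\mathscr F^E$, the product over the edges $E$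 joining $x$ to some $y>x$, under $(m_y)\mapsto(\rho_{y,E}(m_y))_E$, and let $\rho_{x,\delta x}=(\rho_{x,E})_E$. For $w\in\widehat{\mathcal W}$ the Braden–MacPherson sheaf $\mathscr B_w$ is the $k$-sheaf on $\widehat{\mathcal G}$, unique up to isomorphism, such that 1. $\mathscr B_w^x=0$ unless $x\le w$, and $\mathscr B_w^w\cong\widehat S_k$; 2. for every edge $E$ joining $x<y$ the map $\rho_{y,E}$ is surjective with kernel $\alpha(E)\mathscr B_w^y$; 3. for every $x\ne w$ the image of $\rho_{x,\delta x}$ is $\mathscr B_w^{\delta x}$, and $\rho_{x,\delta x}\colon\mathscr B_w^x\to\mathscr B_w^{\delta x}$ is a projective cover in the category of graded $\widehat S_k$-modules. Let $B_w$ be the space of global sections of $\mathscr B_w$, a $\widehat{\mathcal Z}_k$-module by coordinatewise multiplication. **Proposition.** Suppose that $\operatorname{char}k=0$ or $\operatorname{char}k=p\ge h$, and that $p\neq3$ if $R$ is of type $A_2$. Then every indecomposable object of $\mathcal H_k^\circ$ is isomorphic, up to a shift in degree, to $B_x$ for some vertex $x$ of $\widehat{\mathcal G}^\circ$; that is, it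 is isomorphic to $B_x\langle n\rangle$ for some $x\in\widehat{\mathcal W}^\circ$ and $n\in\mathbb Z$, and the sheaf $\mathscr B_x$ exists. -/

import Mathlib

open scoped TensorProduct

universe u

noncomputable section

namespace AffineMomentGraph

/-! ## The affine Weyl group -/

section Weyl

variable {ι V N : Type u} [AddCommGroup V] [Module ℚ V] [AddCommGroup N] [Module ℚ N]

/-- The affine reflection `s_{α,n}`, `α = P.root i`: it maps `v` to `v - (⟨α, v⟩ - n) α^∨`. -/
def affRefl (P : RootPairing ι ℚ V N) (i : ι) (n : ℤ) : N ≃ᵃ[ℚ] N :=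
  (P.coreflection i).toAffineEquiv.trans (AffineEquiv.constVAdd ℚ N ((n : ℚ) • P.coroot i))

theorem affRefl_apply (P : RootPairing ι ℚ V N) (i : ι) (n : ℤ) (v : N) :
    affRefl P i n v = v - (P.root' i v - n) • P.coroot i := by
  simp only [affRefl, AffineEquiv.trans_apply, AffineEquiv.constVAdd_apply, vadd_eq_add,
    LinearEquiv.coe_toAffineEquiv, RootPairing.coreflection_apply, sub_smul]
  abel

/-- The affine Weyl group: the group of affine transformations generated by all `s_{α,n}`. -/
def affineWeylGroup (P : RootPairing ι ℚ V N) : Subgroup (N ≃ᵃ[ℚ] N) :=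
  Subgroup.closure (Set.range fun p : ι × ℤ => affRefl P p.1 p.2)

/-- The affine Weyl group as a type. -/
abbrev AffW (P : RootPairing ι ℚ V N) : Type u := ↥(affineWeylGroup P)

/-- `s_{α,n}` as an element of the affine Weyl group. -/
def refl (P : RootPairing ι ℚ V N) (i : ι) (n : ℤ) : AffW P :=
  ⟨affRefl P i n, Subgroup.subset_closure ⟨(i, n), rfl⟩⟩

variable {P : RootPairing ι ℚ V N} (b : P.Base)

/-- `i` is the highest root: subtracting any root gives a nonnegative combination of simple
roots. -/
def IsHighestRoot (i : ι) : Prop :=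
  ∀ j, P.root i - P.root j ∈ AddSubmonoid.closure (P.root '' b.support)

/-- The Coxeter number: one plus the height of the highest root, which is the maximal height. -/
def coxeterNumber : ℤ := (⨆ i, b.height i) + 1

/-- The root system is of type `A₂`. -/
def IsTypeA2 [P.IsCrystallographic] : Prop :=
  ∃ e : b.support ≃ Fin 2, ∀ i j, b.cartanMatrix i j = CartanMatrix.A 2 (e i) (e j)

/-- The set of simple affine reflections. -/
def simpleRefl : Set (AffW P) :=
  {s | (∃ i ∈ b.support, s = refl P i 0) ∨ ∃ i, IsHighestRoot b i ∧ s = refl P i 1}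

/-- The length function with respect to the simple affine reflections. -/
def length (w : AffW P) : ℕ :=
  sInf {n | ∃ l : List (AffW P), (∀ s ∈ l, s ∈ simpleRefl b) ∧ l.prod = w ∧ l.length = n}

/-- `l` is a reduced expression (of the element `l.prod`). -/
def IsReducedWord (l : List (AffW P)) : Prop :=
  (∀ s ∈ l, s ∈ simpleRefl b) ∧ l.length = length b l.prod

/-- The relation generating the Bruhat order: `y = t x` with `t` a reflection and `x` shorter
than `y`. -/
def BruhatStep (x y : AffW P) : Prop :=
  (∃ (i : ι) (n : ℤ), y = refl P i n * x) ∧ length b x < length b y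

/-- The Bruhat order. -/
def BruhatLE : AffW P → AffW P → Prop := Relation.ReflTransGen (BruhatStep b)

theorem BruhatLE.eq_or_length_lt {x y : AffW P} (h : BruhatLE b x y) :
    x = y ∨ length b x < length b y := by
  induction h with
  | refl => exact Or.inl rfl
  | tail _ h ih =>
    rcases ih with rfl | ih
    · exact Or.inr h.2
    · exact Or.inr (ih.trans h.2)

/-- The affine Weyl group as a partially ordered set, with the Bruhat order. -/
abbrev bruhatOrder : PartialOrder (AffW P) where
  le := BruhatLE b
  le_refl _ := Relation.ReflTransGen.refl
  le_trans _ _ _ := Relation.ReflTransGen.trans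
  le_antisymm x y h h' := by
    rcases BruhatLE.eq_or_length_lt b h with h | h
    · exact h
    · rcases BruhatLE.eq_or_length_lt b h' with h' | h'
      · exact h'.symm
      · omega

/-- The fundamental dominant alcove. -/
def fundamentalAlcove : Set N :=
  {v | ∀ i, b.IsPos i → 0 < P.root' i v ∧ P.root' i v < 1}

/-- The elements `w` whose alcove lies in the anti-fundamental box, that is, in the strip
`-1 < ⟨α, ·⟩ < 0` for each simple root `α`. -/
def antiBox : Set (AffW P) :=
  {w | ∀ v ∈ fundamentalAlcove b, ∀ i ∈ b.support,
    -1 < P.root' i ((w : N ≃ᵃ[ℚ] N) v) ∧ P.root' i ((w : N ≃ᵃ[ℚ] N) v) < 0}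

/-- The elements that are at most `ŵ₀`, the largest element of the anti-fundamental box. -/
def circ : Set (AffW P) :=
  {w | ∃ w₀ ∈ antiBox b, (∀ y ∈ antiBox b, BruhatLE b y w₀) ∧ BruhatLE b w w₀}

/-- The weight lattice `X`. -/
def weightLattice (P : RootPairing ι ℚ V N) : AddSubgroup V where
  carrier := {v | ∀ i, ∃ n : ℤ, P.coroot' i v = n}
  zero_mem' _ := ⟨0, by simp⟩
  add_mem' {v w} hv hw i := by
    obtain ⟨n, hn⟩ := hv i
    obtain ⟨m, hm⟩ := hw i
    exact ⟨n + m, by rw [map_add, hn, hm]; push_cast; rfl⟩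
  neg_mem' {v} hv i := by
    obtain ⟨n, hn⟩ := hv i
    exact ⟨-n, by rw [map_neg, hn]; push_cast; rfl⟩

/-- The affine weight lattice `X ⊕ ℤδ`. -/
abbrev AffX (P : RootPairing ι ℚ V N) : Type u := ↥(weightLattice P) × ℤ

/-- The affine root `α_n = α - nδ`. -/
def affRoot (P : RootPairing ι ℚ V N) [P.IsCrystallographic] (i : ι) (n : ℤ) : AffX P :=
  (⟨P.root i, fun j => by
    obtain ⟨m, hm⟩ := RootPairing.IsValuedIn.exists_value (P := P) (S := ℤ) i j
    exact ⟨m, by rw [RootPairing.root_coroot'_eq_pairing, ← hm]; simp⟩⟩, -n)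

theorem affRoot_ne_zero (P : RootPairing ι ℚ V N) [P.IsCrystallographic] (i : ι) (n : ℤ) :
    affRoot P i n ≠ 0 := by
  intro h
  have h1 : P.root i = 0 := congrArg (fun x : AffX P => (x.1 : V)) h
  exact P.ne_zero i h1

/-- The affine root `α_n = α - nδ` is positive. -/
def IsPosAff (i : ι) (n : ℤ) : Prop := n < 0 ∨ (n = 0 ∧ b.IsPos i)

end Weyl

/-! ## Symmetric algebras -/

section Sym

variable (R Y : Type*) [CommRing R] [AddCommGroup Y]

/-- The symmetric algebra `S(Y ⊗ R)` of the `R`-module obtained from a lattice `Y`. -/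
abbrev Sym := SymmetricAlgebra R (R ⊗[ℤ] Y)

variable {Y} in
/-- A lattice element as an element of the symmetric algebra. -/
def lin (y : Y) : Sym R Y := SymmetricAlgebra.ι R (R ⊗[ℤ] Y) (1 ⊗ₜ y)

/-- The homogeneous components of the symmetric algebra, the lattice being in degree `2`. -/
def symDeg (d : ℤ) : Submodule R (Sym R Y) :=
  if 0 ≤ d ∧ 2 ∣ d then LinearMap.range (SymmetricAlgebra.ι R (R ⊗[ℤ] Y)) ^ (d / 2).toNat else ⊥

theorem symDeg_two_mul (n : ℕ) :
    symDeg R Y (2 * n) = LinearMap.range (SymmetricAlgebra.ι R (R ⊗[ℤ] Y)) ^ n := by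
  rw [symDeg, if_pos ⟨by positivity, by simp⟩]
  congr 1
  omega

theorem mem_symDeg_iff {d : ℤ} {f : Sym R Y} : f ∈ symDeg R Y d ↔ f = 0 ∨
    ∃ n : ℕ, d = 2 * n ∧ f ∈ LinearMap.range (SymmetricAlgebra.ι R (R ⊗[ℤ] Y)) ^ n := by
  constructor
  · intro h
    by_cases hd : 0 ≤ d ∧ 2 ∣ d
    · rw [symDeg, if_pos hd] at h
      exact Or.inr ⟨_, by omega, h⟩
    · rw [symDeg, if_neg hd] at h
      exact Or.inl h
  · rintro (rfl | ⟨n, rfl, h⟩)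
    · exact zero_mem _
    · rwa [symDeg_two_mul]

theorem symDeg_mul {c d : ℤ} {f g : Sym R Y} (hf : f ∈ symDeg R Y c) (hg : g ∈ symDeg R Y d) :
    f * g ∈ symDeg R Y (c + d) := by
  rw [mem_symDeg_iff] at *
  rcases hf with rfl | ⟨n, rfl, hf⟩
  · simp
  rcases hg with rfl | ⟨m, rfl, hg⟩
  · simp
  exact Or.inr ⟨n + m, by push_cast; ring, by rw [pow_add]; exact Submodule.mul_mem_mul hf hg⟩

theorem one_mem_symDeg : (1 : Sym R Y) ∈ symDeg R Y 0 := by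
  rw [mem_symDeg_iff]
  exact Or.inr ⟨0, by simp, by simp⟩

theorem lin_mem_symDeg (y : Y) : lin R y ∈ symDeg R Y 2 := by
  rw [mem_symDeg_iff]
  exact Or.inr ⟨1, by simp, by simp [lin]⟩

/-- The algebra map multiplying the degree `2n` component with `Tⁿ`. -/
def symCoact : Sym R Y →ₐ[R] Polynomial (Sym R Y) :=
  SymmetricAlgebra.lift
    (((Polynomial.monomial 1).restrictScalars R) ∘ₗ SymmetricAlgebra.ι R (R ⊗[ℤ] Y))

theorem symCoact_of_mem {n : ℕ} {f : Sym R Y}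
    (hf : f ∈ LinearMap.range (SymmetricAlgebra.ι R (R ⊗[ℤ] Y)) ^ n) :
    symCoact R Y f = Polynomial.monomial n f := by
  induction hf using Submodule.pow_induction_on_left' with
  | algebraMap r =>
    rw [AlgHom.commutes, Polynomial.monomial_zero_left]; rfl
  | add x y i hx hy h h' => rw [map_add, map_add, h, h']
  | mem_mul m hm i x hx h =>
    obtain ⟨y, rfl⟩ := hm
    rw [map_mul, h, symCoact, SymmetricAlgebra.lift_ι_apply]
    simp only [LinearMap.coe_comp, Function.comp_apply, LinearMap.coe_restrictScalars,
      Polynomial.monomial_mul_monomial]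
    rw [add_comm]

/-- The projection to the component of degree `d`. -/
def symProj (d : ℤ) : Sym R Y →ₗ[R] Sym R Y :=
  if 0 ≤ d ∧ 2 ∣ d then
    ((Polynomial.lcoeff (Sym R Y) (d / 2).toNat).restrictScalars R) ∘ₗ (symCoact R Y).toLinearMap
  else 0

theorem symProj_two_mul (n : ℕ) (f : Sym R Y) :
    symProj R Y (2 * n) f = (symCoact R Y f).coeff n := by
  rw [symProj, if_pos ⟨by positivity, by simp⟩]
  simp

theorem symProj_mul {c : ℤ} {f : Sym R Y} (hf : f ∈ symDeg R Y c) (d : ℤ) (g : Sym R Y) :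
    symProj R Y d (f * g) = f * symProj R Y (d - c) g := by
  rw [mem_symDeg_iff] at hf
  rcases hf with rfl | ⟨n, rfl, hf⟩
  · simp
  by_cases hd : 0 ≤ d ∧ 2 ∣ d
  · obtain ⟨m, rfl⟩ : ∃ m : ℕ, d = 2 * m := ⟨(d / 2).toNat, by omega⟩
    rw [symProj_two_mul, map_mul, symCoact_of_mem R Y hf, ← Polynomial.C_mul_X_pow_eq_monomial,
      mul_assoc, Polynomial.coeff_C_mul, Polynomial.coeff_X_pow_mul']
    split_ifs with h
    · rw [show (2 * (m : ℤ) - 2 * n) = 2 * ((m - n : ℕ) : ℤ) by omega, symProj_two_mul]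
    · rw [symProj, if_neg (by omega)]
      simp
  · rw [symProj, symProj, if_neg hd, if_neg (by omega)]
    simp

theorem symProj_one (d : ℤ) : symProj R Y d 1 = if d = 0 then 1 else 0 := by
  by_cases hd : 0 ≤ d ∧ 2 ∣ d
  · obtain ⟨m, rfl⟩ : ∃ m : ℕ, d = 2 * m := ⟨(d / 2).toNat, by omega⟩
    rw [symProj_two_mul, map_one, Polynomial.coeff_one]
    congr 1
    simp
  · rw [symProj, if_neg hd, if_neg (by rintro rfl; simp at hd)]
    rfl

theorem symProj_same {d : ℤ} {f : Sym R Y} (hf : f ∈ symDeg R Y d) : symProj R Y d f = f := by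
  have := symProj_mul R Y hf d 1
  rwa [sub_self, symProj_one, if_pos rfl, mul_one] at this

theorem symProj_ne {c d : ℤ} (h : d ≠ c) {f : Sym R Y} (hf : f ∈ symDeg R Y c) :
    symProj R Y d f = 0 := by
  have := symProj_mul R Y hf d 1
  rwa [symProj_one, if_neg (by omega), mul_one, mul_zero] at this

theorem mem_iSup_symDeg (f : Sym R Y) : f ∈ ⨆ d, symDeg R Y d := by
  induction f using SymmetricAlgebra.induction with
  | algebraMap r =>
    refine Submodule.mem_iSup_of_mem 0 ?_
    rw [Algebra.algebraMap_eq_smul_one]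
    exact Submodule.smul_mem _ _ (one_mem_symDeg R Y)
  | ι x =>
    refine Submodule.mem_iSup_of_mem 2 ?_
    rw [mem_symDeg_iff]
    exact Or.inr ⟨1, by simp, by simp⟩
  | add x y hx hy => exact add_mem hx hy
  | mul x y hx hy =>
    induction hx using Submodule.iSup_induction' with
    | zero => simp
    | add a a' _ _ h h' => rw [add_mul]; exact add_mem h h'
    | mem i a ha =>
      induction hy using Submodule.iSup_induction' with
      | zero => simp
      | add a a' _ _ h h' => rw [mul_add]; exact add_mem h h'
      | mem j c hc => exact Submodule.mem_iSup_of_mem (i + j) (symDeg_mul R Y ha hc)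

theorem symProj_mem (d : ℤ) (f : Sym R Y) : symProj R Y d f ∈ symDeg R Y d := by
  induction mem_iSup_symDeg R Y f using Submodule.iSup_induction' with
  | zero => simp
  | add a a' _ _ h h' => rw [map_add]; exact add_mem h h'
  | mem i a ha =>
    by_cases h : d = i
    · subst h; rwa [symProj_same R Y ha]
    · rw [symProj_ne R Y h ha]; exact zero_mem _

end Sym

/-! ## Graded modules -/

section Graded

theorem exists_sum_proj {M : Type*} [AddCommGroup M] {deg : ℤ → AddSubgroup M}
    {p : ℤ → M →+ M} (h1 : ∀ n, ∀ m ∈ deg n, p n m = m)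
    (h2 : ∀ n n', n ≠ n' → ∀ m ∈ deg n', p n m = 0) {m : M} (hm : m ∈ ⨆ n, deg n) :
    ∃ s : Finset ℤ, ∀ t, s ⊆ t → m = ∑ n ∈ t, p n m := by
  induction hm using AddSubgroup.iSup_induction' with
  | h1 => exact ⟨∅, fun t _ => by simp⟩
  | hadd x y _ _ hx hy =>
    obtain ⟨s, hs⟩ := hx
    obtain ⟨s', hs'⟩ := hy
    refine ⟨s ∪ s', fun t ht => ?_⟩
    simp only [map_add, Finset.sum_add_distrib]
    rw [← hs t (Finset.union_subset_left ht), ← hs' t (Finset.union_subset_right ht)]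
  | hp i x hx =>
    refine ⟨{i}, fun t ht => ?_⟩
    rw [Finset.sum_eq_single i (fun n _ hn => h2 n i hn x hx)
      (fun h => absurd (ht (Finset.mem_singleton_self i)) h), h1 i x hx]

theorem isInternal_of_proj {M : Type*} [AddCommGroup M] (deg : ℤ → AddSubgroup M)
    (p : ℤ → M →+ M) (h1 : ∀ n, ∀ m ∈ deg n, p n m = m)
    (h2 : ∀ n n', n ≠ n' → ∀ m ∈ deg n', p n m = 0) (h3 : ∀ m, m ∈ ⨆ n, deg n) :
    DirectSum.IsInternal deg := by
  classical
  constructor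
  · rw [injective_iff_map_eq_zero]
    intro x hx
    have key : ∀ (y : DirectSum ℤ fun n => deg n) (n : ℤ),
        p n (DirectSum.coeAddMonoidHom deg y) = y n := by
      intro y n
      induction y using DirectSum.induction_on with
      | zero => simp
      | add a b ha hb => rw [map_add, map_add, ha, hb]; rfl
      | of i x =>
        rw [DirectSum.coeAddMonoidHom_of]
        by_cases h : i = n
        · subst h; rw [h1 _ _ x.2, DirectSum.of_eq_same]
        · rw [h2 n i (Ne.symm h) _ x.2, DirectSum.of_eq_of_ne _ _ _ (Ne.symm h)]; rfl
    ext n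
    rw [← key, hx]
    simp
  · intro m
    have : (⨆ n, deg n) ≤ (DirectSum.coeAddMonoidHom deg).range :=
      iSup_le fun n x hx => ⟨DirectSum.of (fun n => deg n) n ⟨x, hx⟩, by simp⟩
    exact this (h3 m)

variable {k A : Type u} [CommRing k] [CommRing A] [Algebra k A]

/-- A `ℤ`-graded module over the algebra `A` graded by the submodules `𝒜 n`. -/
structure GradedMod (𝒜 : ℤ → Submodule k A) : Type (u + 1) where
  carrier : Type u
  [addCommGroup : AddCommGroup carrier]
  [module : Module A carrier]
  /-- the homogeneous components -/
  deg : ℤ → AddSubgroup carrier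
  isInternal : DirectSum.IsInternal deg
  smul_mem : ∀ {i j : ℤ} {a : A} {m : carrier}, a ∈ 𝒜 i → m ∈ deg j → a • m ∈ deg (i + j)

namespace GradedMod

variable {𝒜 : ℤ → Submodule k A}

instance : CoeSort (GradedMod 𝒜) (Type u) := ⟨carrier⟩

instance (M : GradedMod 𝒜) : AddCommGroup M := M.addCommGroup

instance (M : GradedMod 𝒜) : Module A M := M.module

/-- `f` is homogeneous of degree zero. -/
def IsGradedHom {M L : GradedMod 𝒜} (f : M →ₗ[A] L) : Prop :=
  ∀ n, ∀ m ∈ M.deg n, f m ∈ L.deg n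

/-- Isomorphism of graded modules. -/
def Iso (M L : GradedMod 𝒜) : Prop :=
  ∃ e : M ≃ₗ[A] L, ∀ n m, m ∈ M.deg n ↔ e m ∈ L.deg n

/-- `M` is (isomorphic to) a direct summand of `L`. -/
def IsSummand (M L : GradedMod 𝒜) : Prop :=
  ∃ (f : M →ₗ[A] L) (g : L →ₗ[A] M), IsGradedHom f ∧ IsGradedHom g ∧ g ∘ₗ f = LinearMap.id

/-- `M` is isomorphic to the direct sum of the modules `L j`. -/
def IsDirectSum {r : ℕ} (M : GradedMod 𝒜) (L : Fin r → GradedMod 𝒜) : Prop :=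
  ∃ e : M ≃ₗ[A] ((j : Fin r) → L j), ∀ n m, m ∈ M.deg n ↔ ∀ j, e m j ∈ (L j).deg n

/-- The decomposition of a graded module into its components. -/
def decomp (M : GradedMod 𝒜) : M ≃+ DirectSum ℤ fun n => M.deg n :=
  (AddEquiv.ofBijective (DirectSum.coeAddMonoidHom M.deg) M.isInternal).symm

theorem decomp_of_mem (M : GradedMod 𝒜) {n : ℤ} {m : M} (hm : m ∈ M.deg n) :
    M.decomp m = DirectSum.of (fun i => M.deg i) n ⟨m, hm⟩ := by
  rw [decomp, AddEquiv.symm_apply_eq]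
  exact (DirectSum.coeAddMonoidHom_of M.deg n ⟨m, hm⟩).symm

/-- The component of degree `n`. -/
def proj (M : GradedMod 𝒜) (n : ℤ) : M →+ M :=
  ((M.deg n).subtype.comp (DFinsupp.evalAddMonoidHom n)).comp M.decomp.toAddMonoidHom

theorem proj_mem (M : GradedMod 𝒜) (n : ℤ) (m : M) : M.proj n m ∈ M.deg n := by
  simp [proj]

theorem proj_of_mem (M : GradedMod 𝒜) {n' : ℤ} {m : M} (hm : m ∈ M.deg n') (n : ℤ) :
    M.proj n m = if n = n' then m else 0 := by
  change (((M.decomp m) n : M.deg n) : M) = _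
  rw [decomp_of_mem M hm]
  split_ifs with h
  · subst h
    rw [DirectSum.of_eq_same]
  · have h0 : (DirectSum.of (fun i => M.deg i) n' ⟨m, hm⟩ : DirectSum ℤ fun i => M.deg i) n = 0 :=
      DirectSum.of_eq_of_ne n' n _ h
    rw [h0]
    rfl

theorem mem_iSup (M : GradedMod 𝒜) (m : M) : m ∈ ⨆ n, M.deg n := by
  classical
  obtain ⟨x, rfl⟩ := M.isInternal.2 m
  induction x using DirectSum.induction_on with
  | zero => simp
  | of i x =>
    rw [DirectSum.coeAddMonoidHom_of]
    exact (le_iSup M.deg i) x.2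
  | add a b ha hb => rw [map_add]; exact add_mem ha hb

theorem map_proj {M L : GradedMod 𝒜} {f : M →ₗ[A] L} (hf : IsGradedHom f) (n : ℤ) (m : M) :
    f (M.proj n m) = L.proj n (f m) := by
  induction M.mem_iSup m using AddSubgroup.iSup_induction' with
  | h1 => simp
  | hadd x y _ _ hx hy => simp only [map_add, hx, hy]
  | hp i x hx =>
    rw [proj_of_mem M hx, proj_of_mem L (hf i x hx)]
    split_ifs <;> simp

/-- The shift `M⟨n⟩`, with `M⟨n⟩_i = M_{i + n}`. -/
def shift (M : GradedMod 𝒜) (n : ℤ) : GradedMod 𝒜 where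
  carrier := M
  deg i := M.deg (i + n)
  isInternal := isInternal_of_proj _ (fun i => M.proj (i + n))
    (fun i m hm => by rw [M.proj_of_mem hm, if_pos rfl])
    (fun i j hij m hm => by rw [M.proj_of_mem hm, if_neg (by omega)])
    (fun m => (iSup_le fun i => by
      have h := le_iSup (fun j => M.deg (j + n)) (i - n)
      simp only [sub_add_cancel] at h
      exact h : (⨆ i, M.deg i) ≤ ⨆ i, M.deg (i + n)) (M.mem_iSup m))
  smul_mem {i j a m} ha hm := by
    rw [add_assoc]
    exact M.smul_mem ha hm

/-- `M` is projective in the category of graded modules. -/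
def IsGradedProjective (M : GradedMod 𝒜) : Prop :=
  ∀ (L Q : GradedMod 𝒜) (g : L →ₗ[A] Q) (f : M →ₗ[A] Q), IsGradedHom g → IsGradedHom f →
    Function.Surjective g → ∃ f' : M →ₗ[A] L, IsGradedHom f' ∧ g ∘ₗ f' = f

/-- `M`, together with the homomorphism `ρ`, is a projective cover of the image of `ρ` in the
category of graded modules: `M` is projective, and a homogeneous homomorphism to `M` whose
composition with `ρ` still hits the whole image of `ρ` is surjective. -/
def IsProjectiveCover (M : GradedMod 𝒜) {T : Type u} [AddCommGroup T] [Module A T]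
    (ρ : M →ₗ[A] T) : Prop :=
  M.IsGradedProjective ∧ ∀ (L : GradedMod 𝒜) (g : L →ₗ[A] M), IsGradedHom g →
    LinearMap.range (ρ ∘ₗ g) = LinearMap.range ρ → Function.Surjective g

end GradedMod

end Graded

/-! ## The structure algebra -/

section Struct

/-- The ring `ℤ[1/2]`, the subring of `ℚ` generated by `1/2`. -/
def ZHalf : Type := ↥(Subring.closure {(2 : ℚ)⁻¹})

instance : CommRing ZHalf := inferInstanceAs (CommRing ↥(Subring.closure {(2 : ℚ)⁻¹}))

variable {ι V N : Type u} [AddCommGroup V] [Module ℚ V] [AddCommGroup N] [Module ℚ N]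
variable (P : RootPairing ι ℚ V N)

/-- The homogeneous elements of degree `d` of the product of copies of the symmetric algebra. -/
def homogFam (R : Type*) [CommRing R] (d : ℤ) : Submodule R (AffW P → Sym R (AffX P)) :=
  Submodule.pi Set.univ fun _ => symDeg R (AffX P) d

variable {P} in
theorem mem_homogFam {R : Type*} [CommRing R] {d : ℤ} {z : AffW P → Sym R (AffX P)} :
    z ∈ homogFam P R d ↔ ∀ w, z w ∈ symDeg R (AffX P) d := by
  simp [homogFam, Submodule.mem_pi]

theorem homogFam_mul_mem {R : Type*} [CommRing R] {x y : AffW P → Sym R (AffX P)}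
    (hx : x ∈ ⨆ d, homogFam P R d) (hy : y ∈ ⨆ d, homogFam P R d) :
    x * y ∈ ⨆ d, homogFam P R d := by
  induction hx using Submodule.iSup_induction' with
  | zero => simp
  | add a a' _ _ h h' => rw [add_mul]; exact add_mem h h'
  | mem i a ha =>
    induction hy using Submodule.iSup_induction' with
    | zero => simp
    | add a a' _ _ h h' => rw [mul_add]; exact add_mem h h'
    | mem j c hc =>
      refine Submodule.mem_iSup_of_mem (i + j) ?_
      rw [mem_homogFam] at *
      exact fun w => symDeg_mul _ _ (ha w) (hc w)

variable [P.IsCrystallographic]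

/-- The affine structure algebra over `ℤ[1/2]`. It lives in the degree-wise product of copies of
the symmetric algebra, that is, in the direct sum over `d` of the products of the components of
degree `d`. -/
def structAlg : Subalgebra ZHalf (AffW P → Sym ZHalf (AffX P)) where
  carrier := {z | z ∈ ⨆ d, homogFam P ZHalf d ∧
    ∀ (i : ι) (n : ℤ) (w : AffW P), lin ZHalf (affRoot P i n) ∣ z w - z (refl P i n * w)}
  mul_mem' {x y} hx hy := ⟨homogFam_mul_mem P hx.1 hy.1, fun i n w => by
    have e : (x * y) w - (x * y) (refl P i n * w) =
        x w * (y w - y (refl P i n * w)) + (x w - x (refl P i n * w)) * y (refl P i n * w) := by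
      simp only [Pi.mul_apply]
      ring
    rw [e]
    exact dvd_add (Dvd.dvd.mul_left (hy.2 i n w) _) (Dvd.dvd.mul_right (hx.2 i n w) _)⟩
  add_mem' {x y} hx hy := ⟨add_mem hx.1 hy.1, fun i n w => by
    have e : (x + y) w - (x + y) (refl P i n * w) =
        (x w - x (refl P i n * w)) + (y w - y (refl P i n * w)) := by
      simp only [Pi.add_apply]
      ring
    rw [e]
    exact dvd_add (hx.2 i n w) (hy.2 i n w)⟩
  algebraMap_mem' r := ⟨Submodule.mem_iSup_of_mem 0 (mem_homogFam.2 fun w => by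
    rw [Pi.algebraMap_apply, Algebra.algebraMap_eq_smul_one]
    exact Submodule.smul_mem _ _ (one_mem_symDeg _ _)), fun i n w => by simp⟩

/-- The affine structure algebra as a type. -/
def StructZ : Type u := ↥(structAlg P)

instance : CommRing (StructZ P) := inferInstanceAs (CommRing ↥(structAlg P))

instance : Algebra ZHalf (StructZ P) := inferInstanceAs (Algebra ZHalf ↥(structAlg P))

/-- The inclusion of the structure algebra into the product: `coord P z w` is `z_w`. -/
def coord : StructZ P →ₐ[ZHalf] (AffW P → Sym ZHalf (AffX P)) := (structAlg P).val

theorem coord_injective : Function.Injective (coord P) := Subtype.val_injective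

/-- The grading of the structure algebra. -/
def structDeg (d : ℤ) : Submodule ZHalf (StructZ P) :=
  (homogFam P ZHalf d).comap (coord P).toLinearMap

/-- The elements of the structure algebra invariant under `z ↦ (z_{w s})_w`. -/
def structInv (s : AffW P) : Subalgebra ZHalf (StructZ P) where
  carrier := {z | ∀ w, coord P z (w * s) = coord P z w}
  mul_mem' {x y} hx hy w := by
    rw [map_mul, Pi.mul_apply, Pi.mul_apply, hx w, hy w]
  add_mem' {x y} hx hy w := by
    rw [map_add, Pi.add_apply, Pi.add_apply, hx w, hy w]
  algebraMap_mem' r w := by rw [AlgHom.commutes]; rfl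

/-- The projection of the structure algebra to its component of degree `d`. -/
def structProj (d : ℤ) : StructZ P →ₗ[ZHalf] StructZ P :=
  LinearMap.codRestrict (Subalgebra.toSubmodule (structAlg P))
    ((LinearMap.pi fun w => symProj ZHalf (AffX P) d ∘ₗ LinearMap.proj w) ∘ₗ
      (structAlg P).val.toLinearMap) fun z => by
    refine ⟨Submodule.mem_iSup_of_mem d (mem_homogFam.2 fun w => symProj_mem _ _ _ _),
      fun i n w => ?_⟩
    obtain ⟨f, hf⟩ := z.2.2 i n w
    refine ⟨symProj ZHalf (AffX P) (d - 2) f, ?_⟩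
    rw [← symProj_mul _ _ (lin_mem_symDeg _ _ _), ← hf, map_sub]
    rfl

theorem coord_structProj (d : ℤ) (z : StructZ P) (w : AffW P) :
    coord P (structProj P d z) w = symProj ZHalf (AffX P) d (coord P z w) := rfl

theorem mem_structDeg {d : ℤ} {z : StructZ P} :
    z ∈ structDeg P d ↔ ∀ w, coord P z w ∈ symDeg ZHalf (AffX P) d := mem_homogFam

theorem structProj_mem (d : ℤ) (z : StructZ P) : structProj P d z ∈ structDeg P d :=
  (mem_structDeg P).2 fun w => by rw [coord_structProj]; exact symProj_mem _ _ _ _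

theorem structProj_mul {c : ℤ} {y : StructZ P} (hy : y ∈ structDeg P c) (d : ℤ)
    (z : StructZ P) : structProj P d (y * z) = y * structProj P (d - c) z := by
  apply coord_injective
  funext w
  rw [coord_structProj, map_mul, map_mul, Pi.mul_apply, Pi.mul_apply, coord_structProj]
  exact symProj_mul _ _ ((mem_structDeg P).1 hy w) _ _

theorem structProj_of_mem {c : ℤ} {y : StructZ P} (hy : y ∈ structDeg P c) (d : ℤ) :
    structProj P d y = if d = c then y else 0 := by
  apply coord_injective
  funext w
  rw [coord_structProj]
  split_ifs with h
  · subst h; exact symProj_same _ _ ((mem_structDeg P).1 hy w)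
  · rw [map_zero]; exact symProj_ne _ _ h ((mem_structDeg P).1 hy w)

theorem structDeg_mul {c d : ℤ} {y z : StructZ P} (hy : y ∈ structDeg P c)
    (hz : z ∈ structDeg P d) : y * z ∈ structDeg P (c + d) :=
  (mem_structDeg P).2 fun w => by
    rw [map_mul]
    exact symDeg_mul _ _ ((mem_structDeg P).1 hy w) ((mem_structDeg P).1 hz w)

theorem structAlg_sum (z : StructZ P) : ∃ s : Finset ℤ, z = ∑ n ∈ s, structProj P n z := by
  have h : coord P z ∈ ⨆ d, (homogFam P ZHalf d).toAddSubgroup := by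
    have h0 : coord P z ∈ ⨆ d, homogFam P ZHalf d := z.2.1
    generalize coord P z = x at h0
    induction h0 using Submodule.iSup_induction' with
    | zero => exact zero_mem _
    | add x y _ _ hx hy => exact add_mem hx hy
    | mem i x hx => exact (le_iSup (fun d => (homogFam P ZHalf d).toAddSubgroup) i) hx
  obtain ⟨s, hs⟩ := exists_sum_proj
    (p := fun n => (LinearMap.pi fun w =>
      symProj ZHalf (AffX P) n ∘ₗ LinearMap.proj w :
        (AffW P → Sym ZHalf (AffX P)) →ₗ[ZHalf] _).toAddMonoidHom)
    (fun n m hm => funext fun w => symProj_same _ _ (mem_homogFam.1 hm w))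
    (fun n n' hn m hm => funext fun w => symProj_ne _ _ hn (mem_homogFam.1 hm w)) h
  refine ⟨s, coord_injective P ?_⟩
  rw [map_sum]
  exact hs s subset_rfl

/-! ### Base change to a field -/

variable (k : Type u) [Field k] [Algebra ZHalf k]

/-- The structure algebra over `k`. -/
abbrev StructK : Type u := k ⊗[ZHalf] StructZ P

/-- Its grading. -/
def degK (d : ℤ) : Submodule k (StructK P k) := (structDeg P d).baseChange k

/-- The subalgebra of `s`-invariants over `k`: the image in the structure algebra over `k` of
the base change of the invariants over `ℤ[1/2]`. -/
def invK (s : AffW P) : Subalgebra k (StructK P k) :=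
  (Algebra.TensorProduct.map (AlgHom.id k k) (structInv P s).val).range

/-- The projection to the component of degree `d`. -/
def projK (d : ℤ) : StructK P k →ₗ[k] StructK P k := (structProj P d).baseChange k

theorem degK_induction {d : ℤ} (p : StructK P k → Prop)
    (h : ∀ (c : k) (y : StructZ P), y ∈ structDeg P d → p (c ⊗ₜ y))
    (h0 : p 0) (hadd : ∀ x y, p x → p y → p (x + y)) {z : StructK P k} (hz : z ∈ degK P k d) :
    p z := by
  rw [degK, Submodule.baseChange_eq_span] at hz
  induction hz using Submodule.span_induction with
  | zero => exact h0
  | add x y _ _ hx hy => exact hadd x y hx hy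
  | mem x hx =>
    obtain ⟨y, hy, rfl⟩ := hx
    exact h 1 y hy
  | smul c x hx ih =>
    clear ih
    induction hx using Submodule.span_induction generalizing c with
    | zero => simpa using h0
    | add x y _ _ hx hy => rw [smul_add]; exact hadd _ _ (hx c) (hy c)
    | mem x hx =>
      obtain ⟨y, hy, rfl⟩ := hx
      have e : c • ((TensorProduct.mk ZHalf k (StructZ P) 1) y) = c ⊗ₜ y := by
        simp [TensorProduct.smul_tmul']
      rw [e]
      exact h c y hy
    | smul c' x _ ih => rw [smul_smul]; exact ih _

theorem tmul_mem_degK {d : ℤ} (c : k) {y : StructZ P} (hy : y ∈ structDeg P d) :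
    c ⊗ₜ y ∈ degK P k d :=
  Submodule.tmul_mem_baseChange_of_mem c hy

theorem projK_mul {c : ℤ} {y : StructK P k} (hy : y ∈ degK P k c) (d : ℤ) (z : StructK P k) :
    projK P k d (y * z) = y * projK P k (d - c) z := by
  refine degK_induction P k
    (fun y => projK P k d (y * z) = y * projK P k (d - c) z) ?_ ?_ ?_ hy
  · intro r y hy
    induction z using TensorProduct.induction_on with
    | zero => simp
    | add z z' h h' => simp only [mul_add, map_add, h, h']
    | tmul r' z => simp [projK, structProj_mul P hy]
  · simp
  · intro x y hx hy
    simp only [add_mul, map_add, hx, hy]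

theorem degK_mul {c d : ℤ} {y z : StructK P k} (hy : y ∈ degK P k c) (hz : z ∈ degK P k d) :
    y * z ∈ degK P k (c + d) := by
  refine degK_induction P k (fun y => y * z ∈ degK P k (c + d)) (fun r y hy => ?_)
    (by simp) (fun x y hx hy => by rw [add_mul]; exact add_mem hx hy) hy
  refine degK_induction P k (fun z => (r ⊗ₜ y) * z ∈ degK P k (c + d)) (fun r' z hz => ?_)
    (by simp) (fun x y hx hy => by rw [mul_add]; exact add_mem hx hy) hz
  rw [Algebra.TensorProduct.tmul_mul_tmul]
  exact tmul_mem_degK P k _ (structDeg_mul P hy hz)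

theorem projK_of_mem {c : ℤ} {y : StructK P k} (hy : y ∈ degK P k c) (d : ℤ) :
    projK P k d y = if d = c then y else 0 := by
  refine degK_induction P k (fun y => projK P k d y = if d = c then y else 0) ?_ (by simp)
    (fun x y hx hy => by rw [map_add, hx, hy]; split_ifs <;> simp) hy
  · intro r y hy
    simp only [projK, LinearMap.baseChange_tmul, structProj_of_mem P hy]
    split_ifs <;> simp

theorem mem_iSup_degK (z : StructK P k) : z ∈ ⨆ d, degK P k d := by
  induction z using TensorProduct.induction_on with
  | zero => exact zero_mem _
  | add x y hx hy => exact add_mem hx hy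
  | tmul c z =>
    obtain ⟨s, hs⟩ := structAlg_sum P z
    rw [hs, TensorProduct.tmul_sum]
    exact sum_mem fun n _ => Submodule.mem_iSup_of_mem n
      (tmul_mem_degK P k c (structProj_mem P n z))

theorem invK_induction (s : AffW P) {p : StructK P k → Prop} (h0 : p 0)
    (hadd : ∀ x y, p x → p y → p (x + y))
    (h : ∀ d, ∀ y ∈ degK P k d, y ∈ invK P k s → p y) {y : StructK P k} (hy : y ∈ invK P k s) :
    p y := by
  obtain ⟨y, rfl⟩ := hy
  induction y using TensorProduct.induction_on with
  | zero => simpa using h0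
  | add x y hx hy => rw [map_add]; exact hadd _ _ hx hy
  | tmul c z =>
    have key : ∀ n, structProj P n z.1 ∈ structInv P s := fun n w => by
      rw [coord_structProj, coord_structProj, z.2 w]
    obtain ⟨t, ht⟩ := structAlg_sum P z.1
    have e : (Algebra.TensorProduct.map (AlgHom.id k k) (structInv P s).val) (c ⊗ₜ z) =
        ∑ n ∈ t, c ⊗ₜ structProj P n z.1 := by
      rw [← TensorProduct.tmul_sum, ← ht]
      rfl
    change p ((Algebra.TensorProduct.map (AlgHom.id k k) (structInv P s).val) (c ⊗ₜ z))
    rw [e]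
    refine Finset.sum_induction _ p hadd h0 fun n _ => h n _
      (tmul_mem_degK P k c (structProj_mem P n z.1)) ⟨c ⊗ₜ ⟨_, key n⟩, rfl⟩

/-- Extension of scalars of the symmetric algebra from `ℤ[1/2]` to `k`. -/
def symMap (Y : Type u) [AddCommGroup Y] : Sym ZHalf Y →ₐ[ZHalf] Sym k Y :=
  SymmetricAlgebra.lift (((SymmetricAlgebra.ι k (k ⊗[ℤ] Y)).restrictScalars ZHalf) ∘ₗ
    TensorProduct.AlgebraTensorModule.map (Algebra.linearMap ZHalf k) LinearMap.id)

theorem symMap_lin {Y : Type u} [AddCommGroup Y] (y : Y) : symMap k Y (lin ZHalf y) = lin k y := by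
  simp [symMap, lin, SymmetricAlgebra.lift_ι_apply]

theorem symMap_mem {Y : Type u} [AddCommGroup Y] {d : ℤ} {f : Sym ZHalf Y}
    (hf : f ∈ symDeg ZHalf Y d) : symMap k Y f ∈ symDeg k Y d := by
  rw [mem_symDeg_iff] at *
  rcases hf with rfl | ⟨n, rfl, hf⟩
  · simp
  refine Or.inr ⟨n, rfl, ?_⟩
  induction hf using Submodule.pow_induction_on_left' with
  | algebraMap r =>
    rw [AlgHom.commutes, IsScalarTower.algebraMap_apply ZHalf k, pow_zero]
    exact Submodule.algebraMap_mem _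
  | add x y i hx hy h h' => rw [map_add]; exact add_mem h h'
  | mem_mul m hm i x hx h =>
    obtain ⟨y, rfl⟩ := hm
    rw [map_mul, pow_succ']
    refine Submodule.mul_mem_mul ?_ h
    rw [symMap, SymmetricAlgebra.lift_ι_apply]
    exact ⟨_, rfl⟩

/-- The evaluation `z ↦ z_w`, over `k`. -/
def ev (w : AffW P) : StructK P k →ₐ[k] Sym k (AffX P) :=
  Algebra.TensorProduct.lift (Algebra.ofId k _)
    ((symMap k (AffX P)).comp ((Pi.evalAlgHom ZHalf _ w).comp (coord P)))
    fun _ _ => Commute.all _ _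

theorem ev_tmul (w : AffW P) (c : k) (z : StructZ P) :
    ev P k w (c ⊗ₜ z) = c • symMap k (AffX P) (coord P z w) := by
  simp [ev, Algebra.ofId_apply, Algebra.smul_def]

theorem ev_mem (w : AffW P) {d : ℤ} {z : StructK P k} (hz : z ∈ degK P k d) :
    ev P k w z ∈ symDeg k (AffX P) d := by
  refine degK_induction P k (fun z => ev P k w z ∈ symDeg k (AffX P) d) (fun c y hy => ?_)
    (by simp) (fun x y hx hy => by rw [map_add]; exact add_mem hx hy) hz
  rw [ev_tmul]
  exact Submodule.smul_mem _ _ (symMap_mem k ((mem_structDeg P).1 hy w))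

theorem ev_dvd (i : ι) (n : ℤ) (w : AffW P) (z : StructK P k) :
    lin k (affRoot P i n) ∣ ev P k w z - ev P k (refl P i n * w) z := by
  induction z using TensorProduct.induction_on with
  | zero => simp
  | add x y hx hy =>
    rw [map_add, map_add, add_sub_add_comm]
    exact dvd_add hx hy
  | tmul c z =>
    obtain ⟨f, hf⟩ : lin ZHalf (affRoot P i n) ∣ coord P z w - coord P z (refl P i n * w) :=
      z.2.2 i n w
    rw [ev_tmul, ev_tmul, ← smul_sub, ← map_sub, hf, map_mul, symMap_lin]
    exact ⟨c • symMap k _ f, (mul_smul_comm _ _ _).symm⟩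

/-! ### Translation functors and special modules -/

theorem evAll_mem (z : StructK P k) : (fun w => ev P k w z) ∈ ⨆ d, homogFam P k d := by
  induction mem_iSup_degK P k z using Submodule.iSup_induction' with
  | zero => simp only [map_zero]; exact zero_mem _
  | add x y _ _ hx hy => simp only [map_add]; exact add_mem hx hy
  | mem d z hz => exact Submodule.mem_iSup_of_mem d (mem_homogFam.2 fun w => ev_mem P k w hz)

/-- The additive map `z ⊗ m ↦ ∑ z_i ⊗ m_j`, the sum over `i + j = n`. -/
def thetaProjAux (s : AffW P) (M : GradedMod (degK P k)) (n : ℤ) :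
    StructK P k →+ M →+ StructK P k ⊗[invK P k s] M where
  toFun z := (DirectSum.toAddMonoid fun j =>
    { toFun := fun m : M.deg j => projK P k (n - j) z ⊗ₜ[invK P k s] (m : M)
      map_zero' := TensorProduct.tmul_zero _ _
      map_add' := fun _ _ => TensorProduct.tmul_add _ _ _ }).comp M.decomp.toAddMonoidHom
  map_zero' := by
    ext m
    induction M.mem_iSup m using AddSubgroup.iSup_induction' with
    | h1 => simp
    | hadd x y _ _ hx hy => rw [map_add, map_add, hx, hy]
    | hp i x hx => simp [M.decomp_of_mem hx]
  map_add' z z' := by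
    ext m
    induction M.mem_iSup m using AddSubgroup.iSup_induction' with
    | h1 => simp
    | hadd x y _ _ hx hy => rw [map_add, map_add, hx, hy]
    | hp i x hx => simp [M.decomp_of_mem hx, TensorProduct.add_tmul]

theorem thetaProjAux_of_mem (s : AffW P) (M : GradedMod (degK P k)) (n : ℤ) (z : StructK P k)
    {j : ℤ} {m : M} (hm : m ∈ M.deg j) :
    thetaProjAux P k s M n z m = projK P k (n - j) z ⊗ₜ[invK P k s] m := by
  simp [thetaProjAux, M.decomp_of_mem hm]

/-- The projection to the component of degree `n` of the translated module. -/
def thetaProj (s : AffW P) (M : GradedMod (degK P k)) (n : ℤ) :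
    StructK P k ⊗[invK P k s] M →+ StructK P k ⊗[invK P k s] M :=
  TensorProduct.liftAddHom (thetaProjAux P k s M n) fun r z m => by
    obtain ⟨r, hr⟩ := r
    change thetaProjAux P k s M n (r * z) m = thetaProjAux P k s M n z (r • m)
    refine invK_induction P k s (p := fun r => thetaProjAux P k s M n (r * z) m =
      thetaProjAux P k s M n z (r • m)) (by simp) (fun x y hx hy => ?_) (fun d y hy hy' => ?_) hr
    · rw [add_mul, add_smul, map_add, map_add, AddMonoidHom.add_apply, hx, hy]
    · induction M.mem_iSup m using AddSubgroup.iSup_induction' with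
      | h1 => simp
      | hadd x x' _ _ hx hx' => rw [map_add, smul_add, map_add, hx, hx']
      | hp i x hx =>
        rw [thetaProjAux_of_mem P k s M n _ hx, thetaProjAux_of_mem P k s M n _ (M.smul_mem hy hx),
          projK_mul P k hy]
        have e : n - i - d = n - (d + i) := by ring
        rw [e]
        exact TensorProduct.smul_tmul (⟨y, hy'⟩ : invK P k s) _ _

/-- The components of the translated module. -/
def thetaDeg (s : AffW P) (M : GradedMod (degK P k)) (n : ℤ) :
    AddSubgroup (StructK P k ⊗[invK P k s] M) :=
  AddSubgroup.closure {t | ∃ (i j : ℤ) (z : StructK P k) (m : M),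
    z ∈ degK P k i ∧ m ∈ M.deg j ∧ i + j = n ∧ t = z ⊗ₜ m}

theorem thetaProj_of_mem (s : AffW P) (M : GradedMod (degK P k)) (n : ℤ) {n' : ℤ}
    {t : StructK P k ⊗[invK P k s] M} (ht : t ∈ thetaDeg P k s M n') :
    thetaProj P k s M n t = if n = n' then t else 0 := by
  induction ht using AddSubgroup.closure_induction with
  | zero => simp
  | add x y _ _ hx hy => rw [map_add, hx, hy]; split_ifs <;> simp
  | neg x _ hx => rw [map_neg, hx]; split_ifs <;> simp
  | mem t ht =>
    obtain ⟨i, j, z, m, hz, hm, rfl, rfl⟩ := ht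
    rw [thetaProj, TensorProduct.liftAddHom_tmul, thetaProjAux_of_mem P k s M n z hm,
      projK_of_mem P k hz]
    by_cases h : n = i + j
    · rw [if_pos h, if_pos (by omega)]
    · rw [if_neg h, if_neg (by omega), TensorProduct.zero_tmul]

/-- The translation functor `θ^s`: restriction to the `s`-invariants, followed by induction. -/
def theta (s : AffW P) (M : GradedMod (degK P k)) : GradedMod (degK P k) where
  carrier := StructK P k ⊗[invK P k s] M
  deg := thetaDeg P k s M
  isInternal := isInternal_of_proj _ (thetaProj P k s M)
    (fun n m hm => by rw [thetaProj_of_mem P k s M n hm, if_pos rfl])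
    (fun n n' h m hm => by rw [thetaProj_of_mem P k s M n hm, if_neg h])
    fun t => by
      induction t using TensorProduct.induction_on with
      | zero => exact zero_mem _
      | add x y hx hy => exact add_mem hx hy
      | tmul z m =>
        induction mem_iSup_degK P k z using Submodule.iSup_induction' with
        | zero => rw [TensorProduct.zero_tmul]; exact zero_mem _
        | add x y _ _ hx hy => rw [TensorProduct.add_tmul]; exact add_mem hx hy
        | mem i z hz =>
          induction M.mem_iSup m using AddSubgroup.iSup_induction' with
          | h1 => rw [TensorProduct.tmul_zero]; exact zero_mem _
          | hadd x y _ _ hx hy => rw [TensorProduct.tmul_add]; exact add_mem hx hy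
          | hp j m hm =>
            exact (le_iSup (thetaDeg P k s M) (i + j))
              (AddSubgroup.subset_closure ⟨i, j, z, m, hz, hm, rfl, rfl⟩)
  smul_mem {i j a t} ha ht := by
    induction ht using AddSubgroup.closure_induction with
    | zero => rw [smul_zero]; exact zero_mem _
    | add x y _ _ hx hy => rw [smul_add]; exact add_mem hx hy
    | neg x _ hx => rw [smul_neg]; exact neg_mem hx
    | mem t ht =>
      obtain ⟨i', j', z, m, hz, hm, rfl, rfl⟩ := ht
      refine AddSubgroup.subset_closure ⟨i + i', j', a * z, m, degK_mul P k ha hz, hm, by ring, ?_⟩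
      rw [TensorProduct.smul_tmul', smul_eq_mul]

/-- The symmetric algebra as a graded module over itself. -/
def symSelf (Y : Type u) [AddCommGroup Y] : GradedMod (symDeg k Y) where
  carrier := Sym k Y
  deg d := (symDeg k Y d).toAddSubgroup
  isInternal := isInternal_of_proj _ (fun d => (symProj k Y d).toAddMonoidHom)
    (fun _ _ hm => symProj_same k Y hm) (fun _ _ h _ hm => symProj_ne k Y h hm) fun f => by
      induction mem_iSup_symDeg k Y f using Submodule.iSup_induction' with
      | zero => exact zero_mem _
      | add x y _ _ hx hy => exact add_mem hx hy
      | mem i x hx => exact (le_iSup (fun d => (symDeg k Y d).toAddSubgroup) i) hx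
  smul_mem ha hm := symDeg_mul k Y ha hm

/-- The module `B_e`: the symmetric algebra, on which `z` acts by multiplication with `z_e`. -/
def Be : GradedMod (degK P k) where
  carrier := Sym k (AffX P)
  module := Module.compHom _ (ev P k 1).toRingHom
  deg := (symSelf k (AffX P)).deg
  isInternal := (symSelf k (AffX P)).isInternal
  smul_mem ha hm := symDeg_mul k (AffX P) (ev_mem P k 1 ha) hm

/-- For the word `[s, …, t]` the module `θ^t ∘ ⋯ ∘ θ^s (B_e)`. -/
def bottSamelson (l : List (AffW P)) : GradedMod (degK P k) :=
  l.foldl (fun M s => theta P k s M) (Be P k)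

variable {P} in
/-- The objects of `ℋ°_k`: direct sums of direct summands of shifts of the modules
`θ^t ∘ ⋯ ∘ θ^s (B_e)`, where `s ⋯ t` is a reduced expression of an element that is at most
`ŵ₀`. -/
def IsCircSpecial (b : P.Base) (M : GradedMod (degK P k)) : Prop :=
  ∃ (r : ℕ) (L : Fin r → GradedMod (degK P k)),
    (∀ j, ∃ l : List (AffW P), IsReducedWord b l ∧ l.prod ∈ circ b ∧
      ∃ n : ℤ, (L j).IsSummand ((bottSamelson P k l).shift n)) ∧
    M.IsDirectSum L

variable {P} in
/-- `M` is an indecomposable object of `ℋ°_k`: it is nonzero, and not the direct sum of two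
nonzero objects of `ℋ°_k`. -/
def IsIndecomposableCirc (b : P.Base) (M : GradedMod (degK P k)) : Prop :=
  IsCircSpecial k b M ∧ Nontrivial M ∧
    ∀ L : Fin 2 → GradedMod (degK P k), (∀ j, IsCircSpecial k b (L j)) → M.IsDirectSum L →
      Subsingleton (L 0) ∨ Subsingleton (L 1)

end Struct

/-! ## Sheaves on moment graphs -/

/-- An (ordered) moment graph over `Y`. Each edge joins two comparable vertices `bot E < top E`
and carries a nonzero label in `Y`. -/
structure MomentGraph (Y : Type u) [AddCommGroup Y] : Type (u + 1) where
  V : Type u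
  [order : PartialOrder V]
  E : Type u
  bot : E → V
  top : E → V
  bot_lt_top : ∀ E, bot E < top E
  label : E → Y
  label_ne_zero : ∀ E, label E ≠ 0

namespace MomentGraph

variable {Y : Type u} [AddCommGroup Y]

instance (G : MomentGraph Y) : PartialOrder G.V := G.order

/-- The vertex `x` lies on the edge `E`. -/
abbrev Adj (G : MomentGraph Y) (x : G.V) (E : G.E) : Prop := x = G.bot E ∨ x = G.top E

/-- A `k`-sheaf on a moment graph; all modules and homomorphisms are graded. -/
structure Sheaf (k : Type u) [Field k] (G : MomentGraph Y) : Type (u + 1) where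
  /-- the stalks at the vertices -/
  vert : G.V → GradedMod (symDeg k Y)
  /-- the stalks at the edges -/
  edge : G.E → GradedMod (symDeg k Y)
  label_smul : ∀ (E : G.E) (m : edge E), lin k (G.label E) • m = 0
  ρ : ∀ (x : G.V) (E : G.E), G.Adj x E → (vert x →ₗ[Sym k Y] edge E)
  ρ_graded : ∀ (x : G.V) (E : G.E) (h : G.Adj x E), GradedMod.IsGradedHom (ρ x E h)

namespace Sheaf

variable {k : Type u} [Field k] {G : MomentGraph Y} (F : Sheaf k G)

/-- The homogeneous elements of degree `n` of the product of the stalks over `Ω`. -/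
def homog (Ω : Set G.V) (n : ℤ) : AddSubgroup ((x : Ω) → F.vert x) :=
  AddSubgroup.pi Set.univ fun x => (F.vert x).deg n

theorem mem_homog {Ω : Set G.V} {n : ℤ} {m : (x : Ω) → F.vert x} :
    m ∈ F.homog Ω n ↔ ∀ x : Ω, m x ∈ (F.vert x).deg n := by
  simp [homog, AddSubgroup.mem_pi]

/-- The sections over `Ω`. As for the structure algebra, the product of the stalks is the
degree-wise one. -/
def sections (Ω : Set G.V) : AddSubgroup ((x : Ω) → F.vert x) where
  carrier := {m | m ∈ ⨆ n, F.homog Ω n ∧ ∀ (E : G.E) (h : G.bot E ∈ Ω) (h' : G.top E ∈ Ω),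
    F.ρ (G.bot E) E (Or.inl rfl) (m ⟨_, h⟩) = F.ρ (G.top E) E (Or.inr rfl) (m ⟨_, h'⟩)}
  zero_mem' := ⟨zero_mem _, fun E h h' => by simp⟩
  add_mem' {m m'} hm hm' := ⟨add_mem hm.1 hm'.1, fun E h h' => by
    rw [Pi.add_apply, Pi.add_apply, map_add, map_add, hm.2, hm'.2]⟩
  neg_mem' {m} hm := ⟨neg_mem hm.1, fun E h h' => by
    rw [Pi.neg_apply, Pi.neg_apply, map_neg, map_neg, hm.2]⟩

/-- The component of degree `n` of a section. -/
def sectionsProj (Ω : Set G.V) (n : ℤ) : F.sections Ω →+ F.sections Ω where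
  toFun m := ⟨fun x => (F.vert x).proj n (m.1 x),
    (le_iSup (F.homog Ω) n) (F.mem_homog.2 fun x => (F.vert x).proj_mem n _), fun E h h' => by
      have e := m.2.2 E h h'
      refine (GradedMod.map_proj (F.ρ_graded _ _ _) n _).trans ?_
      rw [e]
      exact (GradedMod.map_proj (F.ρ_graded _ _ _) n _).symm⟩
  map_zero' := Subtype.ext <| funext fun x => map_zero _
  map_add' _ _ := Subtype.ext <| funext fun x => map_add _ _ _

/-- The homogeneous sections of degree `n`. -/
def sectionsDeg (Ω : Set G.V) (n : ℤ) : AddSubgroup (F.sections Ω) :=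
  (F.homog Ω n).comap (F.sections Ω).subtype

theorem mem_sectionsDeg {Ω : Set G.V} {n : ℤ} {m : F.sections Ω} :
    m ∈ F.sectionsDeg Ω n ↔ ∀ x : Ω, m.1 x ∈ (F.vert x).deg n := F.mem_homog

theorem sections_isInternal (Ω : Set G.V) : DirectSum.IsInternal (F.sectionsDeg Ω) := by
  refine isInternal_of_proj _ (F.sectionsProj Ω)
    (fun n m hm => Subtype.ext <| funext fun x => ?_)
    (fun n n' h m hm => Subtype.ext <| funext fun x => ?_) fun m => ?_
  · exact ((F.vert x).proj_of_mem (F.mem_sectionsDeg.1 hm x) n).trans (if_pos rfl)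
  · exact ((F.vert x).proj_of_mem (F.mem_sectionsDeg.1 hm x) n).trans (if_neg h)
  · obtain ⟨s, hs⟩ := exists_sum_proj (deg := F.homog Ω)
      (p := fun n => AddMonoidHom.mk' (fun (m : (x : Ω) → F.vert x) x => (F.vert x).proj n (m x))
        fun a b => funext fun x => map_add _ _ _)
      (fun n m hm => funext fun x =>
        ((F.vert x).proj_of_mem (F.mem_homog.1 hm x) n).trans (if_pos rfl))
      (fun n n' h m hm => funext fun x =>
        ((F.vert x).proj_of_mem (F.mem_homog.1 hm x) n).trans (if_neg h)) m.2.1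
    have e : m = ∑ n ∈ s, F.sectionsProj Ω n m := by
      apply Subtype.ext
      rw [AddSubmonoidClass.coe_finsetSum]
      exact hs s subset_rfl
    rw [e]
    refine sum_mem fun n _ => (le_iSup (F.sectionsDeg Ω) n) (F.mem_sectionsDeg.2 fun x => ?_)
    exact (F.vert x).proj_mem n _

/-- The edges that go up from `x`. -/
abbrev UpEdge (x : G.V) : Type u := {E : G.E // x = G.bot E}

/-- The homomorphism from the stalk at `x` to the product of the stalks at the edges that go up
from `x`. -/
def ρδ (x : G.V) : F.vert x →ₗ[Sym k Y] ((E : UpEdge x) → F.edge E.1) :=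
  LinearMap.pi fun E => F.ρ x E.1 (Or.inl E.2)

/-- The elements of the product of the stalks at the edges that go up from `x` which come from
sections over the vertices above `x`. -/
def upImage (x : G.V) : Set ((E : UpEdge x) → F.edge E.1) :=
  (fun (m : (y : {y : G.V | x < y}) → F.vert y) (E : UpEdge x) =>
    F.ρ (G.top E.1) E.1 (Or.inr rfl) (m ⟨G.top E.1, by
      have h := G.bot_lt_top E.1
      rwa [← E.2] at h⟩)) '' (F.sections {y | x < y} : Set ((y : {y : G.V | x < y}) → F.vert y))

/-- `F` is the Braden–MacPherson sheaf `ℬ_w`. -/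
structure IsBradenMacPherson (w : G.V) : Prop where
  support : ∀ x, ¬ x ≤ w → Subsingleton (F.vert x)
  top : (F.vert w).Iso (symSelf k Y)
  surjective : ∀ E : G.E, Function.Surjective (F.ρ (G.top E) E (Or.inr rfl))
  ker : ∀ (E : G.E) (m : F.vert (G.top E)), F.ρ (G.top E) E (Or.inr rfl) m = 0 ↔
    ∃ m' : F.vert (G.top E), m = lin k (G.label E) • m'
  range : ∀ x, x ≠ w → Set.range (F.ρδ x) = F.upImage x
  cover : ∀ x, x ≠ w → (F.vert x).IsProjectiveCover (F.ρδ x)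

end Sheaf

end MomentGraph

/-! ## The affine Bruhat graph -/

section Bruhat

variable {ι V N : Type u} [AddCommGroup V] [Module ℚ V] [AddCommGroup N] [Module ℚ N]
variable {P : RootPairing ι ℚ V N} [P.IsCrystallographic] (b : P.Base)

/-- The affine Bruhat graph. The edge joining `x` and `t x`, where `t = s_{α,n}` is written with
`α - nδ` positive, is recorded by its lower vertex `x` and by `(α, n)`. -/
abbrev bruhatGraph : MomentGraph (AffX P) where
  V := AffW P
  order := bruhatOrder b
  E := {e : AffW P × (ι × ℤ) // IsPosAff b e.2.1 e.2.2 ∧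
    (bruhatOrder b).lt e.1 (refl P e.2.1 e.2.2 * e.1)}
  bot e := e.1.1
  top e := refl P e.1.2.1 e.1.2.2 * e.1.1
  bot_lt_top e := e.2.2
  label e := affRoot P e.1.2.1 e.1.2.2
  label_ne_zero _ := affRoot_ne_zero P _ _

variable {k : Type u} [Field k] {b} (F : MomentGraph.Sheaf k (bruhatGraph b))

theorem smul_mem_homog {f : AffW P → Sym k (AffX P)} (hf : f ∈ ⨆ d, homogFam P k d)
    {m : (x : (Set.univ : Set (AffW P))) → F.vert x.1} (hm : m ∈ ⨆ n, F.homog Set.univ n) :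
    (fun x => f x.1 • m x) ∈ ⨆ n, F.homog Set.univ n := by
  induction hf using Submodule.iSup_induction' with
  | zero => simp only [Pi.zero_apply, zero_smul]; exact zero_mem _
  | add x y _ _ hx hy => simp only [Pi.add_apply, add_smul]; exact add_mem hx hy
  | mem d f hf =>
    induction hm using AddSubgroup.iSup_induction' with
    | h1 => simp only [Pi.zero_apply, smul_zero]; exact zero_mem _
    | hadd x y _ _ hx hy => simp only [Pi.add_apply, smul_add]; exact add_mem hx hy
    | hp n m hm =>
      exact (le_iSup (F.homog Set.univ) (d + n)) (F.mem_homog.2 fun x =>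
        (F.vert x.1).smul_mem (mem_homogFam.1 hf x.1) (F.mem_homog.1 hm x))

variable [Algebra ZHalf k]

theorem smul_mem_sections (z : StructK P k) {m : (x : (Set.univ : Set (AffW P))) → F.vert x.1}
    (hm : m ∈ F.sections Set.univ) : (fun x => ev P k x.1 z • m x) ∈ F.sections Set.univ := by
  refine ⟨smul_mem_homog F (evAll_mem P k z) hm.1, fun E h h' => ?_⟩
  rw [map_smul, map_smul, ← hm.2 E h h', ← sub_eq_zero, ← sub_smul]
  obtain ⟨f, hf⟩ := ev_dvd P k E.1.2.1 E.1.2.2 E.1.1 z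
  have e : ev P k ((bruhatGraph b).bot E) z - ev P k ((bruhatGraph b).top E) z =
      f * lin k ((bruhatGraph b).label E) := hf.trans (mul_comm _ _)
  rw [e, mul_smul, F.label_smul, smul_zero]

/-- The global sections of a sheaf on the affine Bruhat graph, as a graded module over the
structure algebra, which acts by coordinatewise multiplication. -/
def globalSections : GradedMod (degK P k) where
  carrier := F.sections Set.univ
  module :=
    { smul := fun z m => ⟨fun x => ev P k x.1 z • m.1 x, smul_mem_sections F z m.2⟩
      one_smul := fun m => Subtype.ext <| funext fun x => by
        change ev P k x.1 1 • m.1 x = _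
        rw [map_one, one_smul]
      mul_smul := fun y z m => Subtype.ext <| funext fun x => by
        change ev P k x.1 (y * z) • m.1 x = ev P k x.1 y • ev P k x.1 z • m.1 x
        rw [map_mul, mul_smul]
      smul_zero := fun z => Subtype.ext <| funext fun x => smul_zero _
      smul_add := fun z m m' => Subtype.ext <| funext fun x => smul_add _ _ _
      add_smul := fun y z m => Subtype.ext <| funext fun x => by
        change ev P k x.1 (y + z) • m.1 x = ev P k x.1 y • m.1 x + ev P k x.1 z • m.1 x
        rw [map_add, add_smul]
      zero_smul := fun m => Subtype.ext <| funext fun x => by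
        change ev P k x.1 0 • m.1 x = 0
        rw [map_zero, zero_smul] }
  deg := F.sectionsDeg Set.univ
  isInternal := F.sections_isInternal Set.univ
  smul_mem {i j a m} ha hm := F.mem_sectionsDeg.2 fun x =>
    (F.vert x.1).smul_mem (ev_mem P k x.1 ha) (F.mem_sectionsDeg.1 hm x)

end Bruhat

end AffineMomentGraph

end

open AffineMomentGraph

/-! The plan is to realise every object in play as the global sections of a flabby sheaf on the
Bruhat graph, and to show that indecomposability forces this sheaf to be a Braden–MacPherson sheaf.

For a module `M` over the structure algebra, submodules `K x` are sought such that the quotients `M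
/ K x` are the stalks of a flabby sheaf with graded projective stalks, supported below `w`, with
global sections `M`. This is the content of `IsStalkFiltration`. For `B_e` it is immediate. The
translation step (`IsStalkFiltration.theta`) rests on the decomposition `Z = Z^s ⊕ c Z^s`, where `c`
has the coordinates `w ↦ w(α_s)` and `2` is invertible (`average_add_mul_divDiff`). It gives `θ^s M
= 1 ⊗ M ⊕ c ⊗ M`, and the stalk of `θ^s M` at `y` is the quotient of `M` by `K y ⊓ K (y s)`, through
`1 ⊗ a + c ⊗ b ↦ a + y(α_s) b`.

Flabbiness survives translation because distinct edges at a vertex have coprime labels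
(`lin_affRoot_dvd_of_mem_circ`). This is where the characteristic enters. If `x ≤ ŵ₀`, then every
root has absolute value below `h - 1` at the image under `x` of a fixed point of the fundamental
alcove (`abs_root'_lt_of_mem_circ`), so two parallel labels at a vertex have levels differing by
less than `p`. Roots that are not parallel stay independent modulo `p`, except in type `A₂` with `p
= 3`.

Direct summands inherit the filtration because the structure algebra over `k` separates the vertices
below `ŵ₀` (`exists_lin_actX_ne_zero`): every endomorphism then preserves each `K x`
(`IsStalkFiltration.map_mem`).

Let finally `M` have no idempotent endomorphisms except `0` and `1`. By Fitting's lemma its graded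
endomorphisms are nilpotent or bijective (`nilpotent_or_bijective`). If the stalk at `y` is not a
projective cover of its boundary, it has a free summand of rank one on which the boundary map
vanishes. The projection to this summand extends to an endomorphism of the sheaf that vanishes
outside `{≤ y}` (`exists_extension`). It is not nilpotent, hence bijective, so the sheaf is
supported below `y` with free stalk of rank one at `y` (`of_not_cover`). This happens at a maximal
vertex `x` of the support and therefore at no other vertex of the support, so the sheaf is `ℬ_x` up
to a shift. Any two sheaves `ℬ_x` are isomorphic by comparison of projective covers. -/

noncomputable section

set_option linter.unusedSectionVars false

/-! ## Combinatorics of root systems -/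

namespace AffineMomentGraph

section RootCombinatorics

variable {ι V N : Type u} [AddCommGroup V] [Module ℚ V] [AddCommGroup N] [Module ℚ N]
variable {P : RootPairing ι ℚ V N} (b : P.Base)

/-- The cone of nonnegative integral combinations of simple roots. -/
abbrev posCone : AddSubmonoid V := AddSubmonoid.closure (P.root '' b.support)

theorem exists_nat_coeff_of_mem_posCone {x : V} (hx : x ∈ posCone b) :
    ∃ f : ι → ℕ, x = ∑ j ∈ b.support, f j • P.root j := by
  classical
  induction hx using AddSubmonoid.closure_induction with
  | mem x hx =>
    obtain ⟨j, hj, rfl⟩ := hx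
    exact ⟨Pi.single j 1, by simp [Pi.single_apply, Finset.mem_coe.1 hj]⟩
  | zero => exact ⟨0, by simp⟩
  | add x y _ _ hx hy =>
    obtain ⟨f, rfl⟩ := hx
    obtain ⟨g, rfl⟩ := hy
    exact ⟨f + g, by simp [add_smul, Finset.sum_add_distrib]⟩

theorem sum_nat_mem_posCone (f : ι → ℕ) : ∑ j ∈ b.support, f j • P.root j ∈ posCone b :=
  sum_mem fun _ hj => nsmul_mem (AddSubmonoid.subset_closure (Set.mem_image_of_mem _ hj)) _

theorem IsPos.mem_posCone {i : ι} (hi : b.IsPos i) : P.root i ∈ posCone b := by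
  obtain ⟨f, -, h | h⟩ := b.exists_root_eq_sum_nat_or_neg i
  · rw [h]
    exact sum_nat_mem_posCone b f
  · have e : P.root i = ∑ j ∈ b.support, (fun j => -(f j : ℤ)) j • P.root j := by
      rw [h]; simp [Finset.sum_neg_distrib]
    have h1 := RootPairing.Base.height_eq_sum e
    rw [RootPairing.Base.isPos_iff, h1, Finset.sum_neg_distrib] at hi
    have : 0 ≤ ∑ j ∈ b.support, (f j : ℤ) := Finset.sum_nonneg fun _ _ => by positivity
    omega

theorem pairingIn_cast (P : RootPairing ι ℚ V N) [P.IsCrystallographic] (i j : ι) : (P.pairingIn ℤ i j : ℚ) = P.pairing i j := by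
  simpa using P.algebraMap_pairingIn ℤ i j

variable [Finite ι] [P.IsRootSystem]

/-- The functional that takes every root to its height. -/
theorem exists_height_functional : ∃ r : N, ∀ i, P.root' i r = b.height i := by
  refine ⟨P.flip.toPerfPair.symm (b.toWeightBasis.constr ℚ fun _ => (1 : ℚ)), fun i => ?_⟩
  obtain ⟨f, -, -, hf⟩ := b.exists_root_eq_sum_int i
  have key : ∀ x : V, P.toLinearMap x (P.flip.toPerfPair.symm
      (b.toWeightBasis.constr ℚ fun _ => (1 : ℚ))) = b.toWeightBasis.constr ℚ (fun _ => (1 : ℚ)) x := by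
    intro x
    have := P.flip.toLinearMap.apply_symm_toPerfPair_self
      (b.toWeightBasis.constr ℚ fun _ => (1 : ℚ))
    exact DFunLike.congr_fun this x
  rw [RootPairing.root', key, RootPairing.Base.height_eq_sum hf, hf, map_sum]
  push_cast
  refine Finset.sum_congr rfl fun j hj => ?_
  have e : b.toWeightBasis ⟨j, hj⟩ = P.root j := by simp
  rw [map_zsmul, ← e, Module.Basis.constr_basis]
  simp

/-- A vector of the coweight space on which each root takes its height as value. -/
def rhoCheck : N := (exists_height_functional b).choose

theorem root'_rhoCheck (i : ι) : P.root' i (rhoCheck b) = b.height i :=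
  (exists_height_functional b).choose_spec i

/-- Every simple root takes the value `1` at `rhoCheck b`, so each summand contributes at least `1`.
This makes the cone pointed. -/
theorem eq_zero_or_one_le_of_mem_posCone {x : V} (hx : x ∈ posCone b) :
    x = 0 ∨ 1 ≤ P.toLinearMap x (rhoCheck b) := by
  induction hx using AddSubmonoid.closure_induction with
  | mem x hx =>
    obtain ⟨j, hj, rfl⟩ := hx
    right
    have := root'_rhoCheck b j
    rw [RootPairing.Base.height_one_of_mem_support hj] at this
    rw [← RootPairing.root', this]
    simp
  | zero => exact Or.inl rfl
  | add x y _ _ hx hy =>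
    rcases hx with rfl | hx <;> rcases hy with rfl | hy
    · simp
    · right; simpa using hy
    · right; simpa using hx
    · right
      rw [map_add, LinearMap.add_apply]
      linarith

theorem posCone_antisymm {x : V} (hx : x ∈ posCone b) (hx' : -x ∈ posCone b) : x = 0 := by
  rcases eq_zero_or_one_le_of_mem_posCone b hx with h | h
  · exact h
  · rcases eq_zero_or_one_le_of_mem_posCone b hx' with h' | h'
    · simpa using h'
    · rw [map_neg, LinearMap.neg_apply] at h'
      linarith

theorem isPos_iff_mem_posCone {i : ι} : b.IsPos i ↔ P.root i ∈ posCone b := by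
  refine ⟨IsPos.mem_posCone b, fun h => ?_⟩
  rcases eq_zero_or_one_le_of_mem_posCone b h with h | h
  · exact absurd h (P.ne_zero i)
  · rw [← RootPairing.root', root'_rhoCheck] at h
    rw [RootPairing.Base.isPos_iff]
    exact_mod_cast lt_of_lt_of_le one_pos h

theorem mem_posCone_or_neg (i : ι) : P.root i ∈ posCone b ∨ -P.root i ∈ posCone b :=
  b.root_mem_or_neg_mem i

/-- A positive definite symmetric form invariant under the Weyl group. -/
theorem exists_weylForm (P : RootPairing ι ℚ V N) [P.IsRootSystem] :
    ∃ B : LinearMap.BilinForm ℚ V,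
    (∀ x j, 2 * B x (P.root j) = B (P.root j) (P.root j) * P.coroot' j x) ∧
    ∀ x, x ≠ 0 → 0 < B x x := by
  have := Fintype.ofFinite ι
  refine ⟨P.RootForm, fun x j => ?_, fun x hx => P.rootForm_pos_of_ne_zero ?_ hx⟩
  · have h := congrArg (P.toLinearMap x) (P.rootForm_self_smul_coroot j)
    rw [map_smul, map_nsmul, RootPairing.toLinearMap_apply_apply_Polarization] at h
    simp only [smul_eq_mul, nsmul_eq_mul] at h
    rw [show P.RootForm x (P.root j) = P.RootForm (P.root j) x from
      (P.rootForm_symmetric.eq _ _).symm]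
    exact_mod_cast h.symm
  · rw [RootPairing.rootSpan, RootPairing.IsRootSystem.span_root_eq_top]
    trivial

/-- The form chosen by `exists_weylForm`. -/
def weylForm (P : RootPairing ι ℚ V N) [P.IsRootSystem] : LinearMap.BilinForm ℚ V :=
  (exists_weylForm P).choose

theorem weylForm_root (x : V) (j : ι) :
    2 * weylForm P x (P.root j) = weylForm P (P.root j) (P.root j) * P.coroot' j x :=
  (exists_weylForm P).choose_spec.1 x j

theorem weylForm_pos {x : V} (hx : x ≠ 0) : 0 < weylForm P x x :=
  (exists_weylForm P).choose_spec.2 x hx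

variable {b} in
theorem weylForm_nonneg {x y : V} (hx : ∀ j ∈ b.support, 0 ≤ P.coroot' j x)
    (hy : y ∈ posCone b) : 0 ≤ weylForm P x y := by
  induction hy using AddSubmonoid.closure_induction with
  | mem y hy =>
    obtain ⟨j, hj, rfl⟩ := hy
    have h1 := weylForm_root (P := P) x j
    have h2 := mul_nonneg (weylForm_pos (P := P) (P.ne_zero j)).le (hx j hj)
    linarith
  | zero => simp
  | add y z _ _ hy hz => rw [map_add]; exact add_nonneg hy hz

variable [P.IsCrystallographic]

/-- A root that no other root dominates. -/
def IsMaximalRoot (i : ι) : Prop := ∀ j, P.root j - P.root i ∈ posCone b → j = i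

/-- Among the finitely many roots above `i` take one of greatest height: a root strictly above it
would have larger height. -/
theorem exists_isMaximalRoot (i : ι) : ∃ j, IsMaximalRoot b j ∧ P.root j - P.root i ∈ posCone b := by
  obtain ⟨j, hj, hmax⟩ := Set.Finite.exists_maximalFor (b.height)
    {j | P.root j - P.root i ∈ posCone b} (Set.toFinite _) ⟨i, by simp⟩
  refine ⟨j, fun l hl => ?_, hj⟩
  have h1 : P.root l - P.root i ∈ posCone b := by
    rw [← sub_add_sub_cancel]; exact add_mem hl hj
  rcases eq_zero_or_one_le_of_mem_posCone b hl with h | h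
  · exact P.root.injective (sub_eq_zero.1 h)
  · rw [map_sub, LinearMap.sub_apply, ← RootPairing.root', ← RootPairing.root', root'_rhoCheck,
      root'_rhoCheck] at h
    have h2 : b.height l ≤ b.height j := by
      by_contra hlt
      have := hmax h1 (by omega)
      omega
    have : (b.height l : ℚ) ≤ b.height j := by exact_mod_cast h2
    linarith

variable {b}

theorem IsMaximalRoot.isPos {i : ι} (hi : IsMaximalRoot b i) : b.IsPos i := by
  rw [isPos_iff_mem_posCone]
  refine (mem_posCone_or_neg b i).resolve_right fun h => ?_
  have e : P.root (P.reflectionPerm i i) = -P.root i := by simp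
  have h1 := hi (P.reflectionPerm i i) (by rw [e, sub_eq_add_neg]; exact add_mem h h)
  rw [h1] at e
  rw [eq_neg_iff_add_eq_zero, ← two_smul ℚ, smul_eq_zero] at e
  exact e.elim (by norm_num) (P.ne_zero i)

/-- A negative pairing with a simple root would make the sum of the two a root, which is strictly
larger. The exception, where the sum is zero, makes `i` the negative of a simple root, which is not
maximal. -/
theorem IsMaximalRoot.dominant {i : ι} (hi : IsMaximalRoot b i) {j : ι} (hj : j ∈ b.support) :
    0 ≤ P.pairingIn ℤ i j := by
  by_contra! h
  have hsimple : P.root j ∈ posCone b := AddSubmonoid.subset_closure ⟨j, hj, rfl⟩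
  by_cases h1 : P.root i = -P.root j
  · have := hi j (by rw [h1, sub_neg_eq_add]; exact add_mem hsimple hsimple)
    rw [this, eq_neg_iff_add_eq_zero, ← two_smul ℚ, smul_eq_zero] at h1
    exact h1.elim (by norm_num) (P.ne_zero i)
  · obtain ⟨l, hl⟩ := P.root_add_root_mem_of_pairingIn_neg h h1
    have h2 : P.root l - P.root i = P.root j := by rw [hl, add_sub_cancel_left]
    have := hi l (by rw [h2]; exact hsimple)
    rw [this, sub_self] at h2
    exact P.ne_zero j h2.symm

/-- Two different maximal roots are dominant and have nonpositive scalar product, since otherwise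
their difference would be a root and one would dominate the other. But one of them is a combination
of all simple roots with positive coefficients, so the other is orthogonal to all simple roots,
which is impossible. -/
theorem IsMaximalRoot.eq [P.IsReduced] [P.IsIrreducible] {i l : ι} (hi : IsMaximalRoot b i)
    (hl : IsMaximalRoot b l) : i = l := by
  classical
  by_contra hne
  have hdom : ∀ j ∈ b.support, 0 ≤ P.coroot' j (P.root i) := fun j hj => by
    rw [RootPairing.root_coroot'_eq_pairing, ← pairingIn_cast P]
    exact_mod_cast hi.dominant hj
  obtain ⟨f, hf⟩ := exists_nat_coeff_of_mem_posCone b (IsPos.mem_posCone b hl.isPos)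
  have hnp : ¬ 0 < P.pairingIn ℤ i l := fun h => by
    obtain ⟨m, hm⟩ := P.root_sub_root_mem_of_pairingIn_pos h hne
    rcases mem_posCone_or_neg b m with h | h
    · rw [hm] at h; exact hne (hl i h)
    · rw [hm, neg_sub] at h; exact hne (hi l h).symm
  have hB : weylForm P (P.root i) (P.root l) ≤ 0 := by
    have h1 := weylForm_root (P := P) (P.root i) l
    rw [RootPairing.root_coroot'_eq_pairing, ← pairingIn_cast P] at h1
    have h2 : (P.pairingIn ℤ i l : ℚ) ≤ 0 := by exact_mod_cast not_lt.1 hnp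
    have := mul_nonpos_of_nonneg_of_nonpos (weylForm_pos (P := P) (P.ne_zero l)).le h2
    linarith
  have hterm : ∀ j ∈ b.support, 0 ≤ weylForm P (P.root i) (P.root j) := fun j hj =>
    weylForm_nonneg hdom (AddSubmonoid.subset_closure (Set.mem_image_of_mem _ hj))
  -- The support of a maximal root is everything: at a node outside the support but adjacent to it
  -- the pairing would be negative, against dominance. Irreducibility enters as connectedness of the
  -- Dynkin diagram.
  have hpos : ∀ j : b.support, 0 < f j := by
    intro j
    obtain ⟨j₀, hj₀⟩ : ∃ j : b.support, 0 < f j := by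
      by_contra! h
      apply P.ne_zero l
      rw [hf]
      exact Finset.sum_eq_zero fun j hj => by simp [Nat.le_zero.1 (h ⟨j, hj⟩)]
    refine b.induction_on_cartanMatrix (fun j => 0 < f j) hj₀ fun m n hm hmn => ?_
    by_contra! hn
    have hn0 : f n = 0 := by omega
    have h1 := hl.dominant n.2
    have h2 : (P.pairingIn ℤ l n : ℚ) = ∑ j ∈ b.support, f j * P.pairing j n := by
      rw [pairingIn_cast, ← RootPairing.root_coroot'_eq_pairing, hf, map_sum]
      simp
    have hle : ∀ j ∈ b.support, (f j : ℚ) * P.pairing j n ≤ 0 := by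
      intro j hj
      by_cases hjn : j = n
      · simp [hjn, hn0]
      · have := b.pairingIn_le_zero_of_ne hjn hj n.2
        refine mul_nonpos_of_nonneg_of_nonpos (by positivity) ?_
        rw [← pairingIn_cast P]
        exact_mod_cast this
    have hlt : (f m : ℚ) * P.pairing m n < 0 := by
      have h3 : P.pairingIn ℤ m n ≠ 0 := by
        intro h0
        apply hmn
        rw [RootPairing.Base.cartanMatrix_apply_eq_zero_iff_symm]
        exact h0
      have hmn' : (m : ι) ≠ n := by
        intro h; rw [h, hn0] at hm; omega
      have h4 := b.pairingIn_le_zero_of_ne hmn' m.2 n.2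
      rw [← pairingIn_cast P]
      exact mul_neg_of_pos_of_neg (by exact_mod_cast hm) (by exact_mod_cast lt_of_le_of_ne h4 h3)
    have h5 : (P.pairingIn ℤ l n : ℚ) < 0 := by
      rw [h2]
      exact Finset.sum_neg' hle ⟨m, m.2, hlt⟩
    have : P.pairingIn ℤ l n < 0 := by exact_mod_cast h5
    omega
  have hzero : ∀ j ∈ b.support, (f j : ℚ) * weylForm P (P.root i) (P.root j) = 0 := by
    have hnn : ∀ j ∈ b.support, 0 ≤ (f j : ℚ) * weylForm P (P.root i) (P.root j) := fun j hj =>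
      mul_nonneg (by positivity) (hterm j hj)
    refine (Finset.sum_eq_zero_iff_of_nonneg hnn).1 (le_antisymm ?_ (Finset.sum_nonneg hnn))
    rw [hf, map_sum] at hB
    simpa using hB
  obtain ⟨j, hj, hj'⟩ := b.exists_mem_support_pos_pairingIn_ne_zero i
  apply hj'
  have h1 := hzero j hj
  have h2 : (f j : ℚ) ≠ 0 := by exact_mod_cast (hpos ⟨j, hj⟩).ne'
  have h3 := (mul_eq_zero.1 h1).resolve_left h2
  have h4 := weylForm_root (P := P) (P.root i) j
  rw [h3, mul_zero, eq_comm, mul_eq_zero] at h4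
  have h5 := h4.resolve_left (weylForm_pos (P.ne_zero j)).ne'
  rw [RootPairing.root_coroot'_eq_pairing, RootPairing.pairing_eq_zero_iff, ← pairingIn_cast P] at h5
  exact_mod_cast h5

variable (b) in
theorem exists_isHighestRoot [P.IsReduced] [P.IsIrreducible] : ∃ i, IsHighestRoot b i := by
  obtain ⟨j₀⟩ : Nonempty ι := by
    by_contra h
    rw [not_nonempty_iff] at h
    have h1 := RootPairing.IsRootSystem.span_root_eq_top (P := P)
    rw [Set.range_eq_empty, Submodule.span_empty] at h1
    have := RootPairing.IsIrreducible.nontrivial (P := P)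
    exact bot_ne_top h1
  obtain ⟨i, hi, -⟩ := exists_isMaximalRoot b j₀
  refine ⟨i, fun j => ?_⟩
  obtain ⟨l, hl, h⟩ := exists_isMaximalRoot b j
  rwa [hi.eq hl]

theorem IsHighestRoot.isMaximalRoot {i : ι} (hi : IsHighestRoot b i) : IsMaximalRoot b i :=
  fun j hj => P.root.injective (sub_eq_zero.1 (posCone_antisymm b hj (by rw [neg_sub]; exact hi j)))

end RootCombinatorics
end AffineMomentGraph

/-! ## Affine reflections -/

namespace AffineMomentGraph

section AffineReflections

variable {ι V N : Type u} [AddCommGroup V] [Module ℚ V] [AddCommGroup N] [Module ℚ N]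
variable {P : RootPairing ι ℚ V N}

/-- The action of the affine Weyl group on the coweight space. -/
def act (w : AffW P) (v : N) : N := (w : N ≃ᵃ[ℚ] N) v

@[simp] theorem act_one (v : N) : act (1 : AffW P) v = v := rfl

@[simp] theorem act_mul (w w' : AffW P) (v : N) : act (w * w') v = act w (act w' v) := rfl

theorem AffW.ext {w w' : AffW P} (h : ∀ v, act w v = act w' v) : w = w' :=
  Subtype.ext (AffineEquiv.ext h)

/-- The affine function `α - n`, `α = P.root i`. -/
def affVal (P : RootPairing ι ℚ V N) (i : ι) (n : ℤ) (v : N) : ℚ := P.root' i v - n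

theorem act_refl (i : ι) (n : ℤ) (v : N) :
    act (refl P i n) v = v - affVal P i n v • P.coroot i := affRefl_apply P i n v

theorem root'_coroot (i j : ι) : P.root' i (P.coroot j) = P.pairing i j :=
  P.root_coroot_eq_pairing i j

@[simp] theorem refl_mul_self (i : ι) (n : ℤ) : refl P i n * refl P i n = 1 := by
  refine AffW.ext fun v => ?_
  rw [act_mul, act_refl, act_refl, act_one, affVal, affVal, map_sub, map_smul, root'_coroot,
    P.pairing_same, sub_sub, ← add_smul]
  convert! sub_zero v
  simp only [smul_eq_mul]
  convert! zero_smul ℚ _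
  ring

@[simp] theorem refl_inv (i : ι) (n : ℤ) : (refl P i n)⁻¹ = refl P i n :=
  inv_eq_of_mul_eq_one_left (refl_mul_self i n)

@[simp] theorem refl_mul_refl_mul (i : ι) (n : ℤ) (w : AffW P) :
    refl P i n * (refl P i n * w) = w := by
  rw [← mul_assoc, refl_mul_self, one_mul]

theorem affVal_refl (i : ι) (n : ℤ) (v : N) :
    affVal P i n (act (refl P i n) v) = - affVal P i n v := by
  rw [act_refl, affVal, affVal, map_sub, map_smul, root'_coroot, P.pairing_same, smul_eq_mul]
  ring

theorem AffW.induction {p : AffW P → Prop} (h1 : p 1)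
    (h : ∀ i n w, p w → p (refl P i n * w)) (w : AffW P) : p w := by
  obtain ⟨w, hw⟩ := w
  induction hw using Subgroup.closure_induction_left with
  | one => exact h1
  | mul_left x hx y hy ih =>
    obtain ⟨⟨i, n⟩, rfl⟩ := hx
    exact h i n ⟨y, hy⟩ ih
  | inv_mul_cancel x hx y hy ih =>
    obtain ⟨⟨i, n⟩, rfl⟩ := hx
    have := h i n ⟨y, hy⟩ ih
    rw [← refl_inv] at this
    exact this

/-- The index of the negative root. -/
abbrev negIdx (P : RootPairing ι ℚ V N) (i : ι) : ι := P.reflectionPerm i i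

theorem root_negIdx (i : ι) : P.root (negIdx P i) = -P.root i := by simp

theorem coroot_negIdx (i : ι) : P.coroot (negIdx P i) = -P.coroot i := by simp

theorem affVal_negIdx (i : ι) (n : ℤ) (v : N) :
    affVal P (negIdx P i) (-n) v = - affVal P i n v := by
  rw [affVal, affVal, RootPairing.root', root_negIdx, map_neg, LinearMap.neg_apply]
  push_cast
  ring

theorem refl_negIdx (i : ι) (n : ℤ) : refl P (negIdx P i) (-n) = refl P i n := by
  refine AffW.ext fun v => ?_
  rw [act_refl, act_refl, affVal_negIdx, coroot_negIdx, smul_neg, neg_smul, neg_neg]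

variable [P.IsCrystallographic]

/-- The integer `n'` such that `s_{k,l}` takes the affine root `α_n` to `(s_k α)_{n'}`. -/
abbrev reflShift (P : RootPairing ι ℚ V N) [P.IsCrystallographic] (k : ι) (l : ℤ) (i : ι) (n : ℤ) :
    ℤ := n - P.pairingIn ℤ i k * l

theorem affVal_act_refl (k : ι) (l : ℤ) (i : ι) (n : ℤ) (v : N) :
    affVal P i n (act (refl P k l) v) =
      affVal P (P.reflectionPerm k i) (reflShift P k l i n) v := by
  rw [act_refl]
  simp only [affVal, map_sub, map_smul, root'_coroot, smul_eq_mul, RootPairing.root',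
    RootPairing.root_reflectionPerm, RootPairing.reflection_apply_root, LinearMap.sub_apply,
    LinearMap.smul_apply]
  push_cast [pairingIn_cast P]
  ring

theorem refl_mul_refl (k : ι) (l : ℤ) (i : ι) (n : ℤ) :
    refl P i n * refl P k l =
      refl P k l * refl P (P.reflectionPerm k i) (reflShift P k l i n) := by
  refine AffW.ext fun v => ?_
  rw [act_mul, act_mul, act_refl i, affVal_act_refl]
  set t := affVal P (P.reflectionPerm k i) (reflShift P k l i n) v
  rw [act_refl (P.reflectionPerm k i)]
  change _ = act _ (v - t • _)
  have e : P.coroot i = P.coroot (P.reflectionPerm k i) -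
      P.root' k (P.coroot (P.reflectionPerm k i)) • P.coroot k := by
    rw [RootPairing.coroot_reflectionPerm, ← RootPairing.coreflection_apply]
    simp
  rw [act_refl k, act_refl k, e]
  simp only [affVal, map_sub, map_smul, smul_eq_mul]
  module

/-- This is the action of `w⁻¹` on affine roots. It is kept existential, so that no action on pairs
of a root index and an integer has to be defined. -/
theorem exists_transport (w : AffW P) (i : ι) (n : ℤ) : ∃ j m,
    (∀ v, affVal P j m v = affVal P i n (act w v)) ∧ refl P i n * w = w * refl P j m := by
  induction w using AffW.induction generalizing i n with
  | h1 => exact ⟨i, n, fun _ => rfl, by simp⟩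
  | h k l w ih =>
    obtain ⟨j, m, h, h'⟩ := ih (P.reflectionPerm k i) (reflShift P k l i n)
    refine ⟨j, m, fun v => ?_, ?_⟩
    · rw [h, act_mul, affVal_act_refl]
    · rw [← mul_assoc, refl_mul_refl, mul_assoc, h', mul_assoc]

end AffineReflections

/-! ### Positive affine roots, simple affine roots and generation by simple reflections. -/

section Positivity

variable {ι V N : Type u} [AddCommGroup V] [Module ℚ V] [AddCommGroup N] [Module ℚ N]
variable {P : RootPairing ι ℚ V N} (b : P.Base)
variable [Finite ι] [P.IsRootSystem] [P.IsCrystallographic]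

theorem height_lt_coxeterNumber (i : ι) : b.height i < coxeterNumber b := by
  have : b.height i ≤ ⨆ i, b.height i := le_ciSup (Set.finite_range _).bddAbove i
  rw [coxeterNumber]
  omega

theorem height_negIdx (i : ι) : b.height (negIdx P i) = - b.height i := by
  have h := root'_rhoCheck b (negIdx P i)
  rw [RootPairing.root', root_negIdx, map_neg, LinearMap.neg_apply, ← RootPairing.root',
    root'_rhoCheck] at h
  exact_mod_cast h.symm

theorem abs_height_lt (i : ι) : |b.height i| < coxeterNumber b := by
  have h1 := height_lt_coxeterNumber b i
  have h2 := height_lt_coxeterNumber b (negIdx P i)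
  rw [height_negIdx] at h2
  rw [abs_lt]
  omega

theorem coxeterNumber_pos (i : ι) : 0 < coxeterNumber b := (abs_nonneg _).trans_lt (abs_height_lt b i)

/-- A point of the fundamental alcove: all simple roots take the value `1 / h`. -/
def basePt : N := ((coxeterNumber b : ℚ)⁻¹) • rhoCheck b

/-- The value of the affine root `α_n` at the base point, multiplied with the Coxeter number. -/
def level (i : ι) (n : ℤ) : ℤ := b.height i - n * coxeterNumber b

theorem affVal_basePt (i : ι) (n : ℤ) :
    affVal P i n (basePt b) = (coxeterNumber b : ℚ)⁻¹ * level b i n := by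
  have h : (0 : ℚ) < coxeterNumber b := by exact_mod_cast coxeterNumber_pos b i
  rw [affVal, basePt, map_smul, root'_rhoCheck, level, smul_eq_mul]
  push_cast
  field_simp

/-- All heights are smaller than `h` in absolute value, so the sign of `height - n h` is decided by
`n` unless `n = 0`. -/
theorem isPosAff_iff_level (i : ι) (n : ℤ) : IsPosAff b i n ↔ 0 < level b i n := by
  have h := abs_lt.1 (abs_height_lt b i)
  rw [level, IsPosAff, RootPairing.Base.isPos_iff]
  constructor
  · rintro (h1 | ⟨rfl, h1⟩)
    · nlinarith
    · omega
  · intro h1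
    by_contra! h2
    have h3 : 0 ≤ n := h2.1
    rcases h3.eq_or_lt with h4 | h4
    · have := h2.2 h4.symm
      rw [← h4] at h1
      omega
    · nlinarith

theorem level_ne_zero (i : ι) (n : ℤ) : level b i n ≠ 0 := by
  have h := abs_lt.1 (abs_height_lt b i)
  have h0 := b.height_ne_zero i
  rw [level]
  intro h1
  rcases lt_trichotomy n 0 with h2 | h2 | h2
  · nlinarith
  · subst h2; omega
  · nlinarith

theorem isPosAff_iff (i : ι) (n : ℤ) : IsPosAff b i n ↔ 0 < affVal P i n (basePt b) := by
  have h : (0 : ℚ) < coxeterNumber b := by exact_mod_cast coxeterNumber_pos b i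
  rw [isPosAff_iff_level, affVal_basePt, mul_pos_iff_of_pos_left (inv_pos.2 h)]
  exact_mod_cast Iff.rfl

theorem affVal_basePt_ne_zero (i : ι) (n : ℤ) (w : AffW P) : affVal P i n (act w (basePt b)) ≠ 0 := by
  obtain ⟨j, m, h, -⟩ := exists_transport w i n
  rw [← h, affVal_basePt]
  have h : (0 : ℚ) < coxeterNumber b := by exact_mod_cast coxeterNumber_pos b i
  exact mul_ne_zero (inv_pos.2 h).ne' (by exact_mod_cast level_ne_zero b j m)

theorem basePt_mem : basePt b ∈ fundamentalAlcove b := by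
  intro i hi
  have h : (0 : ℚ) < coxeterNumber b := by exact_mod_cast coxeterNumber_pos b i
  have h1 : (b.height i : ℚ) < coxeterNumber b := by exact_mod_cast height_lt_coxeterNumber b i
  have h2 : (0 : ℚ) < b.height i := by exact_mod_cast (b.isPos_iff.1 hi)
  rw [basePt, map_smul, root'_rhoCheck, smul_eq_mul]
  exact ⟨by positivity, by rw [inv_mul_lt_one₀ h]; exact h1⟩

theorem isPosAff_or (i : ι) (n : ℤ) : IsPosAff b i n ∨ IsPosAff b (negIdx P i) (-n) := by
  rw [isPosAff_iff, isPosAff_iff, affVal_negIdx, neg_pos]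
  exact (affVal_basePt_ne_zero b i n 1).lt_or_gt.symm

/-- The simple affine roots. -/
def IsSimpleAff (i : ι) (n : ℤ) : Prop :=
  (i ∈ b.support ∧ n = 0) ∨ ((∃ j, IsHighestRoot b j ∧ i = negIdx P j) ∧ n = -1)

variable {b}

theorem exists_isSimpleAff {s : AffW P} (hs : s ∈ simpleRefl b) :
    ∃ i n, IsSimpleAff b i n ∧ s = refl P i n := by
  rcases hs with ⟨i, hi, rfl⟩ | ⟨i, hi, rfl⟩
  · exact ⟨i, 0, Or.inl ⟨hi, rfl⟩, rfl⟩
  · exact ⟨negIdx P i, -1, Or.inr ⟨⟨i, hi, rfl⟩, rfl⟩, (refl_negIdx i 1).symm⟩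

theorem IsSimpleAff.mem {i : ι} {n : ℤ} (h : IsSimpleAff b i n) : refl P i n ∈ simpleRefl b := by
  rcases h with ⟨h, rfl⟩ | ⟨⟨j, hj, rfl⟩, rfl⟩
  · exact Or.inl ⟨i, h, rfl⟩
  · exact Or.inr ⟨j, hj, refl_negIdx j 1⟩

theorem IsSimpleAff.isPosAff {i : ι} {n : ℤ} (h : IsSimpleAff b i n) : IsPosAff b i n := by
  rcases h with ⟨h, rfl⟩ | ⟨-, rfl⟩
  · exact Or.inr ⟨rfl, RootPairing.Base.isPos_of_mem_support h⟩
  · exact Or.inl (by norm_num)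

theorem IsHighestRoot.pairingIn_nonneg {i : ι} (hi : IsHighestRoot b i) {j : ι} (hj : b.IsPos j) :
    0 ≤ P.pairingIn ℤ j i := by
  have hdom : ∀ k ∈ b.support, 0 ≤ P.coroot' k (P.root i) := fun k hk => by
    rw [RootPairing.root_coroot'_eq_pairing, ← pairingIn_cast]
    exact_mod_cast hi.isMaximalRoot.dominant hk
  by_contra! h3
  rw [P.pairingIn_lt_zero_iff] at h3
  have h1 := weylForm_nonneg hdom (IsPos.mem_posCone b hj)
  have h2 := weylForm_root (P := P) (P.root i) j
  rw [RootPairing.root_coroot'_eq_pairing, ← pairingIn_cast] at h2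
  have h4 : (P.pairingIn ℤ i j : ℚ) < 0 := by exact_mod_cast h3
  have := mul_neg_of_pos_of_neg (weylForm_pos (P := P) (P.ne_zero j)) h4
  linarith

/-- For a finite simple reflection this is the classical fact on positive roots. The affine simple
reflection sends `α_n` to `(α - cγ)_{n-c}` with `c = ⟨α, γ^∨⟩`, where `γ` is the highest root, and
the sign of the image is read off from `n - c`, a case distinction in `c`. -/
theorem IsSimpleAff.isPosAff_refl [P.IsReduced] {k : ι} {l : ℤ} (hs : IsSimpleAff b k l) {i : ι}
    {n : ℤ} (hi : IsPosAff b i n) (hne : (i, n) ≠ (k, l)) :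
    IsPosAff b (P.reflectionPerm k i) (reflShift P k l i n) := by
  rcases hs with ⟨hk, rfl⟩ | ⟨⟨g, hg, rfl⟩, rfl⟩
  · rw [reflShift, mul_zero, sub_zero]
    rcases hi with hn | ⟨rfl, hi⟩
    · exact Or.inl hn
    · exact Or.inr ⟨rfl, hi.reflectionPerm hk fun h => hne (by rw [h])⟩
  · have hgpos : P.root g ∈ posCone b := IsPos.mem_posCone b hg.isMaximalRoot.isPos
    have hc : P.pairingIn ℤ i (negIdx P g) = - P.pairingIn ℤ i g := by simp
    have hroot : P.root (P.reflectionPerm (negIdx P g) i) =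
        P.root i - P.pairingIn ℤ i g • P.root g := by
      rw [RootPairing.root_reflectionPerm, RootPairing.reflection_apply_root, root_negIdx,
        ← pairingIn_cast, hc, ← Int.cast_smul_eq_zsmul ℚ]
      push_cast
      simp
    rw [reflShift, hc, neg_mul_neg, mul_one]
    set c := P.pairingIn ℤ i g with hcdef
    rcases le_or_gt 0 c with h0 | h0
    · rcases hi with hn | ⟨rfl, hi⟩
      · exact Or.inl (by omega)
      · rcases h0.eq_or_lt with h0 | h0
        · refine Or.inr ⟨by omega, ?_⟩
          rw [isPos_iff_mem_posCone, hroot, ← h0, zero_smul, sub_zero]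
          exact IsPos.mem_posCone b hi
        · exact Or.inl (by omega)
    · have hn : n < 0 := by
        rcases hi with hn | ⟨rfl, hi⟩
        · exact hn
        · have := hg.pairingIn_nonneg hi
          omega
      -- If `c ≤ -2`, then `α + γ` and `-(α + γ)` both lie in the positive cone, the latter because
      -- `γ` dominates `α - cγ`. So `α = -γ`, and the excluded case `(α, n) = (-γ, -1)` is the
      -- simple affine root itself. If `c = -1`, then `α + γ` is a root, and it lies in the cone
      -- because `γ` dominates `-α`.
      rcases (show c ≤ -2 ∨ c = -1 by omega) with h2 | h2
      · have h3 := hg (negIdx P i)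
        have h4 := hg (P.reflectionPerm (negIdx P g) i)
        obtain ⟨e, he⟩ := Int.eq_ofNat_of_zero_le (show 0 ≤ -c - 2 by omega)
        have h5 : -(P.root g - P.root (negIdx P i)) ∈ posCone b := by
          have := add_mem h4 (nsmul_mem hgpos e)
          rw [hroot] at this
          convert! this using 1
          rw [root_negIdx, show c = -2 - (e : ℤ) by omega]
          module
        have h6 := posCone_antisymm b h3 h5
        rw [root_negIdx, sub_neg_eq_add] at h6
        have h7 : i = negIdx P g := P.root.injective (by
          rw [root_negIdx]; exact eq_neg_of_add_eq_zero_right h6)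
        have h8 : c = -2 := by rw [hcdef, h7]; simp
        have h9 : n ≠ -1 := fun h => hne (by rw [h, h7])
        rcases (show n = -2 ∨ n < -2 by omega) with h10 | h10
        · refine Or.inr ⟨by omega, ?_⟩
          rw [isPos_iff_mem_posCone, hroot, h8, h7, root_negIdx]
          convert! hgpos using 1
          module
        · exact Or.inl (by omega)
      · rcases (show n = -1 ∨ n < -1 by omega) with h10 | h10
        · refine Or.inr ⟨by omega, ?_⟩
          rw [isPos_iff_mem_posCone, hroot, h2]
          convert! hg (negIdx P i) using 1
          rw [root_negIdx]
          module
        · exact Or.inl (by omega)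

/-- Otherwise `-α` is dominant and pairs nonpositively with `γ`. Pairing `-α` with the cone element
`γ + α` then gives a nonnegative number that is at most `-(α, α)`, a contradiction. -/
theorem exists_isSimpleAff_pairingIn_pos [P.IsReduced] [P.IsIrreducible] (i : ι) :
    ∃ k l, IsSimpleAff b k l ∧ 0 < P.pairingIn ℤ i k := by
  by_contra! h
  obtain ⟨g, hg⟩ := exists_isHighestRoot b
  have h1 : ∀ j ∈ b.support, 0 ≤ P.coroot' j (-P.root i) := fun j hj => by
    have := h j 0 (Or.inl ⟨hj, rfl⟩)
    rw [map_neg, RootPairing.root_coroot'_eq_pairing, ← pairingIn_cast]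
    have : (P.pairingIn ℤ i j : ℚ) ≤ 0 := by exact_mod_cast this
    linarith
  have h2 := weylForm_nonneg h1 (hg (negIdx P i))
  have h3 := h (negIdx P g) (-1) (Or.inr ⟨⟨g, hg, rfl⟩, rfl⟩)
  have h4 := weylForm_root (P := P) (P.root i) g
  rw [RootPairing.root_coroot'_eq_pairing, ← pairingIn_cast] at h4
  have h5 : (0 : ℚ) ≤ P.pairingIn ℤ i g := by
    rw [show P.pairingIn ℤ i (negIdx P g) = - P.pairingIn ℤ i g by simp] at h3
    exact_mod_cast (by omega : 0 ≤ P.pairingIn ℤ i g)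
  have h6 := mul_nonneg (weylForm_pos (P := P) (P.ne_zero g)).le h5
  have h7 := weylForm_pos (P := P) (P.ne_zero i)
  rw [root_negIdx, sub_neg_eq_add, map_add, map_neg, LinearMap.neg_apply, LinearMap.neg_apply] at h2
  linarith

theorem level_refl (k : ι) (l : ℤ) (i : ι) (n : ℤ) :
    level b (P.reflectionPerm k i) (reflShift P k l i n) =
      level b i n - P.pairingIn ℤ i k * level b k l := by
  have : P.root (P.reflectionPerm k i) = P.root i + (-P.pairingIn ℤ i k) • P.root k := by
    rw [RootPairing.root_reflectionPerm, RootPairing.reflection_apply_root,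
      ← pairingIn_cast, neg_smul, ← Int.cast_smul_eq_zsmul ℚ, sub_eq_add_neg]
  rw [level, level, level, b.height_add_zsmul this, smul_eq_mul, reflShift]
  ring

-- Descent on the level: conjugating with a simple affine reflection whose root pairs positively
-- with `α` lowers the level and keeps it positive, until the root is itself simple.
variable (b) in
theorem refl_mem_closure [P.IsReduced] [P.IsIrreducible] (i : ι) (n : ℤ) :
    refl P i n ∈ Subgroup.closure (simpleRefl b) := by
  have key : ∀ (m : ℕ) (i : ι) (n : ℤ), level b i n = m → IsPosAff b i n →
      refl P i n ∈ Subgroup.closure (simpleRefl b) := by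
    intro m
    induction m using Nat.strong_induction_on with
    | _ m ih =>
      intro i n hm hpos
      obtain ⟨k, l, hkl, hp⟩ := exists_isSimpleAff_pairingIn_pos (b := b) i
      by_cases heq : (i, n) = (k, l)
      · rw [Prod.mk.injEq] at heq
        rw [heq.1, heq.2]
        exact Subgroup.subset_closure hkl.mem
      · have h1 := hkl.isPosAff_refl hpos heq
        have h2 := level_refl (b := b) k l i n
        have h3 := (isPosAff_iff_level b _ _).1 hkl.isPosAff
        have h4 := (isPosAff_iff_level b _ _).1 h1
        obtain ⟨m', hm'⟩ := Int.eq_ofNat_of_zero_le h4.le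
        have h5 := ih m' (by have := mul_pos hp h3; omega) _ _ hm' h1
        have h6 := refl_mul_refl (P := P) k l i n
        have h7 : refl P i n = refl P k l *
            refl P (P.reflectionPerm k i) (reflShift P k l i n) * refl P k l := by
          rw [← h6, mul_assoc, refl_mul_self, mul_one]
        rw [h7]
        have h8 := Subgroup.subset_closure (k := simpleRefl b) hkl.mem
        exact mul_mem (mul_mem h8 h5) h8
  have key' : ∀ (i : ι) (n : ℤ), IsPosAff b i n → refl P i n ∈ Subgroup.closure (simpleRefl b) :=
    fun i n h => by
      obtain ⟨m, hm⟩ := Int.eq_ofNat_of_zero_le ((isPosAff_iff_level b _ _).1 h).le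
      exact key m i n hm h
  rcases isPosAff_or b i n with h | h
  · exact key' i n h
  · rw [← refl_negIdx]
    exact key' _ _ h

end Positivity
end AffineMomentGraph

/-! ## Length and Bruhat order -/

namespace AffineMomentGraph

section Length

variable {ι V N : Type u} [AddCommGroup V] [Module ℚ V] [AddCommGroup N] [Module ℚ N]
variable {P : RootPairing ι ℚ V N} (b : P.Base)
variable [Finite ι] [P.IsRootSystem] [P.IsCrystallographic] [P.IsReduced] [P.IsIrreducible]

variable {b} in
theorem simple_mul_self {s : AffW P} (hs : s ∈ simpleRefl b) : s * s = 1 := by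
  obtain ⟨i, n, -, rfl⟩ := exists_isSimpleAff hs
  exact refl_mul_self i n

theorem exists_word (w : AffW P) :
    ∃ l : List (AffW P), (∀ s ∈ l, s ∈ simpleRefl b) ∧ l.prod = w := by
  have hw : w ∈ Subgroup.closure (simpleRefl b) := by
    induction w using AffW.induction with
    | h1 => exact one_mem _
    | h i n w ih => exact mul_mem (refl_mem_closure b i n) ih
  induction hw using Subgroup.closure_induction_left with
  | one => exact ⟨[], by simp, rfl⟩
  | mul_left x hx y hy ih =>
    obtain ⟨l, hl, rfl⟩ := ih
    exact ⟨x :: l, List.forall_mem_cons.2 ⟨hx, hl⟩, by simp⟩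
  | inv_mul_cancel x hx y hy ih =>
    obtain ⟨l, hl, rfl⟩ := ih
    exact ⟨x :: l, List.forall_mem_cons.2 ⟨hx, hl⟩, by
      rw [List.prod_cons, inv_eq_of_mul_eq_one_left (simple_mul_self hx)]⟩

theorem exists_reduced_word (w : AffW P) :
    ∃ l : List (AffW P), (∀ s ∈ l, s ∈ simpleRefl b) ∧ l.prod = w ∧ l.length = length b w := by
  have h : {n | ∃ l : List (AffW P), (∀ s ∈ l, s ∈ simpleRefl b) ∧ l.prod = w ∧
      l.length = n}.Nonempty := by
    obtain ⟨l, hl, hw⟩ := exists_word b w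
    exact ⟨_, l, hl, hw, rfl⟩
  exact Nat.sInf_mem h

variable {b}

theorem length_prod_le {l : List (AffW P)} (hl : ∀ s ∈ l, s ∈ simpleRefl b) :
    length b l.prod ≤ l.length := Nat.sInf_le ⟨l, hl, rfl, rfl⟩

theorem length_one : length b (1 : AffW P) = 0 :=
  Nat.le_zero.1 (length_prod_le (b := b) (l := []) (by simp))

theorem eq_one_of_length_eq_zero {w : AffW P} (h : length b w = 0) : w = 1 := by
  obtain ⟨l, -, rfl, hl⟩ := exists_reduced_word b w
  rw [h, List.length_eq_zero_iff] at hl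
  simp [hl]

/-- Passing from an alcove to the adjacent one along a simple reflection changes the sign of
exactly one affine root. -/
theorem refl_eq_of_sign_change {s : AffW P} (hs : s ∈ simpleRefl b) {i : ι} {n : ℤ}
    (h : affVal P i n (basePt b) * affVal P i n (act s (basePt b)) < 0) : refl P i n = s := by
  obtain ⟨k, l, hkl, rfl⟩ := exists_isSimpleAff hs
  have key : ∀ {i : ι} {n : ℤ}, 0 < affVal P i n (basePt b) →
      affVal P i n (act (refl P k l) (basePt b)) < 0 → refl P i n = refl P k l := by
    intro i n h1 h2
    by_contra hne
    have h3 := hkl.isPosAff_refl ((isPosAff_iff b i n).2 h1) (fun h => hne (by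
      rw [Prod.mk.injEq] at h; rw [h.1, h.2]))
    rw [isPosAff_iff, ← affVal_act_refl] at h3
    linarith
  rcases mul_neg_iff.1 h with ⟨h1, h2⟩ | ⟨h1, h2⟩
  · exact key h1 h2
  · rw [← refl_negIdx]
    apply key <;> rw [affVal_negIdx] <;> linarith

/-- This is the strong exchange condition. The hyperplane separates the first from the last alcove
of the gallery given by the word, so some letter crosses it, and that letter can be deleted. -/
theorem exists_shorter_word {l : List (AffW P)} (hl : ∀ s ∈ l, s ∈ simpleRefl b) {i : ι} {n : ℤ}
    (h : affVal P i n (basePt b) * affVal P i n (act l.prod (basePt b)) < 0) :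
    ∃ l' : List (AffW P), (∀ s ∈ l', s ∈ simpleRefl b) ∧ l'.prod = refl P i n * l.prod ∧
      l'.length < l.length := by
  induction l generalizing i n with
  | nil =>
    rw [List.prod_nil, act_one] at h
    nlinarith [mul_self_nonneg (affVal P i n (basePt b))]
  | cons s l ih =>
    rw [List.forall_mem_cons] at hl
    rw [List.prod_cons, act_mul] at h
    by_cases hs : refl P i n = s
    · exact ⟨l, hl.2, by rw [List.prod_cons, hs, ← mul_assoc, simple_mul_self hl.1, one_mul],
        by simp⟩
    · have h1 : 0 < affVal P i n (basePt b) * affVal P i n (act s (basePt b)) := by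
        rcases lt_trichotomy (affVal P i n (basePt b) * affVal P i n (act s (basePt b))) 0 with
          h2 | h2 | h2
        · exact absurd (refl_eq_of_sign_change hl.1 h2) hs
        · rcases mul_eq_zero.1 h2 with h3 | h3
          · exact absurd h3 (affVal_basePt_ne_zero b i n 1)
          · exact absurd h3 (affVal_basePt_ne_zero b i n s)
        · exact h2
      obtain ⟨j, m, hjm, hr⟩ := exists_transport s i n
      obtain ⟨l', hl', hp, hlen⟩ := ih hl.2 (i := j) (n := m) (by
        rw [hjm, hjm]
        by_contra! h2
        nlinarith [mul_nonneg h1.le h2, mul_neg_of_pos_of_neg (mul_self_pos.2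
          (affVal_basePt_ne_zero b i n s)) h])
      refine ⟨s :: l', List.forall_mem_cons.2 ⟨hl.1, hl'⟩, ?_, by simpa using hlen⟩
      rw [List.prod_cons, List.prod_cons, hp, ← mul_assoc, ← mul_assoc, hr]

theorem length_refl_mul_lt {w : AffW P} {i : ι} {n : ℤ}
    (h : affVal P i n (basePt b) * affVal P i n (act w (basePt b)) < 0) :
    length b (refl P i n * w) < length b w := by
  obtain ⟨l, hl, rfl, hlen⟩ := exists_reduced_word b w
  obtain ⟨l', hl', hp, hlen'⟩ := exists_shorter_word hl h
  rw [← hp, ← hlen]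
  exact (length_prod_le hl').trans_lt hlen'

/-- A reflection lengthens `w` exactly when its hyperplane does not separate the alcove of `w` from
the fundamental one. All later comparisons of lengths are reduced to signs by this. -/
theorem length_lt_refl_mul_iff {w : AffW P} {i : ι} {n : ℤ} :
    length b w < length b (refl P i n * w) ↔
      0 < affVal P i n (basePt b) * affVal P i n (act w (basePt b)) := by
  have hne : affVal P i n (basePt b) * affVal P i n (act w (basePt b)) ≠ 0 :=
    mul_ne_zero (affVal_basePt_ne_zero b i n 1) (affVal_basePt_ne_zero b i n w)
  constructor
  · intro h
    by_contra! h1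
    have := length_refl_mul_lt (h1.lt_of_ne hne)
    omega
  · intro h
    have := length_refl_mul_lt (b := b) (w := refl P i n * w) (i := i) (n := n) (by
      rw [act_mul, affVal_refl]; linarith)
    rwa [refl_mul_refl_mul] at this

theorem length_refl_mul_ne (w : AffW P) (i : ι) (n : ℤ) :
    length b (refl P i n * w) < length b w ∨ length b w < length b (refl P i n * w) := by
  have hne : affVal P i n (basePt b) * affVal P i n (act w (basePt b)) ≠ 0 :=
    mul_ne_zero (affVal_basePt_ne_zero b i n 1) (affVal_basePt_ne_zero b i n w)
  rcases hne.lt_or_gt with h | h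
  · exact Or.inl (length_refl_mul_lt h)
  · exact Or.inr (length_lt_refl_mul_iff.2 h)

/-- Right multiplication with a simple reflection is left multiplication with a reflection. -/
theorem exists_mul_simple {s : AffW P} (hs : s ∈ simpleRefl b) (w : AffW P) :
    ∃ i n, IsPosAff b i n ∧ w * s = refl P i n * w := by
  obtain ⟨k, l, -, rfl⟩ := exists_isSimpleAff hs
  obtain ⟨j, m, -, h⟩ := exists_transport w⁻¹ k l
  have e : w * refl P k l = refl P j m * w := by
    have : w * (refl P k l * w⁻¹) * w = w * (w⁻¹ * refl P j m) * w := by rw [h]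
    simpa [mul_assoc] using this
  rcases isPosAff_or b j m with hp | hp
  · exact ⟨j, m, hp, e⟩
  · exact ⟨_, _, hp, by rw [refl_negIdx]; exact e⟩

theorem length_mul_simple_le {s : AffW P} (hs : s ∈ simpleRefl b) (w : AffW P) :
    length b (w * s) ≤ length b w + 1 := by
  obtain ⟨l, hl, rfl, hlen⟩ := exists_reduced_word b w
  have := length_prod_le (b := b) (l := l ++ [s]) (by
    intro t ht
    rcases List.mem_append.1 ht with h | h
    · exact hl t h
    · rw [List.mem_singleton.1 h]; exact hs)
  simpa [hlen] using this

theorem length_mul_simple {s : AffW P} (hs : s ∈ simpleRefl b) (w : AffW P) :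
    length b (w * s) = length b w + 1 ∨ length b w = length b (w * s) + 1 := by
  have h1 := length_mul_simple_le hs w
  have h2 := length_mul_simple_le hs (w * s)
  rw [mul_assoc, simple_mul_self hs, mul_one] at h2
  obtain ⟨i, n, -, h⟩ := exists_mul_simple hs w
  have := length_refl_mul_ne (b := b) w i n
  rw [← h] at this
  omega

/-- A reflection that lengthens `w` also lengthens `w s`, unless it exchanges `w` and `w s`. -/
theorem length_lt_refl_mul_mul {s : AffW P} (hs : s ∈ simpleRefl b) {w : AffW P} {i : ι} {n : ℤ}
    (h : length b w < length b (refl P i n * w)) (hne : refl P i n * w ≠ w * s) :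
    length b (w * s) < length b (refl P i n * (w * s)) := by
  rw [length_lt_refl_mul_iff] at h ⊢
  obtain ⟨j, m, hjm, hr⟩ := exists_transport w i n
  have h1 : 0 < affVal P j m (basePt b) * affVal P j m (act s (basePt b)) := by
    rcases lt_trichotomy (affVal P j m (basePt b) * affVal P j m (act s (basePt b))) 0 with
      h2 | h2 | h2
    · exact absurd (by rw [hr, refl_eq_of_sign_change hs h2]) hne
    · rcases mul_eq_zero.1 h2 with h3 | h3
      · exact absurd h3 (affVal_basePt_ne_zero b j m 1)
      · exact absurd h3 (affVal_basePt_ne_zero b j m s)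
    · exact h2
  rw [hjm, hjm] at h1
  rw [act_mul]
  by_contra! h2
  nlinarith [mul_pos h h1, mul_self_pos.2 (affVal_basePt_ne_zero b i n w)]

/-! ### The Bruhat order -/

theorem BruhatLE.length_le {x y : AffW P} (h : BruhatLE b x y) : length b x ≤ length b y := by
  rcases h.eq_or_length_lt with rfl | h
  · exact le_rfl
  · exact h.le

theorem BruhatLE.trans {x y z : AffW P} (h : BruhatLE b x y) (h' : BruhatLE b y z) :
    BruhatLE b x z := Relation.ReflTransGen.trans h h'

theorem BruhatLE.antisymm {x y : AffW P} (h : BruhatLE b x y) (h' : BruhatLE b y x) : x = y := by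
  rcases h.eq_or_length_lt with h1 | h1
  · exact h1
  · have := h'.length_le
    omega

theorem bruhatLE_refl_mul {x : AffW P} {i : ι} {n : ℤ}
    (h : length b x < length b (refl P i n * x)) : BruhatLE b x (refl P i n * x) :=
  Relation.ReflTransGen.single ⟨⟨i, n, rfl⟩, h⟩

theorem bruhatLE_mul_simple {s : AffW P} (hs : s ∈ simpleRefl b) {x : AffW P}
    (h : length b x < length b (x * s)) : BruhatLE b x (x * s) := by
  obtain ⟨i, n, -, e⟩ := exists_mul_simple hs x
  rw [e] at h ⊢
  exact bruhatLE_refl_mul h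

/-- Right multiplication by `s` carries a chain from `x` to `w` to a chain from `x s` to `w s`, by
`length_lt_refl_mul_mul`. It fails only at a step that exchanges `x` and `x s`, and from there on `w
< w s` finishes. -/
theorem BruhatLE.mul_simple {s : AffW P} (hs : s ∈ simpleRefl b) {x w : AffW P}
    (h : BruhatLE b x w) (hw : length b w < length b (w * s)) : BruhatLE b (x * s) (w * s) := by
  induction h using Relation.ReflTransGen.head_induction_on with
  | refl => exact Relation.ReflTransGen.refl
  | @head x _ h h' ih =>
    obtain ⟨⟨i, n, rfl⟩, hlt⟩ := h
    by_cases he : refl P i n * x = x * s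
    · rw [← he]
      exact BruhatLE.trans h' (bruhatLE_mul_simple hs hw)
    · have := length_lt_refl_mul_mul hs hlt he
      rw [mul_assoc] at ih
      exact (bruhatLE_refl_mul this).trans ih

theorem BruhatLE.le_mul_simple {s : AffW P} (hs : s ∈ simpleRefl b) {x w : AffW P}
    (h : BruhatLE b x w) (hx : length b x < length b (x * s))
    (hw : length b (w * s) < length b w) : BruhatLE b x (w * s) := by
  -- Without the assumption `x < x s` the chain argument only gives an alternative, and this weaker
  -- statement is the one that passes through the induction.
  suffices key : ∀ {x w : AffW P}, BruhatLE b x w → length b (w * s) < length b w →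
      BruhatLE b x (w * s) ∨ BruhatLE b (x * s) (w * s) by
    rcases key h hw with h1 | h1
    · exact h1
    · exact (bruhatLE_mul_simple hs hx).trans h1
  intro x w h hw
  induction h using Relation.ReflTransGen.head_induction_on with
  | refl => exact Or.inr Relation.ReflTransGen.refl
  | @head x _ h h' ih =>
    obtain ⟨⟨i, n, rfl⟩, hlt⟩ := h
    rcases ih with h1 | h1
    · exact Or.inl ((bruhatLE_refl_mul hlt).trans h1)
    · by_cases he : refl P i n * x = x * s
      · left
        rwa [he, mul_assoc, simple_mul_self hs, mul_one] at h1
      · right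
        have := length_lt_refl_mul_mul hs hlt he
        rw [mul_assoc] at h1
        exact (bruhatLE_refl_mul this).trans h1

theorem BruhatLE.mul_simple_le {s : AffW P} (hs : s ∈ simpleRefl b) {x w : AffW P}
    (h : BruhatLE b x w) (hw : length b (w * s) < length b w) : BruhatLE b (x * s) w := by
  rcases length_mul_simple hs x with h1 | h1
  · have h2 := (h.le_mul_simple hs (by omega) hw).mul_simple hs (by
      rw [mul_assoc, simple_mul_self hs, mul_one]; exact hw)
    rwa [mul_assoc w, simple_mul_self hs, mul_one] at h2
  · have h2 := bruhatLE_mul_simple (x := x * s) hs (by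
      rw [mul_assoc, simple_mul_self hs, mul_one]; omega)
    rw [mul_assoc, simple_mul_self hs, mul_one] at h2
    exact h2.trans h

/-- The set of points at which all roots have absolute value below `c` is convex and stable under
the finite Weyl group. If `s_{p,q}` lengthens `x` and `p_q` is positive, then `q ≤ 0`, and the point
`v` of `x` lies on the segment from `s_{p,q} v` to its image `v - q p^∨` under the linear reflection
`s_p`. -/
theorem abs_root'_lt {x y : AffW P} (h : BruhatLE b x y) {c : ℚ}
    (hc : ∀ i, |P.root' i (act y (basePt b))| < c) (i : ι) :
    |P.root' i (act x (basePt b))| < c := by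
  induction h using Relation.ReflTransGen.head_induction_on generalizing i with
  | refl => exact hc i
  | @head x _ h h' ih =>
    obtain ⟨⟨k, l, rfl⟩, hlt⟩ := h
    obtain ⟨p, q, hpos, hpq⟩ : ∃ p q, IsPosAff b p q ∧ refl P p q = refl P k l := by
      rcases isPosAff_or b k l with h1 | h1
      · exact ⟨k, l, h1, rfl⟩
      · exact ⟨_, _, h1, refl_negIdx k l⟩
    rw [← hpq] at ih hlt
    rw [length_lt_refl_mul_iff, mul_pos_iff_of_pos_left ((isPosAff_iff b _ _).1 hpos)] at hlt
    set v := act x (basePt b) with hv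
    have hq : (q : ℚ) ≤ 0 := by
      rcases hpos with h1 | ⟨h1, -⟩
      · exact_mod_cast h1.le
      · rw [h1]; simp
    have h1 := ih i
    have h2 := ih (P.reflectionPerm p i)
    have h3 := ih p
    rw [act_mul, ← hv, act_refl, map_sub, map_smul, smul_eq_mul, root'_coroot] at h1 h2 h3
    rw [P.pairing_same] at h3
    have e1 : P.root' (P.reflectionPerm p i) v = P.root' i v - P.pairing i p * P.root' p v := by
      simp [RootPairing.root', RootPairing.root_reflectionPerm, RootPairing.reflection_apply_root]
    have e2 : P.pairing (P.reflectionPerm p i) p = - P.pairing i p := by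
      rw [← P.pairing_reflectionPerm, P.pairing_reflectionPerm_self_right]
    rw [e1, e2] at h2
    rw [affVal] at hlt h1 h2 h3
    set a := P.root' p v
    set m := P.pairing i p
    set β := P.root' i v
    rw [abs_lt] at h1 h2 h3 ⊢
    have ht : 0 < a - q := hlt
    constructor
    · by_contra! hcon
      have g1 : 0 < (a - q) * (-m) := by linarith
      have g2 : 0 < -m := (pos_iff_pos_of_mul_pos g1).1 ht
      nlinarith [mul_nonneg g2.le (neg_nonneg.2 hq)]
    · by_contra! hcon
      have g1 : 0 < (a - q) * m := by linarith
      have g2 : 0 < m := (pos_iff_pos_of_mul_pos g1).1 ht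
      nlinarith [mul_nonneg g2.le (neg_nonneg.2 hq)]

theorem root'_negIdx (i : ι) (v : N) : P.root' (negIdx P i) v = - P.root' i v := by
  simp [RootPairing.root']

/-- A positive root is a sum of as many simple roots as its height, at most `h - 1`, and each of
them has a value between `-1` and `0` in the box. -/
theorem abs_root'_lt_of_mem_antiBox {w : AffW P} (hw : w ∈ antiBox b) (i : ι) :
    |P.root' i (act w (basePt b))| < coxeterNumber b - 1 := by
  have key : ∀ x ∈ posCone b, x = 0 ∨ (- P.toLinearMap x (rhoCheck b) <
      P.toLinearMap x (act w (basePt b)) ∧ P.toLinearMap x (act w (basePt b)) < 0) := by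
    intro x hx
    induction hx using AddSubmonoid.closure_induction with
    | mem x hx =>
      obtain ⟨j, hj, rfl⟩ := hx
      right
      have h1 := root'_rhoCheck b j
      rw [RootPairing.Base.height_one_of_mem_support hj] at h1
      have h2 := hw _ (basePt_mem b) j hj
      rw [← RootPairing.root', h1]
      exact_mod_cast h2
    | zero => exact Or.inl rfl
    | add x y _ _ hx hy =>
      rcases hx with rfl | hx <;> rcases hy with rfl | hy
      · simp
      · right; simpa using hy
      · right; simpa using hx
      · right
        simp only [map_add, LinearMap.add_apply]
        constructor <;> linarith [hx.1, hx.2, hy.1, hy.2]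
  have key' : ∀ j, b.IsPos j → |P.root' j (act w (basePt b))| < coxeterNumber b - 1 := by
    intro j hj
    rcases key _ (IsPos.mem_posCone b hj) with h | h
    · exact absurd h (P.ne_zero j)
    · rw [show P.toLinearMap (P.root j) (rhoCheck b) = b.height j from root'_rhoCheck b j] at h
      change _ < P.root' j _ ∧ P.root' j _ < 0 at h
      have h1 : (b.height j : ℚ) ≤ coxeterNumber b - 1 := by
        have := height_lt_coxeterNumber b j
        exact_mod_cast (by omega : b.height j ≤ coxeterNumber b - 1)
      rw [abs_lt]
      constructor <;> linarith [h.1, h.2]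
  rcases mem_posCone_or_neg b i with h | h
  · exact key' i ((isPos_iff_mem_posCone b).2 h)
  · have := key' (negIdx P i) ((isPos_iff_mem_posCone b).2 (by rwa [root_negIdx]))
    rwa [root'_negIdx, abs_neg] at this

theorem abs_root'_lt_of_mem_circ {w : AffW P} (hw : w ∈ circ b) (i : ι) :
    |P.root' i (act w (basePt b))| < coxeterNumber b - 1 := by
  obtain ⟨w₀, hw₀, -, hle⟩ := hw
  exact abs_root'_lt hle (abs_root'_lt_of_mem_antiBox hw₀) i

theorem mem_circ_of_le {x y : AffW P} (h : BruhatLE b x y) (hy : y ∈ circ b) : x ∈ circ b := by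
  obtain ⟨w₀, hw₀, hmax, hle⟩ := hy
  exact ⟨w₀, hw₀, hmax, h.trans hle⟩

end Length
end AffineMomentGraph

/-! ## Linear forms and the action on the affine weight lattice -/

namespace AffineMomentGraph

/-! ### Linear forms in symmetric algebras -/

section LinearForms

variable (R : Type*) {Y : Type*} [CommRing R] [AddCommGroup Y]

/-- The base change of an integral functional. -/
def funcExt (χ : Y →+ ℤ) : R ⊗[ℤ] Y →ₗ[R] R :=
  (TensorProduct.AlgebraTensorModule.rid ℤ R R).toLinearMap ∘ₗ χ.toIntLinearMap.baseChange R

@[simp] theorem funcExt_tmul (χ : Y →+ ℤ) (r : R) (y : Y) : funcExt R χ (r ⊗ₜ y) = χ y * r := by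
  simp [funcExt]

/-- The functional extends to an algebra map to the polynomial ring that takes `x` to `φ x` times
the variable. -/
theorem ι_ne_zero (φ : R ⊗[ℤ] Y →ₗ[R] R) {x : R ⊗[ℤ] Y} (h : φ x ≠ 0) :
    SymmetricAlgebra.ι R (R ⊗[ℤ] Y) x ≠ 0 := fun h0 => h (by
  have := congrArg (SymmetricAlgebra.lift (Polynomial.monomial 1 ∘ₗ φ)) h0
  simpa using this)

theorem lin_ne_zero {y : Y} (χ : Y →+ ℤ) (h : ((χ y : ℤ) : R) ≠ 0) : lin R y ≠ 0 :=
  ι_ne_zero R (funcExt R χ) (by simpa using h)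

theorem lin_add (x y : Y) : lin R (x + y) = lin R x + lin R y := by
  simp [lin, TensorProduct.tmul_add]

theorem lin_zsmul (n : ℤ) (y : Y) : lin R (n • y) = n • lin R y := by
  simp [lin, TensorProduct.tmul_smul]

theorem lin_neg (y : Y) : lin R (-y) = -lin R y := by
  simp [lin, TensorProduct.tmul_neg]

theorem lin_sub (x y : Y) : lin R (x - y) = lin R x - lin R y := by
  simp [lin, TensorProduct.tmul_sub]

variable {R}

/-- The endomorphism of the symmetric algebra induced by the projection along `a` onto the kernel
of `φ`. -/
def killMap (φ : R ⊗[ℤ] Y →ₗ[R] R) (a : R ⊗[ℤ] Y) : Sym R Y →ₐ[R] Sym R Y :=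
  SymmetricAlgebra.lift (SymmetricAlgebra.ι R _ ∘ₗ (LinearMap.id - φ.smulRight a))

theorem killMap_ι (φ : R ⊗[ℤ] Y →ₗ[R] R) (a x : R ⊗[ℤ] Y) :
    killMap φ a (SymmetricAlgebra.ι R _ x) = SymmetricAlgebra.ι R _ (x - φ x • a) := by
  simp [killMap]

/-- The substitution `killMap` fixes everything modulo `a`, as is checked on generators, and it
sends `a` to zero. Divisibility by `a` thus becomes an equation in the symmetric algebra. -/
theorem ι_dvd_iff (φ : R ⊗[ℤ] Y →ₗ[R] R) {a : R ⊗[ℤ] Y} (ha : φ a = 1) (f : Sym R Y) :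
    SymmetricAlgebra.ι R _ a ∣ f ↔ killMap φ a f = 0 := by
  constructor
  · rintro ⟨g, rfl⟩
    rw [map_mul, killMap_ι, ha, one_smul, sub_self, map_zero, zero_mul]
  · intro h
    have key : ∀ f : Sym R Y, SymmetricAlgebra.ι R _ a ∣ f - killMap φ a f := by
      intro f
      induction f using SymmetricAlgebra.induction with
      | algebraMap r => simp
      | ι x =>
        rw [killMap_ι, map_sub, sub_sub_cancel, map_smul]
        exact ⟨algebraMap R _ (φ x), by rw [Algebra.smul_def, mul_comm]⟩
      | mul x y hx hy =>
        rw [map_mul, show x * y - killMap φ a x * killMap φ a y =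
          (x - killMap φ a x) * y + killMap φ a x * (y - killMap φ a y) by ring]
        exact dvd_add (hx.mul_right _) (hy.mul_left _)
      | add x y hx hy =>
        rw [map_add, add_sub_add_comm]
        exact dvd_add hx hy
    simpa [h] using key f

/-- If `α` and `β` are not proportional, then `α` divides `β f` only if it divides `f`. -/
theorem lin_dvd_of_dvd_mul [IsDomain (Sym R Y)] {α β : Y} (φ : Y →+ ℤ) (hφ : φ α = 2) {e : R}
    (he : e * 2 = 1) (χ : Y →+ ℤ) (hχ : ((2 * χ β - φ β * χ α : ℤ) : R) ≠ 0) {f : Sym R Y}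
    (h : lin R α ∣ lin R β * f) : lin R α ∣ f := by
  have h1 : (e • funcExt R φ) (1 ⊗ₜ α) = 1 := by simp [hφ, mul_comm, he]
  rw [lin, ι_dvd_iff _ h1] at h ⊢
  -- In a domain it suffices that `β` survives the substitution. Its image is `β - (φ β / 2) α`, and
  -- twice the value of `χ` on it is the number assumed to be nonzero.
  rw [map_mul, mul_eq_zero] at h
  refine h.resolve_left ?_
  rw [lin, killMap_ι]
  refine ι_ne_zero R (funcExt R χ) fun h0 => hχ ?_
  have : (2 : R) * ((funcExt R χ) (1 ⊗ₜ[ℤ] β - (e • funcExt R φ) (1 ⊗ₜ[ℤ] β) • 1 ⊗ₜ[ℤ] α)) = 0 := by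
    rw [h0, mul_zero]
  simp only [map_sub, map_smul, LinearMap.smul_apply, funcExt_tmul, smul_eq_mul, mul_one] at this
  push_cast
  linear_combination this + (φ β * χ α : R) * he

end LinearForms

/-! ### The action on the affine weight lattice -/

section AffineWeights

variable {ι V N : Type u} [AddCommGroup V] [Module ℚ V] [AddCommGroup N] [Module ℚ N]
variable {P : RootPairing ι ℚ V N}

/-- The affine function on the coweight space defined by an element of the affine weight lattice. -/
def affFun (x : AffX P) (v : N) : ℚ := P.toLinearMap x.1 v + x.2

theorem affFun_add (x y : AffX P) (v : N) : affFun (x + y) v = affFun x v + affFun y v := by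
  simp only [affFun, Prod.fst_add, Prod.snd_add, AddSubgroup.coe_add, map_add, LinearMap.add_apply]
  push_cast
  ring

theorem affFun_zsmul (n : ℤ) (x : AffX P) (v : N) : affFun (n • x) v = n * affFun x v := by
  simp only [affFun, Prod.smul_fst, Prod.smul_snd, AddSubgroup.coe_zsmul, map_zsmul,
    LinearMap.smul_apply, smul_eq_mul, zsmul_eq_mul]
  push_cast
  ring

theorem affFun_neg (x : AffX P) (v : N) : affFun (-x) v = - affFun x v := by
  have := affFun_zsmul (-1) x v
  simpa using this

theorem affFun_injective {x y : AffX P} (h : ∀ v, affFun x v = affFun y v) : x = y := by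
  have h0 := h 0
  simp only [affFun, map_zero, zero_add] at h0
  refine Prod.ext (Subtype.ext (P.toPerfPair.injective (LinearMap.ext fun v => ?_)))
    (by exact_mod_cast h0)
  have := h v
  rw [affFun, affFun, h0] at this
  exact add_right_cancel this

theorem exists_coroot'_eq (i : ι) (x : AffX P) : ∃ n : ℤ, (n : ℚ) = P.coroot' i (x.1 : V) := by
  obtain ⟨n, hn⟩ := x.1.2 i
  exact ⟨n, hn.symm⟩

/-- The pairing of an affine weight with a coroot. -/
def corootX (P : RootPairing ι ℚ V N) (i : ι) : AffX P →+ ℤ where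
  toFun x := (exists_coroot'_eq i x).choose
  map_zero' := by
    have h := (exists_coroot'_eq i (0 : AffX P)).choose_spec
    generalize (exists_coroot'_eq i (0 : AffX P)).choose = n at h
    simpa using h
  map_add' x y := by
    have h := (exists_coroot'_eq i (x + y)).choose_spec
    have h1 := (exists_coroot'_eq i x).choose_spec
    have h2 := (exists_coroot'_eq i y).choose_spec
    generalize (exists_coroot'_eq i (x + y)).choose = n at h ⊢
    generalize (exists_coroot'_eq i x).choose = n1 at h1 ⊢
    generalize (exists_coroot'_eq i y).choose = n2 at h2 ⊢
    rw [Prod.fst_add, AddSubgroup.coe_add, map_add, ← h1, ← h2] at h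
    exact_mod_cast h

theorem corootX_cast (i : ι) (x : AffX P) : (corootX P i x : ℚ) = P.coroot' i (x.1 : V) :=
  (exists_coroot'_eq i x).choose_spec

variable [P.IsCrystallographic]

theorem corootX_affRoot (i j : ι) (n : ℤ) : corootX P i (affRoot P j n) = P.pairingIn ℤ j i := by
  have : (corootX P i (affRoot P j n) : ℚ) = P.pairingIn ℤ j i := by
    rw [corootX_cast, pairingIn_cast]
    change P.coroot' i (P.root j) = _
    rw [P.root_coroot'_eq_pairing]
  exact_mod_cast this

theorem corootX_affRoot_self (i : ι) (n : ℤ) : corootX P i (affRoot P i n) = 2 := by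
  rw [corootX_affRoot]; simp

theorem affFun_affRoot (i : ι) (n : ℤ) (v : N) : affFun (affRoot P i n) v = affVal P i n v := by
  simp only [affFun, affRoot, affVal, RootPairing.root']
  push_cast
  ring

/-- A reflection subtracts an integral multiple of an affine root, because weights pair integrally
with coroots, so the affine weight lattice is preserved. -/
theorem exists_actX (w : AffW P) :
    ∃ e : AffX P →+ AffX P, ∀ x v, affFun (e x) (act w v) = affFun x v := by
  induction w using AffW.induction with
  | h1 => exact ⟨AddMonoidHom.id _, fun x v => rfl⟩
  | h i n w ih =>
    obtain ⟨e, he⟩ := ih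
    refine ⟨e - ((zmultiplesHom _ (affRoot P i n)).comp ((corootX P i).comp e)), fun x v => ?_⟩
    simp only [AddMonoidHom.sub_apply, AddMonoidHom.comp_apply, zmultiplesHom_apply]
    rw [sub_eq_add_neg, affFun_add, affFun_neg, affFun_zsmul, affFun_affRoot, act_mul, affVal_refl,
      ← he x v, corootX_cast, act_refl]
    simp only [affFun, map_sub, map_smul, smul_eq_mul, RootPairing.coroot',
      LinearMap.flip_apply]
    ring

/-- The action of the affine Weyl group on the affine weight lattice. -/
def actX (w : AffW P) : AffX P →+ AffX P := (exists_actX w).choose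

theorem affFun_actX (w : AffW P) (x : AffX P) (v : N) : affFun (actX w x) (act w v) = affFun x v :=
  (exists_actX w).choose_spec x v

theorem act_surjective (w : AffW P) : Function.Surjective (act w) := fun v => ⟨act w⁻¹ v, by
  rw [← act_mul, mul_inv_cancel, act_one]⟩

theorem eq_actX {w : AffW P} {x y : AffX P} (h : ∀ v, affFun y (act w v) = affFun x v) :
    y = actX w x := affFun_injective fun v => by
  obtain ⟨v, rfl⟩ := act_surjective w v
  rw [h, affFun_actX]

theorem actX_mul (w w' : AffW P) (x : AffX P) : actX (w * w') x = actX w (actX w' x) :=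
  (eq_actX fun v => by rw [act_mul, affFun_actX, affFun_actX]).symm

theorem actX_one (x : AffX P) : actX 1 x = x := (eq_actX fun v => by rw [act_one]).symm

theorem actX_inv (w : AffW P) (x : AffX P) : actX w (actX w⁻¹ x) = x := by
  rw [← actX_mul, mul_inv_cancel, actX_one]

theorem actX_refl (i : ι) (n : ℤ) (x : AffX P) :
    actX (refl P i n) x = x - corootX P i x • affRoot P i n := by
  refine (eq_actX fun v => ?_).symm
  rw [sub_eq_add_neg, affFun_add, affFun_neg, affFun_zsmul, affFun_affRoot, affVal_refl,
    corootX_cast, act_refl]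
  simp only [affFun, map_sub, map_smul, smul_eq_mul, RootPairing.coroot',
    LinearMap.flip_apply]
  ring

theorem actX_refl_self (i : ι) (n : ℤ) :
    actX (refl P i n) (affRoot P i n) = - affRoot P i n := by
  rw [actX_refl, corootX_affRoot_self]
  module

theorem exists_actX_affRoot (w : AffW P) (i : ι) (n : ℤ) :
    ∃ j m, actX w (affRoot P i n) = affRoot P j m ∧ refl P j m * w = w * refl P i n := by
  obtain ⟨j, m, h, h'⟩ := exists_transport w⁻¹ i n
  refine ⟨j, m, (eq_actX fun v => ?_).symm, ?_⟩
  · rw [affFun_affRoot, affFun_affRoot, h, ← act_mul, inv_mul_cancel, act_one]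
  · have : w * (refl P i n * w⁻¹) * w = w * (w⁻¹ * refl P j m) * w := by rw [h']
    simpa [mul_assoc] using this.symm

theorem affRoot_negIdx (i : ι) (n : ℤ) : affRoot P (negIdx P i) (-n) = - affRoot P i n :=
  affFun_injective fun v => by
    rw [affFun_neg, affFun_affRoot, affFun_affRoot, affVal_negIdx]

variable [Finite ι] [P.IsReduced]

theorem eq_or_eq_negIdx_of_four {i j : ι} (h : P.pairing i j * P.pairing j i = 4) :
    i = j ∨ i = negIdx P j := by
  have h1 : P.coxeterWeightIn ℤ i j = 4 := by
    rw [RootPairing.coxeterWeightIn]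
    have : (P.pairingIn ℤ i j * P.pairingIn ℤ j i : ℚ) = 4 := by
      rw [pairingIn_cast, pairingIn_cast, h]
    exact_mod_cast this
  rw [P.coxeterWeightIn_eq_four_iff_not_linearIndependent ℤ] at h1
  rcases RootPairing.IsReduced.eq_or_eq_neg (P := P) i j h1 with h2 | h2
  · exact Or.inl (P.root.injective h2)
  · exact Or.inr (P.root.injective (by rw [h2, root_negIdx]))

/-- The embedding of the weight lattice given by the pairings with all coroots. -/
def weightEmb (P : RootPairing ι ℚ V N) : ↥(weightLattice P) →ₗ[ℤ] (ι → ℤ) :=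
  (AddMonoidHom.mk' (fun (x : ↥(weightLattice P)) i => corootX P i (x, 0)) fun x y =>
      funext fun i => by
        have : ((x + y, 0) : AffX P) = (x, 0) + (y, 0) := by simp
        rw [this, map_add]; rfl).toIntLinearMap

theorem weightEmb_injective [P.IsRootSystem] : Function.Injective (weightEmb P) := by
  rw [injective_iff_map_eq_zero]
  intro x hx
  have h1 : ∀ i, P.coroot' i (x : V) = 0 := fun i => by
    have := congrFun hx i
    rw [← corootX_cast i ((x, 0) : AffX P)]
    exact_mod_cast this
  exact Subtype.ext ((P.eq_zero_iff_forall_coroot'_eq_zero).2 h1)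

/-- The weight lattice embeds in `ι → ℤ`. Freeness makes the symmetric algebras domains, and finite
generation makes their homogeneous components finite-dimensional. -/
instance [P.IsRootSystem] : Module.Free ℤ ↥(weightLattice P) := by
  have := Fintype.ofFinite ι
  exact Module.Free.of_equiv (LinearEquiv.ofInjective _ (weightEmb_injective (P := P))).symm

instance [P.IsRootSystem] : Module.Finite ℤ ↥(weightLattice P) :=
  Module.Finite.of_injective _ (weightEmb_injective (P := P))

end AffineWeights
end AffineMomentGraph

/-! ## Divisibility in symmetric algebras -/

namespace AffineMomentGraph

/-! ### Root systems with Coxeter number at most three. -/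

section SmallCoxeterNumber

variable {ι V N : Type u} [AddCommGroup V] [Module ℚ V] [AddCommGroup N] [Module ℚ N]
variable {P : RootPairing ι ℚ V N} {b : P.Base}
variable [Finite ι] [P.IsRootSystem] [P.IsCrystallographic]

theorem height_reflectionPerm (k i : ι) :
    b.height (P.reflectionPerm k i) = b.height i - P.pairingIn ℤ i k * b.height k := by
  simpa [level, reflShift] using level_refl (b := b) k 0 i 0

theorem pairingIn_reflectionPerm_left (k i l : ι) :
    P.pairingIn ℤ (P.reflectionPerm k i) l =
      P.pairingIn ℤ i l - P.pairingIn ℤ i k * P.pairingIn ℤ k l := by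
  have : (P.pairingIn ℤ (P.reflectionPerm k i) l : ℚ) =
      P.pairingIn ℤ i l - P.pairingIn ℤ i k * P.pairingIn ℤ k l := by
    simp only [pairingIn_cast, ← RootPairing.root_coroot'_eq_pairing, RootPairing.root_reflectionPerm,
      RootPairing.reflection_apply, map_sub, map_smul, smul_eq_mul]
  exact_mod_cast this

/-- The root `s_j α_i` has height `1 - ⟨α_i, α_j^∨⟩`, and all heights are at most `2`. -/
theorem pairingIn_simple_of_coxeterNumber_le_three (h3 : coxeterNumber b ≤ 3) {i j : ι}
    (hi : i ∈ b.support) (hj : j ∈ b.support) (hij : i ≠ j) :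
    P.pairingIn ℤ i j = 0 ∨ P.pairingIn ℤ i j = -1 := by
  have h1 := b.pairingIn_le_zero_of_ne hij hi hj
  have h2 := height_lt_coxeterNumber b (P.reflectionPerm j i)
  rw [height_reflectionPerm, RootPairing.Base.height_one_of_mem_support hi,
    RootPairing.Base.height_one_of_mem_support hj] at h2
  omega

theorem pairingIn_eq_zero_comm (i j : ι) : P.pairingIn ℤ i j = 0 ↔ P.pairingIn ℤ j i = 0 := by
  have h : ∀ i j, P.pairingIn ℤ i j = 0 → P.pairingIn ℤ j i = 0 := fun i j h => by
    have h1 : P.pairing i j = 0 := by rw [← pairingIn_cast, h]; rfl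
    rw [RootPairing.pairing_eq_zero_iff, ← pairingIn_cast] at h1
    exact_mod_cast h1
  exact ⟨h i j, h j i⟩

/-- For a path `i - j - l` the root `s_l s_i α_j` would have height at least `3`. -/
theorem no_path_of_coxeterNumber_le_three (h3 : coxeterNumber b ≤ 3) {i j l : ι}
    (hi : i ∈ b.support) (hj : j ∈ b.support) (hl : l ∈ b.support) (hij : i ≠ j) (hil : i ≠ l)
    (hjl : j ≠ l) (h : P.pairingIn ℤ j i ≠ 0) : P.pairingIn ℤ j l = 0 := by
  by_contra h'
  have e1 := (pairingIn_simple_of_coxeterNumber_le_three h3 hj hi hij.symm).resolve_left h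
  have e2 := (pairingIn_simple_of_coxeterNumber_le_three h3 hj hl hjl).resolve_left h'
  have e3 := b.pairingIn_le_zero_of_ne hil hi hl
  have h2 := height_lt_coxeterNumber b (P.reflectionPerm l (P.reflectionPerm i j))
  rw [height_reflectionPerm, height_reflectionPerm, pairingIn_reflectionPerm_left, e1, e2,
    RootPairing.Base.height_one_of_mem_support hi, RootPairing.Base.height_one_of_mem_support hj,
    RootPairing.Base.height_one_of_mem_support hl] at h2
  omega

variable [P.IsReduced] [P.IsIrreducible]

/-- Since the Dynkin diagram is connected and contains no path with three vertices, it has at most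
two vertices. The hypothesis on the pairings excludes rank one. -/
theorem isTypeA2_of_coxeterNumber_le_three (h3 : coxeterNumber b ≤ 3) {i j : ι}
    (hij : P.pairingIn ℤ i j * P.pairingIn ℤ j i = 1) : IsTypeA2 b := by
  classical
  obtain ⟨a, ha, -⟩ := b.exists_mem_support_pos_pairingIn_ne_zero i
  by_cases hcase : ∃ c ∈ b.support, c ≠ a ∧ P.pairingIn ℤ a c ≠ 0
  · obtain ⟨c, hc, hca, hac⟩ := hcase
    have hca0 : P.pairingIn ℤ c a ≠ 0 := fun h => hac ((pairingIn_eq_zero_comm _ _).1 h)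
    have hsupp : ∀ l : b.support, l = ⟨a, ha⟩ ∨ l = ⟨c, hc⟩ := by
      intro l
      refine b.induction_on_cartanMatrix (fun l => l = ⟨a, ha⟩ ∨ l = ⟨c, hc⟩)
        (i := ⟨a, ha⟩) (Or.inl rfl) ?_
      rintro x ⟨m, hm⟩ hx hmx
      have hmx' : P.pairingIn ℤ m x ≠ 0 := hmx
      by_contra! hne
      have h1 : m ≠ a := fun h => hne.1 (Subtype.ext h)
      have h2 : m ≠ c := fun h => hne.2 (Subtype.ext h)
      rcases hx with rfl | rfl
      · exact hmx' ((pairingIn_eq_zero_comm _ _).1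
          (no_path_of_coxeterNumber_le_three h3 hc ha hm hca h2.symm h1.symm hac))
      · exact hmx' ((pairingIn_eq_zero_comm _ _).1
          (no_path_of_coxeterNumber_le_three h3 ha hc hm hca.symm h1.symm h2.symm hca0))
    have e1 := (pairingIn_simple_of_coxeterNumber_le_three h3 ha hc hca.symm).resolve_left hac
    have e2 := (pairingIn_simple_of_coxeterNumber_le_three h3 hc ha hca).resolve_left hca0
    refine ⟨⟨fun x => if x = ⟨a, ha⟩ then 0 else 1, ![⟨a, ha⟩, ⟨c, hc⟩], fun x => ?_, fun x => ?_⟩, ?_⟩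
    · rcases hsupp x with rfl | rfl
      · simp
      · simp [hca]
    · fin_cases x
      · simp
      · simp [hca]
    · intro x y
      have e3 : b.cartanMatrix ⟨a, ha⟩ ⟨c, hc⟩ = -1 := e1
      have e4 : b.cartanMatrix ⟨c, hc⟩ ⟨a, ha⟩ = -1 := e2
      rcases hsupp x with rfl | rfl <;> rcases hsupp y with rfl | rfl <;>
        simp [CartanMatrix.A, hca, e3, e4]
  · push Not at hcase
    exfalso
    have hsupp : ∀ l : b.support, l = ⟨a, ha⟩ := by
      intro l
      refine b.induction_on_cartanMatrix (fun l => l = ⟨a, ha⟩) (i := ⟨a, ha⟩) rfl ?_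
      rintro x ⟨m, hm⟩ rfl hmx
      have hmx' : P.pairingIn ℤ m a ≠ 0 := hmx
      by_contra hne
      exact hmx' ((pairingIn_eq_zero_comm _ _).1 (hcase m hm fun h => hne (Subtype.ext h)))
    -- With a single simple root all roots are proportional, so the product of the two pairings
    -- equals `⟨i, i⟩⟨j, j⟩ = 4` instead of `1`.
    have hroot : ∀ i, ∃ c : ℤ, c ≠ 0 ∧ P.root i = c • P.root a := by
      intro i
      obtain ⟨f, -, -, hf⟩ := b.exists_root_eq_sum_int i
      rw [Finset.sum_eq_single a (fun l hl hla => absurd (congrArg Subtype.val (hsupp ⟨l, hl⟩)) hla)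
        (fun h => absurd ha h)] at hf
      refine ⟨f a, fun h => ?_, hf⟩
      rw [h, zero_smul] at hf
      exact P.ne_zero i hf
    obtain ⟨c, hc, hci⟩ := hroot i
    obtain ⟨d, hd, hdj⟩ := hroot j
    have h1 : (2 : ℚ) = c * P.coroot' i (P.root a) := by
      rw [← P.pairing_same i, ← RootPairing.root_coroot'_eq_pairing, hci, map_zsmul, zsmul_eq_mul]
    have h2 : (2 : ℚ) = d * P.coroot' j (P.root a) := by
      rw [← P.pairing_same j, ← RootPairing.root_coroot'_eq_pairing, hdj, map_zsmul, zsmul_eq_mul]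
    have h3 : (P.pairingIn ℤ i j * P.pairingIn ℤ j i : ℚ) = 1 := by exact_mod_cast hij
    simp only [pairingIn_cast, ← RootPairing.root_coroot'_eq_pairing] at h3
    rw [hci, hdj, map_zsmul, map_zsmul, zsmul_eq_mul, zsmul_eq_mul] at h3
    have h4 : (c * P.coroot' i (P.root a)) * (d * P.coroot' j (P.root a)) = 1 := by
      linear_combination h3
    rw [← h1, ← h2] at h4
    norm_num at h4

end SmallCoxeterNumber

instance : IsDomain ZHalf := inferInstanceAs (IsDomain ↥(Subring.closure {(2 : ℚ)⁻¹}))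

instance : CharZero ZHalf := inferInstanceAs (CharZero ↥(Subring.closure {(2 : ℚ)⁻¹}))

theorem exists_half : ∃ e : ZHalf, e * 2 = 1 :=
  ⟨⟨2⁻¹, Subring.subset_closure rfl⟩, Subtype.ext (by
    change (2⁻¹ : ℚ) * 2 = 1
    norm_num)⟩

/-- The element `1/2`. -/
def half : ZHalf := exists_half.choose

theorem half_mul_two : half * 2 = 1 := exists_half.choose_spec

/-! ### Coprimality of affine roots in symmetric algebras. -/

section Divisibility

variable {ι V N : Type u} [AddCommGroup V] [Module ℚ V] [AddCommGroup N] [Module ℚ N]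
variable {P : RootPairing ι ℚ V N} {b : P.Base}
variable [Finite ι] [P.IsRootSystem] [P.IsCrystallographic] [P.IsReduced]

/-- The number `4 - ⟨i, j⟩⟨j, i⟩` is the determinant of the pairings of the two roots. It vanishes
only for proportional roots, and then the two reflections belong to parallel hyperplanes at
different levels. -/
theorem four_sub_ne_zero_of_refl_ne {i j : ι} {n m : ℤ} (hne : refl P i n ≠ refl P j m) :
    4 - P.pairingIn ℤ i j * P.pairingIn ℤ j i ≠ 0 ∨
      ∃ m', m' ≠ n ∧ refl P j m = refl P i m' ∧
      (affRoot P j m = affRoot P i m' ∨ affRoot P j m = - affRoot P i m') := by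
  by_cases h : 4 - P.pairingIn ℤ i j * P.pairingIn ℤ j i = 0
  · right
    have h1 : P.pairing j i * P.pairing i j = 4 := by
      rw [← pairingIn_cast, ← pairingIn_cast]
      exact_mod_cast (by linarith : P.pairingIn ℤ j i * P.pairingIn ℤ i j = 4)
    rcases eq_or_eq_negIdx_of_four h1 with rfl | rfl
    · exact ⟨m, fun h => hne (by rw [h]), rfl, Or.inl rfl⟩
    · have h2 := refl_negIdx (P := P) i (-m)
      rw [neg_neg] at h2
      exact ⟨-m, fun h => hne (by rw [h2, h]), h2, Or.inr (by rw [← affRoot_negIdx, neg_neg])⟩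
  · exact Or.inl h

variable {R : Type*} [CommRing R] [IsDomain R]

instance : IsDomain (Sym R (AffX P)) := SymmetricAlgebra.instIsDomain

theorem lin_affRoot_dvd_of_dvd_mul {e : R} (he : e * 2 = 1) {i j : ι} {n m : ℤ}
    (h : ((4 - P.pairingIn ℤ i j * P.pairingIn ℤ j i : ℤ) : R) ≠ 0 ∨
      ∃ m', ((m' - n : ℤ) : R) ≠ 0 ∧ 
      (affRoot P j m = affRoot P i m' ∨ affRoot P j m = - affRoot P i m'))
    {f : Sym R (AffX P)} (hf : lin R (affRoot P i n) ∣ lin R (affRoot P j m) * f) :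
    lin R (affRoot P i n) ∣ f := by
  have h2 : (2 : R) ≠ 0 := fun h => by rw [h, mul_zero] at he; exact zero_ne_one he
  rcases h with h | ⟨m', h, h'⟩
  · refine lin_dvd_of_dvd_mul (corootX P i) (corootX_affRoot_self i n) he (corootX P j) ?_ hf
    rw [corootX_affRoot_self, corootX_affRoot, corootX_affRoot]
    convert h using 2
    ring
  · have hf' : lin R (affRoot P i n) ∣ lin R (affRoot P i m') * f := by
      rcases h' with h' | h'
      · rwa [h'] at hf
      · rwa [h', lin_neg, neg_mul, dvd_neg] at hf
    -- Parallel affine roots have the same finite part, and it is the coefficient of `δ` that tells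
    -- them apart.
    refine lin_dvd_of_dvd_mul (corootX P i) (corootX_affRoot_self i n) he (AddMonoidHom.snd _ ℤ) ?_
      hf'
    rw [corootX_affRoot_self]
    simp only [affRoot, AddMonoidHom.coe_snd]
    rw [show (2 * -m' - 2 * -n : ℤ) = -2 * (m' - n) by ring, Int.cast_mul]
    exact mul_ne_zero (by simpa using h2) h

theorem lin_affRoot_dvd_of_dvd_mul_of_charZero [CharZero R] {e : R} (he : e * 2 = 1) {i j : ι}
    {n m : ℤ} (hne : refl P i n ≠ refl P j m)
    {f : Sym R (AffX P)} (hf : lin R (affRoot P i n) ∣ lin R (affRoot P j m) * f) :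
    lin R (affRoot P i n) ∣ f := by
  refine lin_affRoot_dvd_of_dvd_mul he ?_ hf
  rcases four_sub_ne_zero_of_refl_ne hne with h | ⟨m', h, -, h'⟩
  · exact Or.inl (by exact_mod_cast h)
  · exact Or.inr ⟨m', by exact_mod_cast sub_ne_zero.2 h, h'⟩

end Divisibility

/-! ### The GKM condition below `ŵ₀` over `k`. -/

section GKM

variable {ι V N : Type u} [AddCommGroup V] [Module ℚ V] [AddCommGroup N] [Module ℚ N]
variable {P : RootPairing ι ℚ V N} {b : P.Base}
variable [Finite ι] [P.IsRootSystem] [P.IsCrystallographic] [P.IsReduced] [P.IsIrreducible]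
variable {k : Type u} [Field k] [Algebra ZHalf k]

variable (k) in
theorem half_mul_two_field : algebraMap ZHalf k half * 2 = 1 := by
  have := congrArg (algebraMap ZHalf k) half_mul_two
  rwa [map_mul, map_one, map_ofNat] at this

variable (k) in
theorem two_ne_zero_field : (2 : k) ≠ 0 := fun h => by
  have := half_mul_two_field k
  rw [h, mul_zero] at this
  exact zero_ne_one this

theorem intCast_eq_zero (z : ℤ) : (z : k) = 0 ↔ (ringChar k : ℤ) ∣ z :=
  CharP.intCast_eq_zero_iff k (ringChar k) z

theorem eq_zero_of_abs_lt (hk : ringChar k = 0 ∨ coxeterNumber b ≤ ringChar k) {z : ℤ}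
    (hz : |z| < coxeterNumber b) (h : (z : k) = 0) : z = 0 := by
  rw [intCast_eq_zero] at h
  rcases hk with hk | hk
  · rw [hk] at h
    simpa using h
  · exact Int.eq_zero_of_abs_lt_dvd h (hz.trans_le hk)

variable (k) in
theorem ringChar_cases : ringChar k = 0 ∨ ringChar k = 3 ∨ 5 ≤ ringChar k := by
  have h2 : ringChar k ≠ 2 := fun h => two_ne_zero_field k (by
    have := (intCast_eq_zero (k := k) 2).2 (by rw [h]; rfl)
    exact_mod_cast this)
  have h4 : ringChar k ≠ 4 := fun h => by
    rcases CharP.char_is_prime_or_zero k (ringChar k) with h' | h'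
    · rw [h] at h'; exact absurd h' (by norm_num)
    · omega
  have h1 : ringChar k ≠ 1 := CharP.char_ne_one k (ringChar k)
  omega

/-- The nonzero values are `1`, `2`, `3` and `4`. Since `2` is invertible, only `3` could vanish in
`k`; then `h ≤ p = 3` and the pairings have product `1`, which is type `A₂`. -/
theorem four_sub_coxeterWeight_ne_zero (hk : ringChar k = 0 ∨ coxeterNumber b ≤ ringChar k)
    (hA2 : ¬ (IsTypeA2 b ∧ ringChar k = 3)) {i j : ι}
    (h : 4 - P.pairingIn ℤ i j * P.pairingIn ℤ j i ≠ 0) :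
    ((4 - P.pairingIn ℤ i j * P.pairingIn ℤ j i : ℤ) : k) ≠ 0 := by
  intro h0
  rw [intCast_eq_zero] at h0
  have h1 : P.pairingIn ℤ i j * P.pairingIn ℤ j i ∈ ({0, 1, 2, 3, 4} : Set ℤ) :=
    P.coxeterWeightIn_mem_set_of_isCrystallographic i j
  simp only [Set.mem_insert_iff, Set.mem_singleton_iff] at h1
  rcases ringChar_cases k with hc | hc | hc
  · rw [hc] at h0
    exact h (by simpa using h0)
  · have h3 : P.pairingIn ℤ i j * P.pairingIn ℤ j i = 1 := by
      rw [hc] at h0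
      omega
    exact hA2 ⟨isTypeA2_of_coxeterNumber_le_three (by omega) h3, hc⟩
  · refine h (Int.eq_zero_of_abs_lt_dvd h0 ?_)
    rw [abs_lt]
    omega

/-- The moment graph below `ŵ₀` is a GKM graph over `k`. -/
theorem lin_affRoot_dvd_of_mem_circ (hk : ringChar k = 0 ∨ coxeterNumber b ≤ ringChar k)
    (hA2 : ¬ (IsTypeA2 b ∧ ringChar k = 3)) {x : AffW P} {i j : ι} {n m : ℤ}
    (h1 : refl P i n * x ∈ circ b) (h2 : refl P j m * x ∈ circ b)
    (hne : refl P i n ≠ refl P j m) {f : Sym k (AffX P)}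
    (hf : lin k (affRoot P i n) ∣ lin k (affRoot P j m) * f) : lin k (affRoot P i n) ∣ f := by
  refine lin_affRoot_dvd_of_dvd_mul (half_mul_two_field k) ?_ hf
  rcases four_sub_ne_zero_of_refl_ne hne with h | ⟨m', h, hm, h'⟩
  · exact Or.inl (four_sub_coxeterWeight_ne_zero hk hA2 h)
  · refine Or.inr ⟨m', fun h0 => h ?_, h'⟩
    refine sub_eq_zero.1 (eq_zero_of_abs_lt hk ?_ h0)
    -- The points of `s_{α,n} x` and `s_{α,m'} x` have `α`-values differing by `2(m' - n)`, and both
    -- are below `h - 1` in absolute value. So `|m' - n| < h`, and `m' - n` cannot vanish in `k`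
    -- unless it is zero.
    rw [hm] at h2
    have a1 := abs_lt.1 (abs_root'_lt_of_mem_circ h1 i)
    have a2 := abs_lt.1 (abs_root'_lt_of_mem_circ h2 i)
    simp only [act_mul, act_refl, affVal, map_sub, map_smul, root'_coroot, P.pairing_same,
      smul_eq_mul] at a1 a2
    have : |((m' - n : ℤ) : ℚ)| < coxeterNumber b := by
      push_cast
      rw [abs_lt]
      constructor <;> linarith [a1.1, a1.2, a2.1, a2.2]
    exact_mod_cast this

end GKM
end AffineMomentGraph

/-! ## Separation of the elements below the largest element of the box -/

namespace AffineMomentGraph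

/-! ### Small vectors in the coroot lattice. -/

section Minuscule

variable {ι V N : Type u} [AddCommGroup V] [Module ℚ V] [AddCommGroup N] [Module ℚ N]
variable {P : RootPairing ι ℚ V N}
variable [Finite ι] [P.IsRootSystem] [P.IsCrystallographic]

/-- If the sum `v` is nonzero, positive definiteness gives a coroot `j^∨` in the list with `⟨j, v⟩ >
0`, hence `⟨j, v⟩ = 1`. Then `v - j^∨ = s_j v` satisfies the same bound with a shorter list, so it
vanishes by induction. But `v = j^∨` would give `⟨j, v⟩ = 2`. -/
theorem sum_coroot_eq_zero (l : List ι) (h : ∀ i, |P.root' i (l.map P.coroot).sum| ≤ 1) :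
    (l.map P.coroot).sum = 0 := by
  classical
  induction hn : l.length generalizing l with
  | zero => simp [List.length_eq_zero_iff.1 hn]
  | succ n ih =>
    by_contra hne
    have h1 := weylForm_pos (P := P.flip) hne
    obtain ⟨j, hj, hpos⟩ : ∃ j ∈ l, 0 < weylForm P.flip (l.map P.coroot).sum (P.coroot j) := by
      by_contra! hle
      refine absurd h1 (not_lt.2 ?_)
      have : ∀ l' : List ι, (∀ j ∈ l', j ∈ l) →
          weylForm P.flip (l.map P.coroot).sum (l'.map P.coroot).sum ≤ 0 := by
        intro l' hl'
        induction l' with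
        | nil => simp
        | cons a l' ih' =>
          rw [List.map_cons, List.sum_cons, map_add]
          exact add_nonpos (hle a (hl' a (by simp))) (ih' fun j hj => hl' j (by simp [hj]))
      exact this l fun _ h => h
    have h2 := weylForm_root (P := P.flip) (l.map P.coroot).sum j
    have h3 := weylForm_pos (P := P.flip) (P.flip.ne_zero j)
    have h4 : 0 < P.root' j (l.map P.coroot).sum := by
      change 2 * weylForm P.flip (l.map P.coroot).sum (P.coroot j) =
        weylForm P.flip (P.coroot j) (P.coroot j) * P.root' j (l.map P.coroot).sum at h2
      change 0 < weylForm P.flip (P.coroot j) (P.coroot j) at h3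
      have : 0 < weylForm P.flip (P.coroot j) (P.coroot j) * P.root' j (l.map P.coroot).sum := by
        linarith
      exact (pos_iff_pos_of_mul_pos this).1 h3
    have hint : ∀ l' : List ι, ∃ z : ℤ, (z : ℚ) = P.root' j (l'.map P.coroot).sum := by
      intro l'
      induction l' with
      | nil => exact ⟨0, by simp⟩
      | cons a l' ih' =>
        obtain ⟨z, hz⟩ := ih'
        refine ⟨P.pairingIn ℤ j a + z, ?_⟩
        rw [List.map_cons, List.sum_cons, map_add, ← hz, root'_coroot, ← pairingIn_cast]
        push_cast; rfl
    have h5 : P.root' j (l.map P.coroot).sum = 1 := by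
      obtain ⟨z, hz⟩ := hint l
      have h6 := (abs_le.1 (h j)).2
      rw [← hz] at h4 h6 ⊢
      have : z = 1 := le_antisymm (by exact_mod_cast h6) (by exact_mod_cast h4)
      rw [this]; rfl
    have h6 : ((l.erase j).map P.coroot).sum = (l.map P.coroot).sum - P.coroot j := by
      have := (List.perm_cons_erase hj).map P.coroot
      rw [this.sum_eq, List.map_cons, List.sum_cons]
      abel
    have h7 := ih (l.erase j) (fun i => by
      have := h (P.reflectionPerm j i)
      have e : P.root' (P.reflectionPerm j i) (l.map P.coroot).sum =
          P.root' i ((l.map P.coroot).sum - P.coroot j) := by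
        simp only [RootPairing.root', RootPairing.root_reflectionPerm,
          RootPairing.reflection_apply, map_sub, map_smul, LinearMap.sub_apply,
          LinearMap.smul_apply, smul_eq_mul]
        have h5' : P.toLinearMap (P.root j) (l.map P.coroot).sum = 1 := h5
        rw [h5', mul_one]
        rfl
      rw [h6, ← e]
      exact this) (by rw [List.length_erase_of_mem hj]; omega)
    rw [h6, sub_eq_zero] at h7
    rw [h7, root'_coroot, P.pairing_same] at h5
    norm_num at h5

/-- A vector that takes integral values on the weight lattice lies in the coroot lattice. -/
theorem exists_list_coroot (b : P.Base) {v : N}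
    (hv : ∀ x : weightLattice P, ∃ z : ℤ, P.toLinearMap (x : V) v = z) :
    ∃ l : List ι, v = (l.map P.coroot).sum := by
  classical
  let B := b.flip.toWeightBasis
  have hB : ∀ j, B j = P.coroot j := fun j => b.flip.toWeightBasis_apply j
  have hcoef : ∀ j, ∃ z : ℤ, B.repr v j = z := by
    intro j
    -- The fundamental weight of `j`: its value at a vector is the `j`-th coefficient in the basis
    -- of simple coroots.
    let x : V := P.toPerfPair.symm (B.coord j)
    have hx : ∀ u, P.toLinearMap x u = B.coord j u := fun u => by
      have := P.toLinearMap.apply_symm_toPerfPair_self (B.coord j)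
      exact DFunLike.congr_fun this u
    have hmem : x ∈ weightLattice P := by
      intro i
      obtain ⟨f, -, -, hf⟩ := b.flip.exists_root_eq_sum_int i
      change P.coroot i = ∑ j ∈ b.support, f j • P.coroot j at hf
      refine ⟨f j, ?_⟩
      change P.toLinearMap x (P.coroot i) = _
      rw [hx, hf, map_sum, Finset.sum_eq_single (j : ι)]
      · rw [← hB j]; simp
      · intro l hl hlj
        have : P.coroot l = B ⟨l, hl⟩ := (hB ⟨l, hl⟩).symm
        rw [this, map_zsmul, Module.Basis.coord_apply, Module.Basis.repr_self,
          Finsupp.single_eq_of_ne (fun h => hlj (congrArg Subtype.val h).symm), smul_zero]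
      · exact fun h => absurd j.2 h
    obtain ⟨z, hz⟩ := hv ⟨x, hmem⟩
    exact ⟨z, by rw [← hz]; exact (hx v).symm⟩
  have key : ∀ (z : ℤ) (j : ι), ∃ l : List ι, z • P.coroot j = (l.map P.coroot).sum := by
    intro z j
    obtain ⟨n, rfl | rfl⟩ := z.eq_nat_or_neg
    · exact ⟨List.replicate n j, by simp⟩
    · exact ⟨List.replicate n (negIdx P j), by simp⟩
  have key' : ∀ s : Finset b.flip.support, ∃ l : List ι,
      ∑ j ∈ s, B.repr v j • B j = (l.map P.coroot).sum := by
    intro s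
    induction s using Finset.induction_on with
    | empty => exact ⟨[], by simp⟩
    | insert a s ha ih =>
      obtain ⟨l, hl⟩ := ih
      obtain ⟨z, hz⟩ := hcoef a
      obtain ⟨l', hl'⟩ := key z a
      refine ⟨l' ++ l, ?_⟩
      rw [Finset.sum_insert ha, hl, hz, hB, List.map_append, List.sum_append, ← hl',
        Int.cast_smul_eq_zsmul]
  obtain ⟨l, hl⟩ := key' Finset.univ
  exact ⟨l, by rw [← hl, B.sum_repr]⟩

end Minuscule

/-! ### Separation of the vertices below `ŵ₀` over `k`. -/

section Separation

variable {ι V N : Type u} [AddCommGroup V] [Module ℚ V] [AddCommGroup N] [Module ℚ N]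
variable {P : RootPairing ι ℚ V N} {b : P.Base}
variable [Finite ι] [P.IsRootSystem] [P.IsCrystallographic] [P.IsReduced] [P.IsIrreducible]
variable {k : Type u} [Field k] [Algebra ZHalf k]

/-- Pairing with the coroots of `i` and `j` shows that both mutual pairings are congruent to `2`. In
the list of possible pairs one entry is always at least `-2`, so `p ≥ 5` forces the pair `(2, 2)`.
For `p = 3` the pair `(-1, -1)` survives as well, which is why type `A₂` is excluded. -/
theorem eq_of_pairing_congr (hk : ringChar k = 0 ∨ coxeterNumber b ≤ ringChar k)
    (hA2 : ¬ (IsTypeA2 b ∧ ringChar k = 3)) {i j : ι}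
    (h : ∀ l, (ringChar k : ℤ) ∣ P.pairingIn ℤ i l - P.pairingIn ℤ j l) : i = j := by
  have h1 := h i
  have h2 := h j
  have h3 := P.pairingIn_pairingIn_mem_set_of_isCrystal_of_isRed i j
  have e1 : P.pairingIn ℤ i i = 2 := by simp
  have e2 : P.pairingIn ℤ j j = 2 := by simp
  rw [e1] at h1
  rw [e2] at h2
  have key : P.pairingIn ℤ i j = 2 ∧ P.pairingIn ℤ j i = 2 := by
    have h4 : ringChar k = 3 → ¬ P.pairingIn ℤ i j * P.pairingIn ℤ j i = 1 := fun hc h4 =>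
      hA2 ⟨isTypeA2_of_coxeterNumber_le_three (by omega) h4, hc⟩
    simp only [Set.mem_insert_iff, Set.mem_singleton_iff, Prod.mk.injEq] at h3
    rcases ringChar_cases k with hc | hc | hc
    · rw [hc] at h1 h2
      simp only [Nat.cast_zero, zero_dvd_iff] at h1 h2
      omega
    · have h4 := h4 hc
      rw [hc] at h1 h2
      rcases h3 with h3 | h3 | h3 | h3 | h3 | h3 | h3 | h3 | h3 | h3 | h3 | h3 | h3 <;>
        rw [h3.1, h3.2] at h4 <;> rw [h3.2] at h1 <;> rw [h3.1] at h2 <;> omega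
    · by_contra hne
      have hb : |2 - P.pairingIn ℤ j i| < ringChar k ∨ |P.pairingIn ℤ i j - 2| < ringChar k := by
        rw [abs_lt, abs_lt]; omega
      rcases hb with hb | hb
      · have h5 := Int.eq_zero_of_abs_lt_dvd h1 hb
        have h6 := Int.eq_zero_of_abs_lt_dvd h2 (by rw [abs_lt]; omega)
        omega
      · have h5 := Int.eq_zero_of_abs_lt_dvd h2 hb
        have h6 := Int.eq_zero_of_abs_lt_dvd h1 (by rw [abs_lt]; omega)
        omega
  have h4 : P.pairing i j * P.pairing j i = 4 := by
    rw [← pairingIn_cast, ← pairingIn_cast, key.1, key.2]; norm_num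
  rcases eq_or_eq_negIdx_of_four h4 with h5 | h5
  · exact h5
  · exfalso
    have h6 := pairingIn_cast P i j
    rw [key.1, h5, RootPairing.pairing_reflectionPerm_self_left, P.pairing_same] at h6
    norm_num at h6

theorem dvd_of_lin_eq_zero {y : AffX P} (h : lin k y = 0) (χ : AffX P →+ ℤ) :
    (ringChar k : ℤ) ∣ χ y := by
  by_contra h'
  rw [← intCast_eq_zero] at h'
  exact lin_ne_zero k χ h' h

/-- The elements of `Ŵ°` are distinguished by their action on the affine weight lattice over
`k`. -/
theorem exists_lin_actX_ne_zero (hk : ringChar k = 0 ∨ coxeterNumber b ≤ ringChar k)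
    (hA2 : ¬ (IsTypeA2 b ∧ ringChar k = 3)) {x y : AffW P} (hx : x ∈ circ b) (hy : y ∈ circ b)
    (hne : x ≠ y) : ∃ l : AffX P, lin k (actX x l - actX y l) ≠ 0 := by
  by_contra! h
  apply hne
  have hpos : (0 : ℚ) < coxeterNumber b := by
    obtain ⟨g, -⟩ := exists_isHighestRoot b
    exact_mod_cast coxeterNumber_pos b g
  have hdvd : ∀ (l : AffX P) (χ : AffX P →+ ℤ), (ringChar k : ℤ) ∣ χ (actX x l - actX y l) :=
    fun l χ => dvd_of_lin_eq_zero (h l) χ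
  -- Affine roots are elements of the lattice, so `x` and `y` take each of them to affine roots that
  -- are congruent modulo `p`. By `eq_of_pairing_congr` these have the same finite part, and their
  -- levels differ by a multiple of `p`. Hence `x` and `y` differ by a translation.
  have hroot : ∀ j, ∃ m : ℤ, (ringChar k : ℤ) ∣ m ∧
      ∀ v, P.root' j (act x v - act y v) = -m := by
    intro j
    obtain ⟨j₀, m₀, e₀, -⟩ := exists_actX_affRoot x⁻¹ j 0
    obtain ⟨j', m', e', -⟩ := exists_actX_affRoot y j₀ m₀
    have e : actX x (affRoot P j₀ m₀) = affRoot P j 0 := by rw [← e₀, actX_inv]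
    have hj : j = j' := eq_of_pairing_congr hk hA2 fun l => by
      have := hdvd (affRoot P j₀ m₀) (corootX P l)
      rwa [e, e', map_sub, corootX_affRoot, corootX_affRoot] at this
    subst hj
    refine ⟨m', ?_, fun v => ?_⟩
    · have := hdvd (affRoot P j₀ m₀) (AddMonoidHom.snd _ ℤ)
      rw [e, e'] at this
      simpa [affRoot] using this
    · have h1 := affFun_actX x (affRoot P j₀ m₀) v
      have h2 := affFun_actX y (affRoot P j₀ m₀) v
      rw [e, affFun_affRoot, affVal] at h1
      rw [e', affFun_affRoot, affVal] at h2
      rw [map_sub]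
      push_cast at h1
      linarith
  choose m hm hmv using hroot
  have hconst : ∀ v, act x v - act y v = act x 0 - act y 0 := by
    intro v
    refine sub_eq_zero.1 ((P.flip.eq_zero_iff_forall_coroot'_eq_zero).2 fun j => ?_)
    change P.root' j _ = 0
    rw [map_sub, hmv, hmv, sub_self]
  obtain ⟨d, hd⟩ : ∃ d, d = act x 0 - act y 0 := ⟨_, rfl⟩
  rw [← hd] at hconst
  suffices hd0 : d = 0 from AffW.ext fun v => sub_eq_zero.1 ((hconst v).trans hd0)
  have hroot' : ∀ j, P.root' j d = -m j := fun j => by rw [hd, hmv]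
  -- The translation vector `d` takes values in `pℤ` on all weights, so in positive characteristic
  -- `d / p` lies in the coroot lattice.
  have hweight : ∀ ω : weightLattice P, ∃ z : ℤ, (ringChar k : ℤ) ∣ z ∧
      P.toLinearMap (ω : V) d = z := by
    intro ω
    have e1 : actX x (actX x⁻¹ (ω, 0)) = (ω, 0) := actX_inv x _
    have h3 := hdvd (actX x⁻¹ (ω, 0)) (AddMonoidHom.snd _ ℤ)
    rw [e1] at h3
    have h1 : ∀ u, P.toLinearMap (ω : V) u =
        P.toLinearMap ((actX y (actX x⁻¹ (ω, 0))).1 : V) (u - d) +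
          (actX y (actX x⁻¹ (ω, 0))).2 := by
      intro u
      obtain ⟨v, rfl⟩ := act_surjective x u
      have h1 := affFun_actX x (actX x⁻¹ (ω, 0)) v
      have h2 := affFun_actX y (actX x⁻¹ (ω, 0)) v
      rw [e1, ← h2] at h1
      have h4 : act y v = act x v - d := by rw [← hconst v]; abel
      rw [h4] at h1
      simpa [affFun] using h1
    generalize actX y (actX x⁻¹ (ω, 0)) = q at h1 h3
    have h0 := h1 0
    have hdd : P.toLinearMap (ω : V) d = q.2 := by
      have := h1 d
      simpa using this
    refine ⟨q.2, by simpa using h3, hdd⟩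
  by_cases hp : ringChar k = 0
  · refine (P.flip.eq_zero_iff_forall_coroot'_eq_zero).2 fun j => ?_
    have := hm j
    change P.root' j d = 0
    rw [hp, Nat.cast_zero, zero_dvd_iff] at this
    rw [hroot', this]; simp
  · have hp' := hk.resolve_left hp
    have hp0 : (ringChar k : ℚ) ≠ 0 := by exact_mod_cast hp
    have hμ : d = (ringChar k : ℚ) • ((ringChar k : ℚ)⁻¹ • d) := by
      rw [smul_smul, mul_inv_cancel₀ hp0, one_smul]
    obtain ⟨l, hl⟩ := exists_list_coroot b (v := (ringChar k : ℚ)⁻¹ • d) fun ω => by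
      obtain ⟨z, ⟨c, rfl⟩, hz⟩ := hweight ω
      refine ⟨c, ?_⟩
      rw [map_smul, hz, smul_eq_mul]
      push_cast
      field_simp
    rw [hμ, hl, sum_coroot_eq_zero l, smul_zero]
    intro j
    rw [← hl]
    obtain ⟨c, hc⟩ := hm j
    have hv := hmv j (basePt b)
    rw [map_sub, hc] at hv
    have a1 := abs_lt.1 (abs_root'_lt_of_mem_circ hx j)
    have a2 := abs_lt.1 (abs_root'_lt_of_mem_circ hy j)
    have hpq : (coxeterNumber b : ℚ) ≤ ringChar k := by exact_mod_cast hp'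
    -- The `j`-value of `d` is the difference of two numbers below `h - 1 < p` in absolute value, so
    -- it is below `2p`, and it is a multiple of `p`.
    have hcab : |c| ≤ 1 := by
      by_contra! hlt
      have h2 : (2 : ℚ) ≤ |(c : ℚ)| := by exact_mod_cast hlt
      have h3 : |(ringChar k : ℚ) * c| < 2 * ringChar k := by
        push_cast at hv
        rw [abs_lt]
        constructor <;> linarith [a1.1, a1.2, a2.1, a2.2]
      rw [abs_mul, Nat.abs_cast] at h3
      have h4 : (0 : ℚ) < ringChar k := by positivity
      nlinarith
    rw [map_smul, hroot', hc, smul_eq_mul]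
    have : (ringChar k : ℚ)⁻¹ * -(((ringChar k : ℤ) * c : ℤ) : ℚ) = -c := by
      push_cast
      field_simp
    rw [this, abs_neg]
    exact_mod_cast hcab

end Separation
end AffineMomentGraph

/-! ## The structure algebra -/

namespace AffineMomentGraph

section StructureAlgebra

variable {ι V N : Type u} [AddCommGroup V] [Module ℚ V] [AddCommGroup N] [Module ℚ N]
variable (P : RootPairing ι ℚ V N) [P.IsCrystallographic]

/-- The element of the structure algebra with given coordinates. -/
def mkStruct (z : AffW P → Sym ZHalf (AffX P)) (h : z ∈ ⨆ d, homogFam P ZHalf d)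
    (h' : ∀ (i : ι) (n : ℤ) (w : AffW P), lin ZHalf (affRoot P i n) ∣ z w - z (refl P i n * w)) :
    StructZ P := ⟨z, h, h'⟩

theorem coord_mkStruct {z : AffW P → Sym ZHalf (AffX P)} (h : z ∈ ⨆ d, homogFam P ZHalf d)
    (h' : ∀ (i : ι) (n : ℤ) (w : AffW P), lin ZHalf (affRoot P i n) ∣ z w - z (refl P i n * w)) :
    coord P (mkStruct P z h h') = z := rfl

theorem coord_mem (z : StructZ P) : coord P z ∈ ⨆ d, homogFam P ZHalf d := z.2.1

theorem coord_dvd (z : StructZ P) (i : ι) (n : ℤ) (w : AffW P) :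
    lin ZHalf (affRoot P i n) ∣ coord P z w - coord P z (refl P i n * w) := z.2.2 i n w

theorem StructZ.ext {y z : StructZ P} (h : ∀ w, coord P y w = coord P z w) : y = z :=
  coord_injective P (funext h)

theorem lin_actX_dvd (i : ι) (n : ℤ) (w : AffW P) (x : AffX P) :
    lin ZHalf (affRoot P i n) ∣ lin ZHalf (actX w x) - lin ZHalf (actX (refl P i n * w) x) := by
  rw [actX_mul, actX_refl, lin_sub, sub_sub_cancel, lin_zsmul, zsmul_eq_mul]
  exact dvd_mul_left _ _

/-- The element of the structure algebra with coordinates `w ↦ w x`. -/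
def rightLin (x : AffX P) : StructZ P :=
  mkStruct P (fun w => lin ZHalf (actX w x)) (Submodule.mem_iSup_of_mem 2
    (mem_homogFam.2 fun _ => lin_mem_symDeg _ _ _)) fun i n w => lin_actX_dvd P i n w x

theorem coord_rightLin (x : AffX P) (w : AffW P) :
    coord P (rightLin P x) w = lin ZHalf (actX w x) := rfl

/-- The constant element of the structure algebra. -/
def constLin : AffX P →+ StructZ P :=
  AddMonoidHom.mk' (fun x => mkStruct P (fun _ => lin ZHalf x) (Submodule.mem_iSup_of_mem 2
    (mem_homogFam.2 fun _ => lin_mem_symDeg _ _ _)) fun i n w => by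
      simp only [sub_self, dvd_zero]) fun x y => StructZ.ext P fun w => by
    rw [map_add, Pi.add_apply, coord_mkStruct, coord_mkStruct, coord_mkStruct]
    exact lin_add _ _ _

theorem coord_constLin (x : AffX P) (w : AffW P) :
    coord P (constLin P x) w = lin ZHalf x := rfl

theorem comp_mul_mem {z : AffW P → Sym ZHalf (AffX P)} (hz : z ∈ ⨆ d, homogFam P ZHalf d)
    (s : AffW P) : (fun w => z (w * s)) ∈ ⨆ d, homogFam P ZHalf d := by
  induction hz using Submodule.iSup_induction' with
  | zero => exact zero_mem _
  | add x y _ _ hx hy => exact add_mem hx hy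
  | mem d x hx => exact Submodule.mem_iSup_of_mem d (mem_homogFam.2 fun _ => mem_homogFam.1 hx _)

/-- The automorphism `z ↦ (z_{w s})_w` of the structure algebra. -/
def swap (s : AffW P) : StructZ P →ₗ[ZHalf] StructZ P where
  toFun z := mkStruct P (fun w => coord P z (w * s)) (comp_mul_mem P (coord_mem P z) s)
    fun i n w => by
      have := coord_dvd P z i n (w * s)
      rwa [← mul_assoc] at this
  map_add' _ _ := rfl
  map_smul' _ _ := rfl

theorem coord_swap (s : AffW P) (z : StructZ P) (w : AffW P) :
    coord P (swap P s z) w = coord P z (w * s) := rfl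

variable {P}
variable [Finite ι] [P.IsRootSystem] [P.IsReduced]

theorem mul_mul_cancel {i : ι} {n : ℤ} {y z : StructZ P}
    (h : 2 * rightLin P (affRoot P i n) * y = 2 * rightLin P (affRoot P i n) * z) : y = z := by
  refine StructZ.ext P fun w => ?_
  have h1 := congrFun (congrArg (coord P) h) w
  simp only [map_mul, Pi.mul_apply, coord_rightLin] at h1
  refine mul_left_cancel₀ ?_ h1
  have h2 : coord P (2 : StructZ P) w = 2 := by rw [map_ofNat]; rfl
  rw [h2]
  obtain ⟨j, m, e, -⟩ := exists_actX_affRoot w i n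
  rw [e]
  refine mul_ne_zero ?_ (lin_ne_zero _ (corootX P j) ?_)
  · have : (2 : Sym ZHalf (AffX P)) = algebraMap ZHalf _ 2 := by rw [map_ofNat]
    rw [this, Ne, SymmetricAlgebra.algebraMap_eq_zero_iff]
    exact two_ne_zero
  · rw [corootX_affRoot_self]
    norm_num

/-- Here `r` and `r - m t` are the values of `c` at the two ends of an edge with label `t`, and `g`
and `g'` are the quotients by `2c`. The identity shows that `t` divides `r (g - g')` up to the
factor `2`. -/
theorem divDiff_dvd_aux {A : Type*} [CommRing A] {z z' y y' r t g g' a c e m : A}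
    (h1 : 2 * r * g = z - y) (h2 : 2 * (r - m * t) * g' = z' - y') (h3 : z - z' = t * a)
    (h4 : y - y' = t * c) (h5 : 2 * e = a - c) :
    2 * (r * (g - g')) = 2 * (t * (e - m * g')) := by
  linear_combination h1 - h2 + h3 - h4 - t * h5

/-- The vertices `w` and `w s` are joined by an edge with label `± w(α_s)`, so division by `c` is
possible coordinatewise. That the quotients again satisfy all congruences follows from coprimality
of the labels, which holds over `ℤ[1/2]` without any bound on the vertices. -/
theorem exists_divDiff_homog {i : ι} {n : ℤ} {d : ℤ} {z : StructZ P} (hz : z ∈ structDeg P d) :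
    ∃ q ∈ structDeg P (d - 2),
      2 * rightLin P (affRoot P i n) * q = z - swap P (refl P i n) z := by
  have h1 : ∀ w, ∃ f, coord P z w - coord P z (w * refl P i n) =
      lin ZHalf (actX w (affRoot P i n)) * f := fun w => by
    obtain ⟨j, m, e, e'⟩ := exists_actX_affRoot w i n
    rw [e, ← e']
    exact coord_dvd P z j m w
  choose f hf using h1
  -- The chosen quotients need not be homogeneous, so their components of degree `d - 2` are taken.
  -- The factor `1/2` is part of the definition of the divided difference.
  let g : AffW P → Sym ZHalf (AffX P) := fun w => half • symProj ZHalf (AffX P) (d - 2) (f w)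
  have hgdeg : ∀ w, g w ∈ symDeg ZHalf (AffX P) (d - 2) := fun w =>
    Submodule.smul_mem _ _ (symProj_mem _ _ _ _)
  have hhalf : ∀ x : Sym ZHalf (AffX P), 2 * half • x = x := fun x => by
    rw [← map_ofNat (algebraMap ZHalf (Sym ZHalf (AffX P))) 2, ← Algebra.smul_def, smul_smul,
      mul_comm, half_mul_two, one_smul]
  have hg : ∀ w, 2 * lin ZHalf (actX w (affRoot P i n)) * g w =
      coord P z w - coord P z (w * refl P i n) := fun w => by
    have h2 := symProj_mul ZHalf (AffX P) (lin_mem_symDeg ZHalf (AffX P) (actX w (affRoot P i n)))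
      d (f w)
    rw [← hf, map_sub, symProj_same _ _ ((mem_structDeg P).1 hz _),
      symProj_same _ _ ((mem_structDeg P).1 hz _)] at h2
    rw [h2]
    simp only [g]
    rw [mul_comm 2, mul_assoc, hhalf]
  have hdom : ∀ (x y : Sym ZHalf (AffX P)), 2 * x = 2 * y → x = y := fun x y h => by
    have := congrArg (half • ·) h
    simpa only [← mul_smul_comm, hhalf] using this
  refine ⟨mkStruct P g (Submodule.mem_iSup_of_mem _ (mem_homogFam.2 hgdeg)) fun j m w => ?_,
    (mem_structDeg P).2 hgdeg, StructZ.ext P fun w => ?_⟩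
  -- On the edge from `w` to `w s` both numerator and denominator change sign, so the quotient takes
  -- equal values at its ends. Every other label is coprime to `w(α_s)`, which can therefore be
  -- cancelled.
  · by_cases hw : refl P j m * w = w * refl P i n
    · have h3 := hg w
      have h4 := hg (refl P j m * w)
      have e : refl P j m * w * refl P i n = w := by
        rw [hw, mul_assoc, refl_mul_self, mul_one]
      rw [e, hw, actX_mul, actX_refl_self, map_neg, lin_neg] at h4
      have : g w = g (refl P j m * w) := by
        have h5 : 2 * lin ZHalf (actX w (affRoot P i n)) * g w =
            2 * lin ZHalf (actX w (affRoot P i n)) * g (refl P j m * w) := by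
          rw [hw]
          linear_combination h3 + h4
        refine mul_left_cancel₀ ?_ (hdom _ _ (by simpa only [mul_assoc] using h5))
        obtain ⟨j', m', e', -⟩ := exists_actX_affRoot w i n
        rw [e']
        exact lin_ne_zero _ (corootX P j') (by rw [corootX_affRoot_self]; norm_num)
      rw [this, sub_self]
      exact dvd_zero _
    · obtain ⟨j', m', e1, e2⟩ := exists_actX_affRoot w i n
      refine lin_affRoot_dvd_of_dvd_mul_of_charZero half_mul_two (j := j') (m := m')
        (fun h => hw (by rw [h, e2])) ?_
      have h3 := hg w
      have h4 := hg (refl P j m * w)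
      rw [actX_mul, actX_refl, lin_sub, lin_zsmul] at h4
      rw [e1] at h3 h4
      obtain ⟨a, ha⟩ := coord_dvd P z j m w
      obtain ⟨c, hc⟩ := coord_dvd P z j m (w * refl P i n)
      change coord P z w - coord P z (refl P j m * w) = _ at ha
      change coord P z (w * refl P i n) - coord P z (refl P j m * (w * refl P i n)) = _ at hc
      rw [← mul_assoc] at hc
      rw [zsmul_eq_mul] at h4
      exact ⟨_, hdom _ _ (divDiff_dvd_aux h3 h4 ha hc (hhalf (a - c)))⟩
  · have h2 : coord P (2 : StructZ P) w = 2 := by rw [map_ofNat]; rfl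
    rw [map_mul, map_mul, map_sub, Pi.mul_apply, Pi.mul_apply, Pi.sub_apply]
    exact (congrArg (fun t => t * lin ZHalf (actX w (affRoot P i n)) * g w) h2).trans (hg w)

theorem exists_divDiff (i : ι) (n : ℤ) (z : StructZ P) :
    ∃ q, 2 * rightLin P (affRoot P i n) * q = z - swap P (refl P i n) z := by
  obtain ⟨s, hs⟩ := structAlg_sum P z
  choose q _ hq using fun d => exists_divDiff_homog (i := i) (n := n) (structProj_mem P d z)
  refine ⟨∑ d ∈ s, q d, ?_⟩
  rw [Finset.mul_sum, Finset.sum_congr rfl fun d _ => hq d, Finset.sum_sub_distrib, ← map_sum, ← hs]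

variable (P) in
/-- The divided difference `z ↦ (z - σ z) / 2c`. -/
def divDiff (i : ι) (n : ℤ) : StructZ P →ₗ[ZHalf] StructZ P where
  toFun z := (exists_divDiff i n z).choose
  map_add' x y := mul_mul_cancel (i := i) (n := n) (by
    rw [mul_add, (exists_divDiff i n x).choose_spec, (exists_divDiff i n y).choose_spec,
      (exists_divDiff i n (x + y)).choose_spec, map_add]
    abel)
  map_smul' r x := mul_mul_cancel (i := i) (n := n) (by
    rw [RingHom.id_apply, mul_smul_comm, (exists_divDiff i n x).choose_spec,
      (exists_divDiff i n (r • x)).choose_spec, map_smul, smul_sub])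

theorem divDiff_spec (i : ι) (n : ℤ) (z : StructZ P) :
    2 * rightLin P (affRoot P i n) * divDiff P i n z = z - swap P (refl P i n) z :=
  (exists_divDiff i n z).choose_spec

variable (P) in
/-- The average `z ↦ (z + σ z) / 2`. -/
def average (i : ι) (n : ℤ) : StructZ P →ₗ[ZHalf] StructZ P :=
  half • (LinearMap.id + swap P (refl P i n))

theorem two_mul_half_smul (z : StructZ P) : 2 * half • z = z := by
  rw [← map_ofNat (algebraMap ZHalf (StructZ P)) 2, ← Algebra.smul_def, smul_smul,
    mul_comm, half_mul_two, one_smul]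

theorem average_spec (i : ι) (n : ℤ) (z : StructZ P) :
    2 * average P i n z = z + swap P (refl P i n) z := two_mul_half_smul _

theorem two_mul_cancel {x y : StructZ P} (h : 2 * x = 2 * y) : x = y := by
  have := congrArg (half • ·) h
  simpa only [← mul_smul_comm, two_mul_half_smul] using this

/-- With `average_mem` and `divDiff_mem` this is the decomposition `Z = Z^s ⊕ c Z^s`. It is given by
linear operators, so it survives base change to `k`. -/
theorem average_add_mul_divDiff (i : ι) (n : ℤ) (z : StructZ P) :
    average P i n z + rightLin P (affRoot P i n) * divDiff P i n z = z := by
  refine two_mul_cancel ?_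
  rw [mul_add, ← mul_assoc, average_spec, divDiff_spec]
  ring

theorem swap_mul (s : AffW P) (y z : StructZ P) : swap P s (y * z) = swap P s y * swap P s z := rfl

theorem mem_structInv_iff {s : AffW P} {z : StructZ P} : z ∈ structInv P s ↔ swap P s z = z := by
  constructor
  · exact fun h => StructZ.ext P fun w => h w
  · intro h w
    rw [← coord_swap, h]

theorem swap_swap (i : ι) (n : ℤ) (z : StructZ P) :
    swap P (refl P i n) (swap P (refl P i n) z) = z :=
  StructZ.ext P fun w => by
    rw [coord_swap, coord_swap, mul_assoc, refl_mul_self, mul_one]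

theorem swap_rightLin (i : ι) (n : ℤ) :
    swap P (refl P i n) (rightLin P (affRoot P i n)) = - rightLin P (affRoot P i n) :=
  StructZ.ext P fun w => by
    rw [coord_swap, coord_rightLin, map_neg, Pi.neg_apply, coord_rightLin, actX_mul,
      actX_refl_self, map_neg, lin_neg]

theorem swap_two (s : AffW P) : swap P s 2 = 2 := rfl

theorem average_mem (i : ι) (n : ℤ) (z : StructZ P) : average P i n z ∈ structInv P (refl P i n) := by
  rw [mem_structInv_iff]
  refine two_mul_cancel ?_
  have h := congrArg (swap P (refl P i n)) (average_spec i n z)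
  rw [swap_mul, swap_two, map_add, swap_swap] at h
  rw [h, average_spec, add_comm]

theorem divDiff_mem (i : ι) (n : ℤ) (z : StructZ P) : divDiff P i n z ∈ structInv P (refl P i n) := by
  rw [mem_structInv_iff]
  refine mul_mul_cancel (i := i) (n := n) ?_
  have h := congrArg (swap P (refl P i n)) (divDiff_spec i n z)
  rw [swap_mul, swap_mul, swap_two, swap_rightLin, map_sub, swap_swap] at h
  rw [divDiff_spec]
  linear_combination -h

theorem average_mul {i : ι} {n : ℤ} {y : StructZ P} (hy : y ∈ structInv P (refl P i n))
    (z : StructZ P) : average P i n (y * z) = y * average P i n z := by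
  rw [mem_structInv_iff] at hy
  refine two_mul_cancel ?_
  rw [average_spec, swap_mul, hy]
  linear_combination -y * average_spec i n z

theorem divDiff_mul {i : ι} {n : ℤ} {y : StructZ P} (hy : y ∈ structInv P (refl P i n))
    (z : StructZ P) : divDiff P i n (y * z) = y * divDiff P i n z := by
  rw [mem_structInv_iff] at hy
  refine mul_mul_cancel (i := i) (n := n) ?_
  rw [divDiff_spec, swap_mul, hy]
  linear_combination -y * divDiff_spec i n z

theorem average_one (i : ι) (n : ℤ) : average P i n (1 : StructZ P) = 1 := by
  refine two_mul_cancel ?_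
  rw [average_spec]
  change (1 : StructZ P) + 1 = _
  norm_num

theorem divDiff_one (i : ι) (n : ℤ) : divDiff P i n (1 : StructZ P) = 0 := by
  refine mul_mul_cancel (i := i) (n := n) ?_
  rw [divDiff_spec, mul_zero]
  exact sub_self _

theorem average_mul_right (i : ι) (n : ℤ) (z : StructZ P) :
    average P i n (z * rightLin P (affRoot P i n)) =
      rightLin P (affRoot P i n) ^ 2 * divDiff P i n z := by
  refine two_mul_cancel ?_
  rw [average_spec, swap_mul, swap_rightLin]
  linear_combination - rightLin P (affRoot P i n) * divDiff_spec i n z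

theorem divDiff_mul_right (i : ι) (n : ℤ) (z : StructZ P) :
    divDiff P i n (z * rightLin P (affRoot P i n)) = average P i n z := by
  refine mul_mul_cancel (i := i) (n := n) ?_
  rw [divDiff_spec, swap_mul, swap_rightLin]
  linear_combination - rightLin P (affRoot P i n) * average_spec i n z

theorem average_mem_deg {i : ι} {n d : ℤ} {z : StructZ P} (hz : z ∈ structDeg P d) :
    average P i n z ∈ structDeg P d :=
  Submodule.smul_mem _ _ (add_mem hz ((mem_structDeg P).2 fun _ => (mem_structDeg P).1 hz _))

theorem divDiff_mem_deg {i : ι} {n d : ℤ} {z : StructZ P} (hz : z ∈ structDeg P d) :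
    divDiff P i n z ∈ structDeg P (d - 2) := by
  obtain ⟨q, hq, e⟩ := exists_divDiff_homog (i := i) (n := n) hz
  rw [← divDiff_spec] at e
  rwa [← mul_mul_cancel e]

end StructureAlgebra

/-! ### Base change of the decomposition of the structure algebra to `k`. -/

section BaseChange

variable {ι V N : Type u} [AddCommGroup V] [Module ℚ V] [AddCommGroup N] [Module ℚ N]
variable (P : RootPairing ι ℚ V N) [P.IsCrystallographic]
variable (k : Type u) [Field k] [Algebra ZHalf k]

/-- The inclusion of the constant elements of the structure algebra. -/
def const : Sym k (AffX P) →ₐ[k] StructK P k :=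
  SymmetricAlgebra.lift (LinearMap.liftBaseChange k
    (((TensorProduct.mk ZHalf k (StructZ P) 1).toAddMonoidHom.comp (constLin P)).toIntLinearMap))

theorem const_ι (r : k) (x : AffX P) :
    const P k (SymmetricAlgebra.ι k _ (r ⊗ₜ x)) = r ⊗ₜ constLin P x := by
  simp [const, TensorProduct.smul_tmul']

@[simp] theorem ev_const (w : AffW P) (f : Sym k (AffX P)) : ev P k w (const P k f) = f := by
  have : (ev P k w).comp (const P k) = AlgHom.id k _ := by
    refine SymmetricAlgebra.algHom_ext (LinearMap.ext fun t => ?_)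
    induction t using TensorProduct.induction_on with
    | zero => simp only [map_zero]
    | add x y hx hy => rw [map_add, hx, hy, map_add]
    | tmul r x =>
      change ev P k w (const P k (SymmetricAlgebra.ι k _ (r ⊗ₜ x))) = SymmetricAlgebra.ι k _ (r ⊗ₜ x)
      rw [const_ι, ev_tmul, coord_constLin, symMap_lin, lin, ← map_smul, TensorProduct.smul_tmul',
        smul_eq_mul, mul_one]
  exact DFunLike.congr_fun this f

variable {P k} in
theorem const_mem {d : ℤ} {f : Sym k (AffX P)} (hf : f ∈ symDeg k (AffX P) d) :
    const P k f ∈ degK P k d := by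
  have h1 : (1 : StructK P k) ∈ degK P k 0 :=
    tmul_mem_degK P k 1 ((mem_structDeg P).2 fun w => by rw [map_one]; exact one_mem_symDeg _ _)
  rw [mem_symDeg_iff] at hf
  rcases hf with rfl | ⟨n, rfl, hf⟩
  · rw [map_zero]; exact zero_mem _
  induction hf using Submodule.pow_induction_on_left' with
  | algebraMap r =>
    rw [AlgHom.commutes, Algebra.algebraMap_eq_smul_one]
    exact Submodule.smul_mem _ _ (by simpa using h1)
  | add x y i hx hy h h' => rw [map_add]; exact add_mem h h'
  | mem_mul m hm i x hx h =>
    obtain ⟨t, rfl⟩ := hm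
    rw [map_mul, Nat.cast_succ, mul_add, mul_one, add_comm]
    refine degK_mul P k ?_ h
    induction t using TensorProduct.induction_on with
    | zero => rw [map_zero, map_zero]; exact zero_mem _
    | add x y hx hy => rw [map_add, map_add]; exact add_mem hx hy
    | tmul r x =>
      rw [const_ι]
      exact tmul_mem_degK P k r ((mem_structDeg P).2 fun _ => lin_mem_symDeg _ _ _)

theorem tmul_mem_invK {s : AffW P} (c : k) {z : StructZ P} (hz : z ∈ structInv P s) :
    c ⊗ₜ z ∈ invK P k s := ⟨c ⊗ₜ ⟨z, hz⟩, rfl⟩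

theorem const_mem_invK (s : AffW P) (f : Sym k (AffX P)) : const P k f ∈ invK P k s := by
  induction f using SymmetricAlgebra.induction with
  | algebraMap r => rw [AlgHom.commutes]; exact Subalgebra.algebraMap_mem _ _
  | add x y hx hy => rw [map_add]; exact add_mem hx hy
  | mul x y hx hy => rw [map_mul]; exact mul_mem hx hy
  | ι t =>
    induction t using TensorProduct.induction_on with
    | zero => rw [map_zero, map_zero]; exact zero_mem _
    | add x y hx hy => rw [map_add, map_add]; exact add_mem hx hy
    | tmul r x =>
      rw [const_ι]
      exact tmul_mem_invK P k r fun _ => rfl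

/-- The element of the structure algebra over `k` with coordinates `w ↦ w x`. -/
def rightK (x : AffX P) : StructK P k := 1 ⊗ₜ rightLin P x

theorem ev_rightK (w : AffW P) (x : AffX P) : ev P k w (rightK P k x) = lin k (actX w x) := by
  rw [rightK, ev_tmul, coord_rightLin, symMap_lin, one_smul]

theorem rightK_mem (x : AffX P) : rightK P k x ∈ degK P k 2 :=
  tmul_mem_degK P k 1 ((mem_structDeg P).2 fun _ => lin_mem_symDeg _ _ _)

variable [Finite ι] [P.IsRootSystem] [P.IsReduced] (i : ι) (n : ℤ)

/-- The average over `k`. -/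
def averageK : StructK P k →ₗ[k] StructK P k := (average P i n).baseChange k

/-- The divided difference over `k`. -/
def divDiffK : StructK P k →ₗ[k] StructK P k := (divDiff P i n).baseChange k

theorem invK_tmul_induction {s : AffW P} {p : StructK P k → Prop}
    (h : ∀ (c : k) (y : StructZ P), y ∈ structInv P s → p (c ⊗ₜ y))
    (hadd : ∀ x y, p x → p y → p (x + y)) {z : StructK P k} (hz : z ∈ invK P k s) : p z := by
  obtain ⟨t, rfl⟩ := hz
  induction t using TensorProduct.induction_on with
  | zero =>
    have := h 0 0 (zero_mem _)
    rw [TensorProduct.zero_tmul] at this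
    simpa using this
  | add x y hx hy => rw [map_add]; exact hadd _ _ hx hy
  | tmul c y => exact h c y y.2

variable {i n}

theorem averageK_mem (z : StructK P k) : averageK P k i n z ∈ invK P k (refl P i n) := by
  induction z using TensorProduct.induction_on with
  | zero => rw [map_zero]; exact zero_mem _
  | add x y hx hy => rw [map_add]; exact add_mem hx hy
  | tmul c z => exact tmul_mem_invK P k c (average_mem i n z)

theorem divDiffK_mem (z : StructK P k) : divDiffK P k i n z ∈ invK P k (refl P i n) := by
  induction z using TensorProduct.induction_on with
  | zero => rw [map_zero]; exact zero_mem _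
  | add x y hx hy => rw [map_add]; exact add_mem hx hy
  | tmul c z => exact tmul_mem_invK P k c (divDiff_mem i n z)

theorem averageK_add_mul_divDiffK (z : StructK P k) :
    averageK P k i n z + rightK P k (affRoot P i n) * divDiffK P k i n z = z := by
  induction z using TensorProduct.induction_on with
  | zero => simp
  | add x y hx hy => rw [map_add, map_add, mul_add, add_add_add_comm, hx, hy]
  | tmul c z =>
    simp only [averageK, divDiffK, LinearMap.baseChange_tmul, rightK,
      Algebra.TensorProduct.tmul_mul_tmul, one_mul]
    rw [← TensorProduct.tmul_add, average_add_mul_divDiff]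

theorem averageK_mul {y : StructK P k} (hy : y ∈ invK P k (refl P i n)) (z : StructK P k) :
    averageK P k i n (y * z) = y * averageK P k i n z := by
  refine invK_tmul_induction P k (p := fun y => averageK P k i n (y * z) = y * averageK P k i n z)
    (fun c y hy => ?_) (fun x y hx hy => by rw [add_mul, map_add, hx, hy, add_mul]) hy
  induction z using TensorProduct.induction_on with
  | zero => simp
  | add x y hx hy => rw [mul_add, map_add, hx, hy, map_add, mul_add]
  | tmul c z => simp [averageK, average_mul hy]

theorem divDiffK_mul {y : StructK P k} (hy : y ∈ invK P k (refl P i n)) (z : StructK P k) :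
    divDiffK P k i n (y * z) = y * divDiffK P k i n z := by
  refine invK_tmul_induction P k (p := fun y => divDiffK P k i n (y * z) = y * divDiffK P k i n z)
    (fun c y hy => ?_) (fun x y hx hy => by rw [add_mul, map_add, hx, hy, add_mul]) hy
  induction z using TensorProduct.induction_on with
  | zero => simp
  | add x y hx hy => rw [mul_add, map_add, hx, hy, map_add, mul_add]
  | tmul c z => simp [divDiffK, divDiff_mul hy]

theorem averageK_one : averageK P k i n 1 = 1 := by
  rw [Algebra.TensorProduct.one_def, averageK, LinearMap.baseChange_tmul, average_one]

theorem divDiffK_one : divDiffK P k i n 1 = 0 := by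
  rw [Algebra.TensorProduct.one_def, divDiffK, LinearMap.baseChange_tmul, divDiff_one,
    TensorProduct.tmul_zero]

theorem averageK_mul_right (z : StructK P k) :
    averageK P k i n (z * rightK P k (affRoot P i n)) =
      rightK P k (affRoot P i n) ^ 2 * divDiffK P k i n z := by
  induction z using TensorProduct.induction_on with
  | zero => simp
  | add x y hx hy => rw [add_mul, map_add, hx, hy, map_add, mul_add]
  | tmul c z =>
    rw [rightK, Algebra.TensorProduct.tmul_mul_tmul, averageK, divDiffK,
      LinearMap.baseChange_tmul, LinearMap.baseChange_tmul, average_mul_right,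
      Algebra.TensorProduct.tmul_pow, Algebra.TensorProduct.tmul_mul_tmul, one_pow, mul_one, one_mul]

theorem divDiffK_mul_right (z : StructK P k) :
    divDiffK P k i n (z * rightK P k (affRoot P i n)) = averageK P k i n z := by
  induction z using TensorProduct.induction_on with
  | zero => simp
  | add x y hx hy => rw [add_mul, map_add, hx, hy, map_add]
  | tmul c z =>
    rw [rightK, Algebra.TensorProduct.tmul_mul_tmul, averageK, divDiffK,
      LinearMap.baseChange_tmul, LinearMap.baseChange_tmul, divDiff_mul_right, mul_one]

theorem averageK_mem_deg {d : ℤ} {z : StructK P k} (hz : z ∈ degK P k d) :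
    averageK P k i n z ∈ degK P k d := by
  refine degK_induction P k (fun z => averageK P k i n z ∈ degK P k d) (fun c y hy => ?_)
    (by rw [map_zero]; exact zero_mem _) (fun x y hx hy => by rw [map_add]; exact add_mem hx hy) hz
  exact tmul_mem_degK P k c (average_mem_deg hy)

theorem divDiffK_mem_deg {d : ℤ} {z : StructK P k} (hz : z ∈ degK P k d) :
    divDiffK P k i n z ∈ degK P k (d - 2) := by
  refine degK_induction P k (fun z => divDiffK P k i n z ∈ degK P k (d - 2)) (fun c y hy => ?_)
    (by rw [map_zero]; exact zero_mem _) (fun x y hx hy => by rw [map_add]; exact add_mem hx hy) hz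
  exact tmul_mem_degK P k c (divDiff_mem_deg hy)

theorem averageK_right : averageK P k i n (rightK P k (affRoot P i n)) = 0 := by
  have := averageK_mul_right P k (i := i) (n := n) 1
  rwa [one_mul, divDiffK_one, mul_zero] at this

theorem divDiffK_right : divDiffK P k i n (rightK P k (affRoot P i n)) = 1 := by
  have := divDiffK_mul_right P k (i := i) (n := n) 1
  rwa [one_mul, averageK_one] at this

end BaseChange
end AffineMomentGraph

/-! ## Graded modules -/

namespace AffineMomentGraph

namespace GradedMod

variable {k A : Type u} [CommRing k] [CommRing A] [Algebra k A] {𝒜 : ℤ → Submodule k A}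

theorem proj_same (M : GradedMod 𝒜) {n : ℤ} {m : M} (hm : m ∈ M.deg n) : M.proj n m = m := by
  rw [M.proj_of_mem hm, if_pos rfl]

theorem proj_ne (M : GradedMod 𝒜) {n n' : ℤ} (h : n ≠ n') {m : M} (hm : m ∈ M.deg n') :
    M.proj n m = 0 := by
  rw [M.proj_of_mem hm, if_neg h]

theorem proj_smul (M : GradedMod 𝒜) {d : ℤ} {a : A} (ha : a ∈ 𝒜 d) (n : ℤ) (m : M) :
    M.proj n (a • m) = a • M.proj (n - d) m := by
  induction M.mem_iSup m using AddSubgroup.iSup_induction' with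
  | h1 => simp
  | hadd x y _ _ hx hy => simp only [smul_add, map_add, hx, hy]
  | hp i x hx =>
    rw [M.proj_of_mem (M.smul_mem ha hx), M.proj_of_mem hx]
    by_cases h : n = d + i
    · rw [if_pos h, if_pos (by omega)]
    · rw [if_neg h, if_neg (by omega), smul_zero]

theorem exists_sum (M : GradedMod 𝒜) (m : M) : ∃ s : Finset ℤ, m = ∑ n ∈ s, M.proj n m := by
  obtain ⟨s, hs⟩ := exists_sum_proj (fun n _ hm => M.proj_same hm)
    (fun n n' h _ hm => M.proj_ne h hm) (M.mem_iSup m)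
  exact ⟨s, hs s subset_rfl⟩

@[elab_as_elim]
theorem induction (M : GradedMod 𝒜) {p : M → Prop} (h : ∀ n, ∀ m ∈ M.deg n, p m)
    (hadd : ∀ x y, p x → p y → p (x + y)) (m : M) : p m := by
  induction M.mem_iSup m using AddSubgroup.iSup_induction' with
  | h1 => exact h 0 0 (zero_mem _)
  | hadd x y _ _ hx hy => exact hadd x y hx hy
  | hp i x hx => exact h i x hx

/-- The submodule `K` is graded. -/
def IsHomog (M : GradedMod 𝒜) (K : Submodule A M) : Prop := ∀ n, ∀ m ∈ K, M.proj n m ∈ K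

/-- The projection of a quotient to a homogeneous component. -/
def quotProj (M : GradedMod 𝒜) {K : Submodule A M} (hK : M.IsHomog K) (n : ℤ) :
    M ⧸ K →+ M ⧸ K :=
  QuotientAddGroup.map K.toAddSubgroup K.toAddSubgroup (M.proj n) fun m hm => hK n m hm

theorem quotProj_mk (M : GradedMod 𝒜) {K : Submodule A M} (hK : M.IsHomog K) (n : ℤ) (m : M) :
    M.quotProj hK n (K.mkQ m) = K.mkQ (M.proj n m) := rfl

/-- The quotient of a graded module by a graded submodule. -/
def quot (M : GradedMod 𝒜) (K : Submodule A M) (hK : M.IsHomog K) : GradedMod 𝒜 where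
  carrier := M ⧸ K
  deg n := (M.deg n).map K.mkQ.toAddMonoidHom
  isInternal := isInternal_of_proj _ (M.quotProj hK)
    (by
      rintro n _ ⟨m, hm, rfl⟩
      exact (M.quotProj_mk hK n m).trans (by rw [M.proj_same hm]; rfl))
    (by
      rintro n n' h _ ⟨m, hm, rfl⟩
      exact (M.quotProj_mk hK n m).trans (by rw [M.proj_ne h hm, map_zero]))
    (by
      intro q
      obtain ⟨m, rfl⟩ := K.mkQ_surjective q
      induction m using M.induction with
      | h n m hm =>
        exact (le_iSup (fun n => (M.deg n).map K.mkQ.toAddMonoidHom) n) ⟨m, hm, rfl⟩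
      | hadd x y hx hy => rw [map_add]; exact add_mem hx hy)
  smul_mem := by
    rintro i j a _ ha ⟨m, hm, rfl⟩
    exact ⟨a • m, M.smul_mem ha hm, map_smul K.mkQ a m⟩

variable (M L Q : GradedMod 𝒜)

/-- The projection to a quotient. -/
def quotMk (K : Submodule A M) (hK : M.IsHomog K) : M →ₗ[A] M.quot K hK := K.mkQ

variable {M L Q}

theorem quotMk_graded {K : Submodule A M} (hK : M.IsHomog K) : IsGradedHom (M.quotMk K hK) :=
  fun _ m hm => ⟨m, hm, rfl⟩

theorem quotMk_surjective {K : Submodule A M} (hK : M.IsHomog K) :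
    Function.Surjective (M.quotMk K hK) := K.mkQ_surjective

theorem quotMk_eq_zero {K : Submodule A M} (hK : M.IsHomog K) {m : M} :
    M.quotMk K hK m = 0 ↔ m ∈ K := Submodule.Quotient.mk_eq_zero K

/-- Homomorphisms from a quotient. -/
def quotLift {K : Submodule A M} (hK : M.IsHomog K) (f : M →ₗ[A] L) (h : ∀ m ∈ K, f m = 0) :
    M.quot K hK →ₗ[A] L := K.liftQ f h

theorem quotLift_graded {K : Submodule A M} (hK : M.IsHomog K) {f : M →ₗ[A] L}
    (hf : IsGradedHom f) (h : ∀ m ∈ K, f m = 0) : IsGradedHom (quotLift hK f h) := by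
  rintro n _ ⟨m, hm, rfl⟩
  exact hf n m hm

theorem IsGradedHom.comp {f : M →ₗ[A] L} {g : L →ₗ[A] Q} (hg : IsGradedHom g) (hf : IsGradedHom f) :
    IsGradedHom (g ∘ₗ f) := fun n m hm => hg n _ (hf n m hm)

theorem isGradedHom_id : IsGradedHom (LinearMap.id : M →ₗ[A] M) := fun _ _ hm => hm

theorem IsGradedHom.add {f g : M →ₗ[A] L} (hf : IsGradedHom f) (hg : IsGradedHom g) :
    IsGradedHom (f + g) := fun n m hm => add_mem (hf n m hm) (hg n m hm)

theorem IsGradedHom.sub {f g : M →ₗ[A] L} (hf : IsGradedHom f) (hg : IsGradedHom g) :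
    IsGradedHom (f - g) := fun n m hm => sub_mem (hf n m hm) (hg n m hm)

/-- An injective graded homomorphism reflects degrees. -/
theorem IsGradedHom.mem_deg_of_injective {f : M →ₗ[A] L} (hf : IsGradedHom f)
    (hinj : Function.Injective f) {n : ℤ} {m : M} (h : f m ∈ L.deg n) : m ∈ M.deg n := by
  have : M.proj n m = m := hinj (by rw [map_proj hf, L.proj_same h])
  rw [← this]
  exact M.proj_mem n m

theorem IsGradedHom.exists_mem_deg {f : M →ₗ[A] L} (hf : IsGradedHom f) {n : ℤ} {m : M}
    (h : f m ∈ L.deg n) : ∃ m' ∈ M.deg n, f m' = f m :=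
  ⟨M.proj n m, M.proj_mem n m, by rw [map_proj hf, L.proj_same h]⟩

theorem iso_of_bijective {f : M →ₗ[A] L} (hf : IsGradedHom f) (h : Function.Bijective f) :
    M.Iso L :=
  ⟨LinearEquiv.ofBijective f h, fun n m => ⟨hf n m, fun h' => hf.mem_deg_of_injective h.1 h'⟩⟩

theorem Iso.symm (h : M.Iso L) : L.Iso M := by
  obtain ⟨e, he⟩ := h
  exact ⟨e.symm, fun n m => by rw [he, e.apply_symm_apply]⟩

theorem Iso.trans (h : M.Iso L) (h' : L.Iso Q) : M.Iso Q := by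
  obtain ⟨e, he⟩ := h
  obtain ⟨e', he'⟩ := h'
  exact ⟨e.trans e', fun n m => (he n m).trans (he' n _)⟩

theorem Iso.shift (h : M.Iso L) (n : ℤ) : (M.shift n).Iso (L.shift n) := by
  obtain ⟨e, he⟩ := h
  exact ⟨e, fun i m => he (i + n) m⟩

theorem Iso.isSummand (h : M.Iso L) : M.IsSummand L := by
  obtain ⟨e, he⟩ := h
  exact ⟨e.toLinearMap, e.symm.toLinearMap, fun n m hm => (he n m).1 hm, fun n m hm =>
    (he n _).2 (by simpa using hm), LinearMap.ext fun m => e.symm_apply_apply m⟩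

theorem IsSummand.trans (h : M.IsSummand L) (h' : L.IsSummand Q) : M.IsSummand Q := by
  obtain ⟨f, g, hf, hg, e⟩ := h
  obtain ⟨f', g', hf', hg', e'⟩ := h'
  refine ⟨f' ∘ₗ f, g ∘ₗ g', hf'.comp hf, hg.comp hg', LinearMap.ext fun m => ?_⟩
  have h1 : ∀ x, g' (f' x) = x := DFunLike.congr_fun e'
  have h2 : ∀ x, g (f x) = x := DFunLike.congr_fun e
  change g (g' (f' (f m))) = m
  rw [h1, h2]

theorem IsSummand.isGradedProjective (h : M.IsSummand L) (hL : L.IsGradedProjective) :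
    M.IsGradedProjective := by
  obtain ⟨i, p, hi, hp, e⟩ := h
  intro X Y g f hg hf hs
  obtain ⟨f', hf', e'⟩ := hL X Y g (f ∘ₗ p) hg (hf.comp hp) hs
  refine ⟨f' ∘ₗ i, hf'.comp hi, ?_⟩
  rw [← LinearMap.comp_assoc, e', LinearMap.comp_assoc, e, LinearMap.comp_id]

theorem IsGradedProjective.shift (hM : M.IsGradedProjective) (n : ℤ) :
    (M.shift n).IsGradedProjective := by
  intro X Y g f hg hf hs
  obtain ⟨f', hf', e⟩ := hM (X.shift (-n)) (Y.shift (-n)) g f (fun i m hm => hg _ m hm)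
    (fun i m hm => hf _ m (by
      change m ∈ M.deg (i + -n + n)
      rwa [neg_add_cancel_right])) hs
  refine ⟨f', fun i m hm => ?_, e⟩
  have := hf' (i + n) m hm
  change f' m ∈ X.deg (i + n + -n) at this
  rwa [add_neg_cancel_right] at this

/-- Extensions of graded projective modules are graded projective. -/
theorem isGradedProjective_of_exact {B C : GradedMod 𝒜} (hB : B.IsGradedProjective)
    (hC : C.IsGradedProjective) {j : B →ₗ[A] M} {π : M →ₗ[A] C} (hj : IsGradedHom j)
    (hπ : IsGradedHom π) (hinj : Function.Injective j) (hsurj : Function.Surjective π)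
    (hker : ∀ m, π m = 0 ↔ ∃ x, j x = m) : M.IsGradedProjective := by
  obtain ⟨σ, hσ, e⟩ := hC M C π LinearMap.id hπ isGradedHom_id hsurj
  have e' : ∀ c, π (σ c) = c := DFunLike.congr_fun e
  -- The section `σ` of `π` yields a retraction onto `B`, so a homomorphism from `M` can be lifted
  -- on `B` and on `C` separately.
  have hx : ∀ m, ∃ x, j x = m - σ (π m) := fun m => (hker _).1 (by rw [map_sub, e', sub_self])
  choose r hr using hx
  let r' : M →ₗ[A] B :=
    { toFun := r
      map_add' := fun x y => hinj (by simp only [map_add, hr]; abel)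
      map_smul' := fun a x => hinj (by simp only [map_smul, hr, smul_sub, RingHom.id_apply]) }
  have hr' : ∀ m, j (r' m) = m - σ (π m) := hr
  have hrg : IsGradedHom r' := fun n m hm => hj.mem_deg_of_injective hinj (by
    rw [hr']
    exact sub_mem hm (hσ _ _ (hπ _ _ hm)))
  intro X Y g f hg hf hs
  obtain ⟨f₁, hf₁, e₁⟩ := hB X Y g (f ∘ₗ j) hg (hf.comp hj) hs
  obtain ⟨f₂, hf₂, e₂⟩ := hC X Y g (f ∘ₗ σ) hg (hf.comp hσ) hs
  refine ⟨f₁ ∘ₗ r' + f₂ ∘ₗ π, (hf₁.comp hrg).add (hf₂.comp hπ), LinearMap.ext fun m => ?_⟩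
  have h1 : g (f₁ (r' m)) = f (j (r' m)) := DFunLike.congr_fun e₁ _
  have h2 : g (f₂ (π m)) = f (σ (π m)) := DFunLike.congr_fun e₂ _
  change g (f₁ (r' m) + f₂ (π m)) = f m
  rw [map_add, h1, h2, hr', ← map_add, sub_add_cancel]

theorem Iso.isGradedProjective (h : M.Iso L) (hL : L.IsGradedProjective) : M.IsGradedProjective :=
  h.isSummand.isGradedProjective hL

end GradedMod

theorem symSelf_isGradedProjective (k : Type u) [Field k] (Y : Type u) [AddCommGroup Y] :
    (symSelf k Y).IsGradedProjective := by
  intro L Q g f hg hf hs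
  obtain ⟨l, hl⟩ := hs (f (1 : Sym k Y))
  have h1 : f (1 : Sym k Y) ∈ Q.deg 0 := hf 0 _ (one_mem_symDeg k Y)
  rw [← hl] at h1
  obtain ⟨l', hl', e⟩ := hg.exists_mem_deg h1
  refine ⟨LinearMap.toSpanSingleton (Sym k Y) L l', fun n (m : Sym k Y) hm => ?_, LinearMap.ext fun (m : Sym k Y) => ?_⟩
  · have := L.smul_mem (show m ∈ symDeg k Y n from hm) hl'
    rwa [add_zero] at this
  · change g (m • l') = f m
    rw [map_smul, e, hl]
    exact (f.map_smul m (1 : Sym k Y)).symm.trans (congrArg f (mul_one m))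

/-! ### Restriction of scalars to the symmetric algebra. -/

section Restriction

variable {ι V N : Type u} [AddCommGroup V] [Module ℚ V] [AddCommGroup N] [Module ℚ N]
variable {P : RootPairing ι ℚ V N} [P.IsCrystallographic]
variable {k : Type u} [Field k] [Algebra ZHalf k]

instance (M : GradedMod (degK P k)) : Module (Sym k (AffX P)) M :=
  Module.compHom M (const P k).toRingHom

theorem const_smul {M : GradedMod (degK P k)} (f : Sym k (AffX P)) (m : M) :
    const P k f • m = f • m := rfl

instance (M : GradedMod (degK P k)) : Module k M :=
  Module.compHom M (algebraMap k (StructK P k))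

theorem field_smul_def {M : GradedMod (degK P k)} (c : k) (m : M) :
    algebraMap k (StructK P k) c • m = c • m := rfl

theorem smul_smul_comm {M : GradedMod (degK P k)} (f : Sym k (AffX P)) (z : StructK P k) (m : M) :
    z • f • m = f • z • m := by
  rw [← const_smul, ← const_smul, smul_smul, smul_smul, mul_comm]

instance (M : GradedMod (degK P k)) : IsScalarTower k (Sym k (AffX P)) M where
  smul_assoc c f m := by
    rw [← const_smul, ← const_smul, ← field_smul_def, smul_smul, map_smul, Algebra.smul_def]

/-- The restriction of a graded module over the structure algebra to the symmetric algebra. -/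
abbrev GradedMod.restr (M : GradedMod (degK P k)) : GradedMod (symDeg k (AffX P)) where
  carrier := M
  deg := M.deg
  isInternal := M.isInternal
  smul_mem ha hm := M.smul_mem (const_mem ha) hm

/-- A homomorphism over the structure algebra is linear over the symmetric algebra. -/
def resHom {M L : GradedMod (degK P k)} (f : M →ₗ[StructK P k] L) : M →ₗ[Sym k (AffX P)] L where
  toFun := f
  map_add' := map_add f
  map_smul' a m := f.map_smul (const P k a) m

end Restriction
end AffineMomentGraph

/-! ## Decomposition of translated modules -/

namespace AffineMomentGraph

section Theta

variable {ι V N : Type u} [AddCommGroup V] [Module ℚ V] [AddCommGroup N] [Module ℚ N]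
variable {P : RootPairing ι ℚ V N} [P.IsCrystallographic]
variable {k : Type u} [Field k] [Algebra ZHalf k]

/-- The element `z ⊗ m` of the translated module. -/
def thetaMk (s : AffW P) {M : GradedMod (degK P k)} (z : StructK P k) (m : M) : theta P k s M :=
  z ⊗ₜ[invK P k s] m

variable {s : AffW P} {M : GradedMod (degK P k)}

theorem thetaMk_add (z : StructK P k) (m m' : M) :
    thetaMk s z (m + m') = thetaMk s z m + thetaMk s z m' := TensorProduct.tmul_add _ _ _

theorem add_thetaMk (z z' : StructK P k) (m : M) :
    thetaMk s (z + z') m = thetaMk s z m + thetaMk s z' m := TensorProduct.add_tmul _ _ _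

theorem smul_thetaMk (y z : StructK P k) (m : M) : y • thetaMk s z m = thetaMk s (y * z) m := rfl

theorem thetaMk_mul {y : StructK P k} (hy : y ∈ invK P k s) (z : StructK P k) (m : M) :
    thetaMk s (y * z) m = thetaMk s z (y • m) :=
  TensorProduct.smul_tmul (⟨y, hy⟩ : invK P k s) z m

theorem thetaMk_mem {i j : ℤ} {z : StructK P k} {m : M} (hz : z ∈ degK P k i) (hm : m ∈ M.deg j) :
    thetaMk s z m ∈ (theta P k s M).deg (i + j) :=
  AddSubgroup.subset_closure ⟨i, j, z, m, hz, hm, rfl, rfl⟩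

@[elab_as_elim]
theorem theta_induction {p : theta P k s M → Prop} (t : theta P k s M)
    (h : ∀ z (m : M), p (thetaMk s z m)) (hadd : ∀ t t', p t → p t' → p (t + t')) : p t :=
  TensorProduct.induction_on (motive := p) t
    (by
      have := h 0 0
      rwa [show thetaMk s (0 : StructK P k) (0 : M) = 0 from TensorProduct.tmul_zero _ _] at this)
    h hadd

theorem theta_deg_induction {d : ℤ} {p : theta P k s M → Prop}
    (h0 : p 0) (hneg : ∀ t, p t → p (-t)) (hadd : ∀ t t', p t → p t' → p (t + t'))
    (h : ∀ i j z (m : M), z ∈ degK P k i → m ∈ M.deg j → i + j = d → p (thetaMk s z m))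
    {t : theta P k s M} (ht : t ∈ (theta P k s M).deg d) : p t := by
  change t ∈ thetaDeg P k s M d at ht
  induction ht using AddSubgroup.closure_induction with
  | zero => exact h0
  | add x y _ _ hx hy => exact hadd x y hx hy
  | neg x _ hx => exact hneg x hx
  | mem t ht =>
    obtain ⟨i, j, z, m, hz, hm, e, rfl⟩ := ht
    exact h i j z m hz hm e

variable [Finite ι] [P.IsRootSystem] [P.IsReduced] {i : ι} {n : ℤ}

/-- The biadditive map `(z, m) ↦ F(z) m` for an invariant-linear `F` with values in the
invariants. -/
def thetaLift (F : StructK P k →+ StructK P k)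
    (hF : ∀ y ∈ invK P k s, ∀ z, F (y * z) = y * F z) : theta P k s M →+ M :=
  TensorProduct.liftAddHom
    ((AddMonoidHom.smul : StructK P k →+ M →+ M).comp F) fun r z m => by
      change F (r * z) • m = F z • (r : StructK P k) • m
      rw [hF r r.2, mul_comm, mul_smul]

theorem thetaLift_mk (F : StructK P k →+ StructK P k)
    (hF : ∀ y ∈ invK P k s, ∀ z, F (y * z) = y * F z) (z : StructK P k) (m : M) :
    thetaLift F hF (thetaMk s z m) = F z • m := TensorProduct.liftAddHom_tmul _ _ _ _

/-- The first component of an element of the translated module. -/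
def thetaFst : theta P k (refl P i n) M →+ M :=
  thetaLift (averageK P k i n).toAddMonoidHom fun _ hy z => averageK_mul P k hy z

/-- The second component of an element of the translated module. -/
def thetaSnd : theta P k (refl P i n) M →+ M :=
  thetaLift (divDiffK P k i n).toAddMonoidHom fun _ hy z => divDiffK_mul P k hy z

theorem thetaFst_mk (z : StructK P k) (m : M) :
    thetaFst (thetaMk (refl P i n) z m) = averageK P k i n z • m := thetaLift_mk _ _ _ _

theorem thetaSnd_mk (z : StructK P k) (m : M) :
    thetaSnd (thetaMk (refl P i n) z m) = divDiffK P k i n z • m := thetaLift_mk _ _ _ _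

variable (i n) in
/-- The element `1 ⊗ a + c ⊗ b` of the translated module. -/
def pair (a b : M) : theta P k (refl P i n) M :=
  thetaMk _ 1 a + thetaMk _ (rightK P k (affRoot P i n)) b

@[simp] theorem thetaFst_pair (a b : M) : thetaFst (pair i n a b) = a := by
  rw [pair, map_add, thetaFst_mk, thetaFst_mk, averageK_one, averageK_right]
  simp

@[simp] theorem thetaSnd_pair (a b : M) : thetaSnd (pair i n a b) = b := by
  rw [pair, map_add, thetaSnd_mk, thetaSnd_mk, divDiffK_one, divDiffK_right]
  simp

theorem pair_add (a b a' b' : M) : pair i n (a + a') (b + b') = pair i n a b + pair i n a' b' := by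
  simp only [pair, thetaMk_add]
  abel

/-- Writing `z = e + c d` with invariant `e` and `d` gives `z ⊗ m = 1 ⊗ e m + c ⊗ d m`. Hence `θ^s
M` is `1 ⊗ M ⊕ c ⊗ M`, and `thetaFst` and `thetaSnd` are coordinates on it. -/
theorem pair_eta (t : theta P k (refl P i n) M) : pair i n (thetaFst t) (thetaSnd t) = t := by
  induction t using theta_induction with
  | h z m =>
    rw [thetaFst_mk, thetaSnd_mk, pair, ← thetaMk_mul (averageK_mem P k z),
      ← thetaMk_mul (divDiffK_mem P k z), mul_one, ← add_thetaMk, mul_comm,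
      averageK_add_mul_divDiffK]
  | hadd t t' h h' => rw [map_add, map_add, pair_add, h, h']

theorem theta_ext {t t' : theta P k (refl P i n) M} (h1 : thetaFst t = thetaFst t')
    (h2 : thetaSnd t = thetaSnd t') : t = t' := by
  rw [← pair_eta t, ← pair_eta t', h1, h2]

/-- This is the first component of `(e + c d)(a + c b) = (e a + c² d b) + c (d a + e b)`. -/
theorem thetaFst_smul (z : StructK P k) (t : theta P k (refl P i n) M) :
    thetaFst (z • t) = averageK P k i n z • thetaFst t +
      (rightK P k (affRoot P i n) ^ 2 * divDiffK P k i n z) • thetaSnd t := by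
  rw [← pair_eta t, pair, smul_add, smul_thetaMk, smul_thetaMk, map_add, thetaFst_mk, thetaFst_mk,
    averageK_mul_right, mul_one, ← pair, thetaFst_pair, thetaSnd_pair]

theorem thetaSnd_smul (z : StructK P k) (t : theta P k (refl P i n) M) :
    thetaSnd (z • t) = divDiffK P k i n z • thetaFst t + averageK P k i n z • thetaSnd t := by
  rw [← pair_eta t, pair, smul_add, smul_thetaMk, smul_thetaMk, map_add, thetaSnd_mk, thetaSnd_mk,
    divDiffK_mul_right, mul_one, ← pair, thetaFst_pair, thetaSnd_pair]

theorem averageK_of_mem {y : StructK P k} (hy : y ∈ invK P k (refl P i n)) :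
    averageK P k i n y = y := by
  have := averageK_mul P k hy 1
  rwa [averageK_one, mul_one] at this

theorem divDiffK_of_mem {y : StructK P k} (hy : y ∈ invK P k (refl P i n)) :
    divDiffK P k i n y = 0 := by
  have := divDiffK_mul P k hy 1
  rwa [divDiffK_one, mul_one, mul_zero] at this

theorem thetaFst_inv_smul {y : StructK P k} (hy : y ∈ invK P k (refl P i n))
    (t : theta P k (refl P i n) M) : thetaFst (y • t) = y • thetaFst t := by
  rw [thetaFst_smul, averageK_of_mem hy, divDiffK_of_mem hy, mul_zero, zero_smul, add_zero]

theorem thetaSnd_inv_smul {y : StructK P k} (hy : y ∈ invK P k (refl P i n))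
    (t : theta P k (refl P i n) M) : thetaSnd (y • t) = y • thetaSnd t := by
  rw [thetaSnd_smul, averageK_of_mem hy, divDiffK_of_mem hy, zero_smul, zero_add]

/-- The first component is linear over the symmetric algebra. -/
theorem thetaFst_sym_smul (f : Sym k (AffX P)) (t : theta P k (refl P i n) M) :
    thetaFst (f • t) = f • thetaFst t := thetaFst_inv_smul (const_mem_invK P k _ f) t

theorem thetaSnd_sym_smul (f : Sym k (AffX P)) (t : theta P k (refl P i n) M) :
    thetaSnd (f • t) = f • thetaSnd t := thetaSnd_inv_smul (const_mem_invK P k _ f) t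

theorem thetaFst_mem {d : ℤ} {t : theta P k (refl P i n) M}
    (ht : t ∈ (theta P k (refl P i n) M).deg d) : thetaFst t ∈ M.deg d := by
  refine theta_deg_induction (p := fun t => thetaFst t ∈ M.deg d) ?_ ?_ ?_ ?_ ht
  · rw [map_zero]; exact zero_mem _
  · intro t h; rw [map_neg]; exact neg_mem h
  · intro t t' h h'; rw [map_add]; exact add_mem h h'
  · rintro a b z m hz hm rfl
    rw [thetaFst_mk]
    exact M.smul_mem (averageK_mem_deg P k hz) hm

theorem thetaSnd_mem {d : ℤ} {t : theta P k (refl P i n) M}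
    (ht : t ∈ (theta P k (refl P i n) M).deg d) : thetaSnd t ∈ M.deg (d - 2) := by
  refine theta_deg_induction (p := fun t => thetaSnd t ∈ M.deg (d - 2)) ?_ ?_ ?_ ?_ ht
  · rw [map_zero]; exact zero_mem _
  · intro t h; rw [map_neg]; exact neg_mem h
  · intro t t' h h'; rw [map_add]; exact add_mem h h'
  · rintro a b z m hz hm rfl
    rw [thetaSnd_mk, add_sub_right_comm]
    exact M.smul_mem (divDiffK_mem_deg P k hz) hm

theorem one_mem_degK : (1 : StructK P k) ∈ degK P k 0 := by
  have := const_mem (one_mem_symDeg k (AffX P))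
  rwa [map_one] at this

theorem thetaFst_proj (d : ℤ) (t : theta P k (refl P i n) M) :
    thetaFst ((theta P k (refl P i n) M).proj d t) = M.proj d (thetaFst t) := by
  induction t using (theta P k (refl P i n) M).induction with
  | h n t ht =>
    rw [(theta P k _ M).proj_of_mem ht, M.proj_of_mem (thetaFst_mem ht)]
    split_ifs <;> simp
  | hadd x y hx hy => simp only [map_add, hx, hy]

theorem thetaSnd_proj (d : ℤ) (t : theta P k (refl P i n) M) :
    thetaSnd ((theta P k (refl P i n) M).proj d t) = M.proj (d - 2) (thetaSnd t) := by
  induction t using (theta P k (refl P i n) M).induction with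
  | h n t ht =>
    rw [(theta P k _ M).proj_of_mem ht, M.proj_of_mem (thetaSnd_mem ht)]
    by_cases h : d = n
    · rw [if_pos h, if_pos (by omega)]
    · rw [if_neg h, if_neg (by omega), map_zero]
  | hadd x y hx hy => simp only [map_add, hx, hy]

end Theta
end AffineMomentGraph

/-! ## Stalk filtrations -/

namespace AffineMomentGraph

section Filtration

variable {ι V N : Type u} [AddCommGroup V] [Module ℚ V] [AddCommGroup N] [Module ℚ N]
variable {P : RootPairing ι ℚ V N} [P.IsCrystallographic] (b : P.Base)
variable {k : Type u} [Field k] [Algebra ZHalf k]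

/-- A family of submodules `K x` such that the quotients `M / K x` are the stalks, supported below
`w`, of a flabby sheaf on the affine Bruhat graph with global sections `M`. -/
structure IsStalkFiltration [Finite ι] [P.IsRootSystem] (M : GradedMod (degK P k))
    (K : AffW P → Submodule (Sym k (AffX P)) M) (w : AffW P) : Prop where
  homog : ∀ x, M.restr.IsHomog (K x)
  ev_smul : ∀ x z (m : M), ev P k x z = 0 → z • m ∈ K x
  torsionfree : ∀ x (f : Sym k (AffX P)) (m : M), f ≠ 0 → f • m ∈ K x → m ∈ K x
  projective : ∀ x, (M.restr.quot (K x) (homog x)).IsGradedProjective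
  inf : ∀ m : M, (∀ x, m ∈ K x) → m = 0
  support : ∀ x, ¬ BruhatLE b x w → K x = ⊤
  -- Elements that vanish at `x` vanish on the edges going up from `x`, where the edge stalk is the
  -- stalk at the upper end modulo the label. So the stalk at `x` maps to the edge stalk.
  edge : ∀ x i n, length b x < length b (refl P i n * x) → ∀ m ∈ K x,
    ∃ m', m - lin k (affRoot P i n) • m' ∈ K (refl P i n * x)
  -- Flabbiness: a germ at `x` that vanishes on all edges going up from `x` extends to a global
  -- section that vanishes outside `{≤ x}`.
  extend : ∀ x m, (∀ i n, length b x < length b (refl P i n * x) →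
    ∃ m', m - lin k (affRoot P i n) • m' ∈ K (refl P i n * x)) →
    ∃ m', m - m' ∈ K x ∧ ∀ y, ¬ BruhatLE b y x → m' ∈ K y
  -- If `g` is a nonzerodivisor modulo `f` in the symmetric algebra, then it is one on the stalk
  -- modulo `f`. For free modules this is automatic; carrying it along avoids a proof that graded
  -- projective stalks are free.
  regular : ∀ x (f g : Sym k (AffX P)) m, f ≠ 0 → (∀ h, f ∣ g * h → f ∣ h) →
    (∃ m', g • m - f • m' ∈ K x) → ∃ m', m - f • m' ∈ K x
  -- The last three conditions are finiteness conditions: the bound below serves to split off free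
  -- summands, the other two serve Fitting's lemma.
  bddBelow : ∃ d₀, ∀ d < d₀, ∀ m ∈ M.deg d, m = 0
  finite : ∀ d, ∃ W : Submodule k M, W.FG ∧ ∀ m ∈ M.deg d, m ∈ W
  gen : ∃ T : Finset ℤ, Submodule.span (Sym k (AffX P)) {m : M | ∃ d ∈ T, m ∈ M.deg d} = ⊤

variable {b}
variable [Finite ι] [P.IsRootSystem] [P.IsReduced]
variable {M : GradedMod (degK P k)} {K : AffW P → Submodule (Sym k (AffX P)) M} {w : AffW P}

theorem IsStalkFiltration.sub_ev_smul_mem (h : IsStalkFiltration b M K w) (x : AffW P)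
    (z : StructK P k) (m : M) : z • m - ev P k x z • m ∈ K x := by
  rw [← const_smul, ← sub_smul]
  exact h.ev_smul x _ m (by rw [map_sub, ev_const, sub_self])

theorem IsStalkFiltration.smul_mem (h : IsStalkFiltration b M K w) {x : AffW P}
    (z : StructK P k) {m : M} (hm : m ∈ K x) : z • m ∈ K x := by
  have := add_mem (h.sub_ev_smul_mem x z m) ((K x).smul_mem (ev P k x z) hm)
  rwa [sub_add_cancel] at this

variable (k) in
/-- The image of the simple affine root `α_n` under `y`, as an element of the symmetric algebra. -/
def rootAt (i : ι) (n : ℤ) (y : AffW P) : Sym k (AffX P) := lin k (actX y (affRoot P i n))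

theorem rootAt_mul (i : ι) (n : ℤ) (y : AffW P) : rootAt k i n (y * refl P i n) = - rootAt k i n y := by
  rw [rootAt, actX_mul, actX_refl_self, map_neg, lin_neg, rootAt]

theorem rootAt_refl_mul (i : ι) (n : ℤ) (j : ι) (m : ℤ) (y : AffW P) :
    rootAt k i n (refl P j m * y) =
      rootAt k i n y - corootX P j (actX y (affRoot P i n)) • lin k (affRoot P j m) := by
  rw [rootAt, actX_mul, actX_refl, lin_sub, lin_zsmul, rootAt]

theorem lin_affRoot_ne_zero (i : ι) (n : ℤ) : lin k (affRoot P i n) ≠ 0 :=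
  lin_ne_zero k (corootX P i) (by
    rw [corootX_affRoot_self]
    exact_mod_cast two_ne_zero_field k)

theorem rootAt_ne_zero (i : ι) (n : ℤ) (y : AffW P) : rootAt k i n y ≠ 0 := by
  obtain ⟨j, m, e, -⟩ := exists_actX_affRoot y i n
  rw [rootAt, e]
  exact lin_affRoot_ne_zero j m

variable (k) in
/-- The element `(γ - c) / 2`, which vanishes at `y` and takes the value `γ = y α_n` at `y s`. -/
def lowElt (i : ι) (n : ℤ) (y : AffW P) : StructK P k :=
  (2 : k)⁻¹ • (const P k (rootAt k i n y) - rightK P k (affRoot P i n))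

theorem ev_lowElt (i : ι) (n : ℤ) (y : AffW P) : ev P k y (lowElt k i n y) = 0 := by
  rw [lowElt, map_smul, map_sub, ev_const, ev_rightK, rootAt, sub_self, smul_zero]

theorem ev_lowElt_mul (i : ι) (n : ℤ) (y : AffW P) :
    ev P k (y * refl P i n) (lowElt k i n y) = rootAt k i n y := by
  have := rootAt_mul (k := k) i n y
  rw [rootAt] at this
  rw [lowElt, map_smul, map_sub, ev_const, ev_rightK, this, sub_neg_eq_add, ← two_smul k,
    smul_smul, inv_mul_cancel₀ (two_ne_zero_field k), one_smul]

theorem lowElt_mem (i : ι) (n : ℤ) (y : AffW P) : lowElt k i n y ∈ degK P k 2 :=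
  Submodule.smul_mem _ _ (sub_mem (const_mem (lin_mem_symDeg _ _ _)) (rightK_mem P k _))

theorem lowElt_sub_lowElt (i : ι) (n : ℤ) (y : AffW P) :
    lowElt k i n y - lowElt k i n (y * refl P i n) = const P k (rootAt k i n y) := by
  rw [lowElt, lowElt, ← smul_sub, rootAt_mul, map_neg, sub_sub_sub_cancel_right, sub_neg_eq_add,
    ← two_smul k, smul_smul, inv_mul_cancel₀ (two_ne_zero_field k), one_smul]

variable {i : ι} {n : ℤ}

theorem IsStalkFiltration.lowElt_smul_mem (h : IsStalkFiltration b M K w) (y : AffW P) (m : M) :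
    lowElt k i n y • m ∈ K y := h.ev_smul y _ m (ev_lowElt i n y)

theorem IsStalkFiltration.lowElt_smul_sub_mem (h : IsStalkFiltration b M K w) (y : AffW P) (m : M) :
    lowElt k i n y • m - rootAt k i n y • m ∈ K (y * refl P i n) := by
  have := h.sub_ev_smul_mem (y * refl P i n) (lowElt k i n y) m
  rwa [ev_lowElt_mul] at this

theorem IsStalkFiltration.edge_mul (h : IsStalkFiltration b M K w) {y : AffW P}
    (hy : length b y < length b (y * refl P i n)) {m : M} (hm : m ∈ K y) :
    ∃ m', m - rootAt k i n y • m' ∈ K (y * refl P i n) := by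
  obtain ⟨j, l, e, e'⟩ := exists_actX_affRoot y i n
  rw [rootAt, e, ← e']
  rw [← e'] at hy
  exact h.edge y j l hy m hm

/-- The quotient by `K y ⊓ K (y s)` is an extension of the stalk at `y` by a copy of the stalk at `y
s`, embedded through `lowElt`, so regularity passes to it. The equation is solved at `y` first. The
remaining defect vanishes at `y`, hence is divisible by `γ = y(α_s)` at `y s`; after cancelling `γ`
it is solved there, and `lowElt` brings in the correction without disturbing `y`. -/
theorem IsStalkFiltration.regular_pair_of_lt (h : IsStalkFiltration b M K w) {y : AffW P}
    (hy : length b y < length b (y * refl P i n)) {f g : Sym k (AffX P)} {m : M} (hf : f ≠ 0)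
    (hfg : ∀ h, f ∣ g * h → f ∣ h) (hm : ∃ m', g • m - f • m' ∈ K y ⊓ K (y * refl P i n)) :
    ∃ m', m - f • m' ∈ K y ⊓ K (y * refl P i n) := by
  obtain ⟨m', h1, h2⟩ := hm
  obtain ⟨m₁, hm₁⟩ := h.regular y f g m hf hfg ⟨m', h1⟩
  have h3 : m' - g • m₁ ∈ K y := by
    refine h.torsionfree y f _ hf ?_
    have e : f • (m' - g • m₁) = g • (m - f • m₁) - (g • m - f • m') := by module
    rw [e]
    exact sub_mem ((K y).smul_mem _ hm₁) h1
  obtain ⟨a, ha⟩ := h.edge_mul hy hm₁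
  obtain ⟨c, hc⟩ := h.edge_mul hy h3
  have h4 : g • a - f • c ∈ K (y * refl P i n) := by
    refine h.torsionfree _ (rootAt k i n y) _ (rootAt_ne_zero i n y) ?_
    have e : rootAt k i n y • (g • a - f • c) = (g • m - f • m') -
        g • (m - f • m₁ - rootAt k i n y • a) + f • (m' - g • m₁ - rootAt k i n y • c) := by module
    rw [e]
    exact add_mem (sub_mem h2 (Submodule.smul_mem _ _ ha)) (Submodule.smul_mem _ _ hc)
  obtain ⟨a', ha'⟩ := h.regular _ f g a hf hfg ⟨c, h4⟩
  have hq := h.lowElt_smul_mem (i := i) (n := n) y a'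
  have hq' := h.lowElt_smul_sub_mem (i := i) (n := n) y a'
  generalize lowElt k i n y • a' = q at hq hq'
  refine ⟨m₁ + q, ?_, ?_⟩
  · have e : m - f • (m₁ + q) = (m - f • m₁) - f • q := by module
    rw [e]
    exact sub_mem hm₁ (Submodule.smul_mem _ _ hq)
  · have e : m - f • (m₁ + q) = (m - f • m₁ - rootAt k i n y • a) +
        rootAt k i n y • (a - f • a') - f • (q - rootAt k i n y • a') := by module
    rw [e]
    exact sub_mem (add_mem ha (Submodule.smul_mem _ _ ha')) (Submodule.smul_mem _ _ hq')

theorem mul_refl_mul_refl (y : AffW P) : y * refl P i n * refl P i n = y := by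
  rw [mul_assoc, refl_mul_self, mul_one]

variable [P.IsIrreducible]

theorem length_mul_refl_cases (hs : refl P i n ∈ simpleRefl b) (y : AffW P) :
    length b y < length b (y * refl P i n) ∨
      length b (y * refl P i n) < length b (y * refl P i n * refl P i n) := by
  rw [mul_refl_mul_refl]
  rcases length_mul_simple hs y with h | h <;> omega

theorem IsStalkFiltration.regular_pair (h : IsStalkFiltration b M K w)
    (hs : refl P i n ∈ simpleRefl b) (y : AffW P) {f g : Sym k (AffX P)} {m : M} (hf : f ≠ 0)
    (hfg : ∀ h, f ∣ g * h → f ∣ h) (hm : ∃ m', g • m - f • m' ∈ K y ⊓ K (y * refl P i n)) :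
    ∃ m', m - f • m' ∈ K y ⊓ K (y * refl P i n) := by
  rcases length_mul_refl_cases hs y with hy | hy
  · exact h.regular_pair_of_lt hy hf hfg hm
  · rw [inf_comm] at hm ⊢
    have := h.regular_pair_of_lt (m := m) hy hf hfg
    rw [mul_refl_mul_refl] at this
    exact this hm

theorem IsStalkFiltration.support_mul (h : IsStalkFiltration b M K w)
    (hs : refl P i n ∈ simpleRefl b) (hw : length b w < length b (w * refl P i n)) {x : AffW P}
    (hx : ¬ BruhatLE b x (w * refl P i n)) : K x ⊓ K (x * refl P i n) = ⊤ := by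
  have h1 : ¬ BruhatLE b x w := fun h1 => hx (h1.trans (bruhatLE_mul_simple hs hw))
  have h2 : ¬ BruhatLE b (x * refl P i n) w := fun h2 => hx (by
    have := h2.mul_simple hs hw
    rwa [mul_refl_mul_refl] at this)
  rw [h.support x h1, h.support _ h2, inf_top_eq]

/-- The two linear forms are, up to sign, the labels of two distinct edges at `s_{j,l} y`, leading
to `y` and to `s_{j,l} y s`. Both ends are at most `w s`, so the GKM condition applies. -/
theorem lin_dvd_of_dvd_rootAt_mul
    (hk : ringChar k = 0 ∨ coxeterNumber b ≤ ringChar k)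
    (hA2 : ¬ (IsTypeA2 b ∧ ringChar k = 3))
    (hs : refl P i n ∈ simpleRefl b)
    (hw : length b w < length b (w * refl P i n)) (hc : w * refl P i n ∈ circ b)
    {y : AffW P} {j : ι} {l : ℤ} (hy : length b y < length b (refl P j l * y))
    (hne : refl P j l * y ≠ y * refl P i n) (hle : BruhatLE b (refl P j l * y) (w * refl P i n))
    {f : Sym k (AffX P)} (hf : lin k (affRoot P j l) ∣ rootAt k i n (refl P j l * y) * f) :
    lin k (affRoot P j l) ∣ f := by
  obtain ⟨j', l', e, e'⟩ := exists_actX_affRoot (refl P j l * y) i n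
  rw [rootAt, e] at hf
  have h1 : refl P j l * (refl P j l * y) = y := by rw [← mul_assoc, refl_mul_self, one_mul]
  refine lin_affRoot_dvd_of_mem_circ hk hA2 (x := refl P j l * y) ?_ ?_ ?_ hf
  · rw [h1]
    exact mem_circ_of_le ((bruhatLE_refl_mul hy).trans hle) hc
  · rw [e']
    exact mem_circ_of_le (hle.mul_simple_le hs (by rwa [mul_refl_mul_refl])) hc
  · intro h0
    rw [← h0, h1] at e'
    exact hne ((mul_refl_mul_refl (i := i) (n := n) _).symm.trans
      (congrArg (· * refl P i n) e'.symm))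

/-- At `x = s_{j,l} y` and at `x s` separately the element is divisible by the label. After
multiplication by `γ = x(α_s)`, the difference of the elements `lowElt` for `x` and for `x s`, the
two quotients can be glued. Finally `γ` is cancelled, being coprime to the label. -/
theorem IsStalkFiltration.edge_pair (h : IsStalkFiltration b M K w)
    (hk : ringChar k = 0 ∨ coxeterNumber b ≤ ringChar k)
    (hA2 : ¬ (IsTypeA2 b ∧ ringChar k = 3))
    (hs : refl P i n ∈ simpleRefl b)
    (hw : length b w < length b (w * refl P i n)) (hc : w * refl P i n ∈ circ b)
    {y : AffW P} {j : ι} {l : ℤ} (hy : length b y < length b (refl P j l * y))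
    (hne : refl P j l * y ≠ y * refl P i n) {m : M} (hm : m ∈ K y ⊓ K (y * refl P i n)) :
    ∃ m', m - lin k (affRoot P j l) • m' ∈
      K (refl P j l * y) ⊓ K (refl P j l * y * refl P i n) := by
  by_cases hle : BruhatLE b (refl P j l * y) (w * refl P i n)
  swap
  · rw [h.support_mul hs hw hle]
    exact ⟨0, Submodule.mem_top⟩
  have hy' := length_lt_refl_mul_mul hs hy hne
  obtain ⟨m₁, h1⟩ := h.edge y j l hy m hm.1
  obtain ⟨m₂, h2⟩ := h.edge _ j l hy' m hm.2
  rw [← mul_assoc] at h2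
  refine h.regular_pair hs (refl P j l * y) (lin_affRoot_ne_zero j l)
    (fun f hf => lin_dvd_of_dvd_rootAt_mul hk hA2 hs hw hc hy hne hle hf) ?_
  set x := refl P j l * y
  have h3 : rootAt k i n x • m = lowElt k i n x • m - lowElt k i n (x * refl P i n) • m := by
    rw [← const_smul, ← lowElt_sub_lowElt, sub_smul]
  refine ⟨lowElt k i n x • m₂ - lowElt k i n (x * refl P i n) • m₁, ?_⟩
  have e : rootAt k i n x • m - lin k (affRoot P j l) •
      (lowElt k i n x • m₂ - lowElt k i n (x * refl P i n) • m₁) =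
      lowElt k i n x • (m - lin k (affRoot P j l) • m₂) -
        lowElt k i n (x * refl P i n) • (m - lin k (affRoot P j l) • m₁) := by
    rw [h3]
    simp only [smul_sub, smul_smul_comm]
    abel
  rw [e]
  have hx : ∀ m : M, lowElt k i n (x * refl P i n) • m ∈ K (x * refl P i n) := h.lowElt_smul_mem _
  exact ⟨sub_mem (h.lowElt_smul_mem x _) (h.smul_mem _ h1),
    sub_mem (h.smul_mem _ h2) (hx _)⟩

theorem not_bruhatLE_mul (hs : refl P i n ∈ simpleRefl b) {u x : AffW P}
    (hu : length b (u * refl P i n) < length b u) (hx : ¬ BruhatLE b x u) :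
    ¬ BruhatLE b (x * refl P i n) u := fun h => hx (by
  have := h.mul_simple_le hs hu
  rwa [mul_refl_mul_refl] at this)

theorem not_bruhatLE_of_length_lt {x y : AffW P} (h : length b x < length b y) :
    ¬ BruhatLE b y x := fun h' => by
  have := h'.length_le
  omega

/-- Extend at the larger vertex `u` first, then correct at `u s`. The first extension vanishes
outside `{≤ u}`, a set stable under right multiplication by `s`, so the conditions at `u s` are not
spoiled. The edge from `u s` to `u` is harmless because the remainder vanishes at `u`. -/
theorem IsStalkFiltration.extend_pair (h : IsStalkFiltration b M K w)
    (hs : refl P i n ∈ simpleRefl b) {u : AffW P} (hu : length b (u * refl P i n) < length b u)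
    {m : M} (hm : ∀ j l, length b u < length b (refl P j l * u) →
      (∃ m', m - lin k (affRoot P j l) • m' ∈ K (refl P j l * u)) ∧
      ∃ m', m - lin k (affRoot P j l) • m' ∈ K (refl P j l * u * refl P i n)) :
    ∃ m', m - m' ∈ K u ⊓ K (u * refl P i n) ∧ ∀ x, ¬ BruhatLE b x u → m' ∈ K x := by
  obtain ⟨e₁, h1, h1'⟩ := h.extend u m fun j l hjl => (hm j l hjl).1
  obtain ⟨e₂, h2, h2'⟩ := h.extend (u * refl P i n) (m - e₁) fun j l hjl => by
    by_cases hne : refl P j l * (u * refl P i n) = u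
    · exact ⟨0, by rwa [hne, smul_zero, sub_zero]⟩
    · have hlt := length_lt_refl_mul_mul hs hjl (by rwa [mul_refl_mul_refl])
      rw [mul_refl_mul_refl] at hlt
      obtain ⟨m', hm'⟩ := (hm j l hlt).2
      refine ⟨m', ?_⟩
      rw [← mul_assoc, sub_right_comm]
      exact sub_mem hm' (h1' _ (not_bruhatLE_mul hs hu (not_bruhatLE_of_length_lt hlt)))
  have hus : BruhatLE b (u * refl P i n) u := by
    have := bruhatLE_mul_simple hs (x := u * refl P i n) (by rwa [mul_refl_mul_refl])
    rwa [mul_refl_mul_refl] at this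
  refine ⟨e₁ + e₂, ⟨?_, ?_⟩, fun x hx => add_mem (h1' x hx) (h2' x fun hx' => hx (hx'.trans hus))⟩
  · rw [← sub_sub]
    exact sub_mem h1 (h2' u (not_bruhatLE_of_length_lt hu))
  · rwa [← sub_sub]

end Filtration
end AffineMomentGraph

/-! ## Stalks of translated modules -/

namespace AffineMomentGraph

section ThetaStep

variable {ι V N : Type u} [AddCommGroup V] [Module ℚ V] [AddCommGroup N] [Module ℚ N]
variable {P : RootPairing ι ℚ V N} [P.IsCrystallographic] {b : P.Base}
variable {k : Type u} [Field k] [Algebra ZHalf k]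
variable [Finite ι] [P.IsRootSystem] [P.IsReduced]
variable {M : GradedMod (degK P k)} {K : AffW P → Submodule (Sym k (AffX P)) M} {w : AffW P}
variable {i : ι} {n : ℤ}

variable (M i n) in
/-- The value `a + γ b` of `1 ⊗ a + c ⊗ b` at `y`. -/
def thetaVal (y : AffW P) : theta P k (refl P i n) M →ₗ[Sym k (AffX P)] M where
  toFun t := thetaFst t + rootAt k i n y • thetaSnd t
  map_add' t t' := by rw [map_add, map_add, smul_add]; abel
  map_smul' f t := by
    rw [thetaFst_sym_smul, thetaSnd_sym_smul, RingHom.id_apply, smul_add, smul_comm f]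

theorem thetaVal_apply (y : AffW P) (t : theta P k (refl P i n) M) :
    thetaVal M i n y t = thetaFst t + rootAt k i n y • thetaSnd t := rfl

theorem thetaVal_pair (y : AffW P) (a c : M) :
    thetaVal M i n y (pair i n a c) = a + rootAt k i n y • c := by
  rw [thetaVal_apply, thetaFst_pair, thetaSnd_pair]

theorem thetaVal_mem {y : AffW P} {d : ℤ} {t : theta P k (refl P i n) M}
    (ht : t ∈ (theta P k (refl P i n) M).deg d) : thetaVal M i n y t ∈ M.deg d := by
  have h1 := M.restr.smul_mem (lin_mem_symDeg k (AffX P) (actX y (affRoot P i n))) (thetaSnd_mem ht)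
  rw [add_sub_cancel] at h1
  exact add_mem (thetaFst_mem ht) h1

theorem thetaVal_proj (y : AffW P) (d : ℤ) (t : theta P k (refl P i n) M) :
    thetaVal M i n y ((theta P k (refl P i n) M).proj d t) = M.proj d (thetaVal M i n y t) := by
  have h1 := M.restr.proj_smul (lin_mem_symDeg k (AffX P) (actX y (affRoot P i n))) d (thetaSnd t)
  rw [thetaVal_apply, thetaVal_apply, thetaFst_proj, thetaSnd_proj, map_add]
  exact congrArg _ h1.symm

/-- The filtration of the translated module. -/
def thetaFilt (K : AffW P → Submodule (Sym k (AffX P)) M) (i : ι) (n : ℤ) (y : AffW P) :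
    Submodule (Sym k (AffX P)) (theta P k (refl P i n) M) :=
  (K y ⊓ K (y * refl P i n)).comap (thetaVal M i n y)

theorem mem_thetaFilt {y : AffW P} {t : theta P k (refl P i n) M} :
    t ∈ thetaFilt K i n y ↔ thetaVal M i n y t ∈ K y ⊓ K (y * refl P i n) := Iff.rfl

theorem ev_mul_of_mem_invK {s : AffW P} {y : StructK P k} (hy : y ∈ invK P k s) (x : AffW P) :
    ev P k (x * s) y = ev P k x y := by
  refine invK_tmul_induction P k (p := fun y => ev P k (x * s) y = ev P k x y) (fun c y hy => ?_)
    (fun x y hx hy => by rw [map_add, map_add, hx, hy]) hy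
  rw [ev_tmul, ev_tmul, hy x]

/-- Replacing the outer `c` by a scalar `g` is compatible with the product of `e + c d` and `x + c
y` up to a multiple of `c² - g²`. -/
theorem pair_smul_aux {A X : Type*} [CommRing A] [AddCommGroup X] [Module A X] (e d g c : A)
    (x y : X) : e • x + (c ^ 2 * d) • y + g • (d • x + e • y) =
      (e + g * d) • (x + g • y) + ((c ^ 2 - g ^ 2) * d) • y := by
  module

/-- At `y` and `y s` the element `c` takes the values `γ` and `-γ`, so `c² - γ²` acts by zero at
both vertices. The other coefficient in `pair_smul_aux` is constant on the pair, with value the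
coordinate of `z` at `y`. -/
theorem IsStalkFiltration.theta_ev_smul (h : IsStalkFiltration b M K w) (y : AffW P)
    (z : StructK P k) (t : theta P k (refl P i n) M) (hz : ev P k y z = 0) :
    z • t ∈ thetaFilt K i n y := by
  have e : thetaVal M i n y (z • t) =
      (averageK P k i n z + const P k (rootAt k i n y) * divDiffK P k i n z) •
        thetaVal M i n y t +
      ((rightK P k (affRoot P i n) ^ 2 - const P k (rootAt k i n y) ^ 2) *
        divDiffK P k i n z) • thetaSnd t := by
    rw [thetaVal_apply, thetaVal_apply, thetaFst_smul, thetaSnd_smul, ← const_smul, ← const_smul]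
    exact pair_smul_aux _ _ _ _ _ _
  have hc : ev P k y (rightK P k (affRoot P i n)) = rootAt k i n y := ev_rightK P k y _
  have hc' : ev P k (y * refl P i n) (rightK P k (affRoot P i n)) = - rootAt k i n y := by
    rw [ev_rightK, ← rootAt, rootAt_mul]
  have h0 : ev P k y (averageK P k i n z) + rootAt k i n y * ev P k y (divDiffK P k i n z) = 0 := by
    have := congrArg (ev P k y) (averageK_add_mul_divDiffK P k (i := i) (n := n) z)
    rwa [map_add, map_mul, hc, hz] at this
  rw [mem_thetaFilt, e]
  refine add_mem ⟨h.ev_smul _ _ _ ?_, h.ev_smul _ _ _ ?_⟩ ⟨h.ev_smul _ _ _ ?_, h.ev_smul _ _ _ ?_⟩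
  · rw [map_add, map_mul, ev_const, h0]
  · rw [map_add, map_mul, ev_const, ev_mul_of_mem_invK (averageK_mem P k z),
      ev_mul_of_mem_invK (divDiffK_mem P k z), h0]
  · rw [map_mul, map_sub, map_pow, map_pow, ev_const, hc, sub_self, zero_mul]
  · rw [map_mul, map_sub, map_pow, map_pow, ev_const, hc', neg_sq, sub_self, zero_mul]

theorem IsStalkFiltration.isHomog_inf (h : IsStalkFiltration b M K w) (x y : AffW P) :
    M.restr.IsHomog (K x ⊓ K y) := fun d m hm => ⟨h.homog x d m hm.1, h.homog y d m hm.2⟩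

theorem IsStalkFiltration.theta_homog (h : IsStalkFiltration b M K w) (y : AffW P) :
    (theta P k (refl P i n) M).restr.IsHomog (thetaFilt K i n y) := fun d t ht => by
  have e : (theta P k (refl P i n) M).restr.proj d t = (theta P k (refl P i n) M).proj d t := rfl
  rw [e, mem_thetaFilt, thetaVal_proj]
  exact h.isHomog_inf _ _ d _ ht

/-- Multiplication by `lowElt`, of degree `2`, embeds the shifted stalk at `y s` as the part of the
quotient that vanishes at `y`; the edge condition shows that this is all of it. The quotient is thus
an extension of two graded projective modules. -/
theorem IsStalkFiltration.inf_projective_of_lt (h : IsStalkFiltration b M K w) {y : AffW P}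
    (hy : length b y < length b (y * refl P i n)) :
    (M.restr.quot _ (h.isHomog_inf y (y * refl P i n))).IsGradedProjective := by
  let L := M.restr.quot _ (h.isHomog_inf y (y * refl P i n))
  let q : M.restr →ₗ[Sym k (AffX P)] L := M.restr.quotMk _ (h.isHomog_inf y (y * refl P i n))
  let lw : M.restr →ₗ[Sym k (AffX P)] M.restr :=
    { toFun := fun m => (lowElt k i n y • (m : M) : M)
      map_add' := fun m m' => smul_add _ _ _
      map_smul' := fun f m => smul_smul_comm f (lowElt k i n y) (m : M) }
  have hlw : ∀ m : M, lw m = lowElt k i n y • m := fun _ => rfl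
  have hq : ∀ m : M, q m = 0 ↔ m ∈ K y ⊓ K (y * refl P i n) := fun m =>
    GradedMod.quotMk_eq_zero (h.isHomog_inf y (y * refl P i n))
  have hγ : ∀ m : M, lw m ∈ K (y * refl P i n) ↔ m ∈ K (y * refl P i n) := fun m => by
    have h1 := h.lowElt_smul_sub_mem (i := i) (n := n) y m
    rw [hlw]
    constructor
    · intro h2
      have h3 := sub_mem h2 h1
      rw [sub_sub_cancel] at h3
      exact h.torsionfree _ _ _ (rootAt_ne_zero i n y) h3
    · exact fun h2 => h.smul_mem _ h2
  have hj0 : ∀ m ∈ K (y * refl P i n), (q ∘ₗ lw) m = 0 := fun m hm =>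
    (hq _).2 ⟨h.lowElt_smul_mem y m, (hγ m).2 hm⟩
  let j : (M.restr.quot _ (h.homog (y * refl P i n))).shift (-2) →ₗ[Sym k (AffX P)] L :=
    GradedMod.quotLift (h.homog (y * refl P i n)) (q ∘ₗ lw) hj0
  let π : L →ₗ[Sym k (AffX P)] M.restr.quot _ (h.homog y) :=
    GradedMod.quotLift _ (M.restr.quotMk _ (h.homog y)) fun m hm =>
      (GradedMod.quotMk_eq_zero (h.homog y)).2 hm.1
  have hjm : ∀ m : M, j (M.restr.quotMk _ (h.homog (y * refl P i n)) m) = q (lw m) := fun _ => rfl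
  have hπm : ∀ m : M, π (q m) = M.restr.quotMk _ (h.homog y) m := fun _ => rfl
  refine GradedMod.isGradedProjective_of_exact (j := j) (π := π)
    ((h.projective (y * refl P i n)).shift (-2)) (h.projective y) ?_ ?_ ?_ ?_ ?_
  · rintro d _ ⟨m, hm, rfl⟩
    refine ⟨lw m, ?_, rfl⟩
    have := M.smul_mem (lowElt_mem i n y) (show (m : M) ∈ M.deg (d + -2) from hm)
    rw [add_comm d, add_neg_cancel_left] at this
    exact this
  · exact GradedMod.quotLift_graded _ (GradedMod.quotMk_graded _) _
  · rw [injective_iff_map_eq_zero]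
    intro a ha
    obtain ⟨m, rfl⟩ := GradedMod.quotMk_surjective (h.homog (y * refl P i n)) a
    have h1 := ((hq _).1 ha).2
    exact (GradedMod.quotMk_eq_zero (h.homog (y * refl P i n))).2 ((hγ m).1 h1)
  · intro a
    obtain ⟨m, rfl⟩ := GradedMod.quotMk_surjective (h.homog y) a
    exact ⟨q m, hπm m⟩
  · intro a
    obtain ⟨m, rfl⟩ := GradedMod.quotMk_surjective (h.isHomog_inf y (y * refl P i n)) a
    constructor
    · intro ha
      have hm : m ∈ K y := (GradedMod.quotMk_eq_zero (h.homog y)).1 ha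
      obtain ⟨m', hm'⟩ := h.edge_mul hy hm
      refine ⟨M.restr.quotMk _ (h.homog (y * refl P i n)) m', ?_⟩
      have h1 : q (lw m' - m) = 0 := by
        rw [hq]
        refine ⟨sub_mem (h.lowElt_smul_mem y m') hm, ?_⟩
        have h2 := sub_mem (h.lowElt_smul_sub_mem (i := i) (n := n) y m') hm'
        rwa [sub_sub_sub_cancel_right] at h2
      rw [map_sub, sub_eq_zero] at h1
      exact h1
    · rintro ⟨x, hx⟩
      obtain ⟨m', rfl⟩ := GradedMod.quotMk_surjective (h.homog (y * refl P i n)) x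
      rw [← hx]
      exact (GradedMod.quotMk_eq_zero (h.homog y)).2 (h.lowElt_smul_mem y m')

theorem quot_isGradedProjective_congr {A : Type u} [CommRing A] [Algebra k A]
    {𝒜 : ℤ → Submodule k A} {M : GradedMod 𝒜} {K K' : Submodule A M} (e : K = K')
    (hK : M.IsHomog K) (hK' : M.IsHomog K') (h : (M.quot K hK).IsGradedProjective) :
    (M.quot K' hK').IsGradedProjective := by
  subst e
  exact h

variable [P.IsIrreducible]

theorem IsStalkFiltration.inf_projective (h : IsStalkFiltration b M K w)
    (hs : refl P i n ∈ simpleRefl b) (y : AffW P) :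
    (M.restr.quot _ (h.isHomog_inf y (y * refl P i n))).IsGradedProjective := by
  rcases length_mul_refl_cases hs y with hy | hy
  · exact h.inf_projective_of_lt hy
  · refine quot_isGradedProjective_congr ?_ _ _ (h.inf_projective_of_lt hy)
    rw [mul_refl_mul_refl, inf_comm]

/-- The value map at `y` identifies the new stalk with `M` modulo `K y ⊓ K (y s)`; it is onto
already on `1 ⊗ M`. -/
theorem IsStalkFiltration.theta_projective (h : IsStalkFiltration b M K w)
    (hs : refl P i n ∈ simpleRefl b) (y : AffW P) :
    ((theta P k (refl P i n) M).restr.quot _ (h.theta_homog (i := i) (n := n) y)).IsGradedProjective := by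
  let q : M.restr →ₗ[Sym k (AffX P)] M.restr.quot _ (h.isHomog_inf y (y * refl P i n)) :=
    M.restr.quotMk _ (h.isHomog_inf y (y * refl P i n))
  have hq : ∀ m : M, q m = 0 ↔ m ∈ K y ⊓ K (y * refl P i n) := fun m =>
    GradedMod.quotMk_eq_zero (h.isHomog_inf y (y * refl P i n))
  let φ : (theta P k (refl P i n) M).restr →ₗ[Sym k (AffX P)] M.restr := thetaVal M i n y
  have hφ : GradedMod.IsGradedHom φ := fun d t ht => thetaVal_mem ht
  have h0 : ∀ t ∈ thetaFilt K i n y, (q ∘ₗ φ) t = 0 := fun t ht => (hq _).2 ht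
  refine GradedMod.Iso.isGradedProjective (GradedMod.iso_of_bijective
    (f := GradedMod.quotLift (h.theta_homog (i := i) (n := n) y) (q ∘ₗ φ) h0)
    (GradedMod.quotLift_graded _ ((GradedMod.quotMk_graded _).comp hφ) _) ⟨?_, ?_⟩)
    (h.inf_projective hs y)
  · rw [injective_iff_map_eq_zero]
    intro a ha
    obtain ⟨t, rfl⟩ := GradedMod.quotMk_surjective (h.theta_homog (i := i) (n := n) y) a
    exact (GradedMod.quotMk_eq_zero (h.theta_homog (i := i) (n := n) y)).2 ((hq _).1 ha)
  · intro a
    obtain ⟨m, rfl⟩ := GradedMod.quotMk_surjective (h.isHomog_inf y (y * refl P i n)) a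
    refine ⟨(theta P k (refl P i n) M).restr.quotMk _ (h.theta_homog (i := i) (n := n) y)
      (pair i n m 0), ?_⟩
    change q (thetaVal M i n y (pair i n m 0)) = q m
    rw [thetaVal_pair, smul_zero, add_zero]

end ThetaStep
end AffineMomentGraph

/-! ## Extension of sections of translated modules -/

namespace AffineMomentGraph

section ThetaExtend

variable {ι V N : Type u} [AddCommGroup V] [Module ℚ V] [AddCommGroup N] [Module ℚ N]
variable {P : RootPairing ι ℚ V N} [P.IsCrystallographic] {b : P.Base}
variable {k : Type u} [Field k] [Algebra ZHalf k]
variable [Finite ι] [P.IsRootSystem] [P.IsReduced]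
variable {M : GradedMod (degK P k)} {K : AffW P → Submodule (Sym k (AffX P)) M} {w : AffW P}
variable {i : ι} {n : ℤ}

/-- Only the coefficient `y(α_s)` depends on the vertex, and a reflection changes it by a multiple
of the label. -/
theorem exists_thetaVal_sub (y : AffW P) (j : ι) (l : ℤ) (t : theta P k (refl P i n) M) :
    ∃ m : M, thetaVal M i n y t - thetaVal M i n (refl P j l * y) t = lin k (affRoot P j l) • m := by
  refine ⟨corootX P j (actX y (affRoot P i n)) • thetaSnd t, ?_⟩
  rw [thetaVal_apply, thetaVal_apply, rootAt_refl_mul, sub_smul, smul_assoc,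
    smul_comm (corootX P j _) (lin k _)]
  abel

theorem sub_smul_pair_mem (y : AffW P) {f : Sym k (AffX P)} {t : theta P k (refl P i n) M} {m : M} :
    t - f • pair i n m 0 ∈ thetaFilt K i n y ↔
      thetaVal M i n y t - f • m ∈ K y ⊓ K (y * refl P i n) := by
  rw [mem_thetaFilt, map_sub, map_smul, thetaVal_pair, smul_zero, add_zero]

theorem exists_sub_smul_mem_iff (y : AffW P) {f g : Sym k (AffX P)}
    {t : theta P k (refl P i n) M} :
    (∃ t', g • t - f • t' ∈ thetaFilt K i n y) ↔
      ∃ m, g • thetaVal M i n y t - f • m ∈ K y ⊓ K (y * refl P i n) := by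
  constructor
  · rintro ⟨t', ht'⟩
    refine ⟨thetaVal M i n y t', ?_⟩
    rwa [← map_smul, ← map_smul, ← map_sub]
  · rintro ⟨m, hm⟩
    refine ⟨pair i n m 0, ?_⟩
    rw [sub_smul_pair_mem, map_smul]
    exact hm

theorem exists_sub_smul_mem_iff' (y : AffW P) {f : Sym k (AffX P)}
    {t : theta P k (refl P i n) M} :
    (∃ t', t - f • t' ∈ thetaFilt K i n y) ↔
      ∃ m, thetaVal M i n y t - f • m ∈ K y ⊓ K (y * refl P i n) := by
  simpa only [one_smul] using exists_sub_smul_mem_iff (K := K) y (f := f) (g := 1) (t := t)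

variable [P.IsIrreducible]

/-- On the edge from `y` to `y s` both filtrations come from the same submodule `K y ⊓ K (y s)`, and
the two values differ by a multiple of the label. On all other edges `edge_pair` applies. -/
theorem IsStalkFiltration.theta_edge (h : IsStalkFiltration b M K w)
    (hk : ringChar k = 0 ∨ coxeterNumber b ≤ ringChar k)
    (hA2 : ¬ (IsTypeA2 b ∧ ringChar k = 3))
    (hs : refl P i n ∈ simpleRefl b)
    (hw : length b w < length b (w * refl P i n)) (hc : w * refl P i n ∈ circ b)
    {y : AffW P} {j : ι} {l : ℤ} (hy : length b y < length b (refl P j l * y))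
    {t : theta P k (refl P i n) M} (ht : t ∈ thetaFilt K i n y) :
    ∃ t', t - lin k (affRoot P j l) • t' ∈ thetaFilt K i n (refl P j l * y) := by
  rw [exists_sub_smul_mem_iff']
  obtain ⟨m, hm⟩ := exists_thetaVal_sub y j l t
  by_cases hne : refl P j l * y = y * refl P i n
  · refine ⟨-m, ?_⟩
    rw [smul_neg, sub_neg_eq_add, ← hm, add_sub_cancel, hne, mul_refl_mul_refl, inf_comm]
    exact ht
  · obtain ⟨m', hm'⟩ := h.edge_pair hk hA2 hs hw hc hy hne ht
    refine ⟨m' - m, ?_⟩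
    rw [smul_sub, ← hm]
    convert hm' using 1
    abel

/-- Here `{≤ y}` is stable under right multiplication by `s`. So the value at `y` can be extended
within `M` by `extend_pair`, and `1 ⊗ e` is the required element. -/
theorem IsStalkFiltration.theta_extend_of_gt (h : IsStalkFiltration b M K w)
    (hs : refl P i n ∈ simpleRefl b) {y : AffW P}
    (hy : length b (y * refl P i n) < length b y) {t : theta P k (refl P i n) M}
    (ht : ∀ j l, length b y < length b (refl P j l * y) →
      ∃ t', t - lin k (affRoot P j l) • t' ∈ thetaFilt K i n (refl P j l * y)) :
    ∃ t', t - t' ∈ thetaFilt K i n y ∧ ∀ x, ¬ BruhatLE b x y → t' ∈ thetaFilt K i n x := by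
  obtain ⟨e, he, he'⟩ := h.extend_pair hs hy (m := thetaVal M i n y t) fun j l hjl => by
    obtain ⟨m, hm⟩ := (exists_sub_smul_mem_iff' _).1 (ht j l hjl)
    obtain ⟨m', hm'⟩ := exists_thetaVal_sub y j l t
    have e : thetaVal M i n y t - lin k (affRoot P j l) • (m + m') =
        thetaVal M i n (refl P j l * y) t - lin k (affRoot P j l) • m := by
      rw [smul_add, ← hm']
      abel
    rw [← e] at hm
    exact ⟨⟨_, hm.1⟩, ⟨_, hm.2⟩⟩
  refine ⟨pair i n e 0, ?_, fun x hx => ?_⟩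
  · rw [mem_thetaFilt, map_sub, thetaVal_pair, smul_zero, add_zero]
    exact he
  · rw [mem_thetaFilt, thetaVal_pair, smul_zero, add_zero]
    exact ⟨he' x hx, he' _ (not_bruhatLE_mul hs hy hx)⟩

/-- Elements that vanish outside of `{x ≤ y s}` can be modified so that they vanish outside of
`{x ≤ y}`, without changing them at `y`. -/
theorem IsStalkFiltration.theta_kill (h : IsStalkFiltration b M K w)
    (hs : refl P i n ∈ simpleRefl b) {y : AffW P}
    (hy : length b y < length b (y * refl P i n)) (C : Finset (AffW P))
    (hC : ∀ c ∈ C, BruhatLE b c (y * refl P i n) ∧ ¬ BruhatLE b c y ∧ c ≠ y * refl P i n)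
    (hC' : ∀ x, x ∉ C → ¬ BruhatLE b x y → ∀ c ∈ C, ¬ BruhatLE b x c)
    {t : theta P k (refl P i n) M}
    (ht : ∀ x, ¬ BruhatLE b x y → x ∉ C → t ∈ thetaFilt K i n x) :
    ∃ t', t - t' ∈ thetaFilt K i n y ∧ ∀ x, ¬ BruhatLE b x y → t' ∈ thetaFilt K i n x := by
  classical
  induction hn : C.card generalizing C t with
  | zero =>
    rw [Finset.card_eq_zero] at hn
    subst hn
    exact ⟨t, by rw [sub_self]; exact zero_mem _, fun x hx => ht x hx (by simp)⟩
  | succ r ih =>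
    -- At a longest element `c` of `C` the section already vanishes above `c`, so its germ there
    -- extends to a section supported on `{≤ c}`, which is subtracted.
    obtain ⟨c, hc, hmax⟩ := C.exists_max_image (length b)
      (Finset.card_pos.1 (by omega))
    obtain ⟨hc1, hc2, hc3⟩ := hC c hc
    -- If `c < c s`, then `c ≤ y s` would imply `c ≤ y` by the lifting property.
    have hcs : length b (c * refl P i n) < length b c := by
      rcases length_mul_simple hs c with h1 | h1
      · refine absurd (hc1.le_mul_simple hs (by omega) (by rwa [mul_refl_mul_refl])) ?_
        rwa [mul_refl_mul_refl]
      · omega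
    have hup : ∀ x, BruhatLE b c x → length b c < length b x → t ∈ thetaFilt K i n x := by
      intro x hx hlt
      refine ht x (fun h' => hc2 (hx.trans h')) fun hxC => ?_
      have := hmax x hxC
      omega
    obtain ⟨t₁, h1, h1'⟩ := h.theta_extend_of_gt hs hcs (t := t) fun j l hjl =>
      ⟨0, by rw [smul_zero, sub_zero]; exact hup _ (bruhatLE_refl_mul hjl) hjl⟩
    obtain ⟨t₂, h2, h2'⟩ := ih (C.erase c) (fun x hx => hC x (Finset.mem_of_mem_erase hx))
      (fun x hx hxy c' hc' hle => by
        by_cases hxc : x = c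
        · subst hxc
          rcases hle.eq_or_length_lt with h3 | h3
          · exact Finset.ne_of_mem_erase hc' h3.symm
          · have := hmax c' (Finset.mem_of_mem_erase hc')
            omega
        · exact hC' x (fun h3 => hx (Finset.mem_erase.2 ⟨hxc, h3⟩)) hxy c'
            (Finset.mem_of_mem_erase hc') hle)
      (t := t - t₁) (fun x hxy hx => by
        by_cases hxc : x = c
        · rwa [hxc]
        · have hxC : x ∉ C := fun h3 => hx (Finset.mem_erase.2 ⟨hxc, h3⟩)
          exact sub_mem (ht x hxy hxC) (h1' x (hC' x hxC hxy c hc)))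
      (by rw [Finset.card_erase_of_mem hc, hn]; rfl)
    refine ⟨t₂, ?_, h2'⟩
    -- The subtracted section must not change anything at `y`. Indeed `y ≤ c` would place the length
    -- of `c` strictly between those of `y` and `y s`, which differ by one.
    have hyc : ¬ BruhatLE b y c := fun hle => by
      rcases hle.eq_or_length_lt with h3 | h3
      · exact hc2 (h3 ▸ Relation.ReflTransGen.refl)
      · rcases hc1.eq_or_length_lt with h4 | h4
        · exact hc3 h4
        · rcases length_mul_simple hs y with h5 | h5 <;> omega
    have e : t - t₂ = (t - t₁ - t₂) + t₁ := by abel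
    rw [e]
    exact add_mem h2 (h1' y hyc)

/-- There are finitely many simple reflections, hence finitely many elements of bounded length. -/
theorem finite_bruhatLE (w : AffW P) : {x | BruhatLE b x w}.Finite := by
  have hfin : (simpleRefl b).Finite := by
    have : simpleRefl b ⊆ Set.range (fun i => refl P i 0) ∪ Set.range fun i => refl P i 1 := by
      rintro s (⟨i, -, rfl⟩ | ⟨i, -, rfl⟩)
      · exact Or.inl ⟨i, rfl⟩
      · exact Or.inr ⟨i, rfl⟩
    exact ((Set.finite_range _).union (Set.finite_range _)).subset this
  have hle : ∀ r, {x : AffW P | length b x ≤ r}.Finite := by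
    intro r
    induction r with
    | zero =>
      exact (Set.finite_singleton (1 : AffW P)).subset fun x hx =>
        eq_one_of_length_eq_zero (b := b) (Nat.le_zero.1 hx)
    | succ r ih =>
      refine (ih.union (Set.Finite.image2 (fun x s => s * x) ih hfin)).subset fun x hx => ?_
      obtain ⟨l, hl, rfl, hlen⟩ := exists_reduced_word b x
      change length b l.prod ≤ r + 1 at hx
      rcases l with _ | ⟨s, l⟩
      · left
        change length b (1 : AffW P) ≤ r
        rw [length_one]
        omega
      · right
        refine ⟨l.prod, ?_, s, hl s (by simp), by rw [List.prod_cons]⟩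
        have := length_prod_le (b := b) (l := l) fun s hs => hl s (by simp [hs])
        rw [List.length_cons] at hlen
        change length b l.prod ≤ r
        omega
  exact (hle (length b w)).subset fun x hx => BruhatLE.length_le hx

theorem IsStalkFiltration.theta_extend (h : IsStalkFiltration b M K w)
    (hk : ringChar k = 0 ∨ coxeterNumber b ≤ ringChar k)
    (hA2 : ¬ (IsTypeA2 b ∧ ringChar k = 3))
    (hs : refl P i n ∈ simpleRefl b)
    (hw : length b w < length b (w * refl P i n)) (hc : w * refl P i n ∈ circ b)
    {y : AffW P} {t : theta P k (refl P i n) M}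
    (ht : ∀ j l, length b y < length b (refl P j l * y) →
      ∃ t', t - lin k (affRoot P j l) • t' ∈ thetaFilt K i n (refl P j l * y)) :
    ∃ t', t - t' ∈ thetaFilt K i n y ∧ ∀ x, ¬ BruhatLE b x y → t' ∈ thetaFilt K i n x := by
  classical
  rcases length_mul_refl_cases hs y with hy | hy
  swap
  · exact h.theta_extend_of_gt hs (by rwa [mul_refl_mul_refl] at hy) ht
  obtain ⟨j₀, l₀, hj₀, hj₀'⟩ := exists_actX_affRoot y i n
  have hys : length b (y * refl P i n * refl P i n) < length b (y * refl P i n) := by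
    rwa [mul_refl_mul_refl]
  -- Vanishing on the edge from `y` to `y s` says that the value at `y` is divisible by `γ = y(α_s)`
  -- on the pair; `m` is the quotient.
  obtain ⟨m, hm⟩ : ∃ m, thetaVal M i n y t - rootAt k i n y • m ∈ K y ⊓ K (y * refl P i n) := by
    obtain ⟨m₁, h1⟩ := (exists_sub_smul_mem_iff' _).1 (ht j₀ l₀ (by rwa [hj₀']))
    obtain ⟨m₂, h2⟩ := exists_thetaVal_sub y j₀ l₀ t
    rw [hj₀', mul_refl_mul_refl, inf_comm] at h1
    rw [hj₀'] at h2
    refine ⟨m₁ + m₂, ?_⟩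
    rw [rootAt, hj₀, smul_add, ← h2]
    convert h1 using 1
    abel
  -- The quotient `m` again vanishes on the other edges going up from `y`: `γ m` agrees on the pair
  -- above with a multiple of the label, `γ` differs from the root at that pair by a multiple of the
  -- label, and that root is coprime to the label.
  have key : ∀ j l, length b y < length b (refl P j l * y) → refl P j l * y ≠ y * refl P i n →
      ∃ m', m - lin k (affRoot P j l) • m' ∈
        K (refl P j l * y) ⊓ K (refl P j l * y * refl P i n) := by
    intro j l hjl hne
    by_cases hle : BruhatLE b (refl P j l * y) (w * refl P i n)
    swap
    · rw [h.support_mul hs hw hle]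
      exact ⟨0, Submodule.mem_top⟩
    refine h.regular_pair hs (refl P j l * y) (lin_affRoot_ne_zero j l)
      (fun f hf => lin_dvd_of_dvd_rootAt_mul hk hA2 hs hw hc hjl hne hle hf) ?_
    obtain ⟨m₁, h1⟩ := (exists_sub_smul_mem_iff' _).1 (ht j l hjl)
    obtain ⟨m₂, h2⟩ := exists_thetaVal_sub y j l t
    obtain ⟨m₃, h3⟩ := h.edge_pair hk hA2 hs hw hc hjl hne hm
    refine ⟨m₁ + m₂ - m₃ - corootX P j (actX y (affRoot P i n)) • m, ?_⟩
    rw [rootAt_refl_mul, sub_smul, smul_sub, smul_sub, smul_add, ← h2, smul_assoc,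
      smul_comm (lin k _) (corootX P j _)]
    convert sub_mem h1 h3 using 1
    abel
  obtain ⟨m', hm1, hm2⟩ := h.extend_pair hs hys (m := m) fun j l hjl => by
    have hne : refl P j l * (y * refl P i n) ≠ y := fun h0 => by
      rw [h0] at hjl; omega
    have hlt := length_lt_refl_mul_mul hs hjl (by rwa [mul_refl_mul_refl])
    rw [mul_refl_mul_refl] at hlt
    obtain ⟨m', h1⟩ := key j l hlt fun h0 => by
      rw [← mul_assoc, h0, mul_refl_mul_refl] at hjl
      omega
    rw [← mul_assoc, mul_refl_mul_refl]
    exact ⟨⟨m', h1.2⟩, ⟨m', h1.1⟩⟩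
  rw [mul_refl_mul_refl, inf_comm] at hm1
  -- The element `(γ + c)/2` has value `γ` at `y` and `0` at `y s`. Multiplied with an extension
  -- `m'` of `m` it has the right value at `y`, and it vanishes at `y s` and outside `{≤ y s}`.
  let t₁ : theta P k (refl P i n) M :=
    pair i n ((2 : k)⁻¹ • rootAt k i n y • m') ((2 : k)⁻¹ • m')
  have hval : ∀ x, thetaVal M i n x t₁ =
      (2 : k)⁻¹ • (rootAt k i n y + rootAt k i n x) • m' := fun x => by
    rw [thetaVal_pair, smul_comm (rootAt k i n x), ← smul_add, ← add_smul]
  have ht₁ : t - t₁ ∈ thetaFilt K i n y := by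
    have e : (2 : k)⁻¹ • (rootAt k i n y + rootAt k i n y) = rootAt k i n y := by
      rw [← two_smul k, smul_smul, inv_mul_cancel₀ (two_ne_zero_field k), one_smul]
    have e' : thetaVal M i n y (t - t₁) =
        (thetaVal M i n y t - rootAt k i n y • m) + rootAt k i n y • (m - m') := by
      rw [map_sub, hval, ← smul_assoc, e, smul_sub]
      abel
    rw [mem_thetaFilt, e']
    exact add_mem hm (Submodule.smul_mem _ _ hm1)
  -- What remains is to remove the values at the vertices below `y s` that are neither `y s` nor
  -- below `y`.
  have hC : ({x | BruhatLE b x (y * refl P i n) ∧ ¬ BruhatLE b x y ∧ x ≠ y * refl P i n}).Finite :=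
    (finite_bruhatLE (b := b) (y * refl P i n)).subset fun x hx => hx.1
  obtain ⟨t₂, h2, h2'⟩ := h.theta_kill hs hy hC.toFinset (fun c hc => by simpa using hc)
    (fun x hx hxy c hc hle => by
      rw [Set.Finite.mem_toFinset] at hx hc
      refine hx ⟨hle.trans hc.1, hxy, fun h0 => hc.2.2 ?_⟩
      rw [h0] at hle
      exact hc.1.antisymm hle) (t := t₁) (fun x hxy hx => by
      rw [Set.Finite.mem_toFinset] at hx
      rw [mem_thetaFilt, hval]
      by_cases h0 : x = y * refl P i n
      · rw [h0, rootAt_mul, add_neg_cancel, zero_smul, smul_zero]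
        exact zero_mem _
      · have h3 : ¬ BruhatLE b x (y * refl P i n) := fun h3 => hx ⟨h3, hxy, h0⟩
        have h4 := hm2 x h3
        have h5 := hm2 _ (not_bruhatLE_mul hs hys h3)
        rw [← smul_assoc]
        exact ⟨(K x).smul_mem _ h4, (K _).smul_mem _ h5⟩)
  refine ⟨t₂, ?_, h2'⟩
  rw [← sub_add_sub_cancel t t₁ t₂]
  exact add_mem ht₁ h2

end ThetaExtend
end AffineMomentGraph

/-! ## Translation of stalk filtrations -/

namespace AffineMomentGraph

section Construction

variable {ι V N : Type u} [AddCommGroup V] [Module ℚ V] [AddCommGroup N] [Module ℚ N]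
variable {P : RootPairing ι ℚ V N} [P.IsCrystallographic] {b : P.Base}
variable {k : Type u} [Field k] [Algebra ZHalf k]
variable [Finite ι] [P.IsRootSystem] [P.IsReduced]
variable {M : GradedMod (degK P k)} {K : AffW P → Submodule (Sym k (AffX P)) M} {w : AffW P}
variable {i : ι} {n : ℤ}

variable (M) in
/-- The homomorphism `m ↦ z ⊗ m`. -/
def thetaIncl (s : AffW P) (z : StructK P k) : M →ₗ[Sym k (AffX P)] theta P k s M where
  toFun := thetaMk s z
  map_add' := thetaMk_add z
  map_smul' f m := by
    change thetaMk s z (const P k f • m) = const P k f • thetaMk s z m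
    rw [← thetaMk_mul (const_mem_invK P k s f), smul_thetaMk]

theorem thetaIncl_add (t : theta P k (refl P i n) M) :
    thetaIncl M (refl P i n) 1 (thetaFst t) +
      thetaIncl M (refl P i n) (rightK P k (affRoot P i n)) (thetaSnd t) = t := pair_eta t

theorem thetaIncl_mem {s : AffW P} {d e : ℤ} {z : StructK P k} (hz : z ∈ degK P k d) {m : M}
    (hm : m ∈ M.deg e) : thetaIncl M s z m ∈ (theta P k s M).deg (d + e) := thetaMk_mem hz hm

theorem IsStalkFiltration.theta [P.IsIrreducible] (h : IsStalkFiltration b M K w)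
    (hk : ringChar k = 0 ∨ coxeterNumber b ≤ ringChar k)
    (hA2 : ¬ (IsTypeA2 b ∧ ringChar k = 3))
    (hs : refl P i n ∈ simpleRefl b)
    (hw : length b w < length b (w * refl P i n)) (hc : w * refl P i n ∈ circ b) :
    IsStalkFiltration b (theta P k (refl P i n) M) (thetaFilt K i n) (w * refl P i n) where
  homog := h.theta_homog
  ev_smul := h.theta_ev_smul
  torsionfree x f t hf ht := by
    rw [mem_thetaFilt, map_smul] at ht
    exact ⟨h.torsionfree _ f _ hf ht.1, h.torsionfree _ f _ hf ht.2⟩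
  projective := h.theta_projective hs
  inf t ht := by
    -- The values at `x` and `x s` are `a + γ b` and `a - γ b`, and both lie in `K x`. Since `2` is
    -- invertible, `a` and `γ b` do too.
    have h1 : ∀ x, thetaFst t ∈ K x ∧ rootAt k i n x • thetaSnd t ∈ K x := fun x => by
      have e1 := (mem_thetaFilt.1 (ht x)).1
      have e2 := (mem_thetaFilt.1 (ht (x * refl P i n))).2
      rw [mul_refl_mul_refl, thetaVal_apply, rootAt_mul, neg_smul] at e2
      rw [thetaVal_apply] at e1
      have e3 := add_mem e1 e2
      have e4 := sub_mem e1 e2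
      have h2 : (2 : Sym k (AffX P)) ≠ 0 := by
        rw [← map_ofNat (algebraMap k (Sym k (AffX P))) 2, Ne, SymmetricAlgebra.algebraMap_eq_zero_iff]
        exact two_ne_zero_field k
      constructor
      · refine h.torsionfree x 2 _ h2 ?_
        convert e3 using 1
        rw [two_smul]
        abel
      · refine h.torsionfree x 2 _ h2 ?_
        convert e4 using 1
        rw [two_smul]
        abel
    refine theta_ext ?_ ?_
    · rw [map_zero]
      exact h.inf _ fun x => (h1 x).1
    · rw [map_zero]
      exact h.inf _ fun x => h.torsionfree x _ _ (rootAt_ne_zero i n x) (h1 x).2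
  support x hx := by
    rw [thetaFilt, h.support_mul hs hw hx, Submodule.comap_top]
  edge _ _ _ hy _ ht := h.theta_edge hk hA2 hs hw hc hy ht
  extend _ _ ht := h.theta_extend hk hA2 hs hw hc ht
  regular x f g t hf hfg ht := by
    rw [exists_sub_smul_mem_iff] at ht
    rw [exists_sub_smul_mem_iff']
    exact h.regular_pair hs x hf hfg ht
  bddBelow := by
    obtain ⟨d₀, hd₀⟩ := h.bddBelow
    refine ⟨d₀, fun d hd t ht => theta_ext ?_ ?_⟩
    · rw [map_zero]
      exact hd₀ d hd _ (thetaFst_mem ht)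
    · rw [map_zero]
      exact hd₀ (d - 2) (by omega) _ (thetaSnd_mem ht)
  finite d := by
    obtain ⟨W₁, h1, h1'⟩ := h.finite d
    obtain ⟨W₂, h2, h2'⟩ := h.finite (d - 2)
    let f₁ := (thetaIncl M (refl P i n) 1).restrictScalars k
    let f₂ := (thetaIncl M (refl P i n) (rightK P k (affRoot P i n))).restrictScalars k
    refine ⟨W₁.map f₁ ⊔ W₂.map f₂, (h1.map f₁).sup (h2.map f₂), fun t ht => ?_⟩
    rw [← thetaIncl_add t]
    exact Submodule.add_mem_sup ⟨_, h1' _ (thetaFst_mem ht), rfl⟩ ⟨_, h2' _ (thetaSnd_mem ht), rfl⟩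
  gen := by
    classical
    obtain ⟨T, hT⟩ := h.gen
    -- Generators of `1 ⊗ M` and of `c ⊗ M`, where `c` has degree `2`.
    refine ⟨T ∪ T.image (2 + ·), ?_⟩
    rw [eq_top_iff]
    intro t _
    rw [← thetaIncl_add t]
    have key : ∀ (d : ℤ) (z : StructK P k), z ∈ degK P k d →
        (∀ e ∈ T, d + e ∈ T ∪ T.image (2 + ·)) → ∀ m : M, thetaIncl M (refl P i n) z m ∈
        Submodule.span (Sym k (AffX P)) {m : AffineMomentGraph.theta P k (refl P i n) M |
          ∃ d ∈ T ∪ T.image (2 + ·), m ∈ (AffineMomentGraph.theta P k (refl P i n) M).deg d} := by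
      intro d z hz hd m
      have hm : m ∈ Submodule.span (Sym k (AffX P)) {m : M | ∃ d ∈ T, m ∈ M.deg d} := by
        rw [hT]; exact Submodule.mem_top
      induction hm using Submodule.span_induction with
      | zero => rw [map_zero]; exact zero_mem _
      | add x y _ _ hx hy => rw [map_add]; exact add_mem hx hy
      | smul a x _ hx => rw [map_smul]; exact Submodule.smul_mem _ _ hx
      | mem x hx =>
        obtain ⟨e, he, hx⟩ := hx
        exact Submodule.subset_span ⟨d + e, hd e he, thetaIncl_mem hz hx⟩
    refine add_mem (key 0 1 one_mem_degK (fun e he => ?_) _)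
      (key 2 _ (rightK_mem P k _) (fun e he => ?_) _)
    · rw [zero_add]
      exact Finset.mem_union_left _ he
    · exact Finset.mem_union_right _ (Finset.mem_image_of_mem _ he)

theorem Be_smul (f : Sym k (AffX P)) (m : Be P k) :
    f • m = (show Sym k (AffX P) from f * (show Sym k (AffX P) from m)) := by
  change ev P k 1 (const P k f) * (show Sym k (AffX P) from m) = _
  rw [ev_const]

/-- The filtration of `B_e`. -/
def BeFilt (P : RootPairing ι ℚ V N) [P.IsCrystallographic] (k : Type u) [Field k] [Algebra ZHalf k]
    (x : AffW P) : Submodule (Sym k (AffX P)) (Be P k) :=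
  ⨅ _ : x = 1, ⊥

theorem BeFilt_one : BeFilt P k 1 = ⊥ := by simp [BeFilt]

theorem BeFilt_ne {x : AffW P} (h : x ≠ 1) : BeFilt P k x = ⊤ := by simp [BeFilt, h]

theorem symDeg_fg (Y : Type u) [AddCommGroup Y] [Module.Finite ℤ Y] (d : ℤ) :
    (symDeg k Y d).FG := by
  rw [symDeg]
  split_ifs
  · refine Submodule.FG.pow ?_ _
    rw [← Submodule.map_top]
    exact (Module.Finite.fg_top (R := k) (M := k ⊗[ℤ] Y)).map _
  · exact Submodule.fg_bot

theorem quot_isGradedProjective_of_eq_bot {A 𝔸 : Type u} [CommRing A] [CommRing 𝔸] [Algebra A 𝔸]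
    {𝒜 : ℤ → Submodule A 𝔸} {M : GradedMod 𝒜} (hM : M.IsGradedProjective) {K : Submodule 𝔸 M}
    (hK : M.IsHomog K) (h : K = ⊥) : (M.quot K hK).IsGradedProjective := by
  refine (GradedMod.iso_of_bijective (GradedMod.quotMk_graded hK)
    ⟨(injective_iff_map_eq_zero _).2 fun m hm => ?_,
      GradedMod.quotMk_surjective hK⟩).symm.isGradedProjective hM
  rwa [GradedMod.quotMk_eq_zero hK, h, Submodule.mem_bot] at hm

theorem isGradedProjective_of_subsingleton {A 𝔸 : Type u} [CommRing A] [CommRing 𝔸] [Algebra A 𝔸]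
    {𝒜 : ℤ → Submodule A 𝔸} {M : GradedMod 𝒜} (hM : Subsingleton M) : M.IsGradedProjective :=
  fun L Q g f _ _ _ => ⟨0, fun _ _ _ => zero_mem _, LinearMap.ext fun m => by
    rw [Subsingleton.elim m 0, map_zero, map_zero]⟩

theorem quot_subsingleton {A 𝔸 : Type u} [CommRing A] [CommRing 𝔸] [Algebra A 𝔸]
    {𝒜 : ℤ → Submodule A 𝔸} {M : GradedMod 𝒜} {K : Submodule 𝔸 M}
    (hK : M.IsHomog K) (h : K = ⊤) : Subsingleton (M.quot K hK) :=
  Submodule.Quotient.subsingleton_iff.2 h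

theorem Be_isGradedProjective : (Be P k).restr.IsGradedProjective := by
  let f : symSelf k (AffX P) →ₗ[Sym k (AffX P)] (Be P k).restr :=
    { toFun := fun (m : Sym k (AffX P)) => m
      map_add' := fun _ _ => rfl
      map_smul' := fun a m => (Be_smul a m).symm }
  have hf : GradedMod.IsGradedHom f := fun n m hm => hm
  exact (GradedMod.iso_of_bijective hf ⟨fun _ _ h => h, fun m => ⟨m, rfl⟩⟩).symm.isGradedProjective
    (symSelf_isGradedProjective k (AffX P))

/-- The symmetric algebra as a module over itself, mapped to `B_e`. -/
def BeOf : Sym k (AffX P) ≃ₗ[Sym k (AffX P)] Be P k where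
  toFun m := m
  invFun m := m
  map_add' _ _ := rfl
  map_smul' a m := (Be_smul a m).symm
  left_inv _ := rfl
  right_inv _ := rfl

theorem Be_regular {f g : Sym k (AffX P)} {m : Be P k} (hfg : ∀ h, f ∣ g * h → f ∣ h)
    (hm : ∃ m', g • m - f • m' = 0) : ∃ m', m - f • m' = 0 := by
  obtain ⟨m, rfl⟩ := BeOf.surjective m
  obtain ⟨m', hm'⟩ := hm
  obtain ⟨m', rfl⟩ := BeOf.surjective m'
  rw [← map_smul, ← map_smul, ← map_sub, map_eq_zero_iff _ BeOf.injective, sub_eq_zero] at hm'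
  obtain ⟨a, rfl⟩ := hfg m ⟨m', hm'⟩
  exact ⟨BeOf a, by rw [← map_smul, ← map_sub, smul_eq_mul, sub_self, map_zero]⟩

theorem isStalkFiltration_Be [P.IsIrreducible] : IsStalkFiltration b (Be P k) (BeFilt P k) 1 where
  homog x d m hm := by
    by_cases h : x = 1
    · subst h
      rw [BeFilt_one, Submodule.mem_bot] at hm ⊢
      rw [hm, map_zero]
    · rw [BeFilt_ne h]; exact Submodule.mem_top
  ev_smul x z m hz := by
    by_cases h : x = 1
    · subst h
      rw [BeFilt_one, Submodule.mem_bot]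
      change ev P k 1 z * (show Sym k (AffX P) from m) = 0
      rw [hz, zero_mul]
    · rw [BeFilt_ne h]; exact Submodule.mem_top
  torsionfree x f m hf hm := by
    by_cases h : x = 1
    · subst h
      rw [BeFilt_one, Submodule.mem_bot, Be_smul] at hm
      rw [BeFilt_one, Submodule.mem_bot]
      exact (mul_eq_zero.1 hm).resolve_left hf
    · rw [BeFilt_ne h]; exact Submodule.mem_top
  projective x := by
    by_cases h : x = 1
    · exact quot_isGradedProjective_of_eq_bot Be_isGradedProjective _ (by rw [h, BeFilt_one])
    · exact isGradedProjective_of_subsingleton (quot_subsingleton _ (BeFilt_ne h))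
  inf m hm := by
    have := hm 1
    rwa [BeFilt_one, Submodule.mem_bot] at this
  support x hx := BeFilt_ne fun h => hx (h ▸ Relation.ReflTransGen.refl)
  edge x i n hx m _ := by
    have : refl P i n * x ≠ 1 := fun h => by
      rw [h, length_one] at hx
      omega
    rw [BeFilt_ne this]
    exact ⟨0, Submodule.mem_top⟩
  extend x m _ := by
    by_cases h : x = 1
    · refine ⟨m, by rw [sub_self]; exact zero_mem _, fun y hy => ?_⟩
      rw [BeFilt_ne fun hy' => hy (by rw [h, hy']; exact Relation.ReflTransGen.refl)]
      exact Submodule.mem_top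
    · refine ⟨0, ?_, fun y _ => zero_mem _⟩
      rw [BeFilt_ne h]; exact Submodule.mem_top
  regular x f g m _ hfg hm := by
    by_cases h : x = 1
    · subst h
      rw [BeFilt_one] at hm ⊢
      exact Be_regular hfg hm
    · rw [BeFilt_ne h]
      exact ⟨0, Submodule.mem_top⟩
  bddBelow := ⟨0, fun d hd m hm => by
    change (show Sym k (AffX P) from m) ∈ symDeg k (AffX P) d at hm
    rw [symDeg, if_neg (by omega)] at hm
    exact hm⟩
  finite d := by
    let f : Sym k (AffX P) →ₗ[k] Be P k :=
      { toFun := fun m => m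
        map_add' := fun _ _ => rfl
        map_smul' := fun c m => by
          rw [Algebra.smul_def]
          change _ = ev P k 1 (algebraMap k _ c) * m
          rw [AlgHom.commutes] }
    exact ⟨_, (symDeg_fg (k := k) (AffX P) d).map f, fun m hm => ⟨m, hm, rfl⟩⟩
  gen := by
    refine ⟨{0}, eq_top_iff.2 fun m _ => ?_⟩
    have h1 : (show Be P k from (1 : Sym k (AffX P))) ∈ Submodule.span (Sym k (AffX P))
        {m : Be P k | ∃ d ∈ ({0} : Finset ℤ), m ∈ (Be P k).deg d} :=
      Submodule.subset_span ⟨0, by simp, one_mem_symDeg k (AffX P)⟩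
    have h2 := Submodule.smul_mem _ (show Sym k (AffX P) from m) h1
    rw [Be_smul] at h2
    rwa [show (show Sym k (AffX P) from m) * (show Sym k (AffX P) from
      (show Be P k from (1 : Sym k (AffX P)))) = m from mul_one (show Sym k (AffX P) from m)] at h2

end Construction
end AffineMomentGraph

/-! ## Summands and shifts of stalk filtrations -/

namespace AffineMomentGraph

section Operations

variable {ι V N : Type u} [AddCommGroup V] [Module ℚ V] [AddCommGroup N] [Module ℚ N]
variable {P : RootPairing ι ℚ V N} [P.IsCrystallographic] {b : P.Base}
variable {k : Type u} [Field k] [Algebra ZHalf k]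
variable [Finite ι] [P.IsRootSystem] [P.IsReduced]
variable {M : GradedMod (degK P k)} {K : AffW P → Submodule (Sym k (AffX P)) M} {w : AffW P}

/-- The structure algebra separates the elements below `w`. -/
theorem exists_separating [P.IsIrreducible]
    (hk : ringChar k = 0 ∨ coxeterNumber b ≤ ringChar k)
    (hA2 : ¬ (IsTypeA2 b ∧ ringChar k = 3)) {x : AffW P} (hx : x ∈ circ b) (D : Finset (AffW P))
    (hD : ∀ y ∈ D, y ∈ circ b) :
    ∃ z : StructK P k, ev P k x z ≠ 0 ∧ ∀ y ∈ D, y ≠ x → ev P k y z = 0 := by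
  classical
  induction D using Finset.induction_on with
  | empty => exact ⟨1, by rw [map_one]; exact one_ne_zero, by simp⟩
  | insert y D _ ih =>
    obtain ⟨z, hz, hz'⟩ := ih fun y hy => hD y (Finset.mem_insert_of_mem hy)
    by_cases hyx : y = x
    · refine ⟨z, hz, fun v hv hvx => hz' v ?_ hvx⟩
      exact (Finset.mem_insert.1 hv).resolve_left fun h => hvx (h.trans hyx)
    · obtain ⟨l, hl⟩ := exists_lin_actX_ne_zero hk hA2 hx (hD y (Finset.mem_insert_self _ _))
        (Ne.symm hyx)
      refine ⟨(rightK P k l - const P k (lin k (actX y l))) * z, ?_, fun v hv hvx => ?_⟩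
      · rw [map_mul, map_sub, ev_rightK, ev_const, ← lin_sub]
        exact mul_ne_zero hl hz
      · rw [map_mul]
        rcases Finset.mem_insert.1 hv with rfl | hv
        · rw [map_sub, ev_rightK, ev_const, sub_self, zero_mul]
        · rw [hz' v hv hvx, mul_zero]

/-- Choose `z` with nonzero coordinate at `x` and zero coordinate at all other vertices below `w`.
If `m` vanishes at `x`, then `z m = 0`, so `z` kills `e m`; since the stalk at `x` is torsion free,
`e m` vanishes at `x`. -/
theorem IsStalkFiltration.map_mem [P.IsIrreducible] (h : IsStalkFiltration b M K w)
    (hk : ringChar k = 0 ∨ coxeterNumber b ≤ ringChar k)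
    (hA2 : ¬ (IsTypeA2 b ∧ ringChar k = 3)) (hw : w ∈ circ b) (e : M →ₗ[StructK P k] M)
    {x : AffW P} {m : M} (hm : m ∈ K x) : e m ∈ K x := by
  by_cases hx : BruhatLE b x w
  · obtain ⟨z, hz, hz'⟩ := exists_separating hk hA2 (mem_circ_of_le hx hw)
      (finite_bruhatLE (b := b) w).toFinset (fun y hy => mem_circ_of_le (by simpa using hy) hw)
    have h1 : z • m = 0 := h.inf _ fun y => by
      by_cases hy : BruhatLE b y w
      · by_cases hyx : y = x
        · exact hyx ▸ h.smul_mem z hm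
        · exact h.ev_smul y z m (hz' y (by simpa using hy) hyx)
      · rw [h.support y hy]
        exact Submodule.mem_top
    have h2 := h.sub_ev_smul_mem x z (e m)
    rw [← map_smul, h1, map_zero, zero_sub, neg_mem_iff] at h2
    exact h.torsionfree x _ _ hz h2
  · rw [h.support x hx]
    exact Submodule.mem_top

/-- The filtration of the summand is the preimage of `K`. The projection `f ∘ g` preserves each `K
x` by `map_mem`, so every condition can be solved in `M` and projected back. -/
theorem IsStalkFiltration.isSummand [P.IsIrreducible] (h : IsStalkFiltration b M K w)
    (hk : ringChar k = 0 ∨ coxeterNumber b ≤ ringChar k)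
    (hA2 : ¬ (IsTypeA2 b ∧ ringChar k = 3)) (hw : w ∈ circ b) {L : GradedMod (degK P k)}
    (hL : L.IsSummand M) : ∃ K', IsStalkFiltration b L K' w := by
  obtain ⟨f, g, hf, hg, e⟩ := hL
  have hgf : ∀ x, g (f x) = x := DFunLike.congr_fun e
  have hfg : ∀ x m, m ∈ K x → f (g m) ∈ K x := fun x m hm => h.map_mem hk hA2 hw (f ∘ₗ g) hm
  let f' : L →ₗ[Sym k (AffX P)] M := resHom f
  let g' : M →ₗ[Sym k (AffX P)] L := resHom g
  have hgf' : ∀ x, g' (f' x) = x := hgf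
  have hfg' : ∀ x m, m ∈ K x → f' (g' m) ∈ K x := hfg
  have hf' : GradedMod.IsGradedHom (M := L.restr) (L := M.restr) f' := hf
  have hg' : GradedMod.IsGradedHom (M := M.restr) (L := L.restr) g' := hg
  have key : ∀ x (a : Sym k (AffX P)) m m', f' m - a • m' ∈ K x →
      m - a • g' m' ∈ (K x).comap f' := fun x a m m' hm => by
    rw [Submodule.mem_comap]
    have := hfg' x _ hm
    rwa [map_sub, hgf', map_smul] at this
  have hom : ∀ x, L.restr.IsHomog ((K x).comap f') := fun x d m hm => by
    rw [Submodule.mem_comap] at hm ⊢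
    have := h.homog x d _ hm
    rwa [← GradedMod.map_proj hf'] at this
  refine ⟨fun x => (K x).comap f', hom, fun x z m hz => ?_, fun x a m ha hm => ?_, fun x => ?_,
    fun m hm => ?_, fun x hx => ?_, fun x i n hx m hm => ?_, fun x m hm => ?_,
    fun x a c m ha hac hm => ?_, ?_, fun d => ?_, ?_⟩
  · rw [Submodule.mem_comap]
    change f (z • m) ∈ K x
    rw [map_smul]
    exact h.ev_smul x z _ hz
  · rw [Submodule.mem_comap, map_smul] at hm
    exact h.torsionfree x a _ ha hm
  · have hF : ∀ m ∈ (K x).comap f', (M.restr.quotMk (K x) (h.homog x) ∘ₗ f') m = 0 :=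
      fun m hm => (GradedMod.quotMk_eq_zero (h.homog x)).2 hm
    have hG : ∀ m ∈ K x, (L.restr.quotMk _ (hom x) ∘ₗ g') m = 0 :=
      fun m hm => (GradedMod.quotMk_eq_zero (hom x)).2 (hfg' x m hm)
    refine GradedMod.IsSummand.isGradedProjective ⟨GradedMod.quotLift (hom x) _ hF,
      GradedMod.quotLift (h.homog x) _ hG,
      GradedMod.quotLift_graded _ ((GradedMod.quotMk_graded _).comp hf') _,
      GradedMod.quotLift_graded _ ((GradedMod.quotMk_graded _).comp hg') _,
      LinearMap.ext fun q => ?_⟩ (h.projective x)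
    obtain ⟨m, rfl⟩ := GradedMod.quotMk_surjective _ q
    exact congrArg (L.restr.quotMk _ (hom x)) (hgf' m)
  · have := h.inf (f' m) hm
    rw [← hgf' m, this, map_zero]
  · rw [h.support x hx, Submodule.comap_top]
  · obtain ⟨m', hm'⟩ := h.edge x i n hx _ hm
    exact ⟨_, key _ _ _ _ hm'⟩
  · obtain ⟨m', h1, h2⟩ := h.extend x (f' m) fun i n hx => by
      obtain ⟨m', hm'⟩ := hm i n hx
      exact ⟨f' m', by rwa [Submodule.mem_comap, map_sub, map_smul] at hm'⟩
    have := key x 1 m m' (by rwa [one_smul])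
    rw [one_smul] at this
    exact ⟨g' m', this, fun y hy => hfg' y _ (h2 y hy)⟩
  · obtain ⟨m', hm'⟩ := hm
    rw [Submodule.mem_comap, map_sub, map_smul, map_smul] at hm'
    obtain ⟨m₁, hm₁⟩ := h.regular x a c (f' m) ha hac ⟨_, hm'⟩
    exact ⟨_, key _ _ _ _ hm₁⟩
  · obtain ⟨d₀, h0⟩ := h.bddBelow
    exact ⟨d₀, fun d hd m hm => by rw [← hgf m, h0 d hd _ (hf d m hm), map_zero]⟩
  · obtain ⟨W, hW, hW'⟩ := h.finite d
    exact ⟨W.map (g'.restrictScalars k), hW.map _, fun m hm => ⟨f m, hW' _ (hf d m hm), hgf m⟩⟩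
  · obtain ⟨T, hT⟩ := h.gen
    refine ⟨T, eq_top_iff.2 fun m _ => ?_⟩
    rw [← hgf' m]
    have hm : f' m ∈ Submodule.span (Sym k (AffX P)) {m : M | ∃ d ∈ T, m ∈ M.deg d} :=
      hT ▸ Submodule.mem_top
    have h1 := Submodule.mem_map_of_mem (f := g') hm
    rw [Submodule.map_span] at h1
    refine Submodule.span_mono ?_ h1
    rintro _ ⟨m, ⟨d, hd, hm⟩, rfl⟩
    exact ⟨d, hd, hg d m hm⟩

theorem shift_proj {A 𝔸 : Type u} [CommRing A] [CommRing 𝔸] [Algebra A 𝔸]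
    {𝒜 : ℤ → Submodule A 𝔸} (M : GradedMod 𝒜) (n d : ℤ) (m : M) :
    (M.shift n).proj d m = M.proj (d + n) m := by
  induction m using M.induction with
  | h e m hm =>
    have hm' : m ∈ (M.shift n).deg (e - n) := by
      change m ∈ M.deg (e - n + n)
      rwa [sub_add_cancel]
    by_cases h : d = e - n
    · subst h
      exact ((M.shift n).proj_same hm').trans (M.proj_same (by rwa [sub_add_cancel])).symm
    · exact ((M.shift n).proj_ne h hm').trans (M.proj_ne (by omega) hm).symm
  | hadd x y hx hy =>
    exact ((M.shift n).proj d).map_add x y |>.trans ((congrArg₂ (· + ·) hx hy).trans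
      ((M.proj (d + n)).map_add x y).symm)

theorem IsStalkFiltration.shift (h : IsStalkFiltration b M K w) (n : ℤ) :
    IsStalkFiltration b (M.shift n) K w where
  homog x d m hm := by
    have := h.homog x (d + n) m hm
    exact (shift_proj M.restr n d m).symm ▸ this
  ev_smul := h.ev_smul
  torsionfree := h.torsionfree
  projective x := by
    refine GradedMod.Iso.isGradedProjective ?_ ((h.projective x).shift n)
    exact ⟨LinearEquiv.refl _ _, fun d m => Iff.rfl⟩
  inf := h.inf
  support := h.support
  edge := h.edge
  extend := h.extend
  regular := h.regular
  bddBelow := by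
    obtain ⟨d₀, h0⟩ := h.bddBelow
    exact ⟨d₀ - n, fun d hd m hm => h0 (d + n) (by omega) m hm⟩
  finite d := h.finite (d + n)
  gen := by
    classical
    obtain ⟨T, hT⟩ := h.gen
    refine ⟨T.image (· - n), eq_top_iff.2 fun (m : M) _ => ?_⟩
    have hm : m ∈ Submodule.span (Sym k (AffX P)) {m : M | ∃ d ∈ T, m ∈ M.deg d} :=
      hT ▸ Submodule.mem_top
    refine Submodule.span_mono ?_ hm
    rintro m ⟨d, hd, hm⟩
    refine ⟨d - n, Finset.mem_image_of_mem _ hd, ?_⟩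
    change m ∈ M.deg (d - n + n)
    rwa [sub_add_cancel]

theorem bottSamelson_append (l : List (AffW P)) (s : AffW P) :
    bottSamelson P k (l ++ [s]) = theta P k s (bottSamelson P k l) := by
  rw [bottSamelson, List.foldl_append]
  rfl

/-- Dropping the last letter of a reduced word leaves a reduced word of a smaller element, still
below `ŵ₀`. So each translation lengthens the element, as `IsStalkFiltration.theta` requires. -/
theorem exists_isStalkFiltration [P.IsIrreducible]
    (hk : ringChar k = 0 ∨ coxeterNumber b ≤ ringChar k)
    (hA2 : ¬ (IsTypeA2 b ∧ ringChar k = 3)) {l : List (AffW P)} (hl : IsReducedWord b l)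
    (hc : l.prod ∈ circ b) : ∃ K, IsStalkFiltration b (bottSamelson P k l) K l.prod := by
  induction l using List.reverseRecOn with
  | nil => exact ⟨_, isStalkFiltration_Be⟩
  | append_singleton l s ih =>
    have hs : s ∈ simpleRefl b := hl.1 s (by simp)
    have hl' : ∀ t ∈ l, t ∈ simpleRefl b := fun t ht => hl.1 t (by simp [ht])
    have e : (l ++ [s]).prod = l.prod * s := by simp
    have hlen : l.length + 1 = length b (l.prod * s) := by
      rw [← e, ← hl.2]; simp
    have h1 := length_prod_le hl'
    have h2 := length_mul_simple_le hs l.prod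
    have hlt : length b l.prod < length b (l.prod * s) := by omega
    rw [e] at hc ⊢
    obtain ⟨K, hK⟩ := ih ⟨hl', by omega⟩ (mem_circ_of_le (bruhatLE_mul_simple hs hlt) hc)
    rw [bottSamelson_append]
    obtain ⟨i, n, rfl⟩ : ∃ i n, s = refl P i n := by
      rcases hs with ⟨i, -, h⟩ | ⟨i, -, h⟩
      exacts [⟨i, _, h⟩, ⟨i, _, h⟩]
    exact ⟨_, hK.theta hk hA2 hs hlt hc⟩

end Operations
end AffineMomentGraph

/-! ## Flabby sheaves on moment graphs -/

namespace AffineMomentGraph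

namespace GradedMod

variable {k A : Type u} [CommRing k] [CommRing A] [Algebra k A] {𝒜 : ℤ → Submodule k A}

/-- A graded linear relation from a graded projective module, defined everywhere, contains the graph
of a homomorphism. -/
theorem IsGradedProjective.exists_of_relation {N L : GradedMod 𝒜} (hN : N.IsGradedProjective)
    (R : N → L → Prop) (htot : ∀ m, ∃ l, R m l)
    (hadd : ∀ m m' l l', R m l → R m' l' → R (m + m') (l + l'))
    (hsmul : ∀ (a : A) m l, R m l → R (a • m) (a • l))
    (hproj : ∀ n m l, R m l → R (N.proj n m) (L.proj n l)) :
    ∃ f : N →ₗ[A] L, IsGradedHom f ∧ ∀ m, R m (f m) := by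
  have hsub : ∀ m m' l l', R m l → R m' l' → R (m - m') (l - l') := fun m m' l l' h h' => by
    have := hadd _ _ _ _ h (hsmul (-1) _ _ h')
    rwa [neg_one_smul, neg_one_smul, ← sub_eq_add_neg, ← sub_eq_add_neg] at this
  have h0 : R 0 0 := by
    obtain ⟨l, hl⟩ := htot 0
    have := hsmul 0 _ _ hl
    rwa [zero_smul, zero_smul] at this
  -- `K` is the indeterminacy of the relation. Modulo `K` the relation is a homomorphism, which
  -- lifts because `N` is projective.
  let K : Submodule A L :=
    { carrier := {l | R 0 l}
      zero_mem' := h0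
      add_mem' := fun {l l'} h h' => by
        have := hadd _ _ _ _ h h'
        rwa [add_zero] at this
      smul_mem' := fun a l h => by
        have := hsmul a _ _ h
        rwa [smul_zero] at this }
  have hK : L.IsHomog K := fun n l h => by
    have := hproj n _ _ h
    rwa [map_zero] at this
  choose c hc using htot
  have hmk : ∀ m l, R m l → L.quotMk K hK (c m) = L.quotMk K hK l := fun m l h => by
    rw [← sub_eq_zero, ← map_sub, quotMk_eq_zero]
    have := hsub _ _ _ _ (hc m) h
    rwa [sub_self] at this
  let f : N →ₗ[A] L.quot K hK :=
    { toFun := fun m => L.quotMk K hK (c m)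
      map_add' := fun m m' => by
        rw [← map_add]
        exact hmk _ _ (hadd _ _ _ _ (hc m) (hc m'))
      map_smul' := fun a m => by
        rw [RingHom.id_apply, ← map_smul]
        exact hmk _ _ (hsmul _ _ _ (hc m)) }
  have hf : IsGradedHom f := fun n m hm => by
    refine ⟨L.proj n (c m), L.proj_mem n _, ?_⟩
    have := hproj n _ _ (hc m)
    rw [N.proj_same hm] at this
    exact (hmk _ _ this).symm
  obtain ⟨f', hf', e⟩ := hN L _ (L.quotMk K hK) f (quotMk_graded hK) hf (quotMk_surjective hK)
  refine ⟨f', hf', fun m => ?_⟩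
  have e' : L.quotMk K hK (f' m) = L.quotMk K hK (c m) := DFunLike.congr_fun e m
  rw [← sub_eq_zero, ← map_sub, quotMk_eq_zero] at e'
  have := hadd _ _ _ _ e' (hc m)
  rwa [zero_add, sub_add_cancel] at this

/-- Inverse of a bijective graded homomorphism. -/
theorem IsGradedHom.exists_inverse {N L : GradedMod 𝒜} {f : N →ₗ[A] L} (hf : IsGradedHom f)
    (h : Function.Bijective f) : ∃ g : L →ₗ[A] N, IsGradedHom g ∧ (∀ m, g (f m) = m) ∧
      ∀ l, f (g l) = l := by
  let e := LinearEquiv.ofBijective f h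
  refine ⟨e.symm.toLinearMap, fun n l hl => ?_, e.symm_apply_apply, e.apply_symm_apply⟩
  refine hf.mem_deg_of_injective h.1 ?_
  rwa [show f (e.symm.toLinearMap l) = l from e.apply_symm_apply l]

end GradedMod

namespace MomentGraph.Sheaf

open GradedMod

variable {Y : Type u} [AddCommGroup Y] {k : Type u} [Field k] {G : MomentGraph Y}

/-- The stalks at the vertices are projective, and sections over the vertices above `x` extend
to `x`. -/
structure IsFlabby (F : Sheaf k G) : Prop where
  surjective : ∀ E : G.E, Function.Surjective (F.ρ (G.top E) E (Or.inr rfl))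
  ker : ∀ (E : G.E) (m : F.vert (G.top E)), F.ρ (G.top E) E (Or.inr rfl) m = 0 ↔
    ∃ m' : F.vert (G.top E), m = lin k (G.label E) • m'
  range : ∀ x, Set.range (F.ρδ x) = F.upImage x
  projective : ∀ x, (F.vert x).IsGradedProjective

variable {F H : Sheaf k G}

/-- The maps between the stalks at the ends of the edge `E` are compatible. -/
def Compat (φ : ∀ x, F.vert x →ₗ[Sym k Y] H.vert x) (E : G.E) : Prop :=
  ∀ m n, F.ρ (G.bot E) E (Or.inl rfl) m = F.ρ (G.top E) E (Or.inr rfl) n →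
    H.ρ (G.bot E) E (Or.inl rfl) (φ _ m) = H.ρ (G.top E) E (Or.inr rfl) (φ _ n)

theorem map_mem_iSup_homog {φ : ∀ x, F.vert x →ₗ[Sym k Y] H.vert x} (hφ : ∀ x, IsGradedHom (φ x))
    {Ω : Set G.V} {m : (x : Ω) → F.vert x} (hm : m ∈ ⨆ n, F.homog Ω n) :
    (fun x : Ω => φ x (m x)) ∈ ⨆ n, H.homog Ω n := by
  induction hm using AddSubgroup.iSup_induction' with
  | h1 => simp only [Pi.zero_apply, map_zero]; exact zero_mem _
  | hadd x y _ _ hx hy => simp only [Pi.add_apply, map_add]; exact add_mem hx hy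
  | hp n m hm =>
    exact (le_iSup (H.homog Ω) n) (H.mem_homog.2 fun x => hφ x _ _ (F.mem_homog.1 hm x))

theorem map_mem_sections {φ : ∀ x, F.vert x →ₗ[Sym k Y] H.vert x} (hφ : ∀ x, IsGradedHom (φ x))
    {Ω : Set G.V} (hc : ∀ E, G.bot E ∈ Ω → Compat φ E) {m : (x : Ω) → F.vert x}
    (hm : m ∈ F.sections Ω) : (fun x : Ω => φ x (m x)) ∈ H.sections Ω :=
  ⟨map_mem_iSup_homog hφ hm.1, fun E h h' => hc E h _ _ (hm.2 E h h')⟩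

theorem mem_upImage {x : G.V} {p : (E : UpEdge x) → F.edge E.1} :
    p ∈ F.upImage x ↔ ∃ m ∈ F.sections {y | x < y}, ∀ (E : G.E) (h : x = G.bot E) 
      (h' : x < G.top E), p ⟨E, h⟩ = F.ρ (G.top E) E (Or.inr rfl) (m ⟨G.top E, h'⟩) := by
  constructor
  · rintro ⟨m, hm, rfl⟩
    exact ⟨m, hm, fun E h h' => rfl⟩
  · rintro ⟨m, hm, h⟩
    exact ⟨m, hm, funext fun E => (h E.1 E.2 _).symm⟩

theorem IsFlabby.exists_section (hF : F.IsFlabby) {x : G.V} (m : F.vert x) :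
    ∃ s ∈ F.sections {y | x < y}, ∀ (E : G.E) (h : x = G.bot E) (h' : x < G.top E),
      F.ρ x E (Or.inl h) m = F.ρ (G.top E) E (Or.inr rfl) (s ⟨G.top E, h'⟩) := by
  have : F.ρδ x m ∈ F.upImage x := hF.range x ▸ ⟨m, rfl⟩
  exact mem_upImage.1 this

theorem IsFlabby.exists_of_section (hF : F.IsFlabby) {x : G.V} {s : (y : {y : G.V | x < y}) → F.vert y}
    (hs : s ∈ F.sections {y | x < y}) :
    ∃ m, ∀ (E : G.E) (h : x = G.bot E) (h' : x < G.top E),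
      F.ρ x E (Or.inl h) m = F.ρ (G.top E) E (Or.inr rfl) (s ⟨G.top E, h'⟩) := by
  have : (fun E : UpEdge x => F.ρ (G.top E.1) E.1 (Or.inr rfl) (s ⟨G.top E.1, by
      have h := G.bot_lt_top E.1
      rwa [← E.2] at h⟩)) ∈ Set.range (F.ρδ x) := hF.range x ▸ ⟨s, hs, rfl⟩
  obtain ⟨m, hm⟩ := this
  exact ⟨m, fun E h h' => congrFun hm ⟨E, h⟩⟩

/-- Two lifts to the upper end differ by a multiple of the label, and the label acts by zero on the
edge stalk of the target. So it suffices to test a single lift. -/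
theorem IsFlabby.compat_of_exists (hF : F.IsFlabby) {φ : ∀ x, F.vert x →ₗ[Sym k Y] H.vert x} {E : G.E}
    (h : ∀ m, ∃ n, F.ρ (G.bot E) E (Or.inl rfl) m = F.ρ (G.top E) E (Or.inr rfl) n ∧
      H.ρ (G.bot E) E (Or.inl rfl) (φ _ m) = H.ρ (G.top E) E (Or.inr rfl) (φ _ n)) :
    Compat φ E := by
  intro m n hmn
  obtain ⟨n', h1, h2⟩ := h m
  rw [h2, ← sub_eq_zero, ← map_sub, ← map_sub]
  have h3 : F.ρ (G.top E) E (Or.inr rfl) (n' - n) = 0 := by rw [map_sub, ← h1, hmn, sub_self]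
  obtain ⟨c, hc⟩ := (hF.ker E _).1 h3
  rw [hc, map_smul, map_smul, H.label_smul]

theorem IsFlabby.compat_of_subsingleton (hF : F.IsFlabby) {φ : ∀ x, F.vert x →ₗ[Sym k Y] H.vert x}
    {E : G.E} (h : Subsingleton (F.vert (G.bot E))) : Compat φ E :=
  hF.compat_of_exists fun m => ⟨0, by
    rw [Subsingleton.elim m 0, map_zero, map_zero, map_zero, map_zero, map_zero, map_zero]
    exact ⟨rfl, rfl⟩⟩

/-- Homomorphisms to a flabby sheaf extend downwards. -/
theorem IsFlabby.exists_extension (hF : F.IsFlabby) (hH : H.IsFlabby) (A : Finset G.V)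
    (hA : ∀ x ∈ A, ∀ y, y ≤ x → y ∈ A) (φ : ∀ x, F.vert x →ₗ[Sym k Y] H.vert x)
    (hφ : ∀ x, IsGradedHom (φ x)) (hc : ∀ E, G.bot E ∉ A → Compat φ E) :
    ∃ φ' : ∀ x, F.vert x →ₗ[Sym k Y] H.vert x, (∀ x, IsGradedHom (φ' x)) ∧ (∀ E, Compat φ' E) ∧
      ∀ x ∉ A, φ' x = φ x := by
  classical
  induction hn : A.card generalizing A φ with
  | zero =>
    rw [Finset.card_eq_zero] at hn
    subst hn
    exact ⟨φ, hφ, fun E => hc E (by simp), fun _ _ => rfl⟩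
  | succ n ih =>
    have hne : A.Nonempty := Finset.card_pos.1 (by omega)
    obtain ⟨x, hxA, hx⟩ := A.exists_maximal hne
    have hx' : ∀ y, x < y → y ∉ A := fun y hy hyA => (hx hyA hy.le).not_gt hy
    -- The relation says that `l` is an admissible image of `m` on all edges going up from the
    -- maximal vertex `x`. Flabbiness of both sheaves makes it total: take a section above `x`
    -- matching `m`, map it by `φ`, and extend it to `x`.
    obtain ⟨f, hf, hR⟩ := (hF.projective x).exists_of_relation (L := H.vert x)
      (fun m l => ∀ (E : G.E) (h : x = G.bot E), ∃ n,
        F.ρ x E (Or.inl h) m = F.ρ (G.top E) E (Or.inr rfl) n ∧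
        H.ρ x E (Or.inl h) l = H.ρ (G.top E) E (Or.inr rfl) (φ _ n))
      (fun m => by
        obtain ⟨s, hs, h1⟩ := hF.exists_section m
        obtain ⟨l, hl⟩ := hH.exists_of_section
          (map_mem_sections hφ (fun E hE => hc E (hx' _ hE)) hs)
        refine ⟨l, fun E h => ?_⟩
        have h' : x < G.top E := by
          have := G.bot_lt_top E
          rwa [← h] at this
        exact ⟨_, h1 E h h', hl E h h'⟩)
      (fun m m' l l' h h' E hE => by
        obtain ⟨n, h1, h2⟩ := h E hE
        obtain ⟨n', h1', h2'⟩ := h' E hE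
        exact ⟨n + n', by rw [map_add, map_add, h1, h1'], by
          rw [map_add, map_add, map_add, h2, h2']⟩)
      (fun a m l h E hE => by
        obtain ⟨n, h1, h2⟩ := h E hE
        exact ⟨a • n, by rw [map_smul, map_smul, h1], by
          rw [map_smul, map_smul, map_smul, h2]⟩)
      (fun d m l h E hE => by
        obtain ⟨n, h1, h2⟩ := h E hE
        refine ⟨(F.vert _).proj d n, ?_, ?_⟩
        · rw [map_proj (F.ρ_graded _ _ _), map_proj (F.ρ_graded _ _ _), h1]
        · rw [map_proj (hφ _), map_proj (H.ρ_graded _ _ _), map_proj (H.ρ_graded _ _ _), h2])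
    let ψ : ∀ y, F.vert y →ₗ[Sym k Y] H.vert y := Function.update φ x f
    have hψx : ψ x = f := Function.update_self ..
    have hψ : ∀ y, y ≠ x → ψ y = φ y := fun y hy => Function.update_of_ne hy ..
    obtain ⟨φ', h1, h2, h3⟩ := ih (A.erase x)
      (fun y hy z hz => Finset.mem_erase.2 ⟨fun hzx => by
        subst hzx
        exact (Finset.mem_erase.1 hy).1 (le_antisymm (hx (Finset.mem_erase.1 hy).2 hz) hz),
        hA y (Finset.mem_erase.1 hy).2 z hz⟩) ψ
      (fun y => by
        by_cases hy : y = x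
        · subst hy; rw [hψx]; exact hf
        · rw [hψ y hy]; exact hφ y)
      (fun E hE => by
        by_cases hEx : G.bot E = x
        · subst hEx
          refine hF.compat_of_exists fun m => ?_
          obtain ⟨n, h1, h2⟩ := hR m E rfl
          rw [hψx, hψ _ (G.bot_lt_top E).ne']
          exact ⟨n, h1, h2⟩
        · have hb : G.bot E ∉ A := fun h => hE (Finset.mem_erase.2 ⟨hEx, h⟩)
          have ht : G.top E ≠ x := fun h => hb (hA x hxA _ (h ▸ (G.bot_lt_top E).le))
          intro m n hmn
          rw [hψ _ hEx, hψ _ ht]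
          exact hc E hb m n hmn)
      (by rw [Finset.card_erase_of_mem hxA]; omega)
    refine ⟨φ', h1, h2, fun y hy => ?_⟩
    rw [h3 y fun h => hy (Finset.mem_erase.1 h).2, hψ y fun h => hy (h ▸ hxA)]

/-- Every boundary value of the target at `x` comes from a section above `x`. Pulled back by `ψ`,
this section extends to the source at `x`. So `φ x` hits all boundary values, and the projective
cover property makes it surjective. -/
theorem surjective_of_forall_gt (hF : F.IsFlabby) (hH : H.IsFlabby)
    {φ : ∀ x, F.vert x →ₗ[Sym k Y] H.vert x} {ψ : ∀ x, H.vert x →ₗ[Sym k Y] F.vert x} {x : G.V}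
    (hφ : ∀ x, IsGradedHom (φ x)) (hψ : ∀ x, IsGradedHom (ψ x))
    (hc : ∀ E, x = G.bot E → Compat φ E) (hc' : ∀ E, x < G.bot E → Compat ψ E)
    (hinv : ∀ y, x < y → ∀ l, φ y (ψ y l) = l) (hx : (H.vert x).IsProjectiveCover (H.ρδ x)) :
    Function.Surjective (φ x) := by
  refine hx.2 _ (φ x) (hφ x) (le_antisymm (LinearMap.range_comp_le_range _ _) ?_)
  rintro _ ⟨l, rfl⟩
  obtain ⟨s, hs, h1⟩ := hH.exists_section l
  obtain ⟨m, hm⟩ := hF.exists_of_section (map_mem_sections hψ hc' hs)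
  refine ⟨m, funext fun ⟨E, hE⟩ => ?_⟩
  have h' : x < G.top E := by
    have := G.bot_lt_top E
    rwa [← hE] at this
  refine Eq.trans ?_ (h1 E hE h').symm
  have h2 := hm E hE h'
  subst hE
  exact (hc E rfl _ _ h2).trans (by rw [hinv _ h'])

theorem compat_inverse (hF : F.IsFlabby) (hH : H.IsFlabby)
    {φ : ∀ x, F.vert x →ₗ[Sym k Y] H.vert x} {ψ : ∀ x, H.vert x →ₗ[Sym k Y] F.vert x} {E : G.E}
    (hc : Compat φ E) (hb : ∀ l, φ (G.bot E) (ψ _ l) = l)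
    (ht : ∀ m, ψ (G.top E) (φ _ m) = m) : Compat ψ E := by
  refine hH.compat_of_exists fun l => ?_
  obtain ⟨n, hn⟩ := hF.surjective E (F.ρ (G.bot E) E (Or.inl rfl) (ψ _ l))
  have := hc _ _ hn.symm
  rw [hb] at this
  exact ⟨φ _ n, this, by rw [ht, hn]⟩

/-- Bijectivity propagates downwards along projective covers. -/
theorem bijective_of_forall_gt (hF : F.IsFlabby) (hH : H.IsFlabby)
    {φ : ∀ x, F.vert x →ₗ[Sym k Y] H.vert x} {x : G.V}
    (hφ : ∀ x, IsGradedHom (φ x)) (hc : ∀ E, Compat φ E)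
    (hbij : ∀ y, x < y → Function.Bijective (φ y))
    (hxF : (F.vert x).IsProjectiveCover (F.ρδ x)) (hx : (H.vert x).IsProjectiveCover (H.ρδ x)) :
    Function.Bijective (φ x) := by
  have h1 : ∀ y, ∃ g : H.vert y →ₗ[Sym k Y] F.vert y, IsGradedHom g ∧
      (x < y → (∀ m, g (φ y m) = m) ∧ ∀ l, φ y (g l) = l) := fun y => by
    by_cases hy : x < y
    · obtain ⟨g, h1, h2⟩ := (hφ y).exists_inverse (hbij y hy)
      exact ⟨g, h1, fun _ => h2⟩
    · exact ⟨0, fun _ _ _ => zero_mem _, fun h => absurd h hy⟩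
  choose ψ hψ hψ' using h1
  have hgt : ∀ E, x = G.bot E → x < G.top E := fun E hE => by
    have := G.bot_lt_top E
    rwa [← hE] at this
  have hcψ : ∀ E, x < G.bot E → Compat ψ E := fun E hE =>
    compat_inverse hF hH (hc E) (hψ' _ hE).2
      (hψ' _ (hE.trans (G.bot_lt_top E))).1
  have hsurj := surjective_of_forall_gt hF hH hφ hψ (fun E _ => hc E) hcψ
    (fun y hy => (hψ' y hy).2) hx
  -- Injectivity is obtained by splitting `φ x` and showing that the section `σ` is surjective too.
  -- Together with the inverses above `x`, the section is compatible with the edges going up from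
  -- `x`, so the same lemma applies with the roles of the sheaves exchanged.
  obtain ⟨σ, hσ, e⟩ := hH.projective x _ _ (φ x) LinearMap.id (hφ x) isGradedHom_id hsurj
  have e' : ∀ l, φ x (σ l) = l := DFunLike.congr_fun e
  classical
  let τ : ∀ y, H.vert y →ₗ[Sym k Y] F.vert y := Function.update ψ x σ
  have hτx : τ x = σ := Function.update_self ..
  have hτ : ∀ y, x < y → τ y = ψ y := fun y hy => Function.update_of_ne hy.ne' ..
  have hτg : ∀ y, IsGradedHom (τ y) := fun y => by
    by_cases hy : y = x
    · subst hy; rw [hτx]; exact hσ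
    · rw [show τ y = ψ y from Function.update_of_ne hy ..]; exact hψ y
  have hs' : Function.Surjective (τ x) := by
    refine surjective_of_forall_gt hH hF hτg hφ (fun E hE => ?_) (fun E _ => hc E)
      (fun y hy l => by rw [hτ y hy, (hψ' y hy).1]) hxF
    have ht := hgt E hE
    subst hE
    refine compat_inverse hF hH (hc E) ?_ ?_
    · rw [hτx]; exact e'
    · rw [hτ _ ht]; exact (hψ' _ ht).1
  rw [hτx] at hs'
  refine ⟨fun a c hac => ?_, hsurj⟩
  obtain ⟨a, rfl⟩ := hs' a
  obtain ⟨c, rfl⟩ := hs' c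
  rw [e', e'] at hac
  rw [hac]

theorem edge_subsingleton {E : G.E} (h : Function.Surjective (F.ρ (G.top E) E (Or.inr rfl)))
    (h' : Subsingleton (F.vert (G.top E))) : Subsingleton (F.edge E) := h.subsingleton

theorem IsBradenMacPherson.subsingleton_edge {w : G.V} (h : F.IsBradenMacPherson w) {E : G.E}
    (hE : ¬ G.top E ≤ w) : Subsingleton (F.edge E) :=
  edge_subsingleton (h.surjective E) (h.support _ hE)

theorem IsBradenMacPherson.isFlabby {w : G.V} (h : F.IsBradenMacPherson w) : F.IsFlabby where
  surjective := h.surjective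
  ker := h.ker
  range x := by
    by_cases hx : x = w
    · subst hx
      -- At the top vertex `w` the definition imposes no condition, but all edges going up from it
      -- lead outside the support and have zero stalk.
      have : ∀ E : UpEdge x, Subsingleton (F.edge E.1) := fun E => h.subsingleton_edge fun hE => by
        have := G.bot_lt_top E.1
        rw [← E.2] at this
        exact this.not_ge hE
      ext p
      exact ⟨fun _ => ⟨0, zero_mem (F.sections _), Subsingleton.elim _ _⟩,
        fun _ => ⟨0, Subsingleton.elim _ _⟩⟩
    · exact h.range x hx
  projective x := by
    by_cases hx : x = w
    · subst hx
      exact h.top.isGradedProjective (symSelf_isGradedProjective k Y)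
    · exact (h.cover x hx).1

theorem isGradedHom_zero {N L : GradedMod (symDeg k Y)} :
    IsGradedHom (0 : N →ₗ[Sym k Y] L) := fun _ _ _ => zero_mem _

/-- Braden–MacPherson sheaves at the same vertex are isomorphic. -/
theorem IsBradenMacPherson.exists_bijective {w : G.V} (hF : F.IsBradenMacPherson w)
    (hH : H.IsBradenMacPherson w) (hfin : {x | x ≤ w}.Finite) :
    ∃ φ : ∀ x, F.vert x →ₗ[Sym k Y] H.vert x, (∀ x, IsGradedHom (φ x)) ∧ (∀ E, Compat φ E) ∧
      ∀ x, Function.Bijective (φ x) := by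
  classical
  obtain ⟨e, he⟩ := hF.top.trans hH.top.symm
  let φ₀ : ∀ x, F.vert x →ₗ[Sym k Y] H.vert x :=
    Function.update (fun x => (0 : F.vert x →ₗ[Sym k Y] H.vert x)) w e.toLinearMap
  have h0 : φ₀ w = e.toLinearMap := Function.update_self ..
  have h0' : ∀ x, x ≠ w → φ₀ x = 0 := fun x hx => Function.update_of_ne hx ..
  have hfin' : {x | x < w}.Finite := hfin.subset fun x hx => le_of_lt hx
  obtain ⟨φ, hφ, hc, hφ'⟩ := hF.isFlabby.exists_extension hH.isFlabby hfin'.toFinset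
    (fun x hx y hy => by
      simp only [Set.Finite.mem_toFinset, Set.mem_ofPred_eq] at hx ⊢
      exact hy.trans_lt hx) φ₀
    (fun x => by
      by_cases hx : x = w
      · subst hx; rw [h0]; exact fun n m => (he n m).1
      · rw [h0' x hx]; exact isGradedHom_zero)
    (fun E hE => by
      simp only [Set.Finite.mem_toFinset, Set.mem_ofPred_eq] at hE
      by_cases hEw : G.bot E = w
      · have : Subsingleton (H.edge E) := hH.subsingleton_edge fun h =>
          (hEw ▸ G.bot_lt_top E).not_ge h
        exact fun _ _ _ => Subsingleton.elim _ _
      · exact hF.isFlabby.compat_of_subsingleton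
          (hF.support _ fun h => hE (lt_of_le_of_ne h hEw)))
  have hw : φ w = e.toLinearMap := by rw [hφ' w (by simp), h0]
  refine ⟨φ, hφ, hc, ?_⟩
  have hout : ∀ x, ¬ x ≤ w → Function.Bijective (φ x) := fun x hx => by
    have h1 := hF.support x hx
    have h2 := hH.support x hx
    exact ⟨fun _ _ _ => Subsingleton.elim _ _, fun l => ⟨0, Subsingleton.elim _ _⟩⟩
  by_contra! hcon
  obtain ⟨x₀, hx₀⟩ := hcon
  -- A maximal vertex at which bijectivity fails cannot be `w`, and elsewhere it contradicts
  -- `bijective_of_forall_gt`.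
  let D := hfin.toFinset.filter fun x => ¬ Function.Bijective (φ x)
  have hD : ∀ x, x ∈ D ↔ x ≤ w ∧ ¬ Function.Bijective (φ x) := fun x => by simp [D]
  have hne : D.Nonempty := ⟨x₀, (hD _).2 ⟨not_not.1 fun h => hx₀ (hout _ h), hx₀⟩⟩
  obtain ⟨x, hxD, hx⟩ := D.exists_maximal hne
  refine ((hD x).1 hxD).2 ?_
  by_cases hxw : x = w
  · subst hxw
    rw [hw]
    exact e.bijective
  · refine bijective_of_forall_gt hF.isFlabby hH.isFlabby hφ hc (fun y hy => ?_)
      (hF.cover x hxw) (hH.cover x hxw)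
    by_contra hyb
    have : y ∈ D := (hD _).2 ⟨not_not.1 fun h => hyb (hout _ h), hyb⟩
    exact (hx this hy.le).not_gt hy

end MomentGraph.Sheaf

end AffineMomentGraph

/-! ## The sheaf of a stalk filtration -/

namespace AffineMomentGraph

open MomentGraph GradedMod

section SheafOf

variable {ι V N : Type u} [AddCommGroup V] [Module ℚ V] [AddCommGroup N] [Module ℚ N]
variable {P : RootPairing ι ℚ V N} [P.IsCrystallographic] {b : P.Base}
variable {k : Type u} [Field k] [Algebra ZHalf k]
variable [Finite ι] [P.IsRootSystem] [P.IsReduced]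
variable {M : GradedMod (degK P k)} {K : AffW P → Submodule (Sym k (AffX P)) M} {w : AffW P}

theorem IsHomog.sup_smul {A 𝔸 : Type u} [CommRing A] [CommRing 𝔸] [Algebra A 𝔸]
    {𝒜 : ℤ → Submodule A 𝔸} {M : GradedMod 𝒜} {K : Submodule 𝔸 M} (hK : M.IsHomog K) {d : ℤ} {a : 𝔸}
    (ha : a ∈ 𝒜 d) : M.IsHomog (K ⊔ LinearMap.range (LinearMap.lsmul 𝔸 M a)) := by
  intro n m hm
  obtain ⟨x, hx, _, ⟨y, rfl⟩, rfl⟩ := Submodule.mem_sup.1 hm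
  rw [map_add]
  refine Submodule.add_mem_sup (hK n x hx) ⟨M.proj (n - d) y, ?_⟩
  exact (M.proj_smul ha n y).symm

/-- The kernel of the map from `M` to the stalk at the edge joining `y` and `s_{i,n} y`. -/
def edgeKer (K : AffW P → Submodule (Sym k (AffX P)) M) (i : ι) (n : ℤ) (y : AffW P) :
    Submodule (Sym k (AffX P)) M :=
  K (refl P i n * y) ⊔ LinearMap.range (LinearMap.lsmul _ M (lin k (affRoot P i n)))

theorem mem_edgeKer {i : ι} {n : ℤ} {y : AffW P} {m : M} : m ∈ edgeKer K i n y ↔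
    ∃ m', m - lin k (affRoot P i n) • m' ∈ K (refl P i n * y) := by
  constructor
  · intro hm
    obtain ⟨x, hx, _, ⟨m', rfl⟩, rfl⟩ := Submodule.mem_sup.1 hm
    exact ⟨m', by rwa [LinearMap.lsmul_apply, add_sub_cancel_right]⟩
  · rintro ⟨m', hm'⟩
    rw [← sub_add_cancel m (lin k (affRoot P i n) • m')]
    exact Submodule.add_mem_sup hm' ⟨m', rfl⟩

theorem length_lt_of_lt {x y : AffW P} (h : (bruhatOrder b).lt x y) : length b x < length b y := by
  rcases BruhatLE.eq_or_length_lt b ((bruhatOrder b).lt_iff_le_not_ge x y |>.1 h).1 with h' | h'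
  · subst h'
    exact absurd h (@lt_irrefl _ (bruhatOrder b).toPreorder x)
  · exact h'


namespace IsStalkFiltration

theorem edgeKer_homog (h : IsStalkFiltration b M K w) (i : ι) (n : ℤ) (y : AffW P) :
    M.restr.IsHomog (edgeKer K i n y) :=
  IsHomog.sup_smul (h.homog _) (lin_mem_symDeg k _ _)

/-- The sheaf with stalks `M / K x`. -/
def sheafOf (h : IsStalkFiltration b M K w) : MomentGraph.Sheaf k (bruhatGraph b) where
  vert x := M.restr.quot (K x) (h.homog x)
  edge E := M.restr.quot (edgeKer K E.1.2.1 E.1.2.2 E.1.1) (h.edgeKer_homog _ _ _)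
  label_smul E q := by
    obtain ⟨m, rfl⟩ := quotMk_surjective _ q
    rw [← map_smul, quotMk_eq_zero]
    exact mem_edgeKer.2 ⟨m, by rw [sub_self]; exact zero_mem _⟩
  ρ x E hx := quotLift (h.homog x) (M.restr.quotMk _ (h.edgeKer_homog _ _ _)) fun m hm => by
    rw [quotMk_eq_zero]
    rcases hx with rfl | rfl
    · exact mem_edgeKer.2 (h.edge _ _ _ (length_lt_of_lt E.2.2) m hm)
    · exact Submodule.mem_sup_left hm
  ρ_graded x E hx := quotLift_graded _ (quotMk_graded _) _

/-- The map from `M` to the stalk at `x`. -/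
def stalkMk (h : IsStalkFiltration b M K w) (x : AffW P) :
    M →ₗ[Sym k (AffX P)] h.sheafOf.vert x := M.restr.quotMk (K x) (h.homog x)

theorem stalkMk_surjective (h : IsStalkFiltration b M K w) (x : AffW P) :
    Function.Surjective (h.stalkMk x) := quotMk_surjective (h.homog x)

theorem stalkMk_mem (h : IsStalkFiltration b M K w) (x : AffW P) {n : ℤ} {m : M} (hm : m ∈ M.deg n) :
    h.stalkMk x m ∈ (h.sheafOf.vert x).deg n := quotMk_graded (M := M.restr) (h.homog x) n m hm

theorem stalkMk_eq_zero (h : IsStalkFiltration b M K w) (x : AffW P) {m : M} :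
    h.stalkMk x m = 0 ↔ m ∈ K x := quotMk_eq_zero (h.homog x)

theorem stalkMk_eq (h : IsStalkFiltration b M K w) (x : AffW P) {m m' : M} :
    h.stalkMk x m = h.stalkMk x m' ↔ m - m' ∈ K x := by
  rw [← sub_eq_zero, ← map_sub, stalkMk_eq_zero]

theorem subsingleton_vert (h : IsStalkFiltration b M K w) {x : AffW P} :
    Subsingleton (h.sheafOf.vert x) ↔ K x = ⊤ := Submodule.Quotient.subsingleton_iff

theorem ρ_stalkMk_eq (h : IsStalkFiltration b M K w) {E : (bruhatGraph b).E} {x x' : AffW P}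
    (hx : (bruhatGraph b).Adj x E) (hx' : (bruhatGraph b).Adj x' E) {m m' : M} :
    h.sheafOf.ρ x E hx (h.stalkMk x m) = h.sheafOf.ρ x' E hx' (h.stalkMk x' m') ↔
      ∃ c, m - m' - lin k (affRoot P E.1.2.1 E.1.2.2) • c ∈ K ((bruhatGraph b).top E) := by
  change M.restr.quotMk _ (h.edgeKer_homog _ _ _) m = M.restr.quotMk _ (h.edgeKer_homog _ _ _) m' ↔ _
  rw [← sub_eq_zero, ← map_sub, quotMk_eq_zero]
  exact mem_edgeKer

/-- Edges of the graph carry only the positive one of the two opposite roots, so a given affine root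
agrees with the label up to sign. -/
theorem exists_edge [P.IsIrreducible] {x : AffW P} {i : ι} {n : ℤ} (hlt : length b x < length b (refl P i n * x)) :
    ∃ E : (bruhatGraph b).E, (bruhatGraph b).bot E = x ∧ (bruhatGraph b).top E = refl P i n * x ∧
      (lin k (affRoot P E.1.2.1 E.1.2.2) = lin k (affRoot P i n) ∨
        lin k (affRoot P E.1.2.1 E.1.2.2) = - lin k (affRoot P i n)) := by
  have hlt' : (bruhatOrder b).lt x (refl P i n * x) :=
    ((bruhatOrder b).lt_iff_le_not_ge _ _).2 ⟨bruhatLE_refl_mul hlt, fun h => by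
      have := BruhatLE.length_le h
      omega⟩
  rcases isPosAff_or b i n with hp | hp
  · exact ⟨⟨(x, i, n), hp, hlt'⟩, rfl, rfl, Or.inl rfl⟩
  · refine ⟨⟨(x, negIdx P i, -n), hp, ?_⟩, rfl, ?_, Or.inr ?_⟩
    · rw [refl_negIdx]; exact hlt'
    · change refl P _ _ * x = _
      rw [refl_negIdx]
    · change lin k (affRoot P (negIdx P i) (-n)) = _
      rw [affRoot_negIdx, lin_neg]

/-- Sections of the sheaf over an upper set come from `M`. -/
theorem exists_of_compatible [P.IsIrreducible] (h : IsStalkFiltration b M K w) {Ω : Set (AffW P)}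
    (hΩ : ∀ x ∈ Ω, ∀ y, BruhatLE b x y → y ∈ Ω)
    (s : (x : Ω) → h.sheafOf.vert x.1)
    (hs : ∀ (E : (bruhatGraph b).E) (h1 : (bruhatGraph b).bot E ∈ Ω)
      (h2 : (bruhatGraph b).top E ∈ Ω),
      h.sheafOf.ρ _ E (Or.inl rfl) (s ⟨_, h1⟩) = h.sheafOf.ρ _ E (Or.inr rfl) (s ⟨_, h2⟩)) :
    ∃ m, ∀ x : Ω, s x = h.stalkMk x.1 m := by
  classical
  -- Descending induction: a global element that is correct outside a finite lower set `A` is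
  -- corrected at a longest vertex of `A`. The `extend` condition provides a correction that
  -- vanishes outside `{≤ x}`, so it keeps what has been achieved.
  have key : ∀ (n : ℕ) (A : Finset (AffW P)), A.card = n →
      (∀ x ∈ A, ∀ y, BruhatLE b y x → y ∈ A) → (∃ m, ∀ x : Ω, x.1 ∉ A → s x = h.stalkMk x.1 m) →
      ∃ m, ∀ x : Ω, s x = h.stalkMk x.1 m := by
    intro n
    induction n with
    | zero =>
      rintro A hA - ⟨m, hm⟩
      rw [Finset.card_eq_zero] at hA
      exact ⟨m, fun x => hm x (by simp [hA])⟩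
    | succ n ih =>
      rintro A hA hlow ⟨m, hm⟩
      have hne : A.Nonempty := Finset.card_pos.1 (by omega)
      obtain ⟨x, hxA, hx⟩ := A.exists_max_image (length b) hne
      refine ih (A.erase x) (by rw [Finset.card_erase_of_mem hxA]; omega) (fun y hy z hz => ?_) ?_
      · obtain ⟨hyx, hyA⟩ := Finset.mem_erase.1 hy
        refine Finset.mem_erase.2 ⟨fun hzx => ?_, hlow y hyA z hz⟩
        subst hzx
        rcases BruhatLE.eq_or_length_lt b hz with h1 | h1
        · exact hyx h1.symm
        · exact absurd (hx y hyA) (by omega)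
      by_cases hxΩ : x ∈ Ω
      swap
      · exact ⟨m, fun y hy => hm y fun hyA => hy (Finset.mem_erase.2 ⟨fun h' => hxΩ (h' ▸ y.2), hyA⟩)⟩
      obtain ⟨c, hc⟩ := h.stalkMk_surjective x (s ⟨x, hxΩ⟩)
      obtain ⟨m', h1, h2⟩ := h.extend x (c - m) fun i n hlt => by
        obtain ⟨E, hE, hE', hl⟩ := exists_edge (k := k) hlt
        have ht : (bruhatGraph b).top E ∈ Ω := by
          rw [hE']
          exact hΩ x hxΩ _ (bruhatLE_refl_mul hlt)
        have ht' : (bruhatGraph b).top E ∉ A := fun hA' => by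
          have := hx _ hA'
          rw [hE'] at this
          omega
        subst hE
        have h3 := hs E hxΩ ht
        rw [← hc, hm ⟨_, ht⟩ ht', ρ_stalkMk_eq] at h3
        obtain ⟨c', hc'⟩ := h3
        rw [hE'] at hc'
        rcases hl with hl | hl
        · exact ⟨c', by rwa [hl] at hc'⟩
        · exact ⟨-c', by rwa [hl, neg_smul, ← smul_neg] at hc'⟩
      refine ⟨m + m', fun y hy => ?_⟩
      by_cases hyx : y.1 = x
      · obtain ⟨y, hyΩ⟩ := y
        subst hyx
        rw [← hc, stalkMk_eq]
        rwa [sub_sub] at h1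
      · have hyA : y.1 ∉ A := fun hyA => hy (Finset.mem_erase.2 ⟨hyx, hyA⟩)
        rw [hm y hyA, map_add, (h.stalkMk_eq_zero _).2 (h2 _ fun hle => hyA (hlow x hxA _ hle)),
          add_zero]
  refine key _ (finite_bruhatLE (b := b) w).toFinset rfl (fun x hx y hy => ?_) ⟨0, fun x hx => ?_⟩
  · simp only [Set.Finite.mem_toFinset] at hx ⊢
    exact hy.trans hx
  · have : Subsingleton (h.sheafOf.vert x.1) := h.subsingleton_vert.2 (h.support _ (by simpa using hx))
    exact Subsingleton.elim _ _

theorem stalkMk_mem_sections (h : IsStalkFiltration b M K w) (Ω : Set (AffW P)) (m : M) :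
    (fun x : Ω => h.stalkMk x.1 m) ∈ h.sheafOf.sections Ω := by
  refine ⟨?_, fun E _ _ => (h.ρ_stalkMk_eq _ _).2 ⟨0, by
    rw [sub_self, smul_zero, sub_self]; exact zero_mem _⟩⟩
  induction m using M.induction with
  | h n m hm =>
    exact (le_iSup (h.sheafOf.homog Ω) n) (h.sheafOf.mem_homog.2 fun x => h.stalkMk_mem _ hm)
  | hadd x y hx hy =>
    have e : (fun v : Ω => h.stalkMk v.1 (x + y)) =
        (fun v : Ω => h.stalkMk v.1 x) + fun v : Ω => h.stalkMk v.1 y :=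
      funext fun v => map_add _ _ _
    rw [e]
    exact add_mem hx hy

theorem isFlabby_sheafOf [P.IsIrreducible] (h : IsStalkFiltration b M K w) : h.sheafOf.IsFlabby where
  surjective E q := by
    obtain ⟨m, rfl⟩ := quotMk_surjective (h.edgeKer_homog _ _ _) q
    exact ⟨h.stalkMk _ m, rfl⟩
  ker E q := by
    obtain ⟨m, rfl⟩ := h.stalkMk_surjective _ q
    have h1 := h.ρ_stalkMk_eq (E := E) (x := (bruhatGraph b).top E)
      (x' := (bruhatGraph b).top E) (Or.inr rfl) (Or.inr rfl) (m := m) (m' := 0)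
    rw [map_zero, map_zero, sub_zero] at h1
    rw [h1]
    constructor
    · rintro ⟨c, hc⟩
      exact ⟨h.stalkMk _ c, by rw [← map_smul, stalkMk_eq]; exact hc⟩
    · rintro ⟨c, hc⟩
      obtain ⟨c, rfl⟩ := h.stalkMk_surjective _ c
      exact ⟨c, by rw [← map_smul, stalkMk_eq] at hc; exact hc⟩
  range x := by
    ext p
    rw [Sheaf.mem_upImage]
    constructor
    · rintro ⟨q, rfl⟩
      obtain ⟨m, rfl⟩ := h.stalkMk_surjective x q
      exact ⟨_, h.stalkMk_mem_sections _ m, fun E hE hE' => rfl⟩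
    · rintro ⟨s, hs, hp⟩
      obtain ⟨m, hm⟩ := h.exists_of_compatible (Ω := {y | (bruhatOrder b).lt x y})
        (fun y hy z hz => @lt_of_lt_of_le _ (bruhatOrder b).toPreorder _ _ _ hy hz) s hs.2
      refine ⟨h.stalkMk x m, funext fun E => ?_⟩
      have hlt : (bruhatOrder b).lt x ((bruhatGraph b).top E.1) := by
        have := (bruhatGraph b).bot_lt_top E.1
        rw [← E.2] at this
        exact this
      rw [hp E.1 E.2 hlt, hm]
      rfl
  projective := h.projective

/-- The global sections of the sheaf. -/
theorem iso_globalSections [P.IsIrreducible] (h : IsStalkFiltration b M K w) : M.Iso (globalSections h.sheafOf) := by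
  let f : M →ₗ[StructK P k] globalSections h.sheafOf :=
    { toFun := fun m => ⟨_, h.stalkMk_mem_sections Set.univ m⟩
      map_add' := fun m m' => Subtype.ext <| funext fun x => map_add _ _ _
      map_smul' := fun z m => Subtype.ext <| funext fun x => by
        change h.stalkMk x.1 (z • m) = ev P k x.1 z • h.stalkMk x.1 m
        rw [← map_smul, stalkMk_eq]
        exact h.sub_ev_smul_mem _ _ _ }
  have hf : IsGradedHom f := fun n m hm => (h.sheafOf.mem_sectionsDeg).2 fun x => h.stalkMk_mem _ hm
  refine iso_of_bijective hf ⟨(injective_iff_map_eq_zero _).2 fun m hm => ?_, fun s => ?_⟩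
  · refine h.inf m fun x => (h.stalkMk_eq_zero x).1 ?_
    exact congrFun (congrArg Subtype.val hm) ⟨x, trivial⟩
  · obtain ⟨m, hm⟩ := h.exists_of_compatible (Ω := Set.univ) (fun _ _ _ _ => trivial) s.1 s.2.2
    exact ⟨m, Subtype.ext <| funext fun x => (hm x).symm⟩

end IsStalkFiltration

end SheafOf
end AffineMomentGraph

/-! ## Free direct summands of graded projective modules -/

namespace AffineMomentGraph

open MomentGraph GradedMod

section Split

variable {k Y : Type u} [Field k] [AddCommGroup Y]

theorem algebraMapInv_eq_zero {d : ℤ} (hd : d ≠ 0) {f : Sym k Y} (hf : f ∈ symDeg k Y d) :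
    SymmetricAlgebra.algebraMapInv f = 0 := by
  rw [mem_symDeg_iff] at hf
  rcases hf with rfl | ⟨n, rfl, hf⟩
  · rw [map_zero]
  obtain ⟨n, rfl⟩ : ∃ m, n = m + 1 := ⟨n - 1, by omega⟩
  rw [pow_succ] at hf
  induction hf using Submodule.mul_induction_on' with
  | mem_mul_mem x _ y hy =>
    obtain ⟨y, rfl⟩ := hy
    rw [map_mul, SymmetricAlgebra.algebraMapInv_ι, mul_zero]
  | add x _ y _ hx hy => rw [map_add, hx, hy, add_zero]

theorem exists_algebraMap_of_mem {f : Sym k Y} (hf : f ∈ symDeg k Y 0) :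
    f = algebraMap k _ (SymmetricAlgebra.algebraMapInv f) := by
  rw [mem_symDeg_iff] at hf
  rcases hf with rfl | ⟨n, hn, hf⟩
  · rw [map_zero, map_zero]
  · obtain rfl : n = 0 := by omega
    rw [pow_zero, Submodule.mem_one] at hf
    obtain ⟨c, rfl⟩ := hf
    rw [SymmetricAlgebra.algebraMap_leftInverse]

variable (k Y) in
/-- The augmentation of the symmetric algebra. -/
def symAug : symSelf k Y →+ k :=
  ((SymmetricAlgebra.algebraMapInv : Sym k Y →ₐ[k] k) : Sym k Y →+ k)

theorem symAug_proj (n : ℤ) (l : symSelf k Y) :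
    symAug k Y ((symSelf k Y).proj n l) = if n = 0 then symAug k Y l else 0 := by
  induction l using (symSelf k Y).induction with
  | h e l hl =>
    have h1 : e ≠ 0 → symAug k Y l = 0 := fun he => algebraMapInv_eq_zero he hl
    rw [(symSelf k Y).proj_of_mem hl]
    split_ifs with h h' h'
    · rfl
    · exact h1 (h ▸ h')
    · rw [map_zero, h1 (h' ▸ Ne.symm h)]
    · rw [map_zero]
  | hadd x y hx hy =>
    rw [map_add, map_add, hx, hy, map_add]
    split_ifs
    · rfl
    · rw [add_zero]

/-- A graded projective module which is bounded below and equal to `A + R` with `A` proper has a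
free direct summand of rank one with generator in `R`. -/
theorem exists_free_summand {N : GradedMod (symDeg k Y)} (hN : N.IsGradedProjective)
    (hbdd : ∃ d₀, ∀ d < d₀, ∀ m ∈ N.deg d, m = 0) {A R : Submodule (Sym k Y) N}
    (hA : N.IsHomog A) (hR : N.IsHomog R) (hAR : A ⊔ R = ⊤) (hne : A ≠ ⊤) :
    ∃ d, ∃ r ∈ N.deg d, r ∈ R ∧ ∃ φ : N →ₗ[Sym k Y] Sym k Y, φ r = 1 ∧
      ∀ n, ∀ m ∈ N.deg n, φ m ∈ symDeg k Y (n - d) := by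
  obtain ⟨d₀, hd₀⟩ := hbdd
  -- A lowest degree `d` in which `A` is proper exists because `N` is bounded below. In this degree
  -- `R` contains an element `r` outside `A`.
  have hex : ∃ n : ℕ, ∃ m ∈ N.deg (d₀ + n), m ∉ A := by
    by_contra! hcon
    refine hne (eq_top_iff.2 fun m _ => ?_)
    induction m using N.induction with
    | h n m hm =>
      by_cases h : n < d₀
      · rw [hd₀ n h m hm]; exact zero_mem _
      · exact hcon (n - d₀).toNat m (by rwa [show d₀ + ((n - d₀).toNat : ℤ) = n by omega])
    | hadd x y hx hy => exact add_mem (hx trivial) (hy trivial)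
  classical
  obtain ⟨v, hv, hvA⟩ := Nat.find_spec hex
  set d := d₀ + (Nat.find hex : ℤ) with hd
  have hlow : ∀ e < d, ∀ m ∈ N.deg e, m ∈ A := fun e he m hm => by
    by_cases h : e < d₀
    · rw [hd₀ e h m hm]; exact zero_mem _
    · have := Nat.find_min hex (m := (e - d₀).toNat) (by omega)
      push Not at this
      exact this m (by rwa [show d₀ + ((e - d₀).toNat : ℤ) = e by omega])
  obtain ⟨r, hr, hrR, hrA⟩ : ∃ r ∈ N.deg d, r ∈ R ∧ r ∉ A := by
    obtain ⟨a, ha, r, hr, e⟩ := Submodule.mem_sup.1 (show v ∈ A ⊔ R from hAR ▸ Submodule.mem_top)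
    refine ⟨N.proj d r, N.proj_mem d r, hR d r hr, fun h => hvA ?_⟩
    rw [← N.proj_same hv, ← e, map_add]
    exact add_mem (hA d a ha) h
  let _ : Module k N := Module.compHom N (algebraMap k (Sym k Y))
  have hks : ∀ (c : k) (m : N), algebraMap k (Sym k Y) c • m = c • m := fun _ _ => rfl
  let A' : Submodule k N :=
    { A.toAddSubmonoid with smul_mem' := fun c m hm => A.smul_mem (algebraMap k (Sym k Y) c) hm }
  obtain ⟨g, hg, hgA⟩ := Submodule.exists_le_ker_of_notMem (p := A') (v := r) hrA
  have hgA' : ∀ m ∈ A, g m = 0 := fun m hm => hgA hm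
  -- Elements of positive degree move lower components, which lie in `A`, into degree `d`, and `g`
  -- vanishes on `A`. So `g` on the component of degree `d` is linear through the augmentation.
  have key : ∀ (a : Sym k Y) (m : N), g (N.proj d (a • m)) =
      SymmetricAlgebra.algebraMapInv a * g (N.proj d m) := by
    intro a m
    induction mem_iSup_symDeg k Y a using Submodule.iSup_induction' with
    | zero => simp
    | add x y _ _ hx hy => rw [add_smul, map_add, map_add, hx, hy, map_add, add_mul]
    | mem e a ha =>
      rw [N.proj_smul ha]
      by_cases he : e = 0
      · subst he
        rw [exists_algebraMap_of_mem ha, hks, map_smul, SymmetricAlgebra.algebraMap_leftInverse,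
          sub_zero, smul_eq_mul]
      · rw [algebraMapInv_eq_zero he ha, zero_mul]
        rw [mem_symDeg_iff] at ha
        rcases ha with rfl | ⟨n, rfl, -⟩
        · rw [zero_smul, map_zero]
        · exact hgA' _ (A.smul_mem _ (hlow _ (by omega) _ (N.proj_mem _ _)))
  -- Projectivity lifts the normalised functional from `k` to the symmetric algebra. The lift takes
  -- `r` to an element of degree `0` with augmentation `1`, that is, to `1`.
  obtain ⟨φ, hφ, hR⟩ := hN.exists_of_relation (L := (symSelf k Y).shift (-d))
    (fun m l => symAug k Y l = (g r)⁻¹ * g (N.proj d m))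
    (fun m => ⟨algebraMap k (Sym k Y) ((g r)⁻¹ * g (N.proj d m)),
      SymmetricAlgebra.algebraMap_leftInverse _ _⟩)
    (fun m m' (l l' : Sym k Y) h h' => by
      refine ((symAug k Y).map_add l l').trans ?_
      rw [map_add, map_add, mul_add]
      exact congrArg₂ (· + ·) h h')
    (fun a m (l : Sym k Y) h => by
      refine (map_mul (SymmetricAlgebra.algebraMapInv : Sym k Y →ₐ[k] k) a l).trans ?_
      rw [key, mul_left_comm]
      exact congrArg (SymmetricAlgebra.algebraMapInv a * ·) h)
    (fun n m (l : Sym k Y) h => by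
      refine (congrArg (symAug k Y) (shift_proj _ _ _ _)).trans ((symAug_proj _ _).trans ?_)
      by_cases hnd : n = d
      · rw [if_pos (by omega)]
        refine Eq.trans h ?_
        rw [hnd, N.proj_same (N.proj_mem _ m)]
      · rw [if_neg (by omega), N.proj_ne (Ne.symm hnd) (N.proj_mem _ m), map_zero, mul_zero])
  have h1 : φ r ∈ symDeg k Y 0 := by
    have := hφ d r hr
    change φ r ∈ symDeg k Y (d + -d) at this
    rwa [add_neg_cancel] at this
  refine ⟨d, r, hr, hrR, φ, ?_, fun n m hm => ?_⟩
  · have h2 := hR r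
    rw [N.proj_same hr, inv_mul_cancel₀ hg] at h2
    refine (exists_algebraMap_of_mem h1).trans ?_
    exact (congrArg (algebraMap k (Sym k Y)) h2).trans (map_one _)
  · rw [sub_eq_add_neg]
    exact hφ n m hm

end Split

end AffineMomentGraph

/-! ## Fitting decompositions and global sections -/

namespace AffineMomentGraph

open MomentGraph GradedMod

section Fitting

open Polynomial

variable {ι V N : Type u} [AddCommGroup V] [Module ℚ V] [AddCommGroup N] [Module ℚ N]
variable {P : RootPairing ι ℚ V N} [P.IsCrystallographic]
variable {k : Type u} [Field k] [Algebra ZHalf k]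
variable {M : GradedMod (degK P k)}

instance : IsScalarTower k (StructK P k) M where
  smul_assoc c z m := by rw [← field_smul_def, smul_smul, Algebra.smul_def]

instance : SMulCommClass (StructK P k) k M where
  smul_comm z c m := by rw [← field_smul_def, ← field_smul_def, smul_smul, smul_smul, mul_comm]

variable [Finite ι] [P.IsRootSystem] [P.IsReduced]

theorem field_smul_mem {n : ℤ} {m : M} (c : k) (hm : m ∈ M.deg n) : c • m ∈ M.deg n := by
  have := M.smul_mem (Submodule.smul_mem _ c (one_mem_degK (P := P) (k := k))) hm
  rwa [zero_add, smul_assoc, one_smul] at this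

theorem isGradedHom_pow {Φ : Module.End (StructK P k) M} (hΦ : IsGradedHom Φ) (n : ℕ) :
    IsGradedHom (Φ ^ n) := by
  induction n with
  | zero => exact isGradedHom_id
  | succ n ih => rw [pow_succ]; exact ih.comp hΦ

theorem isGradedHom_aeval {Φ : Module.End (StructK P k) M} (hΦ : IsGradedHom Φ) (p : k[X]) :
    IsGradedHom (aeval Φ p) := by
  induction p using Polynomial.induction_on' with
  | add p q hp hq => rw [map_add]; exact hp.add hq
  | monomial n c =>
    rw [aeval_monomial]
    exact fun d m hm => field_smul_mem c (isGradedHom_pow hΦ n d m hm)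

/-- Graded endomorphisms of a finitely generated module with finite-dimensional components are
algebraic. -/
theorem exists_aeval_eq_zero (hfin : ∀ d, ∃ W : Submodule k M, W.FG ∧ ∀ m ∈ M.deg d, m ∈ W)
    (hgen : ∃ T : Finset ℤ, Submodule.span (Sym k (AffX P)) {m : M | ∃ d ∈ T, m ∈ M.deg d} = ⊤)
    {Φ : Module.End (StructK P k) M} (hΦ : IsGradedHom Φ) : ∃ p : k[X], p ≠ 0 ∧ aeval Φ p = 0 := by
  obtain ⟨T, hT⟩ := hgen
  choose W hW hW' using hfin
  -- A finite-dimensional subspace that is stable under `Φ` and generates `M`. The characteristic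
  -- polynomial of `Φ` on it annihilates `M` by Cayley–Hamilton.
  let V : Submodule k M := Submodule.span k {m : M | ∃ d ∈ T, m ∈ M.deg d}
  have hV : V ≤ ⨆ d ∈ T, W d := Submodule.span_le.2 fun m ⟨d, hd, hm⟩ =>
    (le_iSup₂ (f := fun d (_ : d ∈ T) => W d) d hd) (hW' d m hm)
  have hWfg : (⨆ d ∈ T, W d).FG := Submodule.fg_biSup T W fun d _ => hW d
  have : Module.Finite k ↥(⨆ d ∈ T, W d) := Module.Finite.iff_fg.2 hWfg
  have : Module.Finite k V := Submodule.finiteDimensional_of_le hV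
  have hinv : ∀ m ∈ V, (Φ.restrictScalars k) m ∈ V := fun m hm => by
    induction hm using Submodule.span_induction with
    | zero => rw [map_zero]; exact zero_mem _
    | add x y _ _ hx hy => rw [map_add]; exact add_mem hx hy
    | smul a x _ hx => rw [map_smul]; exact V.smul_mem a hx
    | mem x hx =>
      obtain ⟨d, hd, hx⟩ := hx
      exact Submodule.subset_span ⟨d, hd, hΦ d x hx⟩
  let f : Module.End k V := (Φ.restrictScalars k).restrict hinv
  have hpow : ∀ (n : ℕ) (v : V), (Φ ^ n) (v : M) = ((f ^ n) v : M) := fun n => by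
    induction n with
    | zero => exact fun v => rfl
    | succ n ih =>
      intro v
      rw [pow_succ, pow_succ, Module.End.mul_apply, Module.End.mul_apply, ← ih]
      rfl
  have hev : ∀ (p : k[X]) (v : V), aeval Φ p (v : M) = (aeval f p v : M) := fun p v => by
    induction p using Polynomial.induction_on' with
    | add p q hp hq =>
      rw [map_add, map_add, LinearMap.add_apply, hp, hq]
      rfl
    | monomial n c =>
      rw [aeval_monomial, aeval_monomial]
      exact congrArg (c • ·) (hpow n v)
  refine ⟨f.charpoly, f.charpoly_monic.ne_zero, LinearMap.ext fun m => ?_⟩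
  have hm : m ∈ Submodule.span (Sym k (AffX P)) {m : M | ∃ d ∈ T, m ∈ M.deg d} :=
    hT ▸ Submodule.mem_top
  change resHom (aeval Φ f.charpoly) m = 0
  induction hm using Submodule.span_induction with
  | zero => rw [map_zero]
  | add x y _ _ hx hy => rw [map_add, hx, hy, add_zero]
  | smul a x _ hx => rw [map_smul, hx, smul_zero]
  | mem x hx =>
    refine (hev f.charpoly ⟨x, Submodule.subset_span hx⟩).trans ?_
    rw [LinearMap.aeval_self_charpoly]
    rfl

/-- Fitting's lemma. -/
theorem nilpotent_or_bijective
    (hfin : ∀ d, ∃ W : Submodule k M, W.FG ∧ ∀ m ∈ M.deg d, m ∈ W)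
    (hgen : ∃ T : Finset ℤ, Submodule.span (Sym k (AffX P)) {m : M | ∃ d ∈ T, m ∈ M.deg d} = ⊤)
    (hidem : ∀ e : Module.End (StructK P k) M, IsGradedHom e → e * e = e → e = 0 ∨ e = 1)
    {Φ : Module.End (StructK P k) M} (hΦ : IsGradedHom Φ) :
    (∃ n, Φ ^ n = 0) ∨ Function.Bijective Φ := by
  obtain ⟨p, hp, hpΦ⟩ := exists_aeval_eq_zero hfin hgen hΦ
  obtain ⟨q, hq, hXq⟩ := p.exists_eq_pow_rootMultiplicity_mul_and_not_dvd hp 0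
  rw [C_0, sub_zero] at hq hXq
  generalize p.rootMultiplicity 0 = n at hq
  -- The exponent `n + 1` instead of `n` keeps a factor `X` even when `n = 0`: if the idempotent `a
  -- X^{n+1}` acts as `1`, then `a X^n` provides the inverse of `Φ`.
  have hcop : IsCoprime (X ^ (n + 1)) q :=
    ((irreducible_X (R := k)).coprime_iff_not_dvd.2 hXq).pow_left
  obtain ⟨a, c, hac⟩ := hcop
  have hz : aeval Φ (X ^ (n + 1) * q) = 0 := by
    rw [pow_succ', mul_assoc, ← hq, map_mul, hpΦ, mul_zero]
  have hid : aeval Φ (a * X ^ (n + 1)) * aeval Φ (a * X ^ (n + 1)) = aeval Φ (a * X ^ (n + 1)) := by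
    rw [← map_mul, ← sub_eq_zero, ← map_sub]
    have : a * X ^ (n + 1) * (a * X ^ (n + 1)) - a * X ^ (n + 1) =
        -(a * c) * (X ^ (n + 1) * q) := by
      linear_combination (a * X ^ (n + 1)) * hac
    rw [this, map_mul, hz, mul_zero]
  rcases hidem _ (isGradedHom_aeval hΦ _) hid with h0 | h1
  · refine Or.inl ⟨n + 1, ?_⟩
    have : X ^ (n + 1) = X ^ (n + 1) * (a * X ^ (n + 1)) + c * (X ^ (n + 1) * q) := by
      linear_combination -(X ^ (n + 1)) * hac
    rw [← aeval_X_pow (R := k), this, map_add, map_mul _ _ (a * X ^ (n + 1)), h0, map_mul _ c,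
      hz, mul_zero, mul_zero, add_zero]
  · right
    have h2 : aeval Φ (a * X ^ n) * Φ = 1 := by
      rw [← h1, pow_succ, ← mul_assoc, map_mul _ (a * X ^ n), aeval_X]
    have h3 : Φ * aeval Φ (a * X ^ n) = 1 := by
      rw [← h1, pow_succ, ← mul_assoc, mul_comm (a * X ^ n), map_mul _ X, aeval_X]
    exact Function.bijective_iff_has_inverse.2 ⟨aeval Φ (a * X ^ n), DFunLike.congr_fun h2,
      DFunLike.congr_fun h3⟩

end Fitting

/-! ### Isomorphic flabby sheaves have isomorphic global sections. -/

section GlobalSections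

variable {ι V N : Type u} [AddCommGroup V] [Module ℚ V] [AddCommGroup N] [Module ℚ N]
variable {P : RootPairing ι ℚ V N} [P.IsCrystallographic] {b : P.Base}
variable {k : Type u} [Field k] [Algebra ZHalf k]

theorem globalSections_iso {F H : MomentGraph.Sheaf k (bruhatGraph b)}
    (hF : F.IsFlabby) (hH : H.IsFlabby)
    {φ : ∀ x, F.vert x →ₗ[Sym k (AffX P)] H.vert x} (hφ : ∀ x, IsGradedHom (φ x))
    (hc : ∀ E, Sheaf.Compat φ E) (hbij : ∀ x, Function.Bijective (φ x)) :
    (globalSections F).Iso (globalSections H) := by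
  have h1 : ∀ x, ∃ g : H.vert x →ₗ[Sym k (AffX P)] F.vert x, IsGradedHom g ∧
      (∀ m, g (φ x m) = m) ∧ ∀ l, φ x (g l) = l := fun x => (hφ x).exists_inverse (hbij x)
  choose ψ hψ hψ' using h1
  have hc' : ∀ E, Sheaf.Compat ψ E := fun E =>
    Sheaf.compat_inverse hF hH (hc E) (hψ' _).2 (hψ' _).1
  let f : globalSections F →ₗ[StructK P k] globalSections H :=
    { toFun := fun m => ⟨_, Sheaf.map_mem_sections hφ (fun E _ => hc E) m.2⟩
      map_add' := fun m m' => Subtype.ext <| funext fun x => map_add _ _ _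
      map_smul' := fun z m => Subtype.ext <| funext fun x => (φ x.1).map_smul _ _ }
  have hf : IsGradedHom f := fun n m hm => H.mem_sectionsDeg.2 fun x =>
    hφ x.1 n _ (F.mem_sectionsDeg.1 hm x)
  refine iso_of_bijective hf (Function.bijective_iff_has_inverse.2
    ⟨fun m => ⟨_, Sheaf.map_mem_sections hψ (fun E _ => hc' E) m.2⟩, fun m => ?_, fun m => ?_⟩)
  · exact Subtype.ext <| funext fun x => (hψ' x.1).1 _
  · exact Subtype.ext <| funext fun x => (hψ' x.1).2 _

end GlobalSections

end AffineMomentGraph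

/-! ## Indecomposable modules -/

namespace AffineMomentGraph

open MomentGraph GradedMod

section Indecomposable

variable {ι V N : Type u} [AddCommGroup V] [Module ℚ V] [AddCommGroup N] [Module ℚ N]
variable {P : RootPairing ι ℚ V N} [P.IsCrystallographic] {b : P.Base}
variable {k : Type u} [Field k] [Algebra ZHalf k]
variable [Finite ι] [P.IsRootSystem] [P.IsReduced] [P.IsIrreducible]
variable {M : GradedMod (degK P k)} {K : AffW P → Submodule (Sym k (AffX P)) M} {w : AffW P}

/-- The only graded idempotent endomorphisms are `0` and `1`. -/
def HasTrivialIdempotents (M : GradedMod (degK P k)) : Prop :=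
  ∀ e : Module.End (StructK P k) M, IsGradedHom e → e * e = e → e = 0 ∨ e = 1

namespace IsStalkFiltration

/-- Endomorphisms of the sheaf come from endomorphisms of `M`. -/
theorem exists_end (h : IsStalkFiltration b M K w)
    {Ψ : ∀ x, h.sheafOf.vert x →ₗ[Sym k (AffX P)] h.sheafOf.vert x} (hΨ : ∀ x, IsGradedHom (Ψ x))
    (hc : ∀ E, Sheaf.Compat Ψ E) :
    ∃ Φ : Module.End (StructK P k) M, IsGradedHom Φ ∧
      ∀ x m, h.stalkMk x (Φ m) = Ψ x (h.stalkMk x m) := by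
  have h1 : ∀ m, ∃ m', ∀ x, h.stalkMk x m' = Ψ x (h.stalkMk x m) := fun m => by
    obtain ⟨m', hm'⟩ := h.exists_of_compatible (Ω := Set.univ) (fun _ _ _ _ => trivial)
      (fun x => Ψ x.1 (h.stalkMk x.1 m))
      (fun E h1 h2 => hc E _ _ ((h.stalkMk_mem_sections Set.univ m).2 E h1 h2))
    exact ⟨m', fun x => (hm' ⟨x, trivial⟩).symm⟩
  have hext : ∀ m m', (∀ x, h.stalkMk x m = h.stalkMk x m') → m = m' := fun m m' hm => by
    rw [← sub_eq_zero]
    exact h.inf _ fun x => (h.stalkMk_eq x).1 (hm x)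
  have hz : ∀ x (z : StructK P k) m, h.stalkMk x (z • m) = ev P k x z • h.stalkMk x m :=
    fun x z m => by
      rw [← map_smul, stalkMk_eq]
      exact h.sub_ev_smul_mem _ _ _
  choose c hcm using h1
  refine ⟨{ toFun := c
            map_add' := fun m m' => hext _ _ fun x => by rw [map_add, hcm, hcm, hcm, map_add, map_add]
            map_smul' := fun z m => hext _ _ fun x => by
              rw [RingHom.id_apply, hcm, hz, hz, hcm, map_smul] }, fun n m hm => ?_, fun x m => hcm m x⟩
  change c m ∈ M.deg n
  have : M.proj n (c m) = c m := hext _ _ fun x => by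
    have h2 : h.stalkMk x (M.proj n (c m)) = (h.sheafOf.vert x).proj n (h.stalkMk x (c m)) :=
      map_proj (M := M.restr) (quotMk_graded (h.homog x)) n (c m)
    rw [h2, hcm, ← map_proj (hΨ x), (h.sheafOf.vert x).proj_same (h.stalkMk_mem x hm)]
  rw [← this]
  exact M.proj_mem n _

theorem ker_ρδ_homog {F : Sheaf k (bruhatGraph b)} (x : AffW P) :
    (F.vert x).IsHomog (LinearMap.ker (F.ρδ x)) := fun n m hm => by
  rw [LinearMap.mem_ker] at hm ⊢
  funext E
  refine (map_proj (F.ρ_graded x E.1 (Or.inl E.2)) n m).trans ?_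
  rw [show F.ρ x E.1 (Or.inl E.2) m = 0 from congrFun hm E, map_zero]
  rfl

/-- If the stalk at `y` is not a projective cover, then it is free of rank one and the sheaf is
supported below `y`. -/
theorem of_not_cover (h : IsStalkFiltration b M K w) (hM : HasTrivialIdempotents M) {y : AffW P}
    {A : Submodule (Sym k (AffX P)) (h.sheafOf.vert y)} (hA : (h.sheafOf.vert y).IsHomog A)
    (hsup : A ⊔ LinearMap.ker (h.sheafOf.ρδ y) = ⊤) (hne : A ≠ ⊤) :
    (∀ z, ¬ BruhatLE b z y → K z = ⊤) ∧ ∃ d, ∃ e : h.sheafOf.vert y ≃ₗ[Sym k (AffX P)] Sym k (AffX P),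
      ∀ n m, m ∈ (h.sheafOf.vert y).deg n ↔ e m ∈ symDeg k (AffX P) (n - d) := by
  classical
  have hbdd : ∃ d₀, ∀ d < d₀, ∀ m ∈ (h.sheafOf.vert y).deg d, m = 0 := by
    obtain ⟨d₀, h0⟩ := h.bddBelow
    refine ⟨d₀, ?_⟩
    rintro d hd _ ⟨m, hm, rfl⟩
    rw [h0 d hd m hm, map_zero]
    rfl
  obtain ⟨d, r, hr, hrR, φ, hφr, hφ⟩ := exists_free_summand
    (h.isFlabby_sheafOf.projective y) hbdd hA (ker_ρδ_homog y) hsup hne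
  -- The projection to the free summand generated by `r`. Its image lies in the kernel of the
  -- boundary map, so at `y` it is compatible with zero maps at all vertices not below `y`, and it
  -- extends downwards.
  let ψ : h.sheafOf.vert y →ₗ[Sym k (AffX P)] h.sheafOf.vert y :=
    (LinearMap.toSpanSingleton _ _ r).comp φ
  have hψ : ∀ m, ψ m = φ m • r := fun m => rfl
  have hψg : IsGradedHom ψ := fun n m hm => by
    have := (h.sheafOf.vert y).smul_mem (hφ n m hm) hr
    rwa [sub_add_cancel] at this
  let Ψ₀ : ∀ x, h.sheafOf.vert x →ₗ[Sym k (AffX P)] h.sheafOf.vert x :=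
    Function.update (fun x => (0 : h.sheafOf.vert x →ₗ[Sym k (AffX P)] h.sheafOf.vert x)) y ψ
  have hy : Ψ₀ y = ψ := Function.update_self ..
  have hy' : ∀ x, x ≠ y → Ψ₀ x = 0 := fun x hx => Function.update_of_ne hx ..
  have hfin : {x | BruhatLE b x y ∧ x ≠ y}.Finite := (finite_bruhatLE (b := b) y).subset fun x hx => hx.1
  obtain ⟨Ψ, hΨ, hΨc, hΨ₀⟩ := h.isFlabby_sheafOf.exists_extension h.isFlabby_sheafOf hfin.toFinset
    (fun x hx z hz => by
      simp only [Set.Finite.mem_toFinset, Set.mem_ofPred_eq] at hx ⊢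
      refine ⟨BruhatLE.trans hz hx.1, fun h' => hx.2 ?_⟩
      subst h'
      exact hx.1.antisymm hz) Ψ₀
    (fun x => by
      by_cases hx : x = y
      · subst hx; rw [hy]; exact hψg
      · rw [hy' x hx]; exact Sheaf.isGradedHom_zero)
    (fun E hE m n hmn => by
      have hlt := (bruhatGraph b).bot_lt_top E
      have ht : (bruhatGraph b).top E ≠ y := fun h' => hE (by
        simp only [Set.Finite.mem_toFinset, Set.mem_ofPred_eq]
        rw [← h']
        exact ⟨((bruhatOrder b).lt_iff_le_not_ge _ _ |>.1 hlt).1, fun h'' =>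
          (length_lt_of_lt hlt).ne (congrArg (length b) h'')⟩)
      rw [hy' _ ht, LinearMap.zero_apply, map_zero]
      by_cases hb : (bruhatGraph b).bot E = y
      · subst hb
        rw [hy, hψ, map_smul]
        have : h.sheafOf.ρ _ E (Or.inl rfl) r = 0 := congrFun (LinearMap.mem_ker.1 hrR) ⟨E, rfl⟩
        rw [this, smul_zero]
      · rw [hy' _ hb, LinearMap.zero_apply, map_zero])
  have hyA : y ∉ hfin.toFinset := by simp
  have hzA : ∀ z, ¬ BruhatLE b z y → Ψ z = 0 := fun z hz => by
    rw [hΨ₀ z (fun h' => hz (by simp only [Set.Finite.mem_toFinset, Set.mem_ofPred_eq] at h'; exact h'.1)),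
      hy' z fun h' => hz (h' ▸ Relation.ReflTransGen.refl)]
  have hΨy : Ψ y = ψ := by rw [hΨ₀ y hyA, hy]
  obtain ⟨Φ, hΦ, hΦΨ⟩ := h.exists_end hΨ hΨc
  have hψr : ψ r = r := by rw [hψ, hφr, one_smul]
  have hr0 : r ≠ 0 := fun h0 => by
    rw [h0, map_zero] at hφr
    exact zero_ne_one hφr
  -- The germ `r` is fixed by the endomorphism, so no power of it vanishes. By Fitting's lemma it is
  -- bijective, so it cannot kill a nonzero stalk outside `{≤ y}`, and the stalk at `y` is generated
  -- by `r`.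
  have hbij : Function.Bijective Φ := by
    refine (nilpotent_or_bijective h.finite h.gen hM hΦ).resolve_left ?_
    rintro ⟨n, hn⟩
    obtain ⟨m, hm⟩ := h.stalkMk_surjective y r
    have : ∀ n, h.stalkMk y ((Φ ^ n) m) = r := fun n => by
      induction n with
      | zero => exact hm
      | succ n ih => rw [pow_succ', Module.End.mul_apply, hΦΨ, ih, hΨy, hψr]
    refine hr0 ?_
    rw [← this n, hn, LinearMap.zero_apply, map_zero]
  refine ⟨fun z hz => eq_top_iff.2 fun m _ => ?_, d, ?_⟩
  · obtain ⟨m', rfl⟩ := hbij.2 m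
    rw [← h.stalkMk_eq_zero, hΦΨ, hzA z hz, LinearMap.zero_apply]
  · have hsurj : ∀ m, m = φ m • r := fun m => by
      obtain ⟨m, rfl⟩ := h.stalkMk_surjective y m
      obtain ⟨m', rfl⟩ := hbij.2 m
      rw [hΦΨ, hΨy, hψ, map_smul, hφr, smul_eq_mul, mul_one]
    refine ⟨LinearEquiv.ofLinearMap φ (LinearMap.toSpanSingleton _ _ r) (LinearMap.ext fun f => ?_)
      (LinearMap.ext fun m => (hsurj m).symm), fun n m => ⟨hφ n m, fun hm => ?_⟩⟩
    · change φ (f • r) = f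
      rw [map_smul, hφr, smul_eq_mul, mul_one]
    · rw [hsurj m]
      have := (h.sheafOf.vert y).smul_mem hm hr
      rwa [sub_add_cancel] at this

/-- The sheaf is supported below some `x`, with free stalk of rank one at `x`. -/
theorem exists_top [Nontrivial M] (h : IsStalkFiltration b M K w) (hM : HasTrivialIdempotents M) :
    ∃ x, BruhatLE b x w ∧ K x ≠ ⊤ ∧ (∀ z, ¬ BruhatLE b z x → K z = ⊤) ∧ ∃ d,
      ∃ e : h.sheafOf.vert x ≃ₗ[Sym k (AffX P)] Sym k (AffX P),
      ∀ n m, m ∈ (h.sheafOf.vert x).deg n ↔ e m ∈ symDeg k (AffX P) (n - d) := by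
  have hle : ∀ x, K x ≠ ⊤ → BruhatLE b x w := fun x hx => not_not.1 fun h' => hx (h.support x h')
  have hfin : {x | K x ≠ ⊤}.Finite := (finite_bruhatLE (b := b) w).subset hle
  have hne : hfin.toFinset.Nonempty := by
    obtain ⟨m, hm⟩ := exists_ne (0 : M)
    by_contra hcon
    refine hm (h.inf m fun x => ?_)
    have : K x = ⊤ := by
      by_contra hx
      exact hcon ⟨x, by simpa using hx⟩
    rw [this]
    exact Submodule.mem_top
  obtain ⟨x, hx, hmax⟩ := hfin.toFinset.exists_max_image (length b) hne
  have hx' : K x ≠ ⊤ := by simpa using hx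
  -- At a longest vertex of the support all edges going up have zero stalk, so the whole stalk lies
  -- in the kernel of the boundary map and `A` may be taken to be zero.
  refine ⟨x, hle x hx', hx', h.of_not_cover hM (A := ⊥) (fun n m hm => ?_) ?_ ?_⟩
  · rw [Submodule.mem_bot] at hm ⊢
    rw [hm, map_zero]
  · rw [bot_sup_eq, LinearMap.ker_eq_top]
    refine LinearMap.ext fun m => funext fun E => ?_
    have htop : K ((bruhatGraph b).top E.1) = ⊤ := by
      by_contra h'
      have h1 := hmax _ (by simpa using h')
      have h2 := length_lt_of_lt ((bruhatGraph b).bot_lt_top E.1)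
      rw [← E.2] at h2
      exact absurd h2 h1.not_gt
    have := Sheaf.edge_subsingleton (h.isFlabby_sheafOf.surjective E.1) (h.subsingleton_vert.2 htop)
    exact Subsingleton.elim _ _
  · intro hbt
    exact hx' (h.subsingleton_vert.1 ((Submodule.subsingleton_iff _).1
      (subsingleton_of_bot_eq_top hbt)))

/-- If the projective cover property failed at some `y ≠ x`, then by `of_not_cover` the sheaf would
be supported below `y`. Its support contains `x`, so `x ≤ y`, while the nonzero stalk at `y` gives
`y ≤ x`. -/
theorem isBradenMacPherson (h : IsStalkFiltration b M K w) (hM : HasTrivialIdempotents M) {x : AffW P}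
    (hx : K x ≠ ⊤) (hsupp : ∀ z, ¬ BruhatLE b z x → K z = ⊤)
    (htop : (h.sheafOf.vert x).Iso (symSelf k (AffX P))) : h.sheafOf.IsBradenMacPherson x where
  support z hz := h.subsingleton_vert.2 (hsupp z hz)
  top := htop
  surjective := h.isFlabby_sheafOf.surjective
  ker := h.isFlabby_sheafOf.ker
  range y _ := h.isFlabby_sheafOf.range y
  cover y hyx := by
    refine ⟨h.projective y, fun L g hg hrange => ?_⟩
    rw [← LinearMap.range_eq_top]
    by_contra hne
    obtain ⟨h1, -⟩ := h.of_not_cover hM (A := LinearMap.range g) (by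
      rintro n _ ⟨l, rfl⟩
      exact ⟨L.proj n l, map_proj hg n l⟩) (eq_top_iff.2 fun m _ => by
        have : h.sheafOf.ρδ y m ∈ LinearMap.range (h.sheafOf.ρδ y ∘ₗ g) := hrange ▸ ⟨m, rfl⟩
        obtain ⟨l, hl⟩ := this
        rw [← add_sub_cancel (g l) m]
        refine Submodule.add_mem_sup ⟨l, rfl⟩ ?_
        rw [LinearMap.mem_ker, map_sub, sub_eq_zero]
        exact hl.symm) hne
    have hxy : BruhatLE b x y := not_not.1 fun h' => hx (h1 x h')
    have hyx' : BruhatLE b y x := not_not.1 fun h' => hne (by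
      have := h.subsingleton_vert.2 (hsupp y h')
      exact Subsingleton.elim _ _)
    exact hyx (hyx'.antisymm hxy)

end IsStalkFiltration

/-- The shift by `d` puts the generator of the top stalk in degree zero, so that this stalk is
isomorphic to the symmetric algebra as a graded module. -/
theorem exists_iso_of_isStalkFiltration [Nontrivial M] (h : IsStalkFiltration b M K w)
    (hM : HasTrivialIdempotents M) :
    ∃ x, BruhatLE b x w ∧ ∃ n : ℤ,
      (∃ B : MomentGraph.Sheaf k (bruhatGraph b), B.IsBradenMacPherson x) ∧
      ∀ B : MomentGraph.Sheaf k (bruhatGraph b), B.IsBradenMacPherson x →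
        M.Iso ((globalSections B).shift n) := by
  obtain ⟨x, hxw, hx, hsupp, d, e, he⟩ := h.exists_top hM
  have hM' : HasTrivialIdempotents (M.shift d) := fun f hf hff => hM f (fun n m hm => by
    have := hf (n - d) m (by
      change m ∈ M.deg (n - d + d)
      rwa [sub_add_cancel])
    change f m ∈ M.deg (n - d + d) at this
    rwa [sub_add_cancel] at this) hff
  have hBM : (h.shift d).sheafOf.IsBradenMacPherson x :=
    (h.shift d).isBradenMacPherson hM' hx hsupp ⟨e, fun n m => by
      have := he (n + d) m
      rw [add_sub_cancel_right] at this
      exact this⟩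
  refine ⟨x, hxw, -d, ⟨_, hBM⟩, fun B hB => ?_⟩
  obtain ⟨φ, hφ, hc, hbij⟩ := hBM.exists_bijective hB (finite_bruhatLE (b := b) x)
  have h1 := ((h.shift d).iso_globalSections.trans
    (globalSections_iso hBM.isFlabby hB.isFlabby hφ hc hbij)).shift (-d)
  refine Iso.trans (L := (M.shift d).shift (-d)) ⟨LinearEquiv.refl _ M, fun n m => ?_⟩ h1
  change m ∈ M.deg n ↔ m ∈ M.deg (n + -d + d)
  rw [neg_add_cancel_right]

end Indecomposable
end AffineMomentGraph

/-! ## Direct sum decompositions -/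

namespace AffineMomentGraph

namespace GradedMod

variable {k A : Type u} [CommRing k] [CommRing A] [Algebra k A] {𝒜 : ℤ → Submodule k A}

/-- A graded submodule as a graded module. -/
def sub (M : GradedMod 𝒜) (K : Submodule A M) (hK : M.IsHomog K) : GradedMod 𝒜 where
  carrier := K
  deg n := (M.deg n).comap K.subtype.toAddMonoidHom
  isInternal := isInternal_of_proj _
    (fun n => ((M.proj n).comp K.subtype.toAddMonoidHom).codRestrict K fun m => hK n m.1 m.2)
    (fun _ _ hm => Subtype.ext (M.proj_same hm))
    (fun _ _ h _ hm => Subtype.ext (M.proj_ne h hm)) fun m => by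
      obtain ⟨s, hs⟩ := M.exists_sum m.1
      have e : m = ∑ n ∈ s, (⟨M.proj n m.1, hK n m.1 m.2⟩ : K) := by
        apply Subtype.ext
        rw [AddSubmonoidClass.coe_finsetSum]
        exact hs
      rw [e]
      refine sum_mem fun n _ => ?_
      exact (le_iSup (fun n => (M.deg n).comap K.subtype.toAddMonoidHom) n) (M.proj_mem n m.1)
  smul_mem ha hm := M.smul_mem ha hm

variable {M L : GradedMod 𝒜}

theorem isHomog_range {f : L →ₗ[A] M} (hf : IsGradedHom f) : M.IsHomog (LinearMap.range f) := by
  rintro n _ ⟨l, rfl⟩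
  exact ⟨L.proj n l, map_proj hf n l⟩

theorem sub_isSummand {e : Module.End A M} (he : IsGradedHom e) (hee : e * e = e) :
    (M.sub (LinearMap.range e) (isHomog_range he)).IsSummand M := by
  refine ⟨(LinearMap.range e).subtype, e.rangeRestrict, fun n m hm => hm, fun n m hm => he n m hm,
    LinearMap.ext ?_⟩
  rintro ⟨_, m, rfl⟩
  exact Subtype.ext (DFunLike.congr_fun hee m)

theorem isDirectSum_sub {e : Module.End A M} (he : IsGradedHom e) (he' : IsGradedHom (1 - e))
    (hee : e * e = e) : M.IsDirectSum
      (fun j : Fin 2 => M.sub (LinearMap.range ((![e, 1 - e] : Fin 2 → Module.End A M) j))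
        (isHomog_range (by fin_cases j <;> assumption))) := by
  let c : Fin 2 → Module.End A M := ![e, 1 - e]
  have hc : ∀ j, IsGradedHom (c j) := fun j => by fin_cases j <;> assumption
  have hsum : ∀ m, ∑ j, c j m = m := fun m => by
    rw [Fin.sum_univ_two]
    change e m + (m - e m) = m
    abel
  have horth : ∀ i j m, c i (c j m) = if i = j then c j m else 0 := by
    have h1 : ∀ m, e (e m) = e m := DFunLike.congr_fun hee
    intro i j m
    fin_cases i <;> fin_cases j
    · exact h1 m
    · change e (m - e m) = 0
      rw [map_sub, h1, sub_self]
    · change e m - e (e m) = 0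
      rw [h1, sub_self]
    · change m - e m - e (m - e m) = m - e m
      rw [map_sub, h1, sub_self, sub_zero]
  refine ⟨{ toFun := fun m j => ⟨c j m, m, rfl⟩
            map_add' := fun m m' => funext fun j => Subtype.ext (map_add _ _ _)
            map_smul' := fun a m => funext fun j => Subtype.ext (map_smul _ _ _)
            invFun := fun f => ∑ j, (f j).1
            left_inv := hsum
            right_inv := fun f => funext fun j => Subtype.ext ?_ }, fun n m => ?_⟩
  · change c j (∑ i, (f i).1) = (f j).1
    rw [map_sum, Finset.sum_eq_single j]
    · obtain ⟨m, hm⟩ := (f j).2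
      change c j m = _ at hm
      rw [← hm, horth, if_pos rfl]
    · intro i _ hij
      obtain ⟨m, hm⟩ := (f i).2
      change c i m = _ at hm
      rw [← hm, horth, if_neg hij.symm]
    · exact fun h => absurd (Finset.mem_univ _) h
  · refine ⟨fun hm j => hc j n m hm, fun h => ?_⟩
    rw [← hsum m]
    exact sum_mem fun j _ => h j

end GradedMod

open GradedMod

/-! ### Reduction to summands of a single Bott–Samelson module. -/

section Final

variable {ι V N : Type u} [AddCommGroup V] [Module ℚ V] [AddCommGroup N] [Module ℚ N]
variable {P : RootPairing ι ℚ V N} [P.IsCrystallographic] {b : P.Base}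
variable {k : Type u} [Field k] [Algebra ZHalf k]
variable {M : GradedMod (degK P k)}

/-- `M` is a direct summand of a shift of a Bott–Samelson module of a reduced word in `circ b`. -/
def IsBottSamelsonSummand (b : P.Base) (M : GradedMod (degK P k)) : Prop :=
  ∃ l : List (AffW P), IsReducedWord b l ∧ l.prod ∈ circ b ∧
    ∃ n : ℤ, M.IsSummand ((bottSamelson P k l).shift n)

theorem IsBottSamelsonSummand.of_isSummand {L : GradedMod (degK P k)}
    (h : IsBottSamelsonSummand b L) (hML : M.IsSummand L) : IsBottSamelsonSummand b M := by
  obtain ⟨l, hl, hc, n, hn⟩ := h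
  exact ⟨l, hl, hc, n, hML.trans hn⟩

theorem IsBottSamelsonSummand.isCircSpecial (h : IsBottSamelsonSummand b M) :
    IsCircSpecial k b M :=
  ⟨1, fun _ => M, fun _ => h, (LinearEquiv.funUnique (Fin 1) _ _).symm, fun _ _ =>
    ⟨fun hm _ => hm, fun h => h 0⟩⟩

/-- Indecomposability only concerns decompositions into objects of `ℋ°_k`, so membership of both
images has to be supplied. -/
theorem IsIndecomposableCirc.eq_zero_or_one (hM : IsIndecomposableCirc k b M)
    {e : Module.End (StructK P k) M} (he : IsGradedHom e) (he' : IsGradedHom (1 - e))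
    (hee : e * e = e) (h1 : IsCircSpecial k b (M.sub (LinearMap.range e) (isHomog_range he)))
    (h2 : IsCircSpecial k b (M.sub (LinearMap.range (1 - e)) (isHomog_range he'))) :
    e = 0 ∨ e = 1 := by
  rcases hM.2.2 _ (fun j => by fin_cases j <;> assumption) (isDirectSum_sub he he' hee) with h | h
  · left
    refine LinearMap.ext fun m => ?_
    exact congrArg Subtype.val (h.elim ⟨e m, m, rfl⟩ ⟨0, zero_mem _⟩)
  · right
    refine LinearMap.ext fun m => (sub_eq_zero.1 ?_).symm
    exact congrArg Subtype.val (h.elim ⟨m - e m, m, rfl⟩ ⟨0, zero_mem _⟩)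

/-- For a decomposition of `M` into summands `L j` of Bott–Samelson modules, each projection to an
`L j` is an idempotent with both images visibly in `ℋ°_k`, hence it is `0` or `1`. They are not all
`0`, so `M` is a summand of some `L j`. Closure of `ℋ°_k` under direct summands is not needed. -/
theorem IsIndecomposableCirc.isBottSamelsonSummand (hM : IsIndecomposableCirc k b M) :
    IsBottSamelsonSummand b M := by
  obtain ⟨r, L, hL, E, hE⟩ := hM.1
  have := hM.2.1
  rcases r with - | r
  · exact absurd (E.injective.subsingleton) (not_subsingleton M)
  classical
  have hEs : ∀ n f, (∀ j, f j ∈ (L j).deg n) → E.symm f ∈ M.deg n := fun n f hf =>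
    (hE n _).2 fun j => by rw [E.apply_symm_apply]; exact hf j
  let s : ∀ j, L j →ₗ[StructK P k] M := fun j =>
    E.symm.toLinearMap ∘ₗ LinearMap.single (StructK P k) (fun j => (L j).carrier) j
  let p : ∀ j, M →ₗ[StructK P k] L j := fun j => LinearMap.proj j ∘ₗ E.toLinearMap
  have hp : ∀ j m, p j m = E m j := fun _ _ => rfl
  have hs : ∀ j, IsGradedHom (s j) := fun j n m hm => hEs n _ fun i => by
    by_cases hij : i = j
    · subst hij
      rw [LinearMap.single_apply, Pi.single_eq_same]
      exact hm
    · rw [LinearMap.single_apply, Pi.single_eq_of_ne hij]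
      exact zero_mem _
  have hpg : ∀ j, IsGradedHom (p j) := fun j n m hm => (hE n m).1 hm j
  have hps : ∀ j m, p j (s j m) = m := fun j m => by
    change E (E.symm _) j = m
    rw [E.apply_symm_apply, LinearMap.single_apply, Pi.single_eq_same]
  have hext : ∀ m m', (∀ j, p j m = p j m') → m = m' := fun m m' h => E.injective (funext h)
  have heg : ∀ j, IsGradedHom (s j ∘ₗ p j) := fun j => (hs j).comp (hpg j)
  have key : ∀ j, (s j ∘ₗ p j : Module.End (StructK P k) M) = 0 ∨
      (s j ∘ₗ p j : Module.End (StructK P k) M) = 1 := fun j => by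
    have hidem : ((s j ∘ₗ p j : Module.End (StructK P k) M) * (s j ∘ₗ p j)) = s j ∘ₗ p j :=
      LinearMap.ext fun m => by
        change s j (p j (s j (p j m))) = s j (p j m)
        rw [hps]
    have hg' : IsGradedHom (1 - (s j ∘ₗ p j) : Module.End (StructK P k) M) :=
      isGradedHom_id.sub (heg j)
    refine hM.eq_zero_or_one (heg j) hg' hidem ?_ ?_
    · refine IsBottSamelsonSummand.isCircSpecial (IsBottSamelsonSummand.of_isSummand (hL j)
        ⟨p j ∘ₗ Submodule.subtype _, (s j ∘ₗ p j).rangeRestrict ∘ₗ s j, fun n m hm => hpg j n _ hm,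
          fun n m hm => heg j n _ (hs j n m hm), LinearMap.ext ?_⟩)
      rintro ⟨_, m, rfl⟩
      refine Subtype.ext ?_
      change s j (p j (s j (p j (s j (p j m))))) = s j (p j m)
      rw [hps, hps]
    -- The image of the complementary idempotent is the direct sum of the remaining `L i`, which are
    -- enumerated by `j.succAbove`.
    · let t : M.sub (LinearMap.range (1 - (s j ∘ₗ p j) : Module.End (StructK P k) M))
          (isHomog_range hg') →ₗ[StructK P k] ((i : Fin r) → L (j.succAbove i)) :=
        LinearMap.pi fun i => p (j.succAbove i) ∘ₗ Submodule.subtype _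
      have hj : ∀ m ∈ LinearMap.range (1 - (s j ∘ₗ p j) : Module.End (StructK P k) M), p j m = 0 := by
        rintro _ ⟨m, rfl⟩
        change p j (m - s j (p j m)) = 0
        rw [map_sub, hps, sub_self]
      have hj' : ∀ m, p j m = 0 →
          m ∈ LinearMap.range (1 - (s j ∘ₗ p j) : Module.End (StructK P k) M) := fun m hm =>
        ⟨m, by
          change m - s j (p j m) = m
          rw [hm, map_zero, sub_zero]⟩
      have ht : Function.Bijective t := by
        constructor
        · rw [injective_iff_map_eq_zero]
          rintro ⟨m, hm⟩ h0
          refine Subtype.ext (hext m 0 fun i => ?_)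
          rw [map_zero]
          rcases Fin.eq_self_or_eq_succAbove j i with rfl | ⟨i, rfl⟩
          · exact hj m hm
          · exact congrFun h0 i
        · intro f
          refine ⟨⟨E.symm (j.insertNth (α := fun j => (L j).carrier) 0 f), hj' _ ?_⟩, funext fun i => ?_⟩
          · rw [hp, E.apply_symm_apply, Fin.insertNth_apply_same]
          · change E (E.symm _) (j.succAbove i) = f i
            rw [E.apply_symm_apply, Fin.insertNth_apply_succAbove]
      refine ⟨r, fun i => L (j.succAbove i), fun i => hL _, LinearEquiv.ofBijective t ht,
        fun n m => ⟨fun hm i => hpg _ n m.1 hm, fun h => (hE n m.1).2 fun i => ?_⟩⟩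
      rcases Fin.eq_self_or_eq_succAbove j i with rfl | ⟨i, rfl⟩
      · rw [← hp, hj _ m.2]; exact zero_mem _
      · exact h i
  obtain ⟨j, hj⟩ : ∃ j, (s j ∘ₗ p j : Module.End (StructK P k) M) ≠ 0 := by
    by_contra! hcon
    obtain ⟨m, hm⟩ := exists_ne (0 : M)
    refine hm (hext _ _ fun j => ?_)
    have : s j (p j m) = 0 := DFunLike.congr_fun (hcon j) m
    rw [← hps j (p j m), this]
  have h1 := (key j).resolve_left hj
  exact (hL j).imp fun l hl => ⟨hl.1, hl.2.1, hl.2.2.imp fun n hn =>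
    IsSummand.trans ⟨p j, s j, hpg j, hs j, h1⟩ hn⟩

/-- Once `M` is known to be a summand of a shifted Bott–Samelson module, so is the image of every
graded idempotent. Both images then lie in `ℋ°_k`, and indecomposability applies to arbitrary
idempotents. -/
theorem IsIndecomposableCirc.hasTrivialIdempotents (hM : IsIndecomposableCirc k b M) :
    HasTrivialIdempotents M := fun e he hee => by
  have he' : IsGradedHom (1 - e) := isGradedHom_id.sub he
  have hee' : (1 - e) * (1 - e) = 1 - e := (IsIdempotentElem.one_sub hee)
  have h := hM.isBottSamelsonSummand
  exact hM.eq_zero_or_one he he' hee (h.of_isSummand (sub_isSummand he hee)).isCircSpecial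
    (h.of_isSummand (sub_isSummand he' hee')).isCircSpecial

end Final
end AffineMomentGraph

end

theorem proposition8 {ι V N k : Type u} [Finite ι] [AddCommGroup V] [Module ℚ V]
    [AddCommGroup N] [Module ℚ N] (P : RootPairing ι ℚ V N) [P.IsRootSystem]
    [P.IsCrystallographic] [P.IsReduced] [P.IsIrreducible] (b : P.Base)
    [Field k] [Algebra ZHalf k]
    (hk : ringChar k = 0 ∨ coxeterNumber b ≤ ringChar k)
    (hA2 : ¬ (IsTypeA2 b ∧ ringChar k = 3))
    (M : GradedMod (degK P k)) (hM : IsIndecomposableCirc k b M) :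
    ∃ x ∈ circ b, ∃ n : ℤ,
      (∃ B : MomentGraph.Sheaf k (bruhatGraph b), B.IsBradenMacPherson x) ∧
      ∀ B : MomentGraph.Sheaf k (bruhatGraph b), B.IsBradenMacPherson x →
        M.Iso ((globalSections B).shift n) := by
  obtain ⟨l, hl, hc, n, hn⟩ := hM.isBottSamelsonSummand
  obtain ⟨K, hK⟩ := exists_isStalkFiltration (k := k) hk hA2 hl hc
  obtain ⟨K', hK'⟩ := (hK.shift n).isSummand hk hA2 hc hn
  have := hM.2.1
  obtain ⟨x, hx, h⟩ := exists_iso_of_isStalkFiltration hK' hM.hasTrivialIdempotents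
  exact ⟨x, mem_circ_of_le hx hc, h⟩
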